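/- **Notation.** Let $n\in\mathbb N$, write $z=(x,\xi)\in\mathbb R^n\times\mathbb R^n=\mathbb R^{2n}$ and $\mu\in\overline{\mathbb R}_+=[0,\infty)$, and let $\langle z\rangle=(1+|z|^2)^{1/2}$, $\langle z,\mu\rangle=(1+|z|^2+\mu^2)^{1/2}$. Fix a smooth positive function $[z,\mu]$ on $\mathbb R^{2n}\times\overline{\mathbb R}_+$ with $[z,\mu]=|(z,\mu)|$ whenever $|(z,\mu)|\ge 1$, and a zero-excision function $\chi\in C^\infty(\mathbb R^{2n})$ (zero near the origin, one outside a bounded set). For $d,\nu\in\mathbb R$: * $\Gamma^d_{1,0}(\mathbb R^{2n})$ is the space of smooth $a:\mathbb R^{2n}\to\mathbb C$ with $|\partial_z^\alpha a(z)|\lesssim\langle z\rangle^{d-|\alpha|}$ for all $\alpha$. * $\widetilde\Gamma^{d,\nu}_{1,0}$ is the space of smooth $a:\mathbb R^{2n}\times\overline{\mathbb R}_+\to\mathbb C$ with $|\partial_z^\alpha\partial_\mu^j a(z,\mu)|\lesssim\langle z\rangle^{\nu-|\alpha|}\langle z,\mu\rangle^{d-\nu-j}$ for all $\alpha,j$.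 * $\mathbf{\widetilde\Gamma}^{d,\nu}_{1,0}$ is the space of those $a\in\widetilde\Gamma^{d,\nu}_{1,0}$ for which there are $a^\infty_{[d,\nu+j]}\in\Gamma^{\nu+j}_{1,0}(\mathbb R^{2n})$, $j\in\mathbb N_0$, with $$a-\sum_{j=0}^{N-1}a^\infty_{[d,\nu+j]}(z)\,[z,\mu]^{d-\nu-j}\in\widetilde\Gamma^{d,\nu+N}_{1,0}\qquad\text{for all }N\in\mathbb N_0;$$ $a^\infty_{[d,\nu]}$ is the principal limit symbol of $a$. * $\mathbf{\widetilde\Gamma}^{d,\nu}_{\mathrm{hom}}$ is the space of functions $a(z,\mu)=|(z,\mu)|^d\,\widehat a\big((z,\mu)/|(z,\mu)|\big)$, $z\ne0$, $\mu\ge0$, where $\widehat a$ is smooth on $\{(z,\mu): |(z,\mu)|=1,\ \mu\ge 0,\ z\neq0\}$ and $(r,\phi)\mapsto r^{-\nu}\,\widehat a(r\phi,\sqrt{1-r^2})$, defined for $0<r<1$, $|\phi|=1$, extends to a smooth function on $[0,1)\times\mathbb S^{2n-1}$. The angular symbol of $a$ is $a_{\langle\nu\rangle}(z)=|z|^\nu\lim_{r\to0+}r^{-\nu}\,\widehat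 a\big(rz/|z|,\sqrt{1-r^2}\big)$, $z\ne0$. * $\mathbf{\widetilde\Gamma}^{d,\nu}$ (poly-homogeneous symbols) is the space of those $a\in\mathbf{\widetilde\Gamma}^{d,\nu}_{1,0}$ for which there are $a^{(d-j,\nu-j)}\in\mathbf{\widetilde\Gamma}^{d-j,\nu-j}_{\mathrm{hom}}$, $j\in\mathbb N_0$, with $a-\chi(z)\sum_{j=0}^{N-1}a^{(d-j,\nu-j)}\in\mathbf{\widetilde\Gamma}^{d-N,\nu-N}_{1,0}$ for all $N\in\mathbb N_0$; $a^{(d,\nu)}$ is the homogeneous principal symbol of $a$, and $a_{\langle\nu\rangle}:=(a^{(d,\nu)})_{\langle\nu\rangle}$ its principal angular symbol. The Leibniz product of symbols is the oscillatory integral $$(a_1\#a_0)(x,\xi)=(2\pi)^{-n}\iint e^{-iy\cdot\eta}\,a_1(x,\xi+\eta)\,a_0(x+y,\xi)\,dy\,d\eta ,$$ i.e. the limit as $\varepsilon\to0+$ of the integrals with an additional factor $\kappa(\varepsilon y,\varepsilon\eta)$, for any Schwartz function $\kappa$ on $\mathbb R^{2n}$ with $\kappa(0)=1$; for $\mu$-dependent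 symbols it is taken for each fixed $\mu$. Let $D_x=-i\partial_x$. **Theorem.** Let $d_0,d_1,\nu_0,\nu_1\in\mathbb R$, $a_1\in\mathbf{\widetilde\Gamma}^{d_1,\nu_1}_{1,0}$ and $a_0\in\mathbf{\widetilde\Gamma}^{d_0,\nu_0}_{1,0}$. Then the oscillatory integral defining $a_1\#a_0$ converges for every $(x,\xi,\mu)$ (to a limit independent of $\kappa$), and: 1. $a_1\#a_0\in\mathbf{\widetilde\Gamma}^{d_0+d_1,\nu_0+\nu_1}_{1,0}$. 2. For every $N\in\mathbb N_0$, $$a_1\#a_0-\sum_{|\alpha|\le N-1}\frac1{\alpha!}(\partial_\xi^\alpha a_1)(D_x^\alpha a_0)\in\mathbf{\widetilde\Gamma}^{d_0+d_1-2N,\nu_0+\nu_1-2N}_{1,0}.$$ 3. $(a_1\#a_0)^\infty_{[d_0+d_1,\nu_0+\nu_1]}=a^\infty_{1,[d_1,\nu_1]}\#a^\infty_{0,[d_0,\nu_0]}$ (where the product on the right also converges). 4. If $a_1\in\mathbf{\widetilde\Gamma}^{d_1,\nu_1}$ and $a_0\in\mathbf{\widetilde\Gamma}^{d_0,\nu_0}$,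 then $a_1\#a_0\in\mathbf{\widetilde\Gamma}^{d_0+d_1,\nu_0+\nu_1}$, and on $\{z\neq 0,\ \mu\ge 0\}$, respectively $\{z\ne0\}$, $$(a_1\#a_0)^{(d_0+d_1,\nu_0+\nu_1)}=a_1^{(d_1,\nu_1)}\,a_0^{(d_0,\nu_0)},\qquad (a_1\#a_0)_{\langle\nu_0+\nu_1\rangle}=a_{1,\langle\nu_1\rangle}\,a_{0,\langle\nu_0\rangle}.$$ -/

import Mathlib

open scoped ContDiff SchwartzMap Topology

noncomputable section

namespace Shubin

section Classes

variable {E : Type*} [NormedAddCommGroup E] [InnerProductSpace ℝ E]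

/-- `⟨z⟩ = (1 + |z|²)^{1/2}`. -/
def bracket (z : E) : ℝ := √(1 + ‖z‖ ^ 2)

/-- `⟨z, μ⟩ = (1 + |z|² + μ²)^{1/2}`. -/
def bracketParam (z : E) (μ : ℝ) : ℝ := √(1 + ‖z‖ ^ 2 + μ ^ 2)

/-- The Euclidean norm `|(z, μ)|`. -/
def normParam (z : E) (μ : ℝ) : ℝ := √(‖z‖ ^ 2 + μ ^ 2)

/-- The class `S^d_{1,0}(E)`. Bounding the norm of the `k`-th Fréchet derivative is the same as
bounding all partial derivatives of order `k`. -/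
structure IsSymbol (d : ℝ) (a : E → ℂ) : Prop where
  smooth : ContDiff ℝ ∞ a
  bound : ∀ k : ℕ, ∃ C : ℝ, ∀ z : E, ‖iteratedFDeriv ℝ k a z‖ ≤ C * bracket z ^ (d - k)

/-- The class of symbols with regularity number, `S̃^{d,ν}_{1,0}(E × [0,∞))`.
Symbols are functions of `z : E` and `μ : ℝ`; only the values at `μ ≥ 0` matter. -/
structure IsRegSymbol (d ν : ℝ) (a : E → ℝ → ℂ) : Prop where
  smooth : ContDiffOn ℝ ∞ (fun p : E × ℝ => a p.1 p.2) (Set.univ ×ˢ Set.Ici 0)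
  bound : ∀ k j : ℕ, ∃ C : ℝ, ∀ z : E, ∀ μ : ℝ, 0 ≤ μ →
    ‖iteratedFDeriv ℝ k (fun z' => iteratedDerivWithin j (a z') (Set.Ici 0) μ) z‖ ≤
      C * bracket z ^ (ν - k) * bracketParam z μ ^ (d - ν - j)

/-- `w(z, μ) = [z, μ]`: a smooth positive function on `E × [0,∞)` that coincides with `|(z, μ)|`
whenever `|(z, μ)| ≥ 1`. -/
structure IsSmoothedNorm (w : E → ℝ → ℝ) : Prop where
  smooth : ContDiffOn ℝ ∞ (fun p : E × ℝ => w p.1 p.2) (Set.univ ×ˢ Set.Ici 0)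
  pos : ∀ z : E, ∀ μ : ℝ, 0 ≤ μ → 0 < w z μ
  eq_norm : ∀ z : E, ∀ μ : ℝ, 0 ≤ μ → 1 ≤ normParam z μ → w z μ = normParam z μ

/-- `L j = a^∞_{[d,ν+j]}`, `j = 0, 1, 2, …`, are the coefficients of the expansion at infinity of
`a`; `L 0` is the principal limit symbol of `a`. -/
structure HasLimitExpansion (w : E → ℝ → ℝ) (d ν : ℝ) (a : E → ℝ → ℂ) (L : ℕ → E → ℂ) :
    Prop where
  coeff : ∀ j : ℕ, IsSymbol (ν + j) (L j)
  remainder : ∀ N : ℕ, IsRegSymbol d (ν + N)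
    (fun z μ => a z μ - ∑ j ∈ Finset.range N, L j z * ((w z μ ^ (d - ν - j) : ℝ) : ℂ))

/-- Symbols with expansion at infinity: the bold class `𝐒̃^{d,ν}_{1,0}(E × [0,∞))`. -/
def IsLimitSymbol (w : E → ℝ → ℝ) (d ν : ℝ) (a : E → ℝ → ℂ) : Prop :=
  IsRegSymbol d ν a ∧ ∃ L : ℕ → E → ℂ, HasLimitExpansion w d ν a L

/-- The class `C^{∞,ν}_𝐓` on the half-sphere `{|(z,μ)| = 1, μ ≥ 0, z ≠ 0}` without north pole;
only the values of `b` on this set matter. Smoothness of a function on a unit sphere is expressed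
as smoothness of its extension that is homogeneous of degree zero. -/
structure IsTaylorSphere (ν : ℝ) (b : E → ℝ → ℂ) : Prop where
  smooth : ContDiffOn ℝ ∞
    (fun p : E × ℝ => b ((normParam p.1 p.2)⁻¹ • p.1) ((normParam p.1 p.2)⁻¹ * p.2))
    ({0}ᶜ ×ˢ Set.Ici 0)
  extends_smoothly : ∃ G : ℝ → E → ℂ,
    ContDiffOn ℝ ∞ (fun p : ℝ × E => G p.1 (‖p.2‖⁻¹ • p.2)) (Set.Ico 0 1 ×ˢ {0}ᶜ) ∧
    ∀ r ∈ Set.Ioo (0 : ℝ) 1, ∀ φ : E, ‖φ‖ = 1 →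
      G r φ = ((r ^ (-ν) : ℝ) : ℂ) * b (r • φ) √(1 - r ^ 2)

/-- The bold class `𝐒̃^{d,ν}_hom(E × [0,∞))`; its elements are functions on
`{z ≠ 0, μ ≥ 0}`, and only the values there matter. -/
def IsHomSymbol (d ν : ℝ) (a : E → ℝ → ℂ) : Prop :=
  ∃ b : E → ℝ → ℂ, IsTaylorSphere ν b ∧ ∀ z : E, z ≠ 0 → ∀ μ : ℝ, 0 ≤ μ →
    a z μ = ((normParam z μ ^ d : ℝ) : ℂ) *
      b ((normParam z μ)⁻¹ • z) ((normParam z μ)⁻¹ * μ)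

/-- The angular symbol `a_{⟨ν⟩}(z) = |z|^ν lim_{r → 0+} r^{-ν} a(r z/|z|, (1 - r²)^{1/2})`, `z ≠ 0`,
of `a ∈ 𝐒̃^{d,ν}_hom`. -/
def angularSymbol (ν : ℝ) (a : E → ℝ → ℂ) (z : E) : ℂ :=
  ((‖z‖ ^ ν : ℝ) : ℂ) * Filter.limUnder (𝓝[>] (0 : ℝ))
    (fun r : ℝ => ((r ^ (-ν) : ℝ) : ℂ) * a (r • (‖z‖⁻¹ • z)) √(1 - r ^ 2))

/-- Zero-excision function: smooth, zero near the origin, one outside a bounded set. -/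
structure IsZeroExcision (χ : E → ℝ) : Prop where
  smooth : ContDiff ℝ ∞ χ
  zero_near : ∃ r : ℝ, 0 < r ∧ ∀ z : E, ‖z‖ ≤ r → χ z = 0
  one_far : ∃ R : ℝ, ∀ z : E, R ≤ ‖z‖ → χ z = 1

/-- `A j = a^{(d-j,ν-j)}`, `j = 0, 1, 2, …`, are homogeneous components of `a`; `A 0` is the
homogeneous principal symbol and its angular symbol is the principal angular symbol of `a`. -/
structure HasHomExpansion (w : E → ℝ → ℝ) (χ : E → ℝ) (d ν : ℝ) (a : E → ℝ → ℂ)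
    (A : ℕ → E → ℝ → ℂ) : Prop where
  component : ∀ j : ℕ, IsHomSymbol (d - j) (ν - j) (A j)
  remainder : ∀ N : ℕ, IsLimitSymbol w (d - N) (ν - N)
    (fun z μ => a z μ - (χ z : ℂ) * ∑ j ∈ Finset.range N, A j z μ)

/-- Poly-homogeneous symbols with expansion at infinity: `𝐒̃^{d,ν}(E × [0,∞))`. -/
def IsPolyhomogeneous (w : E → ℝ → ℝ) (χ : E → ℝ) (d ν : ℝ) (a : E → ℝ → ℂ) : Prop :=
  IsLimitSymbol w d ν a ∧ ∃ A : ℕ → E → ℝ → ℂ, HasHomExpansion w χ d ν a A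

/-- `∂_v^α = ∂_{v 0}^{α 0} ⋯ ∂_{v (n-1)}^{α (n-1)}`, for directions `v i` and a multi-index `α`. -/
def multiDeriv {n : ℕ} (v : Fin n → E) (α : Fin n → ℕ) (f : E → ℂ) : E → ℂ :=
  (List.finRange n).foldr (fun i g => (fun h : E → ℂ => fun z => fderiv ℝ h z (v i))^[α i] g) f

end Classes

/-- `ℝⁿ`. -/
abbrev Config (n : ℕ) : Type := EuclideanSpace ℝ (Fin n)

/-- `ℝ²ⁿ = ℝⁿ_x × ℝⁿ_ξ` with the Euclidean norm; coordinates `inl i` are those of `x`, coordinates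
`inr i` those of `ξ`. -/
abbrev Phase (n : ℕ) : Type := EuclideanSpace ℝ (Fin n ⊕ Fin n)

/-- The point `z = (x, ξ)`. -/
def phase {n : ℕ} (x ξ : Config n) : Phase n := WithLp.toLp 2 (Sum.elim x ξ)

/-- The component `x` of `z = (x, ξ)`. -/
def xPart {n : ℕ} (z : Phase n) : Config n := WithLp.toLp 2 (fun i => z (Sum.inl i))

/-- The component `ξ` of `z = (x, ξ)`. -/
def xiPart {n : ℕ} (z : Phase n) : Config n := WithLp.toLp 2 (fun i => z (Sum.inr i))

/-- `∂_ξ^α`. -/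
def partialXi {n : ℕ} (α : Fin n → ℕ) (f : Phase n → ℂ) : Phase n → ℂ :=
  multiDeriv (fun i => EuclideanSpace.single (Sum.inr i) 1) α f

/-- `D_x^α = (-i)^{|α|} ∂_x^α`. -/
def dX {n : ℕ} (α : Fin n → ℕ) (f : Phase n → ℂ) : Phase n → ℂ :=
  fun z => (-Complex.I) ^ (∑ i, α i) *
    multiDeriv (fun i => EuclideanSpace.single (Sum.inl i) 1) α f z

/-- The integrand `e^{-i y·η} κ(εy, εη) p(y, η)` of the regularized oscillatory integral. -/
def oscIntegrand {n : ℕ} (κ : 𝓢(Config n × Config n, ℂ)) (p : Config n → Config n → ℂ) (ε : ℝ)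
    (q : Config n × Config n) : ℂ :=
  Complex.exp (-(Complex.I * ((inner ℝ q.1 q.2 : ℝ) : ℂ))) * κ (ε • q) * p q.1 q.2

/-- The oscillatory integral `(2π)^{-n} ∬ e^{-i y·η} p(y, η) dy dη` exists and equals `J`: for every
Schwartz function `κ` with `κ(0) = 1`, it is the limit as `ε → 0+` of the absolutely convergent
integrals with `p(y, η)` replaced by `κ(εy, εη) p(y, η)`. -/
def HasOscIntegral {n : ℕ} (p : Config n → Config n → ℂ) (J : ℂ) : Prop :=
  ∀ κ : 𝓢(Config n × Config n, ℂ), κ 0 = 1 →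
    (∀ ε : ℝ, 0 < ε → MeasureTheory.Integrable (oscIntegrand κ p ε)) ∧
    Filter.Tendsto (fun ε : ℝ => (((2 * Real.pi) ^ n : ℝ) : ℂ)⁻¹ * ∫ q, oscIntegrand κ p ε q)
      (𝓝[>] 0) (𝓝 J)

/-- The amplitude `(y, η) ↦ a₁(x, ξ + η) a₀(x + y, ξ)` at `z = (x, ξ)`. -/
def leibnizAmplitude {n : ℕ} (a₁ a₀ : Phase n → ℂ) (z : Phase n) (y η : Config n) : ℂ :=
  a₁ (phase (xPart z) (xiPart z + η)) * a₀ (phase (xPart z + y) (xiPart z))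

/-- The Leibniz product
`(a₁ # a₀)(x, ξ) = (2π)^{-n} ∬ e^{-i y·η} a₁(x, ξ + η) a₀(x + y, ξ) dy dη` (oscillatory integral;
an unspecified value if the latter does not exist). -/
def leibniz {n : ℕ} (a₁ a₀ : Phase n → ℂ) (z : Phase n) : ℂ :=
  Classical.epsilon (HasOscIntegral (leibnizAmplitude a₁ a₀ z))

/-- The Leibniz product taken for each `μ`. -/
def leibnizParam {n : ℕ} (a₁ a₀ : Phase n → ℝ → ℂ) (z : Phase n) (μ : ℝ) : ℂ :=
  leibniz (fun z' => a₁ z' μ) (fun z' => a₀ z' μ) z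

/-- `∑_{|α| < N} (1/α!) (∂_ξ^α a₁) (D_x^α a₀)`. -/
def leibnizSum {n : ℕ} (N : ℕ) (a₁ a₀ : Phase n → ℝ → ℂ) (z : Phase n) (μ : ℝ) : ℂ :=
  ∑ k ∈ Finset.range N, ∑ α ∈ Finset.piAntidiag (Finset.univ : Finset (Fin n)) k,
    ((∏ i, (α i).factorial : ℕ) : ℂ)⁻¹ *
      (partialXi α (fun z' => a₁ z' μ) z * dX α (fun z' => a₀ z' μ) z)

end Shubin

end

/-! At a point `(z, μ)` the Leibniz product is the bilinear oscillatory form `oscForm f g` of two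
slices, f(η) = a₁(x, ξ + η, μ) and g(y) = a₀(x + y, ξ, μ). Three properties of this form carry the
analysis. It exists, with uniform bounds, for families of tempered functions (`unifOsc_of_tempFam`):
growth in one variable is traded for derivatives in the dual variable. For f = 1 it is evaluation of
g at the origin (`oscForm_one_left`, Fourier inversion). A factor η_j on f can be moved to -i∂_j on
g (`oscForm_coord_mul`).

The first-order Taylor formula for f then yields a recursion for the remainder of the asymptotic
expansion (`oscRem_succ`) in which every step differentiates both factors once. A derivative in z
gains ⟨z⟩⁻¹, and Peetre's inequality transports weights from a displaced point back to z at the cost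
of powers of ⟨y⟩, which the form tolerates. Hence N steps gain ⟨z⟩^(-2N) (`exists_norm_oscRem_le`).
The product obeys the Leibniz rule for derivatives in z and μ (`hderiv_leibnizParam`), so the bound
passes to all derivatives. It holds for arbitrary temperate weights (`sym_leibnizRem`), and the case
N = 0 is the product itself.

For the expansion at infinity, powers of [z, μ] are inconvenient, because they depend on z and the
product is nonlocal in z. Powers of ⟨μ⟩ are mere scalars for a product taken at fixed μ. Away from a
compact set [z, μ]² = ⟨μ⟩² + (|z|² - 1), so on the region ⟨z⟩ < 2⟨μ⟩ a binomial expansion converts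
one kind of expansion into the other by a triangular change of coefficients that fixes the leading
one. Outside this region ⟨z⟩ and ⟨z, μ⟩ are comparable and the remainder estimates are automatic
(`HasLimitExpansion.muExp`, `MuExp.hasLimitExpansion`). Remainders of sufficiently high order
satisfy global estimates with the separated weights ⟨z⟩^m ⟨μ⟩^s (`MuExp.sym_univ`). This allows two
expansions to be multiplied term by term (`FiberBilin.muExp`). The argument is made for abstract
bilinear operators acting fiberwise in μ; it applies to all Leibniz remainders and to the pointwise
product, and it shows that the leading coefficient of the product is the product of the leading
coefficients.

In the poly-homogeneous case the decompositions into excised homogeneous components are inserted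
into the finite Leibniz sum and the terms are sorted by order (`HasHomExpansion.leibnizParam`).
Excision commutes with derivatives and products up to symbols that vanish for large z, and these
have order -∞ in z (`isLimitSymbol_hd_excision`). The principal component is recovered as a limit
along rays (`HasHomExpansion.tendsto`), so it does not depend on the chosen expansion, and the
angular symbol is multiplicative because limits are. -/

set_option autoImplicit false
set_option linter.unusedSectionVars false
set_option linter.unusedVariables false

open scoped ContDiff SchwartzMap Topology

noncomputable section

namespace Shubin

open MeasureTheory Filter

/-! ### Functions of polynomial growth. -/

section Moderate

variable {X : Type*} [NormedAddCommGroup X]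

/-- Continuous functions of at most polynomial growth. -/
structure ModerateGrowth (p : X → ℂ) : Prop where
  continuous : Continuous p
  bound : ∃ (C : ℝ) (k : ℕ), ∀ q, ‖p q‖ ≤ C * (1 + ‖q‖) ^ k

lemma ModerateGrowth.mul {p r : X → ℂ} (hp : ModerateGrowth p) (hr : ModerateGrowth r) :
    ModerateGrowth (fun q => p q * r q) := by
  obtain ⟨C, k, h⟩ := hp.bound
  obtain ⟨C', k', h'⟩ := hr.bound
  refine ⟨hp.continuous.mul hr.continuous, C * C', k + k', fun q => ?_⟩
  rw [norm_mul]
  calc ‖p q‖ * ‖r q‖ ≤ (C * (1 + ‖q‖) ^ k) * (C' * (1 + ‖q‖) ^ k') :=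
        mul_le_mul (h q) (h' q) (norm_nonneg _) ((norm_nonneg _).trans (h q))
    _ = _ := by ring

end Moderate

/-! ### Regularized oscillatory integrals and integration by parts. -/

section Osc

variable {n : ℕ}

instance isAddHaarMeasure_volume_prod :
    (volume : Measure (Config n × Config n)).IsAddHaarMeasure := by
  rw [Measure.volume_eq_prod]; infer_instance

lemma norm_cexp_neg_I_mul (r : ℝ) : ‖Complex.exp (-(Complex.I * (r : ℂ)))‖ = 1 := by
  rw [Complex.norm_exp]; simp

lemma continuous_oscIntegrand (κ : 𝓢(Config n × Config n, ℂ)) {p : Config n → Config n → ℂ}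
    (hp : Continuous fun q : Config n × Config n => p q.1 q.2) (ε : ℝ) :
    Continuous (oscIntegrand κ p ε) := by
  unfold oscIntegrand
  have : Continuous fun q : Config n × Config n => κ (ε • q) :=
    κ.continuous.comp (continuous_const_smul ε)
  fun_prop

lemma schwartz_decay {X : Type*} [NormedAddCommGroup X] [NormedSpace ℝ X] (κ : 𝓢(X, ℂ)) (k : ℕ) :
    ∃ A : ℝ, 0 ≤ A ∧ ∀ q, (1 + ‖q‖) ^ k * ‖κ q‖ ≤ A := by
  refine ⟨2 ^ k * (Finset.Iic (k, 0)).sup (fun m => SchwartzMap.seminorm ℝ m.1 m.2) κ,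
    by positivity, fun q => ?_⟩
  simpa using SchwartzMap.one_add_le_sup_seminorm_apply (𝕜 := ℝ) (m := (k, 0)) le_rfl le_rfl κ q

lemma integrable_oscIntegrand (κ : 𝓢(Config n × Config n, ℂ)) {p : Config n → Config n → ℂ}
    (hp : ModerateGrowth fun q : Config n × Config n => p q.1 q.2) {ε : ℝ} (hε : 0 < ε) :
    Integrable (oscIntegrand κ p ε) := by
  obtain ⟨C, k, hC⟩ := hp.bound
  set m : ℕ := Module.finrank ℝ (Config n × Config n) + 1
  -- Of the `k + m` powers of decay, `k` absorb the growth of `p` and `m`, one more than the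
  -- dimension, give integrability.
  obtain ⟨A, hA0, hA⟩ := schwartz_decay κ (k + m)
  -- With this constant c(1 + |q|) ≤ 1 + |εq|, so decay of κ in εq becomes decay in q.
  set c : ℝ := min 1 ε
  have hc : 0 < c := lt_min one_pos hε
  have hC0 : 0 ≤ C := by
    have := (norm_nonneg _).trans (hC 0)
    simpa using this
  have hInt : Integrable (fun q : Config n × Config n => C * A * (c ^ (k + m))⁻¹ *
      (1 + ‖q‖) ^ (-(m : ℝ))) := by
    refine (integrable_one_add_norm ?_).const_mul _
    simp [m]
  refine hInt.mono' (continuous_oscIntegrand κ hp.continuous ε).aestronglyMeasurable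
    (Eventually.of_forall fun q => ?_)
  have h1 : 0 < 1 + ‖q‖ := by positivity
  have h2 : c * (1 + ‖q‖) ≤ 1 + ‖ε • q‖ := by
    rw [norm_smul, Real.norm_of_nonneg hε.le, mul_add, mul_one]
    gcongr
    · exact min_le_left _ _
    · exact min_le_right _ _
  have h3 : (c * (1 + ‖q‖)) ^ (k + m) * ‖κ (ε • q)‖ ≤ A :=
    (mul_le_mul_of_nonneg_right (pow_le_pow_left₀ (by positivity) h2 _) (norm_nonneg _)).trans
      (hA _)
  unfold oscIntegrand
  rw [norm_mul, norm_mul, norm_cexp_neg_I_mul, one_mul, Real.rpow_neg h1.le, Real.rpow_natCast]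
  have h4 : ‖κ (ε • q)‖ ≤ A * (c ^ (k + m))⁻¹ * ((1 + ‖q‖) ^ (k + m))⁻¹ := by
    rw [mul_assoc, ← mul_inv, ← mul_pow, ← div_eq_mul_inv, le_div_iff₀ (by positivity), mul_comm]
    exact h3
  calc ‖κ (ε • q)‖ * ‖p q.1 q.2‖
      ≤ (A * (c ^ (k + m))⁻¹ * ((1 + ‖q‖) ^ (k + m))⁻¹) * (C * (1 + ‖q‖) ^ k) :=
        mul_le_mul h4 (hC q) (norm_nonneg _) (by positivity)
    _ = C * A * (c ^ (k + m))⁻¹ * ((1 + ‖q‖) ^ m)⁻¹ := by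
        rw [pow_add (1 + ‖q‖)]; field_simp

/-- Without such a function `HasOscIntegral` would be vacuous; uniqueness of the value rests on its
existence. -/
lemma exists_schwartz_one (n : ℕ) : ∃ κ : 𝓢(Config n × Config n, ℂ), κ 0 = 1 := by
  let φ : ContDiffBump (0 : Config n × Config n) := ⟨1, 2, one_pos, one_lt_two⟩
  have h1 : HasCompactSupport (fun q => ((φ q : ℝ) : ℂ)) :=
    φ.hasCompactSupport.comp_left (g := fun r : ℝ => (r : ℂ)) (by simp)
  have h2 : ContDiff ℝ ∞ (fun q => ((φ q : ℝ) : ℂ)) := Complex.ofRealCLM.contDiff.comp φ.contDiff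
  exact ⟨h1.toSchwartzMap h2, by
    simp [φ.one_of_mem_closedBall (Metric.mem_closedBall_self (by simp [φ]))]⟩

/-- The normalized regularized integral. -/
def oscMean (κ : 𝓢(Config n × Config n, ℂ)) (p : Config n → Config n → ℂ) (ε : ℝ) : ℂ :=
  (((2 * Real.pi) ^ n : ℝ) : ℂ)⁻¹ * ∫ q, oscIntegrand κ p ε q

/-- The Schwartz function in the regularization need not be normalized. -/
lemma HasOscIntegral.tendsto {p : Config n → Config n → ℂ} {J : ℂ} (h : HasOscIntegral p J)
    (κ : 𝓢(Config n × Config n, ℂ)) :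
    (∀ ε : ℝ, 0 < ε → Integrable (oscIntegrand κ p ε)) ∧
      Tendsto (oscMean κ p) (𝓝[>] 0) (𝓝 (κ 0 * J)) := by
  obtain ⟨κ₁, hκ₁⟩ := exists_schwartz_one n
  -- The given κ is κ' - (1 - κ(0))κ₁, a combination of two normalized functions, and the integral
  -- is linear in the regularizing factor. The unnormalized version is needed for derivatives of
  -- cut-offs.
  set κ' := κ + (1 - κ 0) • κ₁
  have hκ' : κ' 0 = 1 := by simp [κ', hκ₁]
  obtain ⟨i1, t1⟩ := h κ₁ hκ₁
  obtain ⟨i2, t2⟩ := h κ' hκ'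
  have hsplit : ∀ ε, oscIntegrand κ p ε =
      fun q => oscIntegrand κ' p ε q - (1 - κ 0) * oscIntegrand κ₁ p ε q := by
    intro ε; funext q; simp [oscIntegrand, κ']; ring
  constructor
  · intro ε hε
    rw [hsplit]
    exact (i2 ε hε).sub ((i1 ε hε).const_mul _)
  · have t3 := t2.sub (t1.const_mul (1 - κ 0))
    have e : J - (1 - κ 0) * J = κ 0 * J := by ring
    rw [e] at t3
    refine t3.congr' ?_
    filter_upwards [self_mem_nhdsWithin] with ε hε
    rw [oscMean, hsplit, integral_sub (i2 ε hε) ((i1 ε hε).const_mul _), integral_const_mul]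
    ring

lemma HasOscIntegral.unique {p : Config n → Config n → ℂ} {J J' : ℂ}
    (h : HasOscIntegral p J) (h' : HasOscIntegral p J') : J = J' := by
  obtain ⟨κ, hκ⟩ := exists_schwartz_one n
  exact tendsto_nhds_unique (h κ hκ).2 (h' κ hκ).2

lemma HasOscIntegral.add {p p' : Config n → Config n → ℂ} {J J' : ℂ}
    (h : HasOscIntegral p J) (h' : HasOscIntegral p' J') :
    HasOscIntegral (fun y η => p y η + p' y η) (J + J') := by
  intro κ hκ
  obtain ⟨i1, t1⟩ := h κ hκ
  obtain ⟨i2, t2⟩ := h' κ hκ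
  have e : ∀ ε, oscIntegrand κ (fun y η => p y η + p' y η) ε =
      fun q => oscIntegrand κ p ε q + oscIntegrand κ p' ε q := by
    intro ε; funext q; simp [oscIntegrand]; ring
  refine ⟨fun ε hε => by rw [e]; exact (i1 ε hε).add (i2 ε hε), (t1.add t2).congr' ?_⟩
  filter_upwards [self_mem_nhdsWithin] with ε hε
  rw [e, integral_add (i1 ε hε) (i2 ε hε)]; ring

lemma HasOscIntegral.const_mul {p : Config n → Config n → ℂ} {J : ℂ}
    (h : HasOscIntegral p J) (c : ℂ) : HasOscIntegral (fun y η => c * p y η) (c * J) := by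
  intro κ hκ
  obtain ⟨i1, t1⟩ := h κ hκ
  have e : ∀ ε, oscIntegrand κ (fun y η => c * p y η) ε =
      fun q => c * oscIntegrand κ p ε q := by
    intro ε; funext q; simp [oscIntegrand]; ring
  refine ⟨fun ε hε => by rw [e]; exact (i1 ε hε).const_mul _, (t1.const_mul c).congr' ?_⟩
  filter_upwards [self_mem_nhdsWithin] with ε hε
  rw [e, integral_const_mul]; ring

lemma hasFDerivAt_phaseFactor (q : Config n × Config n) :
    HasFDerivAt (fun q : Config n × Config n =>
        Complex.exp (-(Complex.I * ((inner ℝ q.1 q.2 : ℝ) : ℂ))))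
      (Complex.exp (-(Complex.I * ((inner ℝ q.1 q.2 : ℝ) : ℂ))) •
        (-(Complex.I • (Complex.ofRealCLM.comp
          (fderiv ℝ (fun q : Config n × Config n => (inner ℝ q.1 q.2 : ℝ)) q))))) q := by
  have h1 : DifferentiableAt ℝ (fun q : Config n × Config n => (inner ℝ q.1 q.2 : ℝ)) q :=
    differentiableAt_fst.inner ℝ differentiableAt_snd
  have h2 := (Complex.ofRealCLM.hasFDerivAt.comp q h1.hasFDerivAt)
  exact ((h2.const_mul Complex.I).neg).cexp

lemma fderiv_phaseFactor_apply (q v : Config n × Config n) :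
    fderiv ℝ (fun q : Config n × Config n =>
        Complex.exp (-(Complex.I * ((inner ℝ q.1 q.2 : ℝ) : ℂ)))) q v =
      -Complex.I * ((inner ℝ v.1 q.2 + inner ℝ q.1 v.2 : ℝ) : ℂ) *
        Complex.exp (-(Complex.I * ((inner ℝ q.1 q.2 : ℝ) : ℂ))) := by
  rw [(hasFDerivAt_phaseFactor q).fderiv]
  have := fderiv_inner_apply ℝ (differentiableAt_fst (𝕜 := ℝ) (p := q)) differentiableAt_snd v
  simp [this, fderiv_fst, fderiv_snd]
  ring

/-- Integration by parts in the regularized integrals. -/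
lemma HasOscIntegral.ibp {p dp : Config n → Config n → ℂ} {J J' : ℂ} (v : Config n × Config n)
    (hp : ModerateGrowth fun q : Config n × Config n => p q.1 q.2)
    (hdiff : Differentiable ℝ fun q : Config n × Config n => p q.1 q.2)
    (hdp : ∀ q, fderiv ℝ (fun q : Config n × Config n => p q.1 q.2) q v = dp q.1 q.2)
    (h : HasOscIntegral p J) (h' : HasOscIntegral dp J') :
    HasOscIntegral (fun y η => ((inner ℝ v.1 η + inner ℝ y v.2 : ℝ) : ℂ) * p y η)
      (-Complex.I * J') := by
  have hl : ModerateGrowth fun q : Config n × Config n =>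
      ((inner ℝ v.1 q.2 + inner ℝ q.1 v.2 : ℝ) : ℂ) := by
    refine ⟨by fun_prop, ‖v.1‖ + ‖v.2‖, 1, fun q => ?_⟩
    rw [Complex.norm_real, pow_one]
    have e1 := norm_fst_le q
    have e2 := norm_snd_le q
    calc ‖(inner ℝ v.1 q.2 + inner ℝ q.1 v.2 : ℝ)‖ ≤ ‖v.1‖ * ‖q.2‖ + ‖q.1‖ * ‖v.2‖ :=
          (norm_add_le _ _).trans (add_le_add (norm_inner_le_norm _ _) (norm_inner_le_norm _ _))
      _ ≤ ‖v.1‖ * ‖q‖ + ‖q‖ * ‖v.2‖ := by gcongr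
      _ ≤ _ := by nlinarith [norm_nonneg v.1, norm_nonneg v.2]
  set pl : Config n → Config n → ℂ :=
    fun y η => ((inner ℝ v.1 η + inner ℝ y v.2 : ℝ) : ℂ) * p y η with hpl
  have hlp : ModerateGrowth fun q : Config n × Config n =>
      ((inner ℝ v.1 q.2 + inner ℝ q.1 v.2 : ℝ) : ℂ) * p q.1 q.2 := hl.mul hp
  intro κ hκ
  refine ⟨fun ε hε => integrable_oscIntegrand κ (p := pl) hlp hε, ?_⟩
  set κ' : 𝓢(Config n × Config n, ℂ) := LineDeriv.lineDerivOp v κ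
  have t1 := (h.tendsto κ').2
  have t2 := (h'.tendsto κ).2
  have hε0 : Tendsto (fun ε : ℝ => (ε : ℂ)) (𝓝[>] 0) (𝓝 0) := by
    have : Tendsto (fun ε : ℝ => (ε : ℂ)) (𝓝 0) (𝓝 ((0 : ℝ) : ℂ)) :=
      Complex.continuous_ofReal.tendsto 0
    simpa using this.mono_left nhdsWithin_le_nhds
  -- The derivative that falls on the cut-off κ(εq) produces ε times a regularized integral of `p`
  -- itself, with `κ'` in place of κ. The latter converges, so this term disappears in the limit.
  have t3 := ((t2.add (hε0.mul t1)).const_mul (-Complex.I))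
  rw [hκ, one_mul, zero_mul, add_zero] at t3
  refine t3.congr' ?_
  filter_upwards [self_mem_nhdsWithin] with ε hε
  have hε : 0 < ε := hε
  set e : Config n × Config n → ℂ := fun q =>
    Complex.exp (-(Complex.I * ((inner ℝ q.1 q.2 : ℝ) : ℂ))) with he
  set u : Config n × Config n → ℂ := fun q => κ (ε • q) * p q.1 q.2 with hu
  have hκd : ∀ q, HasFDerivAt (fun q : Config n × Config n => κ (ε • q))
      ((fderiv ℝ κ (ε • q)).comp (ε • ContinuousLinearMap.id ℝ _)) q := by
    intro q
    have : HasFDerivAt (fun q : Config n × Config n => ε • q)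
      (ε • ContinuousLinearMap.id ℝ (Config n × Config n)) q :=
      (hasFDerivAt_id q).const_smul ε
    exact (κ.differentiableAt.hasFDerivAt (x := ε • q)).comp q this
  have hud : ∀ q, fderiv ℝ u q v = κ (ε • q) * dp q.1 q.2 + ε * (κ' (ε • q) * p q.1 q.2) := by
    intro q
    have := (hκd q).mul (hdiff q).hasFDerivAt
    rw [← hdp]
    change fderiv ℝ ((fun q : Config n × Config n => κ (ε • q)) * fun q => p q.1 q.2) q v = _
    rw [HasFDerivAt.fderiv this]
    simp [κ', SchwartzMap.lineDerivOp_apply_eq_fderiv]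
    ring
  have hed : ∀ q, fderiv ℝ e q v =
      -Complex.I * ((inner ℝ v.1 q.2 + inner ℝ q.1 v.2 : ℝ) : ℂ) * e q :=
    fun q => fderiv_phaseFactor_apply q v
  have i0 : Integrable (fun q => e q * u q) := by
    refine ((h.tendsto κ).1 ε hε).congr (Eventually.of_forall fun q => ?_)
    simp only [oscIntegrand, e, u]; ring
  have i1 : Integrable (fun q => fderiv ℝ e q v * u q) := by
    have := (integrable_oscIntegrand κ (p := pl) hlp hε).const_mul (-Complex.I)
    refine this.congr (Eventually.of_forall fun q => ?_)
    simp only [hed, oscIntegrand, e, u, pl]; ring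
  have ia := (h'.tendsto κ).1 ε hε
  have ib := ((h.tendsto κ').1 ε hε).const_mul (ε : ℂ)
  have i2 : Integrable (fun q => e q * fderiv ℝ u q v) := by
    refine (ia.add ib).congr (Eventually.of_forall fun q => ?_)
    simp only [hud, oscIntegrand, e, Pi.add_apply]; ring
  have key := integral_mul_fderiv_eq_neg_fderiv_mul_of_integrable (μ := volume) i1 i2 i0
    (fun q _ => (hasFDerivAt_phaseFactor q).differentiableAt)
    (fun q _ => ((hκd q).mul (hdiff q).hasFDerivAt).differentiableAt)
  have k1 : ∫ q, e q * fderiv ℝ u q v = (∫ q, oscIntegrand κ dp ε q) +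
      ε * ∫ q, oscIntegrand κ' p ε q := by
    rw [← integral_const_mul, ← integral_add ia ib]
    refine integral_congr_ae (Eventually.of_forall fun q => ?_)
    simp only [hud, oscIntegrand, e]; ring
  have k2 : ∫ q, fderiv ℝ e q v * u q = -Complex.I * ∫ q, oscIntegrand κ pl ε q := by
    rw [← integral_const_mul]
    refine integral_congr_ae (Eventually.of_forall fun q => ?_)
    simp only [hed, oscIntegrand, e, u, pl]; ring
  rw [k1, k2] at key
  simp only [oscMean]
  have k3 := congrArg (fun x => -Complex.I * x) key
  have k4 : ∫ q, oscIntegrand κ pl ε q =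
      -Complex.I * ((∫ q, oscIntegrand κ dp ε q) + ε * ∫ q, oscIntegrand κ' p ε q) := by
    rw [k3]
    linear_combination (∫ q, oscIntegrand κ pl ε q) * Complex.I_mul_I
  rw [k4]; ring

/-- An absolutely convergent integral is an oscillatory integral. -/
lemma hasOscIntegral_of_integrable {p : Config n → Config n → ℂ}
    (hp : ModerateGrowth fun q : Config n × Config n => p q.1 q.2)
    (hi : Integrable fun q : Config n × Config n => p q.1 q.2) :
    HasOscIntegral p ((((2 * Real.pi) ^ n : ℝ) : ℂ)⁻¹ * ∫ q : Config n × Config n,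
      Complex.exp (-(Complex.I * ((inner ℝ q.1 q.2 : ℝ) : ℂ))) * p q.1 q.2) := by
  intro κ hκ
  refine ⟨fun ε hε => integrable_oscIntegrand κ hp hε, Tendsto.const_mul _ ?_⟩
  obtain ⟨A, hA0, hA⟩ := schwartz_decay κ 0
  refine tendsto_integral_filter_of_dominated_convergence (fun q => A * ‖p q.1 q.2‖) ?_ ?_
    (hi.norm.const_mul A) (Eventually.of_forall fun q => ?_)
  · exact Eventually.of_forall fun ε =>
      (continuous_oscIntegrand κ hp.continuous ε).aestronglyMeasurable
  · refine Eventually.of_forall fun ε => Eventually.of_forall fun q => ?_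
    rw [oscIntegrand, norm_mul, norm_mul, norm_cexp_neg_I_mul, one_mul]
    gcongr
    simpa using hA (ε • q)
  · have h1 : Tendsto (fun ε : ℝ => κ (ε • q)) (𝓝[>] 0) (𝓝 1) := by
      have : Continuous fun ε : ℝ => κ (ε • q) := κ.continuous.comp (by fun_prop)
      have := this.tendsto 0
      rw [zero_smul, hκ] at this
      exact this.mono_left nhdsWithin_le_nhds
    have := (h1.const_mul (Complex.exp (-(Complex.I * ((inner ℝ q.1 q.2 : ℝ) : ℂ))))).mul_const
      (p q.1 q.2)
    simpa [oscIntegrand] using this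

end Osc

/-! ### Japanese brackets and Peetre's inequality. -/

section Bracket

variable {E : Type*} [NormedAddCommGroup E]

lemma one_le_bracket [InnerProductSpace ℝ E] (z : E) : 1 ≤ bracket z :=
  Real.one_le_sqrt.2 (by nlinarith [norm_nonneg z])

lemma bracket_pos [InnerProductSpace ℝ E] (z : E) : 0 < bracket z :=
  one_pos.trans_le (one_le_bracket z)

lemma norm_le_bracket [InnerProductSpace ℝ E] (z : E) : ‖z‖ ≤ bracket z :=
  Real.le_sqrt_of_sq_le (by linarith)

lemma bracket_le_one_add_norm [InnerProductSpace ℝ E] (z : E) : bracket z ≤ 1 + ‖z‖ := by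
  refine (Real.sqrt_le_left (by positivity)).2 ?_
  nlinarith [norm_nonneg z]

lemma bracket_sq [InnerProductSpace ℝ E] (z : E) : bracket z ^ 2 = 1 + ‖z‖ ^ 2 :=
  Real.sq_sqrt (by positivity)

lemma bracket_zero [InnerProductSpace ℝ E] : bracket (0 : E) = 1 := by simp [bracket]

lemma continuous_bracket [InnerProductSpace ℝ E] : Continuous (bracket : E → ℝ) := by
  unfold bracket; fun_prop

lemma bracket_le_of_norm_le [InnerProductSpace ℝ E] {F : Type*} [NormedAddCommGroup F]
    [InnerProductSpace ℝ F] {z : E} {w : F} (h : ‖z‖ ≤ ‖w‖) : bracket z ≤ bracket w :=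
  Real.sqrt_le_sqrt (by gcongr)

/-- Peetre's inequality, base case. -/
lemma bracket_add_le [InnerProductSpace ℝ E] (z h : E) :
    bracket (z + h) ≤ 2 * (bracket z * bracket h) := by
  have h1 := bracket_le_one_add_norm (z + h)
  have h2 := norm_add_le z h
  have h3 : (1 + ‖z‖ ^ 2) * (1 + ‖h‖ ^ 2) = (bracket z * bracket h) ^ 2 := by
    rw [mul_pow, bracket_sq, bracket_sq]
  have h4 := bracket_sq (z + h)
  have h5 : ‖z + h‖ ^ 2 ≤ (‖z‖ + ‖h‖) ^ 2 := by gcongr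
  refine abs_le_of_sq_le_sq' ?_ (mul_nonneg zero_le_two
    (mul_pos (bracket_pos z) (bracket_pos h)).le) |>.2
  rw [mul_pow, ← h3, h4]
  nlinarith [sq_nonneg (‖z‖ - ‖h‖), sq_nonneg (‖z‖ * ‖h‖)]

lemma bracket_le_add [InnerProductSpace ℝ E] (z h : E) :
    bracket z ≤ 2 * (bracket (z + h) * bracket h) := by
  have := bracket_add_le (z + h) (-h)
  rw [add_neg_cancel_right] at this
  simpa [bracket] using this

end Bracket

/-! ### Iterated partial derivatives and uniformly bounded families. -/

section Partial

variable {ι : Type*} [Fintype ι] [DecidableEq ι]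

/-- The partial derivative in the coordinate direction `i`. -/
def cderiv (i : ι) (f : EuclideanSpace ℝ ι → ℂ) : EuclideanSpace ℝ ι → ℂ :=
  fun y => fderiv ℝ f y (EuclideanSpace.single i 1)

/-- Iterated partial derivatives; the first entry of the list is applied first. -/
def pd (l : List ι) (f : EuclideanSpace ℝ ι → ℂ) : EuclideanSpace ℝ ι → ℂ :=
  l.foldl (fun g i => cderiv i g) f

@[simp] lemma pd_nil (f : EuclideanSpace ℝ ι → ℂ) : pd [] f = f := rfl

@[simp] lemma pd_cons (i : ι) (l : List ι) (f : EuclideanSpace ℝ ι → ℂ) :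
    pd (i :: l) f = pd l (cderiv i f) := rfl

lemma contDiff_cderiv {f : EuclideanSpace ℝ ι → ℂ} (hf : ContDiff ℝ ∞ f) (i : ι) :
    ContDiff ℝ ∞ (cderiv i f) :=
  (hf.fderiv_right (m := ∞) (by simp)).clm_apply contDiff_const

lemma cderiv_add {f g : EuclideanSpace ℝ ι → ℂ} (hf : ContDiff ℝ ∞ f) (hg : ContDiff ℝ ∞ g)
    (i : ι) : cderiv i (fun y => f y + g y) = fun y => cderiv i f y + cderiv i g y := by
  funext y
  have h1 := (hf.differentiable (by simp) y)
  have h2 := (hg.differentiable (by simp) y)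
  simp only [cderiv]
  rw [fderiv_fun_add h1 h2]; rfl

lemma cderiv_mul {f g : EuclideanSpace ℝ ι → ℂ} (hf : ContDiff ℝ ∞ f) (hg : ContDiff ℝ ∞ g)
    (i : ι) : cderiv i (fun y => f y * g y) =
      fun y => cderiv i f y * g y + f y * cderiv i g y := by
  funext y
  have h1 := (hf.differentiable (by simp) y)
  have h2 := (hg.differentiable (by simp) y)
  simp only [cderiv]
  rw [fderiv_fun_mul h1 h2]
  simp; ring

lemma cderiv_const_mul {f : EuclideanSpace ℝ ι → ℂ} (hf : ContDiff ℝ ∞ f) (c : ℂ)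
    (i : ι) : cderiv i (fun y => c * f y) = fun y => c * cderiv i f y := by
  funext y
  simp only [cderiv]
  rw [fderiv_const_mul (hf.differentiable (by simp) y)]; rfl

lemma pd_add {f g : EuclideanSpace ℝ ι → ℂ} (hf : ContDiff ℝ ∞ f) (hg : ContDiff ℝ ∞ g)
    (l : List ι) : pd l (fun y => f y + g y) = fun y => pd l f y + pd l g y := by
  induction l generalizing f g with
  | nil => rfl
  | cons i l ih => rw [pd_cons, cderiv_add hf hg, ih (contDiff_cderiv hf i) (contDiff_cderiv hg i)]
                   rfl

lemma pd_const_mul {f : EuclideanSpace ℝ ι → ℂ} (hf : ContDiff ℝ ∞ f) (c : ℂ)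
    (l : List ι) : pd l (fun y => c * f y) = fun y => c * pd l f y := by
  induction l generalizing f with
  | nil => rfl
  | cons i l ih => rw [pd_cons, cderiv_const_mul hf, ih (contDiff_cderiv hf i)]; rfl

/-- Families of smooth functions all of whose derivatives are bounded by a given weight, uniformly
in the parameter. -/
structure BddFam {T : Type*} (σ : T → EuclideanSpace ℝ ι → ℝ) (f : T → EuclideanSpace ℝ ι → ℂ) :
    Prop where
  smooth : ∀ t, ContDiff ℝ ∞ (f t)
  bound : ∀ l : List ι, ∃ C : ℝ, ∀ t y, ‖pd l (f t) y‖ ≤ C * σ t y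

variable {T : Type*} {σ σ' : T → EuclideanSpace ℝ ι → ℝ} {f g : T → EuclideanSpace ℝ ι → ℂ}

lemma BddFam.cderiv (hf : BddFam σ f) (i : ι) : BddFam σ (fun t => cderiv i (f t)) :=
  ⟨fun t => contDiff_cderiv (hf.smooth t) i, fun l => hf.bound (i :: l)⟩

lemma BddFam.mono (hf : BddFam σ f) {K : ℝ} (hσ : ∀ t y, 0 ≤ σ t y)
    (h : ∀ t y, σ t y ≤ K * σ' t y) : BddFam σ' f := by
  refine ⟨hf.smooth, fun l => ?_⟩
  obtain ⟨C, hC⟩ := hf.bound l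
  refine ⟨|C| * K, fun t y => (hC t y).trans ?_⟩
  calc C * σ t y ≤ |C| * σ t y := mul_le_mul_of_nonneg_right (le_abs_self C) (hσ t y)
    _ ≤ |C| * (K * σ' t y) := mul_le_mul_of_nonneg_left (h t y) (abs_nonneg C)
    _ = _ := by ring

lemma BddFam.add (hf : BddFam σ f) (hg : BddFam σ g) : BddFam σ (fun t y => f t y + g t y) := by
  refine ⟨fun t => (hf.smooth t).add (hg.smooth t), fun l => ?_⟩
  obtain ⟨C, hC⟩ := hf.bound l
  obtain ⟨C', hC'⟩ := hg.bound l
  refine ⟨C + C', fun t y => ?_⟩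
  rw [pd_add (hf.smooth t) (hg.smooth t), add_mul]
  exact (norm_add_le _ _).trans (add_le_add (hC t y) (hC' t y))

lemma BddFam.const_mul (hf : BddFam σ f) (c : ℂ) : BddFam σ (fun t y => c * f t y) := by
  refine ⟨fun t => contDiff_const.mul (hf.smooth t), fun l => ?_⟩
  obtain ⟨C, hC⟩ := hf.bound l
  refine ⟨‖c‖ * C, fun t y => ?_⟩
  rw [pd_const_mul (hf.smooth t), norm_mul, mul_assoc]
  exact mul_le_mul_of_nonneg_left (hC t y) (norm_nonneg _)

lemma BddFam.mul (hf : BddFam σ f) (hg : BddFam σ' g) :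
    BddFam (fun t y => σ t y * σ' t y) (fun t y => f t y * g t y) := by
  refine ⟨fun t => (hf.smooth t).mul (hg.smooth t), fun l => ?_⟩
  induction l generalizing f g with
  | nil =>
    obtain ⟨C, hC⟩ := hf.bound []
    obtain ⟨C', hC'⟩ := hg.bound []
    refine ⟨C * C', fun t y => ?_⟩
    simp only [pd_nil] at *
    rw [norm_mul]
    calc ‖f t y‖ * ‖g t y‖ ≤ (C * σ t y) * (C' * σ' t y) :=
          mul_le_mul (hC t y) (hC' t y) (norm_nonneg _) ((norm_nonneg _).trans (hC t y))
      _ = _ := by ring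
  | cons i l ih =>
    obtain ⟨C, hC⟩ := ih (hf.cderiv i) hg
    obtain ⟨C', hC'⟩ := ih hf (hg.cderiv i)
    refine ⟨C + C', fun t y => ?_⟩
    rw [pd_cons, cderiv_mul (hf.smooth t) (hg.smooth t),
      pd_add ((contDiff_cderiv (hf.smooth t) i).mul (hg.smooth t))
        ((hf.smooth t).mul (contDiff_cderiv (hg.smooth t) i)), add_mul]
    exact (norm_add_le _ _).trans (add_le_add (hC t y) (hC' t y))

/-- Families of smooth functions, all derivatives of which are `O(⟨y⟩^M)`. -/
abbrev TempFam (M : ℝ) (f : T → EuclideanSpace ℝ ι → ℂ) : Prop :=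
  BddFam (fun _ y => bracket y ^ M) f

lemma TempFam.mul {M M' : ℝ} (hf : TempFam M f) (hg : TempFam M' g) :
    TempFam (M + M') (fun t y => f t y * g t y) := by
  have := BddFam.mul hf hg
  refine this.mono (K := 1) (fun t y => ?_) (fun t y => ?_)
  · have := bracket_pos y; positivity
  · rw [one_mul, Real.rpow_add (bracket_pos y)]

lemma TempFam.mono {M M' : ℝ} (hf : TempFam M f) (h : M ≤ M') : TempFam M' f :=
  BddFam.mono hf (K := 1) (fun t y => Real.rpow_nonneg (bracket_pos y).le _) (fun t y => by
    rw [one_mul]; exact Real.rpow_le_rpow_of_exponent_le (one_le_bracket y) h)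

lemma TempFam.moderateGrowth {M : ℝ} (hf : TempFam M f) (t : T) : ModerateGrowth (f t) := by
  obtain ⟨C, hC⟩ := hf.bound []
  refine ⟨(hf.smooth t).continuous, |C|, ⌈|M|⌉₊, fun y => (hC t y).trans ?_⟩
  have h1 := one_le_bracket y
  have h2 := bracket_le_one_add_norm y
  rw [← Real.rpow_natCast]
  refine mul_le_mul (le_abs_self C) ?_ (by positivity) (abs_nonneg C)
  calc bracket y ^ M ≤ bracket y ^ (⌈|M|⌉₊ : ℝ) :=
        Real.rpow_le_rpow_of_exponent_le h1 ((le_abs_self M).trans (Nat.le_ceil _))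
    _ ≤ (1 + ‖y‖) ^ (⌈|M|⌉₊ : ℝ) :=
        Real.rpow_le_rpow (by positivity) h2 (by positivity)

lemma ModerateGrowth.tensor {X Y : Type*} [NormedAddCommGroup X] [NormedAddCommGroup Y]
    {p : Y → ℂ} {r : X → ℂ} (hp : ModerateGrowth p) (hr : ModerateGrowth r) :
    ModerateGrowth (fun q : X × Y => p q.2 * r q.1) := by
  have h1 : ModerateGrowth (fun q : X × Y => p q.2) := by
    obtain ⟨C, k, h⟩ := hp.bound
    refine ⟨hp.continuous.comp continuous_snd, |C|, k, fun q => (h q.2).trans ?_⟩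
    have := norm_snd_le q
    gcongr
    exact le_abs_self C
  have h2 : ModerateGrowth (fun q : X × Y => r q.1) := by
    obtain ⟨C, k, h⟩ := hr.bound
    refine ⟨hr.continuous.comp continuous_fst, |C|, k, fun q => (h q.1).trans ?_⟩
    have := norm_fst_le q
    gcongr
    exact le_abs_self C
  exact h1.mul h2

/-- `(1 + i y_j)⁻¹`. -/
def cinv (j : ι) (y : EuclideanSpace ℝ ι) : ℂ := (1 + Complex.I * (y j : ℂ))⁻¹

lemma one_add_I_mul_ne_zero (r : ℝ) : (1 + Complex.I * (r : ℂ)) ≠ 0 := by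
  intro h
  have := congrArg Complex.re h
  simp at this

lemma norm_cinv_sq (j : ι) (y : EuclideanSpace ℝ ι) : ‖cinv j y‖ ^ 2 = (1 + y j ^ 2)⁻¹ := by
  rw [cinv, norm_inv, inv_pow, ← Complex.normSq_eq_norm_sq]
  simp [Complex.normSq_apply, sq]

lemma norm_cinv_le_one (j : ι) (y : EuclideanSpace ℝ ι) : ‖cinv j y‖ ≤ 1 := by
  have h := norm_cinv_sq j y
  have : (1 + y j ^ 2)⁻¹ ≤ 1 := inv_le_one_of_one_le₀ (by nlinarith [sq_nonneg (y j)])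
  nlinarith [norm_nonneg (cinv j y)]

lemma hasFDerivAt_coord (j : ι) (y : EuclideanSpace ℝ ι) :
    HasFDerivAt (fun y : EuclideanSpace ℝ ι => 1 + Complex.I * ((y j : ℝ) : ℂ))
      (Complex.I • Complex.ofRealCLM.comp (EuclideanSpace.proj j : EuclideanSpace ℝ ι →L[ℝ] ℝ)) y :=
  (((Complex.ofRealCLM.comp
    (EuclideanSpace.proj j : EuclideanSpace ℝ ι →L[ℝ] ℝ)).hasFDerivAt).const_mul
      Complex.I).const_add 1

lemma contDiff_coord (j : ι) : ContDiff ℝ ∞ (fun y : EuclideanSpace ℝ ι => ((y j : ℝ) : ℂ)) :=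
  (Complex.ofRealCLM.comp (EuclideanSpace.proj j : EuclideanSpace ℝ ι →L[ℝ] ℝ)).contDiff

lemma contDiff_cinv (j : ι) : ContDiff ℝ ∞ (cinv (ι := ι) j) :=
  (contDiff_const.add (contDiff_const.mul (contDiff_coord j))).inv
    fun y => one_add_I_mul_ne_zero _

lemma cderiv_cinv_pow (i j : ι) (m : ℕ) : cderiv i (fun y => cinv j y ^ m) =
    fun y => (if i = j then -Complex.I * m else 0) * cinv j y ^ (m + 1) := by
  funext y
  have h1 := (hasFDerivAt_coord j y)
  have h2 := ((hasDerivAt_inv (one_add_I_mul_ne_zero (y j))).comp_hasFDerivAt y h1).pow m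
  have h3 : HasFDerivAt (fun y => cinv j y ^ m) _ y := h2
  simp only [cderiv]
  rw [h3.fderiv]
  rcases m with _ | m
  · simp
  · by_cases hij : i = j
    · subst hij
      simp only [Nat.add_sub_cancel, Function.comp, _root_.smul_apply,
        ContinuousLinearMap.comp_apply, cinv, if_true]
      simp
      field_simp [one_add_I_mul_ne_zero (y i)]
      ring
    · simp [hij, Ne.symm hij]

/-- Differentiation turns the power m of `cinv j` into a multiple of the power m + 1, and |`cinv j`|
≤ 1. The induction over the list therefore treats all positive powers at once. -/
lemma bddFam_cinv (j : ι) : BddFam (fun (_ : T) y => ‖cinv j y‖) (fun _ => cinv j) := by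
  have key : ∀ l : List ι, ∀ m : ℕ, ∃ C : ℝ, 0 ≤ C ∧ ∀ y,
      ‖pd l (fun y => cinv j y ^ (m + 1)) y‖ ≤ C * ‖cinv j y‖ := by
    intro l
    induction l with
    | nil =>
      intro m
      refine ⟨1, zero_le_one, fun y => ?_⟩
      rw [pd_nil, norm_pow, pow_succ, mul_comm, mul_comm 1]
      exact mul_le_mul_of_nonneg_left (pow_le_one₀ (norm_nonneg _) (norm_cinv_le_one j y))
        (norm_nonneg _)
    | cons i l ih =>
      intro m
      obtain ⟨C, hC0, hC⟩ := ih (m + 1)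
      refine ⟨(m + 1) * C, by positivity, fun y => ?_⟩
      rw [pd_cons, cderiv_cinv_pow, pd_const_mul ((contDiff_cinv j).pow _), norm_mul, mul_assoc]
      have : ‖(if i = j then -Complex.I * ((m + 1 : ℕ) : ℂ) else 0)‖ ≤ (m : ℝ) + 1 := by
        split_ifs
        · rw [norm_mul, norm_neg, Complex.norm_I, one_mul, Complex.norm_natCast]; push_cast; rfl
        · rw [norm_zero]; positivity
      exact mul_le_mul this (hC y) (norm_nonneg _) (by positivity)
  refine ⟨fun _ => contDiff_cinv j, fun l => ?_⟩
  obtain ⟨C, _, hC⟩ := key l 0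
  exact ⟨C, fun t y => by simpa using hC y⟩

lemma tempFam_cinv (j : ι) : TempFam 0 (fun (_ : T) => cinv (ι := ι) j) :=
  (bddFam_cinv j).mono (K := 1) (fun t y => norm_nonneg _)
    (fun t y => by simpa using norm_cinv_le_one j y)

/-- Products of factors `(1 + i y_j)⁻¹`. -/
def cinvs (l : List ι) (y : EuclideanSpace ℝ ι) : ℂ := (l.map fun j => cinv j y).prod

lemma bddFam_cinvs (l : List ι) :
    BddFam (fun (_ : T) y => ‖cinvs l y‖) (fun _ => cinvs l) := by
  induction l with
  | nil =>
    refine ⟨fun _ => by unfold cinvs; simpa using contDiff_const, fun l => ?_⟩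
    have h1 : cinvs ([] : List ι) = fun _ => 1 := by funext y; simp [cinvs]
    rcases l with _ | ⟨i, l⟩
    · exact ⟨1, fun t y => by simp⟩
    · refine ⟨0, fun t y => ?_⟩
      have h0 : cderiv i (cinvs ([] : List ι)) = fun y => 0 * (1 : ℂ) := by
        funext y; simp [h1, cderiv]
      rw [pd_cons, h0, pd_const_mul contDiff_const]
      simp
  | cons j l ih =>
    have h : cinvs (j :: l) = fun y => cinv j y * cinvs l y := by funext y; simp [cinvs]
    simpa only [h, norm_mul] using (bddFam_cinv j).mul ih

lemma one_add_sum_le_prod {κ : Type*} (s : Finset κ) (r : κ → ℝ) (hr : ∀ i, 0 ≤ r i) :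
    1 + ∑ i ∈ s, r i ≤ ∏ i ∈ s, (1 + r i) := by
  classical
  induction s using Finset.induction_on with
  | empty => simp
  | insert a s ha ih =>
    rw [Finset.sum_insert ha, Finset.prod_insert ha]
    have h1 : 0 ≤ ∑ i ∈ s, r i := Finset.sum_nonneg fun i _ => hr i
    have h2 := hr a
    nlinarith [mul_le_mul_of_nonneg_left ih h2, mul_nonneg h2 h1]

/-- Multiplying out, ∏(1 + y_j²) ≥ 1 + |y|². One factor for each coordinate thus gains a full power
of ⟨y⟩, although a single factor decays in one direction only. -/
lemma norm_prod_cinv_le (y : EuclideanSpace ℝ ι) :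
    ‖∏ j, cinv j y‖ ≤ bracket y ^ (-1 : ℝ) := by
  rw [Real.rpow_neg_one]
  refine abs_le_of_sq_le_sq' ?_ (inv_nonneg.2 (bracket_pos y).le) |>.2
  rw [norm_prod, ← Finset.prod_pow, inv_pow, bracket_sq, EuclideanSpace.norm_sq_eq]
  simp only [norm_cinv_sq, Finset.prod_inv_distrib]
  have h : 1 + ∑ i, ‖y i‖ ^ 2 ≤ ∏ i, (1 + y i ^ 2) := by
    simpa using one_add_sum_le_prod Finset.univ (fun i => y i ^ 2) (fun i => sq_nonneg _)
  exact inv_anti₀ (by positivity) h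

/-- Multiplication by sufficiently many factors `(1 + i y_j)⁻¹` makes a tempered family decay. -/
lemma exists_cinvs_mul {M : ℝ} (hf : TempFam M f) (K : ℝ) :
    ∃ l : List ι, TempFam K (fun t y => cinvs l y * f t y) := by
  -- Each round through all coordinates lowers the growth by one power of ⟨y⟩, and the growth has to
  -- drop from M to K.
  set P : ℕ := ⌈M - K⌉₊
  set l : List ι := (List.replicate P (Finset.univ : Finset ι).toList).flatten
  refine ⟨l, TempFam.mono (M := -(P : ℝ) + M) ?_ ?_⟩
  · refine TempFam.mul ((bddFam_cinvs l).mono (K := 1) (fun t y => norm_nonneg _) fun t y => ?_) hf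
    have : cinvs l y = (∏ j, cinv j y) ^ P := by
      simp [cinvs, l, List.map_flatten, List.prod_flatten]
    rw [one_mul, this, norm_pow, neg_eq_neg_one_mul, Real.rpow_mul (bracket_pos y).le,
      Real.rpow_natCast]
    exact pow_le_pow_left₀ (norm_nonneg _) (norm_prod_cinv_le y) P
  · have := Nat.le_ceil (M - K)
    linarith

end Partial

/-! ### Existence and uniform boundedness for tempered families. -/

section OscForm

variable {n : ℕ} {T : Type*}

/-- The oscillatory integral `(2π)^{-n} ∬ e^{-i y·η} f(η) g(y) dy dη`. -/
def oscForm (f g : Config n → ℂ) : ℂ :=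
  Classical.epsilon (HasOscIntegral fun y η => f η * g y)

lemma oscForm_eq {f g : Config n → ℂ} {J : ℂ} (h : HasOscIntegral (fun y η => f η * g y) J) :
    oscForm f g = J :=
  (Classical.epsilon_spec (p := HasOscIntegral fun y η => f η * g y) ⟨J, h⟩).unique h

/-- Uniformly bounded families of oscillatory integrals. -/
def UnifOsc (f g : T → Config n → ℂ) : Prop :=
  ∃ (J : T → ℂ) (C : ℝ), ∀ t, HasOscIntegral (fun y η => f t η * g t y) (J t) ∧ ‖J t‖ ≤ C

lemma fderiv_tensor_right {f g : Config n → ℂ} (hf : ContDiff ℝ ∞ f) (hg : ContDiff ℝ ∞ g)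
    (j : Fin n) (q : Config n × Config n) :
    fderiv ℝ (fun q : Config n × Config n => f q.2 * g q.1) q (0, EuclideanSpace.single j 1) =
      cderiv j f q.2 * g q.1 := by
  have h1 : HasFDerivAt (fun q : Config n × Config n => f q.2) _ q :=
    (hf.differentiable (by simp) q.2).hasFDerivAt.comp q hasFDerivAt_snd
  have h2 : HasFDerivAt (fun q : Config n × Config n => g q.1) _ q :=
    (hg.differentiable (by simp) q.1).hasFDerivAt.comp q hasFDerivAt_fst
  have h3 : HasFDerivAt (fun q : Config n × Config n => f q.2 * g q.1) _ q := h1.mul h2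
  rw [h3.fderiv]
  simp [cderiv]; ring

lemma fderiv_tensor_left {f g : Config n → ℂ} (hf : ContDiff ℝ ∞ f) (hg : ContDiff ℝ ∞ g)
    (j : Fin n) (q : Config n × Config n) :
    fderiv ℝ (fun q : Config n × Config n => f q.2 * g q.1) q (EuclideanSpace.single j 1, 0) =
      f q.2 * cderiv j g q.1 := by
  have h1 : HasFDerivAt (fun q : Config n × Config n => f q.2) _ q :=
    (hf.differentiable (by simp) q.2).hasFDerivAt.comp q hasFDerivAt_snd
  have h2 : HasFDerivAt (fun q : Config n × Config n => g q.1) _ q :=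
    (hg.differentiable (by simp) q.1).hasFDerivAt.comp q hasFDerivAt_fst
  have h3 : HasFDerivAt (fun q : Config n × Config n => f q.2 * g q.1) _ q := h1.mul h2
  rw [h3.fderiv]
  simp [cderiv]

lemma differentiable_tensor {f g : Config n → ℂ} (hf : ContDiff ℝ ∞ f) (hg : ContDiff ℝ ∞ g) :
    Differentiable ℝ (fun q : Config n × Config n => f q.2 * g q.1) :=
  ((hf.differentiable (by simp)).comp differentiable_snd).mul
    ((hg.differentiable (by simp)).comp differentiable_fst)

section single

variable {f g : T → Config n → ℂ} {M M' : ℝ}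

/-- Since y_j e^{-i y·η} = i ∂_{η_j} e^{-i y·η}, a factor y_j is traded for a derivative of `f`. -/
lemma hasOscIntegral_coord_right (hf : TempFam M f) (hg : TempFam M' g) (j : Fin n) (t : T)
    {J J' : ℂ} (h : HasOscIntegral (fun y η => f t η * g t y) J)
    (h' : HasOscIntegral (fun y η => cderiv j (f t) η * g t y) J') :
    HasOscIntegral (fun y η => f t η * ((y j : ℂ) * g t y)) (-Complex.I * J') := by
  have := HasOscIntegral.ibp (p := fun y η => f t η * g t y)
    (dp := fun y η => cderiv j (f t) η * g t y) (0, EuclideanSpace.single j 1)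
    ((hf.moderateGrowth t).tensor (hg.moderateGrowth t))
    (differentiable_tensor (hf.smooth t) (hg.smooth t))
    (fderiv_tensor_right (hf.smooth t) (hg.smooth t) j) 
    h h'
  refine cast ?_ this
  congr 1
  funext y η
  simp [EuclideanSpace.inner_single_right]
  ring

lemma hasOscIntegral_coord_left (hf : TempFam M f) (hg : TempFam M' g) (j : Fin n) (t : T)
    {J J' : ℂ} (h : HasOscIntegral (fun y η => f t η * g t y) J)
    (h' : HasOscIntegral (fun y η => f t η * cderiv j (g t) y) J') :
    HasOscIntegral (fun y η => ((η j : ℂ) * f t η) * g t y) (-Complex.I * J') := by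
  have := HasOscIntegral.ibp (p := fun y η => f t η * g t y)
    (dp := fun y η => f t η * cderiv j (g t) y) (EuclideanSpace.single j 1, 0)
    ((hf.moderateGrowth t).tensor (hg.moderateGrowth t))
    (differentiable_tensor (hf.smooth t) (hg.smooth t))
    (fderiv_tensor_left (hf.smooth t) (hg.smooth t) j) 
    h h'
  refine cast ?_ this
  congr 1
  funext y η
  simp [EuclideanSpace.inner_single_left]
  ring

/-- Write g = (1 + i y_j)·(`cinv j`·g). The summand i y_j is integrated by parts and becomes a
derivative of `f` with coefficient i·(-i) = 1, whence the value J + J'. The growth of `g` is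
lowered, whereas `f` is only differentiated and stays in its class. -/
lemma UnifOsc.of_right (hf : TempFam M f) (hg : TempFam M' g) (j : Fin n)
    (h : UnifOsc f (fun t y => cinv j y * g t y))
    (h' : UnifOsc (fun t => cderiv j (f t)) (fun t y => cinv j y * g t y)) : UnifOsc f g := by
  obtain ⟨J, C, hJ⟩ := h
  obtain ⟨J', C', hJ'⟩ := h'
  have hg' : TempFam (0 + M') (fun t y => cinv j y * g t y) := (tempFam_cinv j).mul hg
  refine ⟨fun t => J t + J' t, C + C', fun t =>
    ⟨?_, (norm_add_le _ _).trans (add_le_add (hJ t).2 (hJ' t).2)⟩⟩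
  have h1 := hasOscIntegral_coord_right hf hg' j t (hJ t).1 (hJ' t).1
  have h2 := (hJ t).1.add (h1.const_mul Complex.I)
  refine cast ?_ h2
  congr 1
  · funext y η
    have := one_add_I_mul_ne_zero (y j)
    simp only [cinv]
    field_simp
  · linear_combination (-(J' t)) * Complex.I_mul_I

lemma UnifOsc.of_left (hf : TempFam M f) (hg : TempFam M' g) (j : Fin n)
    (h : UnifOsc (fun t y => cinv j y * f t y) g)
    (h' : UnifOsc (fun t y => cinv j y * f t y) (fun t => cderiv j (g t))) : UnifOsc f g := by
  obtain ⟨J, C, hJ⟩ := h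
  obtain ⟨J', C', hJ'⟩ := h'
  have hf' : TempFam (0 + M) (fun t y => cinv j y * f t y) := (tempFam_cinv j).mul hf
  refine ⟨fun t => J t + J' t, C + C', fun t =>
    ⟨?_, (norm_add_le _ _).trans (add_le_add (hJ t).2 (hJ' t).2)⟩⟩
  have h1 := hasOscIntegral_coord_left hf' hg j t (hJ t).1 (hJ' t).1
  have h2 := (hJ t).1.add (h1.const_mul Complex.I)
  refine cast ?_ h2
  congr 1
  · funext y η
    have := one_add_I_mul_ne_zero (η j)
    simp only [cinv]
    field_simp
  · linear_combination (-(J' t)) * Complex.I_mul_I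

end single

/-- Removing one factor involves both `f` and one of its derivatives, so the hypothesis has to cover
all families of growth `M` and not just the given one. -/
lemma UnifOsc.of_cinvs_right {M : ℝ} (l : List (Fin n)) {M' : ℝ} {g : T → Config n → ℂ}
    (hg : TempFam M' g)
    (h : ∀ f : T → Config n → ℂ, TempFam M f → UnifOsc f (fun t y => cinvs l y * g t y))
    (f : T → Config n → ℂ) (hf : TempFam M f) : UnifOsc f g := by
  induction l generalizing f g M' with
  | nil => simpa [cinvs] using h f hf
  | cons j l ih =>
    have h1 : ∀ f : T → Config n → ℂ, TempFam M f → UnifOsc f (fun t y => cinv j y * g t y) := by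
      refine ih ((tempFam_cinv j).mul hg) fun f hf => ?_
      refine cast ?_ (h f hf)
      congr 1
      funext t y
      simp [cinvs]; ring
    exact .of_right hf hg j (h1 f hf) (h1 _ (hf.cderiv j))

lemma UnifOsc.of_cinvs_left {M : ℝ} (l : List (Fin n)) {M' : ℝ} {f : T → Config n → ℂ}
    (hf : TempFam M' f)
    (h : ∀ g : T → Config n → ℂ, TempFam M g → UnifOsc (fun t y => cinvs l y * f t y) g)
    (g : T → Config n → ℂ) (hg : TempFam M g) : UnifOsc f g := by
  induction l generalizing f g M' with
  | nil => simpa [cinvs] using h g hg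
  | cons j l ih =>
    have h1 : ∀ g : T → Config n → ℂ, TempFam M g → UnifOsc (fun t y => cinv j y * f t y) g := by
      refine ih ((tempFam_cinv j).mul hf) fun g hg => ?_
      refine cast ?_ (h g hg)
      congr 1
      funext t y
      simp [cinvs]; ring
    exact .of_left hf hg j (h1 g hg) (h1 _ (hg.cderiv j))

lemma integrable_bracket_rpow :
    Integrable (fun y : Config n => bracket y ^ (-((n : ℝ) + 1))) := by
  have := integrable_rpow_neg_one_add_norm_sq (E := Config n) (μ := volume) (r := (n : ℝ) + 1)
    (by simp)
  refine this.congr (Eventually.of_forall fun y => ?_)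
  simp only [bracket]
  rw [Real.sqrt_eq_rpow, ← Real.rpow_mul (by positivity)]
  congr 1; ring

lemma unifOsc_of_decay {f g : T → Config n → ℂ} (hf : TempFam (-((n : ℝ) + 1)) f)
    (hg : TempFam (-((n : ℝ) + 1)) g) : UnifOsc f g := by
  obtain ⟨C, hC⟩ := hf.bound []
  obtain ⟨C', hC'⟩ := hg.bound []
  set b : Config n → ℝ := fun y => bracket y ^ (-((n : ℝ) + 1))
  have hb : ∀ y, 0 ≤ b y := fun y => Real.rpow_nonneg (bracket_pos y).le _
  have hInt : Integrable (fun q : Config n × Config n => (C * C') * (b q.1 * b q.2)) := by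
    rw [Measure.volume_eq_prod]
    exact (integrable_bracket_rpow.mul_prod integrable_bracket_rpow).const_mul _
  have hle : ∀ t (q : Config n × Config n), ‖f t q.2 * g t q.1‖ ≤ (C * C') * (b q.1 * b q.2) := by
    intro t q
    rw [norm_mul]
    calc ‖f t q.2‖ * ‖g t q.1‖ ≤ (C * b q.2) * (C' * b q.1) :=
          mul_le_mul (hC t _) (hC' t _) (norm_nonneg _) ((norm_nonneg _).trans (hC t _))
      _ = _ := by ring
  have hmod : ∀ t, ModerateGrowth fun q : Config n × Config n => f t q.2 * g t q.1 :=
    fun t => (hf.moderateGrowth t).tensor (hg.moderateGrowth t)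
  have hi : ∀ t, Integrable fun q : Config n × Config n => f t q.2 * g t q.1 := fun t =>
    hInt.mono' (hmod t).continuous.aestronglyMeasurable (Eventually.of_forall (hle t))
  refine ⟨_, ‖(((2 * Real.pi) ^ n : ℝ) : ℂ)⁻¹‖ * ∫ q : Config n × Config n,
    (C * C') * (b q.1 * b q.2),
    fun t => ⟨hasOscIntegral_of_integrable (p := fun y η => f t η * g t y) (hmod t) (hi t), ?_⟩⟩
  rw [norm_mul]
  refine mul_le_mul_of_nonneg_left ?_ (norm_nonneg _)
  refine norm_integral_le_of_norm_le hInt (Eventually.of_forall fun q => ?_)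
  rw [norm_mul, norm_cexp_neg_I_mul, one_mul]
  exact hle t q

/-- Oscillatory integrals of tempered families exist and are uniformly bounded. -/
theorem unifOsc_of_tempFam {M M' : ℝ} {f g : T → Config n → ℂ} (hf : TempFam M f)
    (hg : TempFam M' g) : UnifOsc f g := by
  -- First `g` is made to decay at the cost of derivatives of `f`, then `f` at the cost of
  -- derivatives of the modified `g`. The second step does no damage to the first because all
  -- derivatives of the modified `g` decay equally well.
  obtain ⟨l, hl⟩ := exists_cinvs_mul hg (-((n : ℝ) + 1))
  refine .of_cinvs_right l hg (fun f hf => ?_) f hf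
  obtain ⟨l', hl'⟩ := exists_cinvs_mul hf (-((n : ℝ) + 1))
  exact .of_cinvs_left l' hf (fun g hg => unifOsc_of_decay hl' hg) _ hl

lemma exists_norm_oscForm_le {M M' : ℝ} {f g : T → Config n → ℂ} (hf : TempFam M f)
    (hg : TempFam M' g) : ∃ C, ∀ t, ‖oscForm (f t) (g t)‖ ≤ C := by
  obtain ⟨J, C, hJ⟩ := unifOsc_of_tempFam hf hg
  exact ⟨C, fun t => by rw [oscForm_eq (hJ t).1]; exact (hJ t).2⟩

/-- Smooth functions all of whose derivatives are `O(⟨y⟩^M)` for one and the same `M`. -/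
def Tempered (f : Config n → ℂ) : Prop := ∃ M : ℝ, TempFam M (fun _ : Unit => f)

lemma TempFam.tempered {M : ℝ} {f : T → Config n → ℂ} (hf : TempFam M f) (t : T) :
    Tempered (f t) :=
  ⟨M, fun _ => hf.smooth t, fun l => (hf.bound l).imp fun C hC _ y => hC t y⟩

lemma Tempered.contDiff {f : Config n → ℂ} (hf : Tempered f) : ContDiff ℝ ∞ f :=
  hf.choose_spec.smooth ()

lemma Tempered.cderiv {f : Config n → ℂ} (hf : Tempered f) (j : Fin n) : Tempered (cderiv j f) :=
  hf.imp fun _ h => BddFam.cderiv h j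

lemma Tempered.add {f g : Config n → ℂ} (hf : Tempered f) (hg : Tempered g) :
    Tempered (fun y => f y + g y) := by
  obtain ⟨M, hM⟩ := hf
  obtain ⟨M', hM'⟩ := hg
  exact ⟨max M M', BddFam.add (hM.mono (le_max_left _ _)) (hM'.mono (le_max_right _ _))⟩

lemma Tempered.const_mul {f : Config n → ℂ} (hf : Tempered f) (c : ℂ) :
    Tempered (fun y => c * f y) :=
  hf.imp fun _ h => BddFam.const_mul h c

lemma tempered_const (c : ℂ) : Tempered (fun _ : Config n => c) := by
  have h : Tempered (cinvs ([] : List (Fin n))) :=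
    ⟨0, (bddFam_cinvs (T := Unit) ([] : List (Fin n))).mono (K := 1) (fun _ _ => norm_nonneg _)
      (fun _ y => by simp [cinvs])⟩
  simpa [cinvs] using h.const_mul c

lemma hasOscIntegral_oscForm {f g : Config n → ℂ} (hf : Tempered f) (hg : Tempered g) :
    HasOscIntegral (fun y η => f η * g y) (oscForm f g) := by
  obtain ⟨M, hM⟩ := hf
  obtain ⟨M', hM'⟩ := hg
  obtain ⟨J, C, hJ⟩ := unifOsc_of_tempFam hM hM'
  rw [oscForm_eq (hJ ()).1]
  exact (hJ ()).1

lemma oscForm_add_left {f f' g : Config n → ℂ} (hf : Tempered f) (hf' : Tempered f')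
    (hg : Tempered g) : oscForm (fun y => f y + f' y) g = oscForm f g + oscForm f' g := by
  refine oscForm_eq ?_
  simpa only [add_mul] using (hasOscIntegral_oscForm hf hg).add (hasOscIntegral_oscForm hf' hg)

lemma oscForm_add_right {f g g' : Config n → ℂ} (hf : Tempered f) (hg : Tempered g)
    (hg' : Tempered g') : oscForm f (fun y => g y + g' y) = oscForm f g + oscForm f g' := by
  refine oscForm_eq ?_
  simpa only [mul_add] using (hasOscIntegral_oscForm hf hg).add (hasOscIntegral_oscForm hf hg')

lemma oscForm_const_mul_left {f g : Config n → ℂ} (hf : Tempered f) (hg : Tempered g) (c : ℂ) :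
    oscForm (fun y => c * f y) g = c * oscForm f g := by
  refine oscForm_eq ?_
  simpa only [mul_assoc] using (hasOscIntegral_oscForm hf hg).const_mul c

lemma oscForm_const_mul_right {f g : Config n → ℂ} (hf : Tempered f) (hg : Tempered g) (c : ℂ) :
    oscForm f (fun y => c * g y) = c * oscForm f g := by
  refine oscForm_eq ?_
  simpa only [mul_left_comm] using (hasOscIntegral_oscForm hf hg).const_mul c

/-- This exchange is the source of the operators D_x in the asymptotic expansion: each Taylor factor
η_j of the left function becomes -i∂_j on the right one. -/
lemma oscForm_coord_mul {f g : Config n → ℂ} (hf : Tempered f) (hg : Tempered g) (j : Fin n) :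
    oscForm (fun η => (η j : ℂ) * f η) g = oscForm f (fun y => -Complex.I * cderiv j g y) := by
  rw [oscForm_const_mul_right hf (hg.cderiv j)]
  have h1 := hasOscIntegral_oscForm hf hg
  have h2 := hasOscIntegral_oscForm hf (hg.cderiv j)
  obtain ⟨M, hM⟩ := hf
  obtain ⟨M', hM'⟩ := hg
  exact oscForm_eq (hasOscIntegral_coord_left hM hM' j () h1 h2)

end OscForm

/-! ### Evaluation at the origin by Fourier inversion. -/

section Delta

open scoped FourierTransform

variable {n : ℕ}

/-- A regularizing factor of product form lets the η-integral be computed on its own, as a Fourier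
transform. -/
lemma exists_schwartz_tensor (n : ℕ) : ∃ (φ : 𝓢(Config n, ℂ)) (κ : 𝓢(Config n × Config n, ℂ)),
    φ 0 = 1 ∧ ∀ q, κ q = φ q.1 * φ q.2 := by
  let φ : ContDiffBump (0 : Config n) := ⟨1, 2, one_pos, one_lt_two⟩
  have h1 : HasCompactSupport (fun q => ((φ q : ℝ) : ℂ)) :=
    φ.hasCompactSupport.comp_left (g := fun r : ℝ => (r : ℂ)) (by simp)
  have h2 : ContDiff ℝ ∞ (fun q => ((φ q : ℝ) : ℂ)) := Complex.ofRealCLM.contDiff.comp φ.contDiff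
  have h3 : HasCompactSupport
      (fun q : Config n × Config n => ((φ q.1 : ℝ) : ℂ) * ((φ q.2 : ℝ) : ℂ)) := by
    refine HasCompactSupport.of_support_subset_isCompact
      ((isCompact_closedBall (0 : Config n) 2).prod (isCompact_closedBall (0 : Config n) 2)) ?_
    intro q hq
    have ha : (φ q.1 : ℝ) ≠ 0 := fun h => hq (by simp [h])
    have hb : (φ q.2 : ℝ) ≠ 0 := fun h => hq (by simp [h])
    have e := φ.support_eq
    exact ⟨Metric.ball_subset_closedBall (e ▸ Function.mem_support.2 ha),
      Metric.ball_subset_closedBall (e ▸ Function.mem_support.2 hb)⟩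
  have h4 : ContDiff ℝ ∞
      (fun q : Config n × Config n => ((φ q.1 : ℝ) : ℂ) * ((φ q.2 : ℝ) : ℂ)) :=
    (h2.comp contDiff_fst).mul (h2.comp contDiff_snd)
  exact ⟨h1.toSchwartzMap h2, h3.toSchwartzMap h4, by
    simp [φ.one_of_mem_closedBall (Metric.mem_closedBall_self (by simp [φ]))], fun q => rfl⟩

lemma integral_fourier_schwartz (φ : 𝓢(Config n, ℂ)) : ∫ u, (𝓕 φ) u = φ 0 := by
  have h := φ.continuous.fourierInv_fourier_eq φ.integrable (𝓕 φ).integrable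
  have h0 := congrFun h 0
  rw [Real.fourierInv_eq'] at h0
  simpa [SchwartzMap.fourier_coe] using h0

/-- Substitute v = εη. The 2π in the argument accounts for the kernel e^{-2πi v·w} in the definition
of the Fourier transform. -/
lemma integral_phase_smul (φ : 𝓢(Config n, ℂ)) {ε : ℝ} (hε : 0 < ε) (y : Config n) :
    ∫ η, Complex.exp (-(Complex.I * ((inner ℝ y η : ℝ) : ℂ))) * φ (ε • η) =
      (((ε ^ n)⁻¹ : ℝ) : ℂ) * (𝓕 φ) ((2 * Real.pi * ε)⁻¹ • y) := by
  have hpi := Real.pi_pos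
  rw [SchwartzMap.fourier_coe, Real.fourier_eq']
  have := Measure.integral_comp_smul (volume : Measure (Config n)) (fun v : Config n =>
    Complex.exp ((↑(-2 * Real.pi * inner ℝ v ((2 * Real.pi * ε)⁻¹ • y)) * Complex.I)) • φ v) ε
  rw [finrank_euclideanSpace_fin, abs_of_pos (by positivity)] at this
  rw [← Complex.real_smul, ← this]
  refine integral_congr_ae (Eventually.of_forall fun η => ?_)
  simp only [smul_eq_mul]
  congr 2
  rw [real_inner_smul_left, real_inner_smul_right, real_inner_comm]
  have : -2 * Real.pi * (ε * ((2 * Real.pi * ε)⁻¹ * inner ℝ η y)) = - inner ℝ η y := by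
    field_simp
  rw [this]; push_cast; ring

/-- The oscillatory integral with amplitude `g(y)` is the evaluation at the origin. -/
lemma oscForm_one_left {g : Config n → ℂ} (hg : Tempered g) : oscForm (fun _ => 1) g = g 0 := by
  obtain ⟨φ, κ, hφ, hκ⟩ := exists_schwartz_tensor n
  have hosc := hasOscIntegral_oscForm (tempered_const 1) hg
  obtain ⟨hInt, hlim⟩ := hosc κ (by simp [hκ, hφ])
  refine tendsto_nhds_unique hlim ?_
  have hpi := Real.pi_pos
  have hgc := hg.contDiff.continuous
  -- Integrate out η and substitute y = 2πεu: all powers of 2π and ε cancel. In the resulting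
  -- integral the arguments of φ and `g` shrink to 0, so it tends to g(0)∫𝓕φ = g(0)φ(0) = g(0).
  have key : ∀ ε : ℝ, 0 < ε → (((2 * Real.pi) ^ n : ℝ) : ℂ)⁻¹ *
      ∫ q, oscIntegrand κ (fun y η => 1 * g y) ε q =
      ∫ u, φ ((2 * Real.pi * ε ^ 2) • u) * g ((2 * Real.pi * ε) • u) * (𝓕 φ) u := by
    intro ε hε
    have h1 := hInt ε hε
    rw [Measure.volume_eq_prod] at h1 ⊢
    rw [integral_prod _ h1]
    obtain ⟨F, hF⟩ : ∃ F : Config n → ℂ, F = fun u => φ ((2 * Real.pi * ε ^ 2) • u) *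
      g ((2 * Real.pi * ε) • u) * (𝓕 φ) u := ⟨_, rfl⟩
    have h2 : ∀ y : Config n, ∫ η, oscIntegrand κ (fun y η => 1 * g y) ε (y, η) =
        (((ε ^ n)⁻¹ : ℝ) : ℂ) * F ((2 * Real.pi * ε)⁻¹ • y) := by
      intro y
      rw [hF]
      have e1 : ∀ η, oscIntegrand κ (fun y η => 1 * g y) ε (y, η) =
          (φ (ε • y) * g y) *
            (Complex.exp (-(Complex.I * ((inner ℝ y η : ℝ) : ℂ))) * φ (ε • η)) := by
        intro η; simp [oscIntegrand, hκ]; ring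
      simp only [e1]
      rw [integral_const_mul, integral_phase_smul φ hε]
      simp only [smul_smul]
      have e2 : 2 * Real.pi * ε ^ 2 * (2 * Real.pi * ε)⁻¹ = ε := by field_simp
      have e3 : 2 * Real.pi * ε * (2 * Real.pi * ε)⁻¹ = 1 := by field_simp
      rw [e2, e3, one_smul]
      ring
    rw [integral_congr_ae (Eventually.of_forall h2)]
    rw [integral_const_mul, Measure.integral_comp_inv_smul volume F (2 * Real.pi * ε),
      finrank_euclideanSpace_fin, abs_of_pos (by positivity), Complex.real_smul, ← mul_assoc,
      ← mul_assoc]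
    have : (((2 * Real.pi) ^ n : ℝ) : ℂ)⁻¹ * (((ε ^ n)⁻¹ : ℝ) : ℂ) *
        (((2 * Real.pi * ε) ^ n : ℝ) : ℂ) = 1 := by
      rw [← Complex.ofReal_inv, ← Complex.ofReal_mul, ← Complex.ofReal_mul, ← Complex.ofReal_one]
      congr 1
      rw [mul_pow (2 * Real.pi) ε]; field_simp
    rw [this, one_mul, hF]
  have hrw : (fun ε : ℝ => (((2 * Real.pi) ^ n : ℝ) : ℂ)⁻¹ *
      ∫ q, oscIntegrand κ (fun y η => 1 * g y) ε q) =ᶠ[𝓝[>] 0]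
      fun ε => ∫ u, φ ((2 * Real.pi * ε ^ 2) • u) * g ((2 * Real.pi * ε) • u) * (𝓕 φ) u := by
    filter_upwards [self_mem_nhdsWithin] with ε hε using key ε hε
  refine Tendsto.congr' hrw.symm ?_
  have hfin : g 0 = ∫ u, g 0 * (𝓕 φ) u := by
    rw [integral_const_mul, integral_fourier_schwartz, hφ, mul_one]
  rw [hfin]
  obtain ⟨M, hM⟩ := hg
  obtain ⟨C, k, hC⟩ := (hM.moderateGrowth ()).bound
  obtain ⟨A, hA0, hA⟩ := schwartz_decay φ 0
  -- Here `k` powers compensate the growth of `g` and the other n + 1 make the majorant integrable.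
  obtain ⟨A', hA'0, hA'⟩ := schwartz_decay (𝓕 φ) (k + (n + 1))
  have hC0 : 0 ≤ C := by simpa using (norm_nonneg _).trans (hC 0)
  refine tendsto_integral_filter_of_dominated_convergence
    (fun u => A * (C * (1 + 2 * Real.pi) ^ k * A') * (1 + ‖u‖) ^ (-((n + 1 : ℕ) : ℝ))) ?_ ?_ ?_ ?_
  · refine Eventually.of_forall fun ε => Continuous.aestronglyMeasurable ?_
    have c1 : Continuous fun u : Config n => φ ((2 * Real.pi * ε ^ 2) • u) :=
      φ.continuous.comp (by fun_prop)
    exact (c1.mul (hgc.comp (by fun_prop))).mul (𝓕 φ).continuous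
  · have : Set.Ioo (0 : ℝ) 1 ∈ 𝓝[>] (0 : ℝ) := Ioo_mem_nhdsGT one_pos
    filter_upwards [this] with ε hε
    refine Eventually.of_forall fun u => ?_
    have h1 : 0 < 1 + ‖u‖ := by positivity
    rw [norm_mul, norm_mul, Real.rpow_neg h1.le, Real.rpow_natCast]
    have b1 : ‖φ ((2 * Real.pi * ε ^ 2) • u)‖ ≤ A := by simpa using hA ((2 * Real.pi * ε ^ 2) • u)
    have b2 : ‖g ((2 * Real.pi * ε) • u)‖ ≤ C * ((1 + 2 * Real.pi) * (1 + ‖u‖)) ^ k := by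
      refine (hC _).trans ?_
      have hle : ‖(2 * Real.pi * ε) • u‖ ≤ 2 * Real.pi * ‖u‖ := by
        rw [norm_smul, Real.norm_of_nonneg (by have := hε.1; positivity)]
        have h5 := mul_le_mul_of_nonneg_left hε.2.le (mul_pos two_pos hpi).le
        rw [mul_one] at h5
        exact mul_le_mul_of_nonneg_right h5 (norm_nonneg u)
      gcongr
      nlinarith [norm_nonneg u]
    have b3 : ‖(𝓕 φ) u‖ ≤ A' * ((1 + ‖u‖) ^ (k + (n + 1)))⁻¹ := by
      rw [← div_eq_mul_inv, le_div_iff₀ (by positivity), mul_comm]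
      exact hA' u
    calc _ ≤ A * (C * ((1 + 2 * Real.pi) * (1 + ‖u‖)) ^ k) *
          (A' * ((1 + ‖u‖) ^ (k + (n + 1)))⁻¹) := by gcongr
      _ = _ := by rw [mul_pow, pow_add]; field_simp
  · refine (integrable_one_add_norm ?_).const_mul _
    simp
  · refine Eventually.of_forall fun u => ?_
    have c1 : Continuous fun ε : ℝ => φ ((2 * Real.pi * ε ^ 2) • u) * g ((2 * Real.pi * ε) • u) *
        (𝓕 φ) u := by
      have c1 : Continuous fun ε : ℝ => φ ((2 * Real.pi * ε ^ 2) • u) :=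
        φ.continuous.comp (by fun_prop)
      exact (c1.mul (hgc.comp (by fun_prop))).mul continuous_const
    have := c1.tendsto 0
    simp only [ne_eq, OfNat.ofNat_ne_zero, not_false_eq_true, zero_pow, mul_zero, zero_smul, hφ,
      one_mul] at this
    exact this.mono_left nhdsWithin_le_nhds

end Delta

/-! ### Weighted averages along rays. -/

section Average

variable {E F : Type} [NormedAddCommGroup E] [NormedSpace ℝ E] [FiniteDimensional ℝ E]
  [NormedAddCommGroup F] [NormedSpace ℝ F]

/-- The average `∫₀¹ θ^m f(θ y) dθ`. -/
def average (m : ℕ) (f : E → F) (y : E) : F := ∫ θ in (0 : ℝ)..1, θ ^ m • f (θ • y)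

/-- Differentiating f(θy) in y releases a factor θ. This is why the averages carry a weight θ^m: the
class of weighted averages is closed under differentiation. -/
lemma hasFDerivAt_average [CompleteSpace F] (m : ℕ) {f : E → F} (hf : ContDiff ℝ 1 f) (y : E) :
    HasFDerivAt (average m f) (average (m + 1) (fderiv ℝ f) y) y := by
  have hdf : Continuous (fderiv ℝ f) := hf.continuous_fderiv one_ne_zero
  have : ProperSpace E := FiniteDimensional.proper_real E
  obtain ⟨K, hK⟩ := (isCompact_closedBall (0 : E) (‖y‖ + 1)).exists_bound_of_continuousOn
    hdf.continuousOn
  refine (intervalIntegral.hasFDerivAt_integral_of_dominated_of_fderiv_le (𝕜 := ℝ)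
    (s := Metric.ball y 1)
    (F := fun x θ => θ ^ m • f (θ • x)) (F' := fun x θ => θ ^ (m + 1) • fderiv ℝ f (θ • x))
    (bound := fun _ => K) (Metric.ball_mem_nhds y one_pos) ?_ ?_ ?_ ?_ ?_ ?_)
  · refine Eventually.of_forall fun x => Continuous.aestronglyMeasurable ?_
    exact (by fun_prop : Continuous fun θ : ℝ => θ ^ m).smul (hf.continuous.comp (by fun_prop))
  · refine Continuous.intervalIntegrable ?_ _ _
    exact (by fun_prop : Continuous fun θ : ℝ => θ ^ m).smul (hf.continuous.comp (by fun_prop))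
  · have : SecondCountableTopologyEither ℝ (E →L[ℝ] F) := ⟨Or.inl inferInstance⟩
    refine Continuous.aestronglyMeasurable ?_
    exact (by fun_prop : Continuous fun θ : ℝ => θ ^ (m + 1)).smul (hdf.comp (by fun_prop))
  · refine Eventually.of_forall fun θ hθ x hx => ?_
    rw [Set.uIoc_of_le zero_le_one] at hθ
    have hx' : ‖x‖ ≤ ‖y‖ + 1 := by
      have h1 : ‖x - y‖ < 1 := by simpa [dist_eq_norm] using hx
      have := norm_le_norm_add_norm_sub' x y
      linarith
    have h2 : ‖θ • x‖ ≤ ‖y‖ + 1 := by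
      rw [norm_smul, Real.norm_of_nonneg hθ.1.le]
      nlinarith [norm_nonneg x, hθ.2]
    have h3 := hK (θ • x) (by simpa using h2)
    rw [norm_smul, norm_pow, Real.norm_of_nonneg hθ.1.le]
    have h4 : θ ^ (m + 1) ≤ 1 := pow_le_one₀ hθ.1.le hθ.2
    nlinarith [norm_nonneg (fderiv ℝ f (θ • x)), pow_nonneg hθ.1.le (m + 1)]
  · exact intervalIntegrable_const
  · refine Eventually.of_forall fun θ hθ x hx => ?_
    have h1 : HasFDerivAt (fun x : E => θ • x) (θ • ContinuousLinearMap.id ℝ E) x :=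
      (hasFDerivAt_id x).const_smul θ
    have h2 := ((hf.differentiable one_ne_zero (θ • x)).hasFDerivAt.comp x h1).const_smul (θ ^ m)
    refine h2.congr_fderiv ?_
    ext v
    simp [pow_succ, smul_smul]

lemma contDiff_average (k : ℕ) (m : ℕ) {f : E → F} [CompleteSpace F] (hf : ContDiff ℝ ∞ f) :
    ContDiff ℝ k (average m f) := by
  -- The target space varies because the derivative takes values in `E →L[ℝ] F`.
  induction k generalizing F m with
  | zero =>
    rw [Nat.cast_zero, contDiff_zero]
    exact Differentiable.continuous (𝕜 := ℝ) fun y =>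
      (hasFDerivAt_average m (hf.of_le (by simp)) y).differentiableAt
  | succ k ih =>
    rw [Nat.cast_succ, contDiff_succ_iff_hasFDerivAt]
    exact ⟨average (m + 1) (fderiv ℝ f), ih (m + 1) (hf.fderiv_right (by simp)), fun y =>
      hasFDerivAt_average m (hf.of_le (by simp)) y⟩

lemma average_zero [CompleteSpace F] (m : ℕ) (f : E → F) :
    average m f 0 = ((m : ℝ) + 1)⁻¹ • f 0 := by
  simp [average]

lemma norm_average_le (m : ℕ) {f : E → F} {y : E} {K : ℝ}
    (h : ∀ θ ∈ Set.Icc (0 : ℝ) 1, ‖f (θ • y)‖ ≤ K) : ‖average m f y‖ ≤ K := by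
  have := intervalIntegral.norm_integral_le_of_norm_le_const (a := 0) (b := 1) (C := K)
    (f := fun θ : ℝ => θ ^ m • f (θ • y)) (fun θ hθ => ?_)
  · simpa [average] using this
  · rw [Set.uIoc_of_le zero_le_one] at hθ
    have h1 := h θ ⟨hθ.1.le, hθ.2⟩
    rw [norm_smul, norm_pow, Real.norm_of_nonneg hθ.1.le]
    have h4 : θ ^ m ≤ 1 := pow_le_one₀ hθ.1.le hθ.2
    nlinarith [norm_nonneg (f (θ • y)), pow_nonneg hθ.1.le m]

end Average

/-! ### Commuting derivatives; multi-indices as lists. -/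

section Commute

variable {ι : Type*} [Fintype ι] [DecidableEq ι]

lemma two_le_infty : (2 : WithTop ℕ∞) ≤ ∞ :=
  WithTop.coe_le_coe.2 (le_top : ((2 : ℕ) : ℕ∞) ≤ ⊤)

lemma cderiv_comm {f : EuclideanSpace ℝ ι → ℂ} (hf : ContDiff ℝ ∞ f) (i j : ι) :
    cderiv i (cderiv j f) = cderiv j (cderiv i f) := by
  funext y
  have hd : Differentiable ℝ (fderiv ℝ f) :=
    (hf.fderiv_right (m := ∞) (by simp)).differentiable (by simp)
  have key : ∀ v w : EuclideanSpace ℝ ι, fderiv ℝ (fun z => fderiv ℝ f z v) y w =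
      fderiv ℝ (fderiv ℝ f) y w v := by
    intro v w
    have := ((hd y).hasFDerivAt.clm_apply (hasFDerivAt_const v y)).fderiv
    rw [this]; simp
  exact (key _ _).trans (((hf.contDiffAt.isSymmSndFDerivAt (by simpa using two_le_infty)).eq _ _).trans (key _ _).symm)

lemma pd_append (l l' : List ι) (f : EuclideanSpace ℝ ι → ℂ) : pd (l ++ l') f = pd l' (pd l f) :=
  List.foldl_append

lemma pd_perm {l l' : List ι} (h : l.Perm l') {f : EuclideanSpace ℝ ι → ℂ}
    (hf : ContDiff ℝ ∞ f) : pd l f = pd l' f := by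
  induction h generalizing f with
  | nil => rfl
  | cons i _ ih => exact ih (contDiff_cderiv hf i)
  | swap i j l => rw [pd_cons, pd_cons, pd_cons, pd_cons, cderiv_comm hf]
  | trans _ _ ih ih' => exact (ih hf).trans (ih' hf)

/-- The list of coordinate directions `σ i`, each repeated `α i` times. -/
def dirList {n : ℕ} (σ : Fin n → ι) (α : Fin n → ℕ) : List ι :=
  -- Reversed, because in `multiDeriv` the last direction acts first, whereas `pd` applies the head
  -- of the list first.
  (List.finRange n).reverse.flatMap fun i => List.replicate (α i) (σ i)

lemma multiDeriv_eq_pd {n : ℕ} (σ : Fin n → ι) (α : Fin n → ℕ) (f : EuclideanSpace ℝ ι → ℂ) :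
    multiDeriv (fun i => EuclideanSpace.single (σ i) 1) α f = pd (dirList σ α) f := by
  have h1 : ∀ (i : ι) (k : ℕ) (g : EuclideanSpace ℝ ι → ℂ),
      (fun h : EuclideanSpace ℝ ι → ℂ => fun z => fderiv ℝ h z (EuclideanSpace.single i 1))^[k] g =
        pd (List.replicate k i) g := by
    intro i k
    induction k with
    | zero => intro g; rfl
    | succ k ih => intro g; rw [Function.iterate_succ_apply, ih]; rfl
  unfold multiDeriv dirList
  induction (List.finRange n) with
  | nil => rfl
  | cons i L ih =>
    rw [List.foldr_cons, ih, h1, List.reverse_cons, List.flatMap_append, pd_append]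
    simp

lemma coe_dirList {n : ℕ} (σ : Fin n → ι) (α : Fin n → ℕ) :
    (dirList σ α : Multiset ι) = ∑ i, α i • {σ i} := by
  have h : ∀ L : List (Fin n), ((L.flatMap fun i => List.replicate (α i) (σ i) : List ι) :
      Multiset ι) = (L.map fun i => α i • ({σ i} : Multiset ι)).sum := by
    intro L
    induction L with
    | nil => rfl
    | cons i L ih =>
      rw [List.flatMap_cons, ← Multiset.coe_add, ih, List.map_cons, List.sum_cons,
        Multiset.nsmul_singleton, Multiset.coe_replicate]
  rw [dirList, h, List.map_reverse, List.sum_reverse, ← List.ofFn_eq_map, List.sum_ofFn]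

lemma dirList_add_single {n : ℕ} (σ : Fin n → ι) (α : Fin n → ℕ) (i : Fin n) :
    (dirList σ (α + Pi.single i 1)).Perm (σ i :: dirList σ α) := by
  rw [← Multiset.coe_eq_coe, ← Multiset.cons_coe, coe_dirList, coe_dirList]
  simp only [Pi.add_apply, add_smul, Finset.sum_add_distrib]
  rw [Finset.sum_eq_single (a := i) (f := fun x => (Pi.single i 1 : Fin n → ℕ) x • ({σ x} : Multiset ι))]
  · simp [add_comm, Multiset.singleton_add]
  · intro b _ hb; simp [hb]
  · simp

lemma length_dirList {n : ℕ} (σ : Fin n → ι) (α : Fin n → ℕ) :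
    (dirList σ α).length = ∑ i, α i := by
  have := congrArg Multiset.card (coe_dirList σ α)
  simpa using this

end Commute

/-! ### A recursion for sums over multi-indices. -/

section Combinatorics

variable {n : ℕ}

/-- For fixed i, substitute α = β + e_i: as α! = α_i β!, the term of β becomes α_i/α!, and the
multi-indices with α_i = 0 contribute nothing. Summing over i gives Σα_i = k + 1, which cancels the
factor 1/(k + 1). -/
lemma sum_piAntidiag_succ (k : ℕ) (X : (Fin n → ℕ) → ℂ) :
    ∑ α ∈ Finset.piAntidiag (Finset.univ : Finset (Fin n)) (k + 1),
        ((∏ i, (α i).factorial : ℕ) : ℂ)⁻¹ * X α =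
      ∑ i, ∑ β ∈ Finset.piAntidiag (Finset.univ : Finset (Fin n)) k,
        ((∏ i, (β i).factorial : ℕ) : ℂ)⁻¹ * (((k : ℂ) + 1)⁻¹ * X (β + Pi.single i 1)) := by
  have hfac : ∀ (β : Fin n → ℕ) (i : Fin n),
      ((∏ j, ((β + Pi.single i 1 : Fin n → ℕ) j).factorial : ℕ) : ℂ) =
        ((β i : ℂ) + 1) * ((∏ j, (β j).factorial : ℕ) : ℂ) := by
    intro β i
    rw [← Finset.mul_prod_erase _ _ (Finset.mem_univ i),
      ← Finset.mul_prod_erase Finset.univ (fun j => (β j).factorial) (Finset.mem_univ i)]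
    have : ∏ j ∈ Finset.univ.erase i, ((β + Pi.single i 1 : Fin n → ℕ) j).factorial =
        ∏ j ∈ Finset.univ.erase i, (β j).factorial := by
      refine Finset.prod_congr rfl fun j hj => ?_
      simp [Finset.ne_of_mem_erase hj]
    rw [this]
    simp [Nat.factorial_succ, mul_assoc]
  have hstep : ∀ i : Fin n, ∑ β ∈ Finset.piAntidiag (Finset.univ : Finset (Fin n)) k,
        ((∏ i, (β i).factorial : ℕ) : ℂ)⁻¹ * (((k : ℂ) + 1)⁻¹ * X (β + Pi.single i 1)) =
      ∑ α ∈ Finset.piAntidiag (Finset.univ : Finset (Fin n)) (k + 1),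
        ((k : ℂ) + 1)⁻¹ * ((α i : ℂ) * (((∏ i, (α i).factorial : ℕ) : ℂ)⁻¹ * X α)) := by
    intro i
    rw [← Finset.sum_filter_of_ne (s := Finset.piAntidiag Finset.univ (k + 1))
      (p := fun α => α i ≠ 0)]
    · refine Finset.sum_nbij' (fun β => β + Pi.single i 1) (fun α => α - Pi.single i 1) ?_ ?_ ?_
        ?_ ?_
      · intro β hβ
        simp only [Finset.mem_piAntidiag, Finset.mem_filter] at hβ ⊢
        refine ⟨⟨?_, by simp⟩, by simp⟩
        simp [Finset.sum_add_distrib, hβ.1]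
      · intro α hα
        simp only [Finset.mem_piAntidiag, Finset.mem_filter] at hα ⊢
        refine ⟨?_, by simp⟩
        have hle : Pi.single i 1 ≤ α := by
          intro j
          by_cases hj : j = i
          · subst hj; simp; omega
          · simp [hj]
        have h1 : ∑ j, (α - Pi.single i 1 : Fin n → ℕ) j + ∑ j, (Pi.single i 1 : Fin n → ℕ) j = k + 1 := by
          rw [← Finset.sum_add_distrib, ← hα.1.1]
          refine Finset.sum_congr rfl fun j _ => ?_
          exact Nat.sub_add_cancel (hle j)
        simpa using h1
      · intro β hβ; simp
      · intro α hα
        simp only [Finset.mem_filter] at hα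
        have hle : Pi.single i 1 ≤ α := by
          intro j
          by_cases hj : j = i
          · subst hj; simp; omega
          · simp [hj]
        exact tsub_add_cancel_of_le hle
      · intro β hβ
        rw [hfac]
        have h1 : (β i : ℂ) + 1 ≠ 0 := by exact_mod_cast Nat.succ_ne_zero (β i)
        have h2 : ((k : ℂ) + 1) ≠ 0 := by exact_mod_cast Nat.succ_ne_zero k
        have h3 : ((∏ j, (β j).factorial : ℕ) : ℂ) ≠ 0 := by
          exact_mod_cast (Finset.prod_ne_zero_iff.2 fun j _ => Nat.factorial_ne_zero _)
        simp only [Pi.add_apply, Pi.single_eq_same, Nat.cast_add, Nat.cast_one]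
        field_simp
    · intro α _ hne h0
      apply hne; simp [h0]
  simp only [hstep]
  rw [Finset.sum_comm]
  refine Finset.sum_congr rfl fun α hα => ?_
  rw [← Finset.mul_sum, ← Finset.sum_mul]
  have h1 : ∑ i, (α i : ℂ) = (k : ℂ) + 1 := by
    have := (Finset.mem_piAntidiag.1 hα).1
    exact_mod_cast this
  have h2 : ((k : ℂ) + 1) ≠ 0 := by exact_mod_cast Nat.succ_ne_zero k
  rw [h1]; field_simp

end Combinatorics

/-! ### Taylor expansion of the oscillatory form. -/

section Remainder

variable {n : ℕ}

lemma contDiff_infty_average {m : ℕ} {f : Config n → ℂ} (hf : ContDiff ℝ ∞ f) :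
    ContDiff ℝ ∞ (average m f) :=
  contDiff_infty.2 fun k => contDiff_average k m hf

lemma cderiv_average (m : ℕ) {f : Config n → ℂ} (hf : ContDiff ℝ ∞ f) (i : Fin n) :
    cderiv i (average m f) = average (m + 1) (cderiv i f) := by
  funext y
  simp only [cderiv]
  rw [(hasFDerivAt_average m (hf.of_le (by simp)) y).fderiv]
  simp only [average]
  rw [ContinuousLinearMap.intervalIntegral_apply]
  · rfl
  · refine Continuous.intervalIntegrable ?_ _ _
    exact (by fun_prop : Continuous fun θ : ℝ => θ ^ (m + 1)).smul
      ((hf.continuous_fderiv (by simp)).comp (by fun_prop))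

lemma pd_average (m : ℕ) {f : Config n → ℂ} (hf : ContDiff ℝ ∞ f) (l : List (Fin n)) :
    pd l (average m f) = average (m + l.length) (pd l f) := by
  induction l generalizing m f with
  | nil => rfl
  | cons i l ih =>
    rw [pd_cons, cderiv_average m hf, ih _ (contDiff_cderiv hf i), pd_cons, List.length_cons]
    congr 1; ring

lemma fderiv_apply_eq_sum {f : Config n → ℂ} (y v : Config n) :
    fderiv ℝ f y v = ∑ i, (v i : ℂ) * cderiv i f y := by
  have h : v = ∑ i, v i • EuclideanSpace.single i (1 : ℝ) := by
    ext j; simp [Pi.single_apply]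
  conv_lhs => rw [h]
  simp [cderiv, map_sum]

lemma eq_add_sum_coord_mul_average {f : Config n → ℂ} (hf : ContDiff ℝ ∞ f) (y : Config n) :
    f y = f 0 + ∑ i, (y i : ℂ) * average 0 (cderiv i f) y := by
  have hd : ∀ θ : ℝ, HasDerivAt (fun θ : ℝ => f (θ • y)) (fderiv ℝ f (θ • y) y) θ := by
    intro θ
    have h1 : HasDerivAt (fun θ : ℝ => θ • y) y θ := by
      simpa using (hasDerivAt_id θ).smul_const y
    exact (hf.differentiable (by simp) (θ • y)).hasFDerivAt.comp_hasDerivAt θ h1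
  have hc : Continuous fun θ : ℝ => fderiv ℝ f (θ • y) y :=
    ((hf.continuous_fderiv (by simp)).comp (by fun_prop)).clm_apply continuous_const
  have h := intervalIntegral.integral_eq_sub_of_hasDerivAt (a := 0) (b := 1)
    (fun θ _ => hd θ) (hc.intervalIntegrable _ _)
  simp only [fderiv_apply_eq_sum, one_smul, zero_smul] at h
  rw [intervalIntegral.integral_finsetSum] at h
  · simp only [average, pow_zero, one_smul, ← intervalIntegral.integral_const_mul]
    rw [h]; ring
  · intro i _
    refine Continuous.intervalIntegrable ?_ _ _
    exact continuous_const.mul ((contDiff_cderiv hf i).continuous.comp (by fun_prop))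

lemma Tempered.average {f : Config n → ℂ} (hf : Tempered f) (m : ℕ) :
    Tempered (average m f) := by
  obtain ⟨M, hM⟩ := hf
  have hM' := hM.mono (le_abs_self M)
  refine ⟨|M|, fun _ => contDiff_infty_average (hM.smooth ()), fun l => ?_⟩
  obtain ⟨C, hC⟩ := hM'.bound l
  refine ⟨|C|, fun _ y => ?_⟩
  rw [pd_average m (hM.smooth ())]
  refine norm_average_le _ fun θ hθ => (hC () _).trans ?_
  have h1 : bracket (θ • y) ≤ bracket y := bracket_le_of_norm_le (by
    rw [norm_smul, Real.norm_of_nonneg hθ.1]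
    nlinarith [norm_nonneg y, hθ.2])
  exact mul_le_mul (le_abs_self C) (Real.rpow_le_rpow (bracket_pos _).le h1 (abs_nonneg M))
    (Real.rpow_nonneg (bracket_pos _).le _) (abs_nonneg C)

lemma cderiv_coord (i j : Fin n) : cderiv i (fun y : Config n => ((y j : ℝ) : ℂ)) =
    fun _ => if i = j then 1 else 0 := by
  funext y
  have := (Complex.ofRealCLM.comp
    (EuclideanSpace.proj j : Config n →L[ℝ] ℝ)).hasFDerivAt (x := y)
  simp only [cderiv]
  have h : HasFDerivAt (fun y : Config n => ((y j : ℝ) : ℂ)) _ y := this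
  rw [h.fderiv]
  by_cases hij : i = j
  · subst hij; simp
  · simp [hij, Ne.symm hij]

lemma tempered_coord (j : Fin n) : Tempered (fun y : Config n => ((y j : ℝ) : ℂ)) := by
  refine ⟨1, fun _ => contDiff_coord j, fun l => ?_⟩
  rcases l with _ | ⟨i, l⟩
  · refine ⟨1, fun _ y => ?_⟩
    rw [pd_nil, Complex.norm_real, one_mul, Real.rpow_one]
    exact (PiLp.norm_apply_le y j).trans (norm_le_bracket y)
  · obtain ⟨M, hM⟩ := tempered_const (n := n) (if i = j then 1 else 0)
    rcases l with _ | ⟨i', l⟩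
    · refine ⟨1, fun _ y => ?_⟩
      rw [pd_cons, cderiv_coord, pd_nil, one_mul, Real.rpow_one]
      refine le_trans ?_ (one_le_bracket y)
      split_ifs <;> simp
    · refine ⟨0, fun _ y => ?_⟩
      have h0 : cderiv i' (fun _ : Config n => if i = j then (1 : ℂ) else 0) =
          fun y => 0 * (1 : ℂ) := by
        funext y; simp [cderiv]
      rw [pd_cons, cderiv_coord, pd_cons, h0, pd_const_mul contDiff_const]
      simp

lemma Tempered.mul {f g : Config n → ℂ} (hf : Tempered f) (hg : Tempered g) :
    Tempered (fun y => f y * g y) := by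
  obtain ⟨M, hM⟩ := hf
  obtain ⟨M', hM'⟩ := hg
  exact ⟨M + M', TempFam.mul hM hM'⟩

lemma tempered_sum {κ : Type*} (s : Finset κ) {f : κ → Config n → ℂ} (hf : ∀ i, Tempered (f i)) :
    Tempered (fun y => ∑ i ∈ s, f i y) := by
  classical
  induction s using Finset.induction_on with
  | empty => simpa using tempered_const 0
  | insert a s ha ih => simpa [Finset.sum_insert ha] using (hf a).add ih

lemma oscForm_zero_left {g : Config n → ℂ} (hg : Tempered g) : oscForm (fun _ => 0) g = 0 := by
  simpa using oscForm_const_mul_left (tempered_const (n := n) 0) hg 0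

lemma oscForm_sum_left {κ : Type*} (s : Finset κ) {f : κ → Config n → ℂ} {g : Config n → ℂ}
    (hf : ∀ i, Tempered (f i)) (hg : Tempered g) :
    oscForm (fun y => ∑ i ∈ s, f i y) g = ∑ i ∈ s, oscForm (f i) g := by
  classical
  induction s using Finset.induction_on with
  | empty => simpa using oscForm_zero_left hg
  | insert a s ha ih =>
    simp only [Finset.sum_insert ha]
    rw [oscForm_add_left (hf a) (tempered_sum s hf) hg, ih]

/-- First-order Taylor formula for `f`: the constant term is evaluated by `oscForm_one_left`, and
the coordinate in each remaining term is moved to `g` as a derivative. -/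
lemma oscForm_eq_add_sum {f g : Config n → ℂ} (hf : Tempered f) (hg : Tempered g) :
    oscForm f g = f 0 * g 0 +
      ∑ i, oscForm (average 0 (cderiv i f)) (fun y => -Complex.I * cderiv i g y) := by
  have ht : ∀ i, Tempered (fun y : Config n => (y i : ℂ) * average 0 (cderiv i f) y) :=
    fun i => (tempered_coord i).mul ((hf.cderiv i).average 0)
  have h : f = fun y => f 0 * 1 + ∑ i, (y i : ℂ) * average 0 (cderiv i f) y := by
    funext y; rw [mul_one]; exact eq_add_sum_coord_mul_average hf.contDiff y
  conv_lhs => rw [h]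
  rw [oscForm_add_left ((tempered_const 1).const_mul _) (tempered_sum _ ht) hg,
    oscForm_const_mul_left (tempered_const 1) hg, oscForm_one_left hg, oscForm_sum_left _ ht hg]
  congr 1
  exact Finset.sum_congr rfl fun i _ => oscForm_coord_mul ((hf.cderiv i).average 0) hg i

/-- `∑_{|α| = k} (1/α!) ∂^α f(0) (-i)^k ∂^α g(0)`. -/
def taylorTerm (k : ℕ) (f g : Config n → ℂ) : ℂ :=
  ∑ α ∈ Finset.piAntidiag (Finset.univ : Finset (Fin n)) k,
    ((∏ i, (α i).factorial : ℕ) : ℂ)⁻¹ *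
      (pd (dirList id α) f 0 * ((-Complex.I) ^ (∑ i, α i) * pd (dirList id α) g 0))

lemma taylorTerm_zero (f g : Config n → ℂ) : taylorTerm 0 f g = f 0 * g 0 := by
  have : dirList (ι := Fin n) (n := n) id 0 = [] := by
    rw [← List.length_eq_zero_iff, length_dirList]; simp
  simp [taylorTerm, this]

/-- At the origin a derivative of order k of `average 0 (cderiv i f)` is that of `cderiv i f`
divided by k + 1. This is the factor in `sum_piAntidiag_succ`, so the Taylor terms satisfy the same
recursion as the form. -/
lemma taylorTerm_succ (k : ℕ) {f g : Config n → ℂ} (hf : ContDiff ℝ ∞ f) (hg : ContDiff ℝ ∞ g) :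
    taylorTerm (k + 1) f g =
      ∑ i, taylorTerm k (average 0 (cderiv i f)) (fun y => -Complex.I * cderiv i g y) := by
  unfold taylorTerm
  rw [sum_piAntidiag_succ]
  refine Finset.sum_congr rfl fun i _ => Finset.sum_congr rfl fun β hβ => ?_
  have hk : ∑ i, β i = k := (Finset.mem_piAntidiag.1 hβ).1
  have hk' : ∑ j, (β + Pi.single i 1 : Fin n → ℕ) j = k + 1 := by
    simp [Finset.sum_add_distrib, hk]
  rw [pd_perm (dirList_add_single id β i) hf, pd_perm (dirList_add_single id β i) hg, pd_cons,
    pd_cons, pd_average 0 (contDiff_cderiv hf i), pd_const_mul (contDiff_cderiv hg i),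
    average_zero, hk', hk, length_dirList, hk]
  simp only [id, zero_add, Complex.real_smul]
  push_cast
  ring

/-- Remainder of the asymptotic expansion of the oscillatory integral. -/
def oscRem (N : ℕ) (f g : Config n → ℂ) : ℂ :=
  oscForm f g - ∑ k ∈ Finset.range N, taylorTerm k f g

/-- The form and its Taylor terms obey the same recursion, and the term of degree 0 cancels. Each
step spends one derivative on either factor, which is why N steps will gain 2N powers. -/
lemma oscRem_succ (N : ℕ) {f g : Config n → ℂ} (hf : Tempered f) (hg : Tempered g) :
    oscRem (N + 1) f g =
      ∑ i, oscRem N (average 0 (cderiv i f)) (fun y => -Complex.I * cderiv i g y) := by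
  unfold oscRem
  rw [Finset.sum_range_succ', taylorTerm_zero, oscForm_eq_add_sum hf hg, Finset.sum_sub_distrib,
    Finset.sum_comm]
  simp only [taylorTerm_succ _ hf.contDiff hg.contDiff]
  ring

/-- Families of functions whose derivatives gain powers of `r`, at the cost of growth. -/
structure ScaleFam {T : Type*} (A r : T → ℝ) (M : ℝ) (f : T → Config n → ℂ) : Prop where
  smooth : ∀ t, ContDiff ℝ ∞ (f t)
  -- The number j of powers of `r` to be gained is free up to the order of the derivative. Taking j
  -- = 0 gives tempered growth with the exponent `M` for all derivatives, while one more power is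
  -- spent at each differentiation in the recursion for the remainder.
  bound : ∀ l : List (Fin n), ∀ j ≤ l.length, ∃ C : ℝ, 0 ≤ C ∧ ∀ t y,
    ‖pd l (f t) y‖ ≤ C * (A t * r t ^ j * bracket y ^ (M + j))

variable {T : Type*} {A A' r : T → ℝ} {M M' : ℝ} {f g : T → Config n → ℂ}

lemma ScaleFam.tempFam (hA : ∀ t, 0 < A t) (hf : ScaleFam A r M f) :
    TempFam M (fun t y => ((A t)⁻¹ : ℂ) * f t y) := by
  refine ⟨fun t => contDiff_const.mul (hf.smooth t), fun l => ?_⟩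
  obtain ⟨C, hC0, hC⟩ := hf.bound l 0 (Nat.zero_le _)
  refine ⟨C, fun t y => ?_⟩
  have := hC t y
  have hA := hA t
  rw [pd_const_mul (hf.smooth t), norm_mul, ← Complex.ofReal_inv, Complex.norm_real,
    Real.norm_of_nonneg (inv_pos.2 hA).le, inv_mul_le_iff₀ hA]
  simp only [pow_zero, mul_one, Nat.cast_zero, add_zero] at this
  linarith

lemma ScaleFam.tempered (hA : ∀ t, 0 < A t) (hf : ScaleFam A r M f) (t : T) :
    Tempered (f t) := by
  have h := ((hf.tempFam hA).tempered t).const_mul (A t : ℂ)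
  have hA := hA t
  have : (fun y => (A t : ℂ) * (((A t)⁻¹ : ℂ) * f t y)) = f t := by
    funext y
    have : (A t : ℂ) ≠ 0 := by exact_mod_cast hA.ne'
    field_simp
  rwa [this] at h

lemma ScaleFam.cderiv (hf : ScaleFam A r M f) (i : Fin n) :
    ScaleFam (fun t => A t * r t) r (M + 1) (fun t => cderiv i (f t)) := by
  refine ⟨fun t => contDiff_cderiv (hf.smooth t) i, fun l j hj => ?_⟩
  obtain ⟨C, hC0, hC⟩ := hf.bound (i :: l) (j + 1) (by simpa using hj)
  refine ⟨C, hC0, fun t y => (hC t y).trans_eq ?_⟩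
  rw [pow_succ]; push_cast
  rw [show M + ((j : ℝ) + 1) = M + 1 + j by ring]; ring

lemma ScaleFam.const_mul (hf : ScaleFam A r M f) (c : ℂ) :
    ScaleFam A r M (fun t y => c * f t y) := by
  refine ⟨fun t => contDiff_const.mul (hf.smooth t), fun l j hj => ?_⟩
  obtain ⟨C, hC0, hC⟩ := hf.bound l j hj
  refine ⟨‖c‖ * C, by positivity, fun t y => ?_⟩
  rw [pd_const_mul (hf.smooth t), norm_mul, mul_assoc]
  exact mul_le_mul_of_nonneg_left (hC t y) (norm_nonneg _)

lemma ScaleFam.average (hA : ∀ t, 0 < A t) (hr : ∀ t, 0 < r t) (hM : 0 ≤ M)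
    (hf : ScaleFam A r M f) (m : ℕ) : ScaleFam A r M (fun t => average m (f t)) := by
  refine ⟨fun t => contDiff_infty_average (hf.smooth t), fun l j hj => ?_⟩
  obtain ⟨C, hC0, hC⟩ := hf.bound l j hj
  refine ⟨C, hC0, fun t y => ?_⟩
  rw [pd_average m (hf.smooth t)]
  refine norm_average_le _ fun θ hθ => (hC t _).trans ?_
  have h1 : bracket (θ • y) ≤ bracket y := bracket_le_of_norm_le (by
    rw [norm_smul, Real.norm_of_nonneg hθ.1]
    nlinarith [norm_nonneg y, hθ.2])
  have hA := hA t
  have hr := hr t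
  have h2 := bracket_pos (θ • y)
  gcongr

/-- Quantitative form of the asymptotic expansion. -/
theorem exists_norm_oscRem_le (N : ℕ) (hA : ∀ t, 0 < A t) (hA' : ∀ t, 0 < A' t)
    (hr : ∀ t, 0 < r t) (hM : 0 ≤ M) (hM' : 0 ≤ M') (hf : ScaleFam A r M f)
    (hg : ScaleFam A' r M' g) :
    ∃ C, ∀ t, ‖oscRem N (f t) (g t)‖ ≤ C * (A t * A' t * r t ^ (2 * N)) := by
  induction N generalizing A A' M M' f g with
  | zero =>
    -- After division by `A` and `A'` the families are tempered uniformly in the parameter.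
    obtain ⟨C, hC⟩ := exists_norm_oscForm_le (hf.tempFam hA) (hg.tempFam hA')
    refine ⟨C, fun t => ?_⟩
    have h := hC t
    have hf1 := (hf.tempered hA t)
    have hg1 := (hg.tempered hA' t)
    rw [oscForm_const_mul_left hf1 (hg1.const_mul _), oscForm_const_mul_right hf1 hg1, norm_mul,
      norm_mul, ← Complex.ofReal_inv, ← Complex.ofReal_inv, Complex.norm_real, Complex.norm_real,
      Real.norm_of_nonneg (inv_pos.2 (hA t)).le, Real.norm_of_nonneg (inv_pos.2 (hA' t)).le,
      inv_mul_le_iff₀ (hA t), inv_mul_le_iff₀ (hA' t)] at h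
    simp only [oscRem, Finset.range_zero, Finset.sum_empty, sub_zero, mul_zero, pow_zero, mul_one]
    linarith
  | succ N ih =>
    -- Each factor is differentiated once and gains one `r`; the growth exponents rise by 1, which
    -- is harmless because they only affect the constant.
    have hA1 : ∀ t, 0 < A t * r t := fun t => mul_pos (hA t) (hr t)
    have hA1' : ∀ t, 0 < A' t * r t := fun t => mul_pos (hA' t) (hr t)
    have h1 : ∀ i : Fin n, ∃ C, ∀ t, ‖oscRem N (Shubin.average 0 (Shubin.cderiv i (f t)))
        (fun y => -Complex.I * Shubin.cderiv i (g t) y)‖ ≤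
          C * ((A t * r t) * (A' t * r t) * r t ^ (2 * N)) := fun i =>
      ih hA1 hA1' (by positivity : 0 ≤ M + 1) (by positivity : 0 ≤ M' + 1)
        ((hf.cderiv i).average hA1 hr (by positivity) 0)
        ((hg.cderiv i).const_mul (-Complex.I))
    choose C hC using h1
    refine ⟨∑ i, C i, fun t => ?_⟩
    rw [oscRem_succ N (hf.tempered hA t) (hg.tempered hA' t), Finset.sum_mul]
    refine (norm_sum_le _ _).trans (Finset.sum_le_sum fun i _ => (hC i t).trans_eq ?_)
    ring

end Remainder

/-! ### Partial derivatives on the half space. -/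

section Calculus

variable {ι : Type*} [Fintype ι] [DecidableEq ι]

/-- The half space `E × [0,∞)`. -/
abbrev halfSpace (ι : Type*) : Set (EuclideanSpace ℝ ι × ℝ) := Set.univ ×ˢ Set.Ici 0

/-- Smooth functions on `E × [0,∞)`. -/
def Smooth (a : EuclideanSpace ℝ ι → ℝ → ℂ) : Prop :=
  ContDiffOn ℝ ∞ (fun p : EuclideanSpace ℝ ι × ℝ => a p.1 p.2) (halfSpace ι)

/-- Equality on `E × [0,∞)`. -/
def EqHalf {F : Type*} (a b : EuclideanSpace ℝ ι → ℝ → F) : Prop :=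
  ∀ z μ, 0 ≤ μ → a z μ = b z μ

/-- Partial derivatives on `E × [0,∞)`: `none` stands for `∂_μ`, `some i` for `∂_{z_i}`. -/
def hderiv : Option ι → (EuclideanSpace ℝ ι → ℝ → ℂ) → EuclideanSpace ℝ ι → ℝ → ℂ
  | none, a => fun z μ => derivWithin (a z) (Set.Ici 0) μ
  | some i, a => fun z μ => cderiv i (fun z' => a z' μ) z

/-- Iterated partial derivatives; the first entry of the list is applied first. -/
def hd (l : List (Option ι)) (a : EuclideanSpace ℝ ι → ℝ → ℂ) : EuclideanSpace ℝ ι → ℝ → ℂ :=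
  l.foldl (fun b o => hderiv o b) a

/-- The coordinate directions of `E × ℝ`. -/
def hdir : Option ι → EuclideanSpace ℝ ι × ℝ
  | none => (0, 1)
  | some i => (EuclideanSpace.single i 1, 0)

variable {a b : EuclideanSpace ℝ ι → ℝ → ℂ}

@[simp] lemma hd_nil : hd [] a = a := rfl
@[simp] lemma hd_cons (o : Option ι) (l : List (Option ι)) : hd (o :: l) a = hd l (hderiv o a) :=
  rfl
lemma hd_append (l l' : List (Option ι)) : hd (l ++ l') a = hd l' (hd l a) := List.foldl_append

lemma uniqueDiffOn_halfSpace : UniqueDiffOn ℝ (halfSpace ι) :=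
  uniqueDiffOn_univ.prod (uniqueDiffOn_Ici 0)

lemma mem_halfSpace {z : EuclideanSpace ℝ ι} {μ : ℝ} (hμ : 0 ≤ μ) : (z, μ) ∈ halfSpace ι :=
  ⟨trivial, hμ⟩

lemma Smooth.hasFDerivWithinAt (ha : Smooth a) {z : EuclideanSpace ℝ ι} {μ : ℝ} (hμ : 0 ≤ μ) :
    HasFDerivWithinAt (fun p : EuclideanSpace ℝ ι × ℝ => a p.1 p.2)
      (fderivWithin ℝ (fun p : EuclideanSpace ℝ ι × ℝ => a p.1 p.2) (halfSpace ι) (z, μ))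
      (halfSpace ι) (z, μ) :=
  (ha.differentiableOn (by simp) _ (mem_halfSpace hμ)).hasFDerivWithinAt

lemma hasFDerivAt_slice {L : EuclideanSpace ℝ ι × ℝ →L[ℝ] ℂ} {z : EuclideanSpace ℝ ι} {μ : ℝ}
    (hμ : 0 ≤ μ) (h : HasFDerivWithinAt (fun p : EuclideanSpace ℝ ι × ℝ => a p.1 p.2) L
      (halfSpace ι) (z, μ)) :
    HasFDerivAt (fun z' => a z' μ) (L.comp (.inl ℝ _ _)) z := by
  have h1 : HasFDerivWithinAt (fun z' : EuclideanSpace ℝ ι => (z', μ)) (.inl ℝ _ _) Set.univ z :=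
    (hasFDerivAt_prodMk_left z μ).hasFDerivWithinAt
  have := h.comp z h1 (fun z' _ => mem_halfSpace hμ)
  exact hasFDerivWithinAt_univ.1 this

lemma hasDerivWithinAt_slice {L : EuclideanSpace ℝ ι × ℝ →L[ℝ] ℂ} {z : EuclideanSpace ℝ ι} {μ : ℝ}
    (h : HasFDerivWithinAt (fun p : EuclideanSpace ℝ ι × ℝ => a p.1 p.2) L
      (halfSpace ι) (z, μ)) :
    HasDerivWithinAt (a z) (L (0, 1)) (Set.Ici 0) μ := by
  have h1 : HasFDerivWithinAt (fun μ' : ℝ => (z, μ')) (.inr ℝ (EuclideanSpace ℝ ι) ℝ)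
      (Set.Ici 0) μ :=
    (hasFDerivAt_prodMk_right z μ).hasFDerivWithinAt
  have := h.comp μ h1 (fun μ' hμ' => mem_halfSpace hμ')
  exact this.hasDerivWithinAt.congr_deriv (by simp)

lemma hderiv_eq_of_hasFDerivWithinAt {L : EuclideanSpace ℝ ι × ℝ →L[ℝ] ℂ}
    {z : EuclideanSpace ℝ ι} {μ : ℝ}
    (hμ : 0 ≤ μ) (h : HasFDerivWithinAt (fun p : EuclideanSpace ℝ ι × ℝ => a p.1 p.2) L
      (halfSpace ι) (z, μ)) (o : Option ι) : hderiv o a z μ = L (hdir o) := by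
  cases o with
  | none => exact (hasDerivWithinAt_slice h).derivWithin (uniqueDiffOn_Ici 0 μ hμ)
  | some i =>
    simp only [hderiv, cderiv, (hasFDerivAt_slice hμ h).fderiv, hdir]
    simp

lemma Smooth.hderiv_eq (ha : Smooth a) {z : EuclideanSpace ℝ ι} {μ : ℝ} (hμ : 0 ≤ μ)
    (o : Option ι) : hderiv o a z μ =
      fderivWithin ℝ (fun p : EuclideanSpace ℝ ι × ℝ => a p.1 p.2) (halfSpace ι) (z, μ) (hdir o) :=
  hderiv_eq_of_hasFDerivWithinAt hμ (ha.hasFDerivWithinAt hμ) o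

lemma Smooth.congr (ha : Smooth a) (h : EqHalf b a) : Smooth b :=
  ContDiffOn.congr ha fun p hp => h p.1 p.2 hp.2

lemma Smooth.hderiv (ha : Smooth a) (o : Option ι) : Smooth (hderiv o a) := by
  have h1 : ContDiffOn ℝ ∞ (fderivWithin ℝ (fun p : EuclideanSpace ℝ ι × ℝ => a p.1 p.2)
      (halfSpace ι)) (halfSpace ι) := ha.fderivWithin uniqueDiffOn_halfSpace (by simp)
  exact (h1.clm_apply contDiffOn_const).congr fun p hp => ha.hderiv_eq hp.2 o

lemma Smooth.hd (ha : Smooth a) (l : List (Option ι)) : Smooth (hd l a) := by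
  induction l generalizing a with
  | nil => exact ha
  | cons o l ih => exact ih (ha.hderiv o)

lemma Smooth.slice (ha : Smooth a) {μ : ℝ} (hμ : 0 ≤ μ) : ContDiff ℝ ∞ (fun z => a z μ) := by
  rw [← contDiffOn_univ]
  exact ContDiffOn.comp ha (contDiff_id.prodMk contDiff_const).contDiffOn
    fun z _ => mem_halfSpace hμ

lemma EqHalf.hderiv (h : EqHalf a b) (o : Option ι) : EqHalf (hderiv o a) (hderiv o b) := by
  intro z μ hμ
  cases o with
  | none => exact derivWithin_congr (fun μ' hμ' => h z μ' hμ') (h z μ hμ)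
  | some i =>
    have : (fun z' => a z' μ) = fun z' => b z' μ := funext fun z' => h z' μ hμ
    simp only [Shubin.hderiv, this]

lemma EqHalf.hd (h : EqHalf a b) (l : List (Option ι)) : EqHalf (hd l a) (hd l b) := by
  induction l generalizing a b with
  | nil => exact h
  | cons o l ih => exact ih (h.hderiv o)

lemma EqHalf.trans {F : Type*} {a b c : EuclideanSpace ℝ ι → ℝ → F} (h : EqHalf a b)
    (h' : EqHalf b c) : EqHalf a c := fun z μ hμ => (h z μ hμ).trans (h' z μ hμ)

lemma EqHalf.refl {F : Type*} (a : EuclideanSpace ℝ ι → ℝ → F) : EqHalf a a := fun _ _ _ => rfl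

lemma Smooth.add (ha : Smooth a) (hb : Smooth b) : Smooth (fun z μ => a z μ + b z μ) :=
  ContDiffOn.add ha hb

lemma Smooth.mul (ha : Smooth a) (hb : Smooth b) : Smooth (fun z μ => a z μ * b z μ) :=
  ContDiffOn.mul ha hb

lemma smooth_const (c : ℂ) : Smooth (fun (_ : EuclideanSpace ℝ ι) (_ : ℝ) => c) :=
  contDiffOn_const

lemma Smooth.const_mul (ha : Smooth a) (c : ℂ) : Smooth (fun z μ => c * a z μ) :=
  (smooth_const c).mul ha

lemma hderiv_add (ha : Smooth a) (hb : Smooth b) (o : Option ι) :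
    EqHalf (hderiv o fun z μ => a z μ + b z μ) (fun z μ => hderiv o a z μ + hderiv o b z μ) := by
  intro z μ hμ
  beta_reduce
  rw [hderiv_eq_of_hasFDerivWithinAt (a := fun z μ => a z μ + b z μ) hμ
    ((ha.hasFDerivWithinAt hμ).add (hb.hasFDerivWithinAt hμ)), ha.hderiv_eq hμ, hb.hderiv_eq hμ]
  rfl

lemma hderiv_mul (ha : Smooth a) (hb : Smooth b) (o : Option ι) :
    EqHalf (hderiv o fun z μ => a z μ * b z μ)
      (fun z μ => hderiv o a z μ * b z μ + a z μ * hderiv o b z μ) := by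
  intro z μ hμ
  beta_reduce
  rw [hderiv_eq_of_hasFDerivWithinAt (a := fun z μ => a z μ * b z μ) hμ
    ((ha.hasFDerivWithinAt hμ).mul (hb.hasFDerivWithinAt hμ)), ha.hderiv_eq hμ, hb.hderiv_eq hμ]
  simp; ring

lemma hderiv_const_mul (ha : Smooth a) (c : ℂ) (o : Option ι) :
    EqHalf (hderiv o fun z μ => c * a z μ) (fun z μ => c * hderiv o a z μ) := by
  intro z μ hμ
  beta_reduce
  rw [hderiv_eq_of_hasFDerivWithinAt (a := fun z μ => c * a z μ) hμ
    ((ha.hasFDerivWithinAt hμ).const_mul c), ha.hderiv_eq hμ]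
  rfl

lemma hd_add (ha : Smooth a) (hb : Smooth b) (l : List (Option ι)) :
    EqHalf (hd l fun z μ => a z μ + b z μ) (fun z μ => hd l a z μ + hd l b z μ) := by
  induction l generalizing a b with
  | nil => exact .refl _
  | cons o l ih => exact ((hderiv_add ha hb o).hd l).trans (ih (ha.hderiv o) (hb.hderiv o))

lemma hd_const_mul (ha : Smooth a) (c : ℂ) (l : List (Option ι)) :
    EqHalf (hd l fun z μ => c * a z μ) (fun z μ => c * hd l a z μ) := by
  induction l generalizing a with
  | nil => exact .refl _
  | cons o l ih => exact ((hderiv_const_mul ha c o).hd l).trans (ih (ha.hderiv o))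

lemma hderiv_comm (ha : Smooth a) (o o' : Option ι) :
    EqHalf (hderiv o (hderiv o' a)) (hderiv o' (hderiv o a)) := by
  intro z μ hμ
  set f : EuclideanSpace ℝ ι × ℝ → ℂ := fun p => a p.1 p.2
  have hdf : ContDiffOn ℝ ∞ (fderivWithin ℝ f (halfSpace ι)) (halfSpace ι) :=
    ContDiffOn.fderivWithin ha uniqueDiffOn_halfSpace (by simp)
  have hp : (z, μ) ∈ halfSpace ι := mem_halfSpace hμ
  have key : ∀ o o' : Option ι, hderiv o (hderiv o' a) z μ =
      fderivWithin ℝ (fderivWithin ℝ f (halfSpace ι)) (halfSpace ι) (z, μ) (hdir o) (hdir o') := by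
    intro o o'
    have h1 := (hdf.differentiableOn (by simp) _ hp).hasFDerivWithinAt
    have h2 := h1.clm_apply (hasFDerivWithinAt_const (hdir o') (z, μ) (halfSpace ι))
    have h3 : HasFDerivWithinAt (fun p : EuclideanSpace ℝ ι × ℝ => hderiv o' a p.1 p.2) _
      (halfSpace ι) (z, μ) := h2.congr (fun p hp => ha.hderiv_eq hp.2 o') (ha.hderiv_eq hμ o')
    rw [hderiv_eq_of_hasFDerivWithinAt hμ h3]
    simp
  rw [key, key]
  -- Boundary points μ = 0 are included: they lie in the closure of the interior of the half space.
  refine ((ha (z, μ) hp).isSymmSndFDerivWithinAt (by simpa using two_le_infty)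
    uniqueDiffOn_halfSpace ?_ hp).eq _ _
  rw [interior_prod_eq, closure_prod_eq]
  simp [hμ]

lemma hd_perm (ha : Smooth a) {l l' : List (Option ι)} (h : l.Perm l') :
    EqHalf (hd l a) (hd l' a) := by
  induction h generalizing a with
  | nil => exact .refl _
  | cons o _ ih => exact ih (ha.hderiv o)
  | swap o o' l => exact (hderiv_comm ha o o').hd l
  | trans _ _ ih ih' => exact (ih ha).trans (ih' ha)

lemma hd_map_some (l : List ι) (a : EuclideanSpace ℝ ι → ℝ → ℂ) (z : EuclideanSpace ℝ ι) (μ : ℝ) :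
    hd (l.map some) a z μ = pd l (fun z' => a z' μ) z := by
  induction l generalizing a with
  | nil => rfl
  | cons i l ih => exact ih _

lemma hd_replicate_none (j : ℕ) (a : EuclideanSpace ℝ ι → ℝ → ℂ) :
    EqHalf (hd (List.replicate j none) a)
      (fun z μ => iteratedDerivWithin j (a z) (Set.Ici 0) μ) := by
  induction j generalizing a with
  | zero => intro z μ hμ; simp
  | succ j ih =>
    intro z μ hμ
    beta_reduce
    rw [iteratedDerivWithin_succ']
    exact ih (hderiv none a) z μ hμ

/-- Normal form in which the derivatives in μ act first, as in the estimates defining `IsRegSymbol`.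
-/
lemma exists_perm_replicate_append (l : List (Option ι)) : ∃ (j : ℕ) (l' : List ι),
    l.Perm (List.replicate j none ++ l'.map some) := by
  induction l with
  | nil => exact ⟨0, [], by simp⟩
  | cons o l ih =>
    obtain ⟨j, l', h⟩ := ih
    cases o with
    | none => exact ⟨j + 1, l', by simpa [List.replicate_succ] using h⟩
    | some i => exact ⟨j, i :: l', (h.cons (some i)).trans List.perm_middle.symm⟩

lemma iteratedFDeriv_cderiv {f : EuclideanSpace ℝ ι → ℂ} (hf : ContDiff ℝ ∞ f) (i : ι) (k : ℕ)
    (y : EuclideanSpace ℝ ι) (m : Fin k → EuclideanSpace ℝ ι) :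
    iteratedFDeriv ℝ k (cderiv i f) y m =
      iteratedFDeriv ℝ (k + 1) f y (Fin.snoc m (EuclideanSpace.single i 1)) := by
  rw [iteratedFDeriv_succ_apply_right]
  have h : cderiv i f = (ContinuousLinearMap.apply ℝ ℂ (EuclideanSpace.single i (1 : ℝ))) ∘
      fderiv ℝ f := by funext y; rfl
  rw [h, ContinuousLinearMap.iteratedFDeriv_comp_left _
    ((hf.fderiv_right (m := ∞) (by simp)).contDiffAt) (WithTop.coe_le_coe.2 le_top)]
  simp

lemma norm_pd_le {f : EuclideanSpace ℝ ι → ℂ} (hf : ContDiff ℝ ∞ f) (l : List ι)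
    (y : EuclideanSpace ℝ ι) : ‖pd l f y‖ ≤ ‖iteratedFDeriv ℝ l.length f y‖ := by
  -- The directions must be independent of the function, because the induction applies them to
  -- `cderiv i f`.
  suffices h : ∃ m : Fin l.length → EuclideanSpace ℝ ι, (∀ k, ‖m k‖ = 1) ∧
      ∀ f : EuclideanSpace ℝ ι → ℂ, ContDiff ℝ ∞ f →
        pd l f y = iteratedFDeriv ℝ l.length f y m by
    obtain ⟨m, hm, h⟩ := h
    rw [h f hf]
    refine (ContinuousMultilinearMap.le_opNorm _ _).trans_eq ?_
    simp [hm]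
  clear hf
  induction l with
  | nil => exact ⟨Fin.elim0, fun k => k.elim0, fun f _ => by simp⟩
  | cons i l ih =>
    obtain ⟨m, hm, h⟩ := ih
    refine ⟨Fin.snoc m (EuclideanSpace.single i 1), fun k => ?_, fun f hf => ?_⟩
    · refine Fin.lastCases ?_ (fun k => ?_) k
      · simp
      · simpa using hm k
    · rw [pd_cons, h _ (contDiff_cderiv hf i), iteratedFDeriv_cderiv hf]
      rfl

lemma exists_list_iteratedFDeriv (k : ℕ) (I : Fin k → ι) : ∃ l : List ι, l.length = k ∧
    ∀ (f : EuclideanSpace ℝ ι → ℂ), ContDiff ℝ ∞ f → ∀ y,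
      iteratedFDeriv ℝ k f y (fun j => EuclideanSpace.single (I j) 1) = pd l f y := by
  induction k with
  | zero => exact ⟨[], rfl, fun f _ y => by simp⟩
  | succ k ih =>
    obtain ⟨l, hl, h⟩ := ih (fun j => I j.castSucc)
    refine ⟨I (Fin.last k) :: l, by simp [hl], fun f hf y => ?_⟩
    rw [pd_cons, ← h _ (contDiff_cderiv hf _), iteratedFDeriv_cderiv hf]
    congr 1
    funext j
    refine Fin.lastCases ?_ (fun j => ?_) j <;> simp

lemma norm_multilinear_le {k : ℕ}
    (φ : ContinuousMultilinearMap ℝ (fun _ : Fin k => EuclideanSpace ℝ ι) ℂ) :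
    ‖φ‖ ≤ ∑ I : Fin k → ι, ‖φ (fun j => EuclideanSpace.single (I j) 1)‖ := by
  refine φ.opNorm_le_bound (Finset.sum_nonneg fun _ _ => norm_nonneg _) fun m => ?_
  have hm : m = fun j => ∑ i, (m j i) • EuclideanSpace.single i (1 : ℝ) := by
    funext j; ext i; simp [Pi.single_apply]
  conv_lhs => rw [hm]
  rw [ContinuousMultilinearMap.map_sum, Finset.sum_mul]
  refine (norm_sum_le _ _).trans (Finset.sum_le_sum fun I _ => ?_)
  rw [ContinuousMultilinearMap.map_smul_univ, norm_smul, mul_comm, norm_prod]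
  gcongr with j
  exact PiLp.norm_apply_le (m j) (I j)

end Calculus

/-! ### Symbol estimates with general weights. -/

section Sym

variable {ι : Type*} [Fintype ι] [DecidableEq ι]

/-- The factor by which a derivative changes the weight. -/
def wfac (ρ : EuclideanSpace ℝ ι → ℝ → ℝ) : Option ι → EuclideanSpace ℝ ι → ℝ → ℝ
  | none => fun z μ => (ρ z μ)⁻¹
  | some _ => fun z _ => (bracket z)⁻¹

/-- The factor by which iterated derivatives change the weight. -/
def wfacs (ρ : EuclideanSpace ℝ ι → ℝ → ℝ) (l : List (Option ι)) (z : EuclideanSpace ℝ ι) (μ : ℝ) :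
    ℝ :=
  (l.map fun o => wfac ρ o z μ).prod

/-- Smooth functions on `E × [0,∞)` that satisfy symbol estimates on `Ω` with the weight `σ`, where
derivatives in `z` gain `⟨z⟩⁻¹` and derivatives in `μ` gain `ρ⁻¹`. -/
structure Sym (ρ σ : EuclideanSpace ℝ ι → ℝ → ℝ) (Ω : Set (EuclideanSpace ℝ ι × ℝ))
    (a : EuclideanSpace ℝ ι → ℝ → ℂ) : Prop where
  smooth : Smooth a
  bound : ∀ l : List (Option ι), ∃ C : ℝ, ∀ z μ, 0 ≤ μ → (z, μ) ∈ Ω →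
    ‖hd l a z μ‖ ≤ C * (σ z μ * wfacs ρ l z μ)

variable {ρ ρ' σ σ' : EuclideanSpace ℝ ι → ℝ → ℝ} {Ω Ω' : Set (EuclideanSpace ℝ ι × ℝ)}
  {a b : EuclideanSpace ℝ ι → ℝ → ℂ}

@[simp] lemma wfacs_nil (z : EuclideanSpace ℝ ι) (μ : ℝ) : wfacs ρ [] z μ = 1 := rfl

@[simp] lemma wfacs_cons (o : Option ι) (l : List (Option ι)) (z : EuclideanSpace ℝ ι) (μ : ℝ) :
    wfacs ρ (o :: l) z μ = wfac ρ o z μ * wfacs ρ l z μ := by simp [wfacs]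

lemma wfacs_perm {l l' : List (Option ι)} (h : l.Perm l') (z : EuclideanSpace ℝ ι) (μ : ℝ) :
    wfacs ρ l z μ = wfacs ρ l' z μ :=
  (h.map _).prod_eq

lemma wfacs_replicate_append (j : ℕ) (l : List ι) (z : EuclideanSpace ℝ ι) (μ : ℝ) :
    wfacs ρ (List.replicate j none ++ l.map some) z μ =
      (ρ z μ)⁻¹ ^ j * (bracket z)⁻¹ ^ l.length := by
  have : (List.map ((fun o => wfac ρ o z μ) ∘ some) l).prod = (bracket z)⁻¹ ^ l.length := by
    rw [List.prod_eq_pow_card _ (bracket z)⁻¹]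
    · simp
    · intro x hx
      obtain ⟨i, _, rfl⟩ := List.mem_map.1 hx
      rfl
  simp only [wfacs, List.map_append, List.prod_append, List.map_replicate, List.prod_replicate,
    List.map_map, this]
  rfl

lemma wfac_pos (hρ : ∀ z μ, 0 < ρ z μ) (o : Option ι) (z : EuclideanSpace ℝ ι) (μ : ℝ) :
    0 < wfac ρ o z μ := by
  cases o with
  | none => exact inv_pos.2 (hρ z μ)
  | some i => exact inv_pos.2 (bracket_pos z)

lemma wfacs_pos (hρ : ∀ z μ, 0 < ρ z μ) (l : List (Option ι)) (z : EuclideanSpace ℝ ι) (μ : ℝ) :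
    0 < wfacs ρ l z μ := by
  induction l with
  | nil => simp
  | cons o l ih => rw [wfacs_cons]; exact mul_pos (wfac_pos hρ o z μ) ih

lemma Sym.hderiv (ha : Sym ρ σ Ω a) (o : Option ι) :
    Sym ρ (fun z μ => σ z μ * wfac ρ o z μ) Ω (hderiv o a) := by
  refine ⟨ha.smooth.hderiv o, fun l => ?_⟩
  obtain ⟨C, hC⟩ := ha.bound (o :: l)
  refine ⟨C, fun z μ hμ hz => (hC z μ hμ hz).trans_eq ?_⟩
  rw [wfacs_cons]; ring

lemma Sym.congr (ha : Sym ρ σ Ω a) (h : EqHalf b a) : Sym ρ σ Ω b := by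
  refine ⟨ha.smooth.congr h, fun l => ?_⟩
  obtain ⟨C, hC⟩ := ha.bound l
  exact ⟨C, fun z μ hμ hz => by rw [h.hd l z μ hμ]; exact hC z μ hμ hz⟩

lemma Sym.subset (ha : Sym ρ σ Ω a) (h : Ω' ⊆ Ω) : Sym ρ σ Ω' a :=
  ⟨ha.smooth, fun l => (ha.bound l).imp fun _ hC z μ hμ hz => hC z μ hμ (h hz)⟩

lemma Sym.mono (ha : Sym ρ σ Ω a) (hρ : ∀ z μ, 0 < ρ z μ) (K : ℝ)
    (hσ : ∀ z μ, 0 ≤ μ → (z, μ) ∈ Ω → 0 ≤ σ z μ)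
    (h : ∀ z μ, 0 ≤ μ → (z, μ) ∈ Ω → σ z μ ≤ K * σ' z μ) : Sym ρ σ' Ω a := by
  refine ⟨ha.smooth, fun l => ?_⟩
  obtain ⟨C, hC⟩ := ha.bound l
  refine ⟨|C| * K, fun z μ hμ hz => (hC z μ hμ hz).trans ?_⟩
  have h1 := wfacs_pos hρ l z μ
  calc C * (σ z μ * wfacs ρ l z μ) ≤ |C| * (σ z μ * wfacs ρ l z μ) :=
        mul_le_mul_of_nonneg_right (le_abs_self C) (mul_nonneg (hσ z μ hμ hz) h1.le)
    _ ≤ |C| * ((K * σ' z μ) * wfacs ρ l z μ) := by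
        gcongr
        exact h z μ hμ hz
    _ = _ := by ring

lemma Sym.union (ha : Sym ρ σ Ω a) (ha' : Sym ρ σ Ω' a) (hρ : ∀ z μ, 0 < ρ z μ)
    (hσ : ∀ z μ, 0 ≤ μ → (z, μ) ∈ Ω ∪ Ω' → 0 ≤ σ z μ) : Sym ρ σ (Ω ∪ Ω') a := by
  refine ⟨ha.smooth, fun l => ?_⟩
  obtain ⟨C, hC⟩ := ha.bound l
  obtain ⟨C', hC'⟩ := ha'.bound l
  refine ⟨max C C', fun z μ hμ hz => ?_⟩
  have h1 := mul_nonneg (hσ z μ hμ hz) (wfacs_pos hρ l z μ).le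
  rcases hz with hz | hz
  · exact (hC z μ hμ hz).trans (mul_le_mul_of_nonneg_right (le_max_left _ _) h1)
  · exact (hC' z μ hμ hz).trans (mul_le_mul_of_nonneg_right (le_max_right _ _) h1)

/-- Change of the weight function for derivatives in `μ`. -/
lemma Sym.change (ha : Sym ρ σ Ω a) (hρ : ∀ z μ, 0 < ρ z μ) (hρ' : ∀ z μ, 0 < ρ' z μ) (K : ℝ)
    (hσ : ∀ z μ, 0 ≤ μ → (z, μ) ∈ Ω → 0 ≤ σ z μ)
    (h : ∀ z μ, 0 ≤ μ → (z, μ) ∈ Ω → ρ' z μ ≤ K * ρ z μ) : Sym ρ' σ Ω a := by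
  have hw : ∀ l : List (Option ι), ∃ K' : ℝ, 0 ≤ K' ∧ ∀ z μ, 0 ≤ μ → (z, μ) ∈ Ω →
      wfacs ρ l z μ ≤ K' * wfacs ρ' l z μ := by
    intro l
    induction l with
    | nil => exact ⟨1, zero_le_one, by simp⟩
    | cons o l ih =>
      obtain ⟨K', hK', hl⟩ := ih
      cases o with
      | some i =>
        refine ⟨K', hK', fun z μ hμ hz => ?_⟩
        simp only [wfacs_cons, wfac]
        have h1 := inv_pos.2 (bracket_pos z)
        calc _ ≤ (bracket z)⁻¹ * (K' * wfacs ρ' l z μ) :=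
              mul_le_mul_of_nonneg_left (hl z μ hμ hz) h1.le
          _ = _ := by ring
      | none =>
        refine ⟨|K| * K', by positivity, fun z μ hμ hz => ?_⟩
        simp only [wfacs_cons, wfac]
        have h1 := hρ z μ
        have h2 := hρ' z μ
        have h3 : (ρ z μ)⁻¹ ≤ |K| * (ρ' z μ)⁻¹ := by
          rw [← div_eq_mul_inv, le_div_iff₀ h2, inv_mul_le_iff₀ h1]
          refine (h z μ hμ hz).trans ?_
          rw [mul_comm]
          exact mul_le_mul_of_nonneg_left (le_abs_self K) h1.le
        calc _ ≤ (|K| * (ρ' z μ)⁻¹) * (K' * wfacs ρ' l z μ) :=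
              mul_le_mul h3 (hl z μ hμ hz) (wfacs_pos hρ l z μ).le (by positivity)
          _ = _ := by ring
  refine ⟨ha.smooth, fun l => ?_⟩
  obtain ⟨C, hC⟩ := ha.bound l
  obtain ⟨K', hK', hl⟩ := hw l
  refine ⟨|C| * K', fun z μ hμ hz => (hC z μ hμ hz).trans ?_⟩
  have h0 := hσ z μ hμ hz
  calc C * (σ z μ * wfacs ρ l z μ) ≤ |C| * (σ z μ * wfacs ρ l z μ) :=
        mul_le_mul_of_nonneg_right (le_abs_self C)
          (mul_nonneg (hσ z μ hμ hz) (wfacs_pos hρ l z μ).le)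
    _ ≤ |C| * (σ z μ * (K' * wfacs ρ' l z μ)) := by
        gcongr
        exact hl z μ hμ hz
    _ = _ := by ring

lemma Sym.add (ha : Sym ρ σ Ω a) (hb : Sym ρ σ Ω b) : Sym ρ σ Ω (fun z μ => a z μ + b z μ) := by
  refine ⟨ha.smooth.add hb.smooth, fun l => ?_⟩
  obtain ⟨C, hC⟩ := ha.bound l
  obtain ⟨C', hC'⟩ := hb.bound l
  refine ⟨C + C', fun z μ hμ hz => ?_⟩
  rw [hd_add ha.smooth hb.smooth l z μ hμ, add_mul]
  exact (norm_add_le _ _).trans (add_le_add (hC z μ hμ hz) (hC' z μ hμ hz))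

lemma Sym.const_mul (ha : Sym ρ σ Ω a) (c : ℂ) : Sym ρ σ Ω (fun z μ => c * a z μ) := by
  refine ⟨ha.smooth.const_mul c, fun l => ?_⟩
  obtain ⟨C, hC⟩ := ha.bound l
  refine ⟨‖c‖ * C, fun z μ hμ hz => ?_⟩
  rw [hd_const_mul ha.smooth c l z μ hμ, norm_mul, mul_assoc]
  exact mul_le_mul_of_nonneg_left (hC z μ hμ hz) (norm_nonneg _)

lemma Sym.sub (ha : Sym ρ σ Ω a) (hb : Sym ρ σ Ω b) : Sym ρ σ Ω (fun z μ => a z μ - b z μ) := by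
  simpa [sub_eq_add_neg] using ha.add (hb.const_mul (-1))

lemma hd_zero (l : List (Option ι)) :
    EqHalf (hd l fun (_ : EuclideanSpace ℝ ι) (_ : ℝ) => (0 : ℂ)) (fun _ _ => 0) := by
  have := hd_const_mul (smooth_const (ι := ι) 0) 0 l
  intro z μ hμ
  simpa using this z μ hμ

lemma sym_zero : Sym ρ σ Ω (fun _ _ => 0) :=
  ⟨smooth_const 0, fun l => ⟨0, fun z μ hμ _ => by rw [hd_zero l z μ hμ]; simp⟩⟩

lemma Sym.sum {κ : Type*} (s : Finset κ) {f : κ → EuclideanSpace ℝ ι → ℝ → ℂ}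
    (hf : ∀ i ∈ s, Sym ρ σ Ω (f i)) : Sym ρ σ Ω (fun z μ => ∑ i ∈ s, f i z μ) := by
  classical
  induction s using Finset.induction_on with
  | empty => simpa using sym_zero
  | insert i s hi ih =>
    simp only [Finset.sum_insert hi]
    exact (hf i (Finset.mem_insert_self i s)).add
      (ih fun j hj => hf j (Finset.mem_insert_of_mem hj))

lemma Sym.mul (ha : Sym ρ σ Ω a) (hb : Sym ρ σ' Ω b) :
    Sym ρ (fun z μ => σ z μ * σ' z μ) Ω (fun z μ => a z μ * b z μ) := by
  refine ⟨ha.smooth.mul hb.smooth, fun l => ?_⟩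
  induction l generalizing a b σ σ' with
  | nil =>
    obtain ⟨C, hC⟩ := ha.bound []
    obtain ⟨C', hC'⟩ := hb.bound []
    refine ⟨C * C', fun z μ hμ hz => ?_⟩
    have h1 := hC z μ hμ hz
    have h2 := hC' z μ hμ hz
    simp only [hd_nil, wfacs_nil, mul_one] at *
    rw [norm_mul]
    calc ‖a z μ‖ * ‖b z μ‖ ≤ (C * σ z μ) * (C' * σ' z μ) :=
          mul_le_mul h1 h2 (norm_nonneg _) ((norm_nonneg _).trans h1)
      _ = _ := by ring
  | cons o l ih =>
    obtain ⟨C, hC⟩ := ih (ha.hderiv o) hb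
    obtain ⟨C', hC'⟩ := ih ha (hb.hderiv o)
    refine ⟨C + C', fun z μ hμ hz => ?_⟩
    rw [hd_cons, (hderiv_mul ha.smooth hb.smooth o).hd l z μ hμ,
      hd_add ((ha.smooth.hderiv o).mul hb.smooth) (ha.smooth.mul (hb.smooth.hderiv o)) l z μ hμ]
    refine (norm_add_le _ _).trans ((add_le_add (hC z μ hμ hz) (hC' z μ hμ hz)).trans_eq ?_)
    rw [wfacs_cons]; ring

end Sym

/-! ### The symbol classes in terms of weighted estimates. -/

section Convert

variable {ι : Type*} [Fintype ι] [DecidableEq ι]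

/-- The weight `⟨z, μ⟩` as a function of `z` and `μ`. -/
abbrev jp : EuclideanSpace ℝ ι → ℝ → ℝ := bracketParam

/-- The weight `⟨μ⟩` as a function of `z` and `μ`. -/
def jm (_ : EuclideanSpace ℝ ι) (μ : ℝ) : ℝ := bracket μ

lemma jp_pos (z : EuclideanSpace ℝ ι) (μ : ℝ) : 0 < jp z μ :=
  Real.sqrt_pos.2 (by positivity)

lemma jm_pos (z : EuclideanSpace ℝ ι) (μ : ℝ) : 0 < jm z μ := bracket_pos μ

/-- The weight `⟨z⟩^ν ⟨z,μ⟩^{d-ν}`. -/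
def wReg (d ν : ℝ) (z : EuclideanSpace ℝ ι) (μ : ℝ) : ℝ := bracket z ^ ν * jp z μ ^ (d - ν)

/-- The weight `⟨z⟩^m ⟨μ⟩^s`. -/
def wTen (m s : ℝ) (z : EuclideanSpace ℝ ι) (μ : ℝ) : ℝ := bracket z ^ m * jm z μ ^ s

lemma wReg_pos (d ν : ℝ) (z : EuclideanSpace ℝ ι) (μ : ℝ) : 0 < wReg d ν z μ :=
  mul_pos (Real.rpow_pos_of_pos (bracket_pos z) _) (Real.rpow_pos_of_pos (jp_pos z μ) _)

lemma wTen_pos (m s : ℝ) (z : EuclideanSpace ℝ ι) (μ : ℝ) : 0 < wTen m s z μ :=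
  mul_pos (Real.rpow_pos_of_pos (bracket_pos z) _) (Real.rpow_pos_of_pos (jm_pos z μ) _)

lemma rpow_mul_inv_pow {x : ℝ} (hx : 0 < x) (m : ℝ) (k : ℕ) : x ^ m * x⁻¹ ^ k = x ^ (m - k) := by
  rw [Real.rpow_sub hx, Real.rpow_natCast, inv_pow, div_eq_mul_inv]

/-- A Fréchet derivative is controlled by its values on basis vectors, that is, by partial
derivatives. The order of these is immaterial by `hd_perm`. -/
theorem isRegSymbol_iff {d ν : ℝ} {a : EuclideanSpace ℝ ι → ℝ → ℂ} :
    IsRegSymbol d ν a ↔ Sym jp (wReg d ν) Set.univ a := by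
  have hslice : ∀ j (z : EuclideanSpace ℝ ι) (μ : ℝ), 0 ≤ μ →
      (fun z' => iteratedDerivWithin j (a z') (Set.Ici 0) μ) =
        fun z' => hd (List.replicate j none) a z' μ := fun j z μ hμ =>
    funext fun z' => (hd_replicate_none j a z' μ hμ).symm
  have hw : ∀ (j : ℕ) (l : List ι) z μ, wReg d ν z μ *
      wfacs jp (List.replicate j none ++ l.map some) z μ =
      bracket z ^ (ν - l.length) * bracketParam z μ ^ (d - ν - j) := by
    intro j l z μ
    rw [wfacs_replicate_append, wReg, ← rpow_mul_inv_pow (bracket_pos z),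
      ← rpow_mul_inv_pow (jp_pos z μ)]
    ring
  constructor
  · intro h
    have hs : Smooth a := h.smooth
    refine ⟨hs, fun l => ?_⟩
    obtain ⟨j, l', hl⟩ := exists_perm_replicate_append l
    obtain ⟨C, hC⟩ := h.bound l'.length j
    refine ⟨C, fun z μ hμ _ => ?_⟩
    have h1 := hC z μ hμ
    rw [hslice j z μ hμ] at h1
    rw [hd_perm hs hl z μ hμ, wfacs_perm hl, hw, hd_append, hd_map_some, ← mul_assoc]
    exact (norm_pd_le ((hs.hd _).slice hμ) l' z).trans h1
  · intro h
    have hs : Smooth a := h.smooth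
    refine ⟨hs, fun k j => ?_⟩
    choose l hl hI using exists_list_iteratedFDeriv (ι := ι) k
    choose C hC using fun I => h.bound (List.replicate j none ++ (l I).map some)
    refine ⟨∑ I, C I, fun z μ hμ => ?_⟩
    rw [hslice j z μ hμ, mul_assoc, Finset.sum_mul]
    refine (norm_multilinear_le _).trans (Finset.sum_le_sum fun I _ => ?_)
    rw [hI I _ ((hs.hd _).slice hμ) z, ← hd_map_some (l I) (hd (List.replicate j none) a),
      ← hd_append]
    refine (hC I z μ hμ trivial).trans_eq ?_
    rw [hw, hl]

lemma smooth_of_contDiff {f : EuclideanSpace ℝ ι → ℂ} (hf : ContDiff ℝ ∞ f) :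
    Smooth (fun z _ => f z) :=
  (hf.comp contDiff_fst).contDiffOn

lemma hd_const_param {f : EuclideanSpace ℝ ι → ℂ} (j : ℕ) (l : List ι) (z : EuclideanSpace ℝ ι)
    {μ : ℝ} (hμ : 0 ≤ μ) :
    hd (List.replicate j none ++ l.map some) (fun z _ => f z) z μ =
      if j = 0 then pd l f z else 0 := by
  rw [hd_append, hd_map_some]
  rcases j with _ | j
  · rfl
  · have h0 : hderiv none (fun (z : EuclideanSpace ℝ ι) (_ : ℝ) => f z) = fun _ _ => 0 := by
      funext z μ; simp [hderiv]
    have : (fun z' => hd (List.replicate (j + 1) none) (fun z _ => f z) z' μ) =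
        fun y => 0 * (1 : ℂ) := by
      funext z'
      rw [List.replicate_succ, hd_cons, h0, hd_zero _ z' μ hμ]; simp
    rw [this, pd_const_mul contDiff_const]
    simp

/-- Derivatives in μ vanish, so the weight `ρ` is arbitrary. Thus one and the same coefficient can
be used next to powers of [z, μ], with `ρ = jp`, and next to powers of ⟨μ⟩, with `ρ = jm`. -/
theorem isSymbol_iff {m : ℝ} {f : EuclideanSpace ℝ ι → ℂ} (ρ : EuclideanSpace ℝ ι → ℝ → ℝ) 
    (hρ : ∀ z μ, 0 < ρ z μ) :
    IsSymbol m f ↔ Sym ρ (fun z _ => bracket z ^ m) Set.univ (fun z _ => f z) := by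
  constructor
  · intro h
    have hs : Smooth (fun z (_ : ℝ) => f z) := smooth_of_contDiff h.smooth
    refine ⟨hs, fun l => ?_⟩
    obtain ⟨j, l', hl⟩ := exists_perm_replicate_append l
    obtain ⟨C, hC⟩ := h.bound l'.length
    refine ⟨|C|, fun z μ hμ _ => ?_⟩
    rw [hd_perm hs hl z μ hμ, wfacs_perm hl, wfacs_replicate_append, hd_const_param j l' z hμ]
    split_ifs with hj
    · subst hj
      rw [pow_zero, one_mul, rpow_mul_inv_pow (bracket_pos z)]
      exact ((norm_pd_le h.smooth l' z).trans (hC z)).trans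
        (mul_le_mul_of_nonneg_right (le_abs_self C) (Real.rpow_nonneg (bracket_pos z).le _))
    · rw [norm_zero]
      have := hρ z μ
      have := bracket_pos z
      positivity
  · intro h
    have hs : ContDiff ℝ ∞ f := h.smooth.slice le_rfl
    refine ⟨hs, fun k => ?_⟩
    choose l hl hI using exists_list_iteratedFDeriv (ι := ι) k
    choose C hC using fun I => h.bound ((l I).map some)
    refine ⟨∑ I, C I, fun z => ?_⟩
    rw [Finset.sum_mul]
    refine (norm_multilinear_le _).trans (Finset.sum_le_sum fun I _ => ?_)
    have h1 := hC I z 0 le_rfl trivial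
    have h2 := wfacs_replicate_append (ρ := ρ) 0 (l I) z 0
    simp only [List.replicate_zero, List.nil_append, pow_zero, one_mul] at h2
    rw [hd_map_some, h2, rpow_mul_inv_pow (bracket_pos z), hl] at h1
    rw [hI I f hs z]
    exact h1

end Convert

/-! ### Increments of functions of temperate growth. -/

section Temp

variable {ι : Type*} [Fintype ι] [DecidableEq ι] {a b : EuclideanSpace ℝ ι → ℝ → ℂ}

/-- The coordinates on `E × ℝ`. -/
def hcoord : Option ι → (EuclideanSpace ℝ ι × ℝ →L[ℝ] ℝ)
  | none => .snd ℝ _ _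
  | some i => (EuclideanSpace.proj i : EuclideanSpace ℝ ι →L[ℝ] ℝ).comp (.fst ℝ _ _)

lemma abs_hcoord_le (o : Option ι) (v : EuclideanSpace ℝ ι × ℝ) : |hcoord o v| ≤ ‖v‖ := by
  cases o with
  | none => exact norm_snd_le v
  | some i => exact (PiLp.norm_apply_le v.1 i).trans (norm_fst_le v)

lemma sum_hcoord_smul_hdir (v : EuclideanSpace ℝ ι × ℝ) : ∑ o, hcoord o v • hdir o = v := by
  rw [Fintype.sum_option]
  refine Prod.ext ?_ ?_
  · simp only [hdir, hcoord, Prod.fst_add, Prod.fst_sum]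
    ext i
    simp [Pi.single_apply]
  · simp only [hdir, hcoord, Prod.snd_add, Prod.snd_sum]
    simp

/-- The continuous linear form with given values on the coordinate directions. -/
def hform (c : Option ι → ℂ) : EuclideanSpace ℝ ι × ℝ →L[ℝ] ℂ :=
  ∑ o, (hcoord o).smulRight (c o)

lemma hform_apply (c : Option ι → ℂ) (v : EuclideanSpace ℝ ι × ℝ) :
    hform c v = ∑ o, (hcoord o v : ℂ) * c o := by
  simp [hform]

lemma norm_hform_le (c : Option ι → ℂ) : ‖hform c‖ ≤ ∑ o, ‖c o‖ := by
  refine ContinuousLinearMap.opNorm_le_bound _ (Finset.sum_nonneg fun _ _ => norm_nonneg _)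
    fun v => ?_
  rw [hform_apply, Finset.sum_mul]
  refine (norm_sum_le _ _).trans (Finset.sum_le_sum fun o _ => ?_)
  rw [norm_mul, Complex.norm_real, mul_comm]
  exact mul_le_mul_of_nonneg_left (abs_hcoord_le o v) (norm_nonneg _)

lemma hform_sub (c c' : Option ι → ℂ) : hform c - hform c' = hform (fun o => c o - c' o) := by
  ext v
  · simp [hform_apply, mul_sub]
  · simp [hform_apply, mul_sub]

lemma Smooth.hasFDerivWithinAt_hform (ha : Smooth a) {p : EuclideanSpace ℝ ι × ℝ} (hp : 0 ≤ p.2) :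
    HasFDerivWithinAt (fun p : EuclideanSpace ℝ ι × ℝ => a p.1 p.2)
      (hform fun o => Shubin.hderiv o a p.1 p.2) (halfSpace ι) p := by
  convert ha.hasFDerivWithinAt (z := p.1) hp using 1
  refine ContinuousLinearMap.ext fun v => ?_
  simp only [hform_apply, ha.hderiv_eq hp]
  conv_rhs => rw [← sum_hcoord_smul_hdir v, map_sum]
  simp only [map_smul, Complex.real_smul]

/-- Smooth functions all of whose derivatives are `O((⟨z⟩⟨μ⟩)^M)`. -/
structure Temp (M : ℕ) (a : EuclideanSpace ℝ ι → ℝ → ℂ) : Prop where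
  smooth : Smooth a
  bound : ∀ l : List (Option ι), ∃ C : ℝ, 0 ≤ C ∧ ∀ z μ, 0 ≤ μ →
    ‖hd l a z μ‖ ≤ C * (bracket z * bracket μ) ^ M

variable {M : ℕ}

lemma Temp.hderiv (ha : Temp M a) (o : Option ι) : Temp M (hderiv o a) :=
  ⟨ha.smooth.hderiv o, fun l => ha.bound (o :: l)⟩

lemma Temp.mono {M' : ℕ} (ha : Temp M a) (h : M ≤ M') : Temp M' a := by
  refine ⟨ha.smooth, fun l => ?_⟩
  obtain ⟨C, hC0, hC⟩ := ha.bound l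
  refine ⟨C, hC0, fun z μ hμ => (hC z μ hμ).trans ?_⟩
  have h1 := one_le_bracket z
  have h2 := one_le_bracket μ
  gcongr
  exact one_le_mul_of_one_le_of_one_le h1 h2

lemma bracket_mul_bracket_le {z z' : EuclideanSpace ℝ ι} {μ μ' : ℝ} (hz : ‖z' - z‖ ≤ 1)
    (hμ : ‖μ' - μ‖ ≤ 1) : bracket z' * bracket μ' ≤ 16 * (bracket z * bracket μ) := by
  have h1 := bracket_add_le z (z' - z)
  have h2 := bracket_add_le μ (μ' - μ)
  rw [add_sub_cancel] at h1 h2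
  have h3 : bracket (z' - z) ≤ 2 := (bracket_le_one_add_norm _).trans (by linarith)
  have h4 : bracket (μ' - μ) ≤ 2 := (bracket_le_one_add_norm _).trans (by linarith)
  have := bracket_pos z
  have := bracket_pos μ
  have := bracket_pos z'
  have := bracket_pos μ'
  calc bracket z' * bracket μ' ≤ (2 * (bracket z * 2)) * (2 * (bracket μ * 2)) := by
        gcongr
        · exact h1.trans (by gcongr)
        · exact h2.trans (by gcongr)
    _ = _ := by ring

/-- First-order increments, with uniform bounds. -/
lemma Temp.exists_norm_sub_le (ha : Temp M a) : ∃ C : ℝ, 0 ≤ C ∧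
    ∀ p p' : EuclideanSpace ℝ ι × ℝ, 0 ≤ p.2 → 0 ≤ p'.2 → ‖p' - p‖ ≤ 1 →
      ‖a p'.1 p'.2 - a p.1 p.2‖ ≤ C * (bracket p.1 * bracket p.2) ^ M * ‖p' - p‖ := by
  choose C hC0 hC using fun o => ha.bound [o]
  refine ⟨(∑ o, C o) * 16 ^ M, mul_nonneg (Finset.sum_nonneg fun o _ => hC0 o) (by positivity),
    fun p p' hp hp' h => ?_⟩
  have hconv : Convex ℝ (halfSpace ι ∩ Metric.closedBall p 1) :=
    (convex_univ.prod (convex_Ici 0)).inter (convex_closedBall p 1)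
  refine hconv.norm_image_sub_le_of_norm_hasFDerivWithin_le
    (f := fun p : EuclideanSpace ℝ ι × ℝ => a p.1 p.2)
    (f' := fun p => hform fun o => Shubin.hderiv o a p.1 p.2) (fun q hq => ?_) (fun q hq => ?_)
    ⟨⟨trivial, hp⟩, by simp⟩ ⟨⟨trivial, hp'⟩, by simpa [dist_eq_norm] using h⟩
  · exact (ha.smooth.hasFDerivWithinAt_hform hq.1.2).mono Set.inter_subset_left
  · refine (norm_hform_le _).trans ?_
    rw [Finset.sum_mul, Finset.sum_mul]
    refine Finset.sum_le_sum fun o _ => (hC o q.1 q.2 hq.1.2).trans ?_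
    have hq2 : ‖q - p‖ ≤ 1 := by simpa [dist_eq_norm] using hq.2
    have := bracket_mul_bracket_le ((norm_fst_le (q - p)).trans hq2)
      ((norm_snd_le (q - p)).trans hq2)
    have h1 := bracket_pos q.1
    have h2 := bracket_pos q.2
    rw [mul_assoc, ← mul_pow]
    exact mul_le_mul_of_nonneg_left (pow_le_pow_left₀ (by positivity) this M) (hC0 o)

/-- Second-order increments, with uniform bounds. -/
lemma Temp.exists_norm_sub_sub_le (ha : Temp M a) : ∃ C : ℝ, 0 ≤ C ∧
    ∀ p p' : EuclideanSpace ℝ ι × ℝ, 0 ≤ p.2 → 0 ≤ p'.2 → ‖p' - p‖ ≤ 1 →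
      ‖a p'.1 p'.2 - a p.1 p.2 - ∑ o, (hcoord o (p' - p) : ℂ) * Shubin.hderiv o a p.1 p.2‖ ≤
        C * (bracket p.1 * bracket p.2) ^ M * ‖p' - p‖ ^ 2 := by
  choose C hC0 hC using fun o => (ha.hderiv o).exists_norm_sub_le
  refine ⟨∑ o, C o, Finset.sum_nonneg fun o _ => hC0 o, fun p p' hp hp' h => ?_⟩
  have hconv : Convex ℝ (halfSpace ι ∩ Metric.closedBall p ‖p' - p‖) :=
    (convex_univ.prod (convex_Ici 0)).inter (convex_closedBall p _)
  have key := hconv.norm_image_sub_le_of_norm_hasFDerivWithin_le'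
    (f := fun p : EuclideanSpace ℝ ι × ℝ => a p.1 p.2) (x := p) (y := p')
    (φ := hform fun o => Shubin.hderiv o a p.1 p.2)
    (C := (∑ o, C o) * (bracket p.1 * bracket p.2) ^ M * ‖p' - p‖)
    (f' := fun p => hform fun o => Shubin.hderiv o a p.1 p.2) (fun q hq => ?_) (fun q hq => ?_)
    ⟨⟨trivial, hp⟩, by simp⟩ ⟨⟨trivial, hp'⟩, by simp [dist_eq_norm]⟩
  · rw [hform_apply] at key
    refine key.trans_eq ?_
    ring
  · exact (ha.smooth.hasFDerivWithinAt_hform hq.1.2).mono Set.inter_subset_left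
  · rw [hform_sub]
    refine (norm_hform_le _).trans ?_
    rw [Finset.sum_mul, Finset.sum_mul]
    have hq2 : ‖q - p‖ ≤ ‖p' - p‖ := by simpa [dist_eq_norm] using hq.2
    refine Finset.sum_le_sum fun o _ => (hC o p q hp hq.1.2 (hq2.trans h)).trans ?_
    have h1 := bracket_pos p.1
    have h2 := bracket_pos p.2
    have h3 := hC0 o
    gcongr

end Temp

/-! ### Affine coordinate subspaces. -/

section Embedding

variable {ι : Type*} [Fintype ι] [DecidableEq ι] {n : ℕ}

/-- Embedding along coordinate directions. -/
def emb (σ : Fin n → ι) : Config n →L[ℝ] EuclideanSpace ℝ ι :=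
  ∑ i, (EuclideanSpace.proj i : Config n →L[ℝ] ℝ).smulRight (EuclideanSpace.single (σ i) 1)

lemma emb_apply (σ : Fin n → ι) (y : Config n) :
    emb σ y = ∑ i, y i • EuclideanSpace.single (σ i) 1 := by
  simp [emb]

lemma emb_single (σ : Fin n → ι) (i : Fin n) :
    emb σ (EuclideanSpace.single i 1) = EuclideanSpace.single (σ i) 1 := by
  simp [emb_apply]

lemma norm_emb {σ : Fin n → ι} (hσ : Function.Injective σ) (y : Config n) : ‖emb σ y‖ = ‖y‖ := by
  have h : Orthonormal ℝ (fun i => EuclideanSpace.single (σ i) (1 : ℝ)) :=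
    (EuclideanSpace.orthonormal_single (𝕜 := ℝ) (ι := ι)).comp σ hσ
  rw [← sq_eq_sq₀ (norm_nonneg _) (norm_nonneg _), ← real_inner_self_eq_norm_sq, emb_apply,
    h.inner_sum, EuclideanSpace.norm_sq_eq]
  simp [sq]

lemma pd_comp_emb (σ : Fin n → ι) {f : EuclideanSpace ℝ ι → ℂ} (hf : ContDiff ℝ ∞ f)
    (z : EuclideanSpace ℝ ι) (l : List (Fin n)) :
    pd l (fun y => f (z + emb σ y)) = fun y => pd (l.map σ) f (z + emb σ y) := by
  induction l generalizing f with
  | nil => rfl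
  | cons i l ih =>
    rw [pd_cons, List.map_cons, pd_cons, ← ih (contDiff_cderiv hf (σ i))]
    congr 1
    funext y
    have h1 : HasFDerivAt (fun y => z + emb σ y) (emb σ) y := (emb σ).hasFDerivAt.const_add z
    have h2 := ((hf.differentiable (by simp) (z + emb σ y)).hasFDerivAt).comp y h1
    have h3 : HasFDerivAt (fun y => f (z + emb σ y)) _ y := h2
    simp only [cderiv]
    rw [h3.fderiv, ContinuousLinearMap.comp_apply, emb_single]

lemma contDiff_comp_emb (σ : Fin n → ι) {f : EuclideanSpace ℝ ι → ℂ} (hf : ContDiff ℝ ∞ f)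
    (z : EuclideanSpace ℝ ι) : ContDiff ℝ ∞ (fun y => f (z + emb σ y)) :=
  hf.comp (contDiff_const.add (emb σ).contDiff)

end Embedding

/-! ### Slices and their difference quotients as tempered families. -/

section Slices

variable {ι : Type*} [Fintype ι] [DecidableEq ι] {n : ℕ} {a : EuclideanSpace ℝ ι → ℝ → ℂ} {M : ℕ}
  {σ : Fin n → ι}

/-- The restriction of a symbol to an affine subspace through `p`. -/
def slice (σ : Fin n → ι) (a : EuclideanSpace ℝ ι → ℝ → ℂ) (p : EuclideanSpace ℝ ι × ℝ)
    (y : Config n) : ℂ := a (p.1 + emb σ y) p.2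

lemma Smooth.contDiff_slice (ha : Smooth a) (σ : Fin n → ι) {p : EuclideanSpace ℝ ι × ℝ}
    (hp : 0 ≤ p.2) : ContDiff ℝ ∞ (Shubin.slice σ a p) :=
  contDiff_comp_emb σ (ha.slice hp) p.1

lemma pd_slice (ha : Smooth a) (σ : Fin n → ι) {p : EuclideanSpace ℝ ι × ℝ}
    (hp : 0 ≤ p.2) (l : List (Fin n)) :
    pd l (slice σ a p) = slice σ (hd ((l.map σ).map some) a) p := by
  funext y
  change pd l (fun y => a (p.1 + emb σ y) p.2) y = hd _ a _ _
  rw [hd_map_some, pd_comp_emb σ (ha.slice hp) p.1]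

lemma cderiv_slice (ha : Smooth a) (σ : Fin n → ι) {p : EuclideanSpace ℝ ι × ℝ}
    (hp : 0 ≤ p.2) (i : Fin n) :
    cderiv i (slice σ a p) = slice σ (hderiv (some (σ i)) a) p :=
  pd_slice ha σ hp [i]

lemma cderiv_sum {κ : Type*} (s : Finset κ) {f : κ → Config n → ℂ}
    (hf : ∀ k, ContDiff ℝ ∞ (f k)) (i : Fin n) :
    cderiv i (fun y => ∑ k ∈ s, f k y) = fun y => ∑ k ∈ s, cderiv i (f k) y := by
  funext y
  simp only [cderiv]
  rw [fderiv_fun_sum fun k _ => (hf k).differentiable (by simp) y]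
  simp

lemma cderiv_sub {f g : Config n → ℂ} (hf : ContDiff ℝ ∞ f) (hg : ContDiff ℝ ∞ g)
    (i : Fin n) : cderiv i (fun y => f y - g y) = fun y => cderiv i f y - cderiv i g y := by
  funext y
  simp only [cderiv]
  rw [fderiv_fun_sub (hf.differentiable (by simp) y) (hg.differentiable (by simp) y)]
  rfl

/-- If a construction commutes with derivatives along the slice, then a sup bound valid for all
temperate functions controls all derivatives as well: it is applied to derivatives of `a`, which are
temperate of the same order. -/
lemma tempFam_of_commute {T : Type*} (F : (EuclideanSpace ℝ ι → ℝ → ℂ) → T → Config n → ℂ)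
    (h1 : ∀ a, Temp M a → ∀ t, ContDiff ℝ ∞ (F a t))
    (h2 : ∀ a, Temp M a → ∀ t i, cderiv i (F a t) = F (hderiv (some (σ i)) a) t)
    (h3 : ∀ a, Temp M a → ∃ C : ℝ, ∀ t y, ‖F a t y‖ ≤ C * bracket y ^ M) (ha : Temp M a) :
    TempFam M (F a) := by
  refine ⟨h1 a ha, fun l => ?_⟩
  simp only [Real.rpow_natCast]
  induction l generalizing a with
  | nil => exact h3 a ha
  | cons i l ih =>
    obtain ⟨C, hC⟩ := ih (ha.hderiv (some (σ i)))
    exact ⟨C, fun t y => by rw [pd_cons, h2 a ha]; exact hC t y⟩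

lemma bracket_emb (hσ : Function.Injective σ) (y : Config n) : bracket (emb σ y) = bracket y := by
  simp [bracket, norm_emb hσ]

lemma bracket_add_emb_le (hσ : Function.Injective σ) (z : EuclideanSpace ℝ ι) (y : Config n) :
    bracket (z + emb σ y) ≤ 2 * (bracket z * bracket y) := by
  rw [← bracket_emb hσ]; exact bracket_add_le _ _

/-- The weight at a point of an affine subspace. -/
lemma weight_slice_le (hσ : Function.Injective σ) (z : EuclideanSpace ℝ ι) (μ : ℝ) (y : Config n)
    (M : ℕ) : (bracket (z + emb σ y) * bracket μ) ^ M ≤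
      (2 * (bracket z * bracket μ)) ^ M * bracket y ^ M := by
  have h1 := bracket_add_emb_le hσ z y
  have h2 := bracket_pos μ
  have h3 := bracket_pos (z + emb σ y)
  rw [← mul_pow]
  refine pow_le_pow_left₀ (by positivity) ?_ M
  calc bracket (z + emb σ y) * bracket μ ≤ 2 * (bracket z * bracket y) * bracket μ := by gcongr
    _ = _ := by ring

variable (p : EuclideanSpace ℝ ι × ℝ)

/-- Points of the half space close to `p`, but different from `p`. -/
abbrev Near (p : EuclideanSpace ℝ ι × ℝ) : Type _ :=
  {q : EuclideanSpace ℝ ι × ℝ // 0 ≤ q.2 ∧ 0 < ‖q - p‖ ∧ ‖q - p‖ ≤ 1}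

lemma tempFam_slice (hσ : Function.Injective σ) (ha : Temp M a) :
    TempFam M (fun (t : Near p) => slice σ a t) := by
  refine tempFam_of_commute (σ := σ) (fun a (t : Near p) => slice σ a t)
    (fun a ha t => ha.smooth.contDiff_slice σ t.2.1)
    (fun a ha t i => cderiv_slice ha.smooth σ t.2.1 i) (fun a ha => ?_) ha
  obtain ⟨C, hC0, hC⟩ := ha.bound []
  refine ⟨C * (32 * (bracket p.1 * bracket p.2)) ^ M, fun t y => ?_⟩
  refine (hC _ _ t.2.1).trans ?_
  rw [mul_assoc]
  refine mul_le_mul_of_nonneg_left ((weight_slice_le hσ _ _ y M).trans ?_) hC0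
  have h1 := bracket_mul_bracket_le ((norm_fst_le (t.1 - p)).trans t.2.2.2)
    ((norm_snd_le (t.1 - p)).trans t.2.2.2)
  have h2 := bracket_pos t.1.1
  have h3 := bracket_pos t.1.2
  have h4 := bracket_pos y
  gcongr ?_ ^ M * _
  linarith

lemma tempFam_slice_sub (hσ : Function.Injective σ) (hp : 0 ≤ p.2) (ha : Temp M a) :
    TempFam M (fun (t : Near p) y =>
      ((‖t.1 - p‖⁻¹ : ℝ) : ℂ) * (slice σ a t y - slice σ a p y)) := by
  refine tempFam_of_commute (σ := σ) (fun a (t : Near p) y =>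
      ((‖t.1 - p‖⁻¹ : ℝ) : ℂ) * (slice σ a t y - slice σ a p y))
    (fun a ha t => contDiff_const.mul ((ha.smooth.contDiff_slice σ t.2.1).sub
      (ha.smooth.contDiff_slice σ hp)))
    (fun a ha t i => ?_) (fun a ha => ?_) ha
  · rw [cderiv_const_mul ((ha.smooth.contDiff_slice σ t.2.1).sub (ha.smooth.contDiff_slice σ hp)),
      cderiv_sub (ha.smooth.contDiff_slice σ t.2.1) (ha.smooth.contDiff_slice σ hp),
      cderiv_slice ha.smooth σ t.2.1, cderiv_slice ha.smooth σ hp]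
  · obtain ⟨C, hC0, hC⟩ := ha.exists_norm_sub_le
    refine ⟨C * (2 * (bracket p.1 * bracket p.2)) ^ M, fun t y => ?_⟩
    have h1 := hC (p.1 + emb σ y, p.2) (t.1.1 + emb σ y, t.1.2) hp t.2.1
    have h0 : (t.1.1 + emb σ y, t.1.2) - (p.1 + emb σ y, p.2) = t.1 - p := by
      refine Prod.ext ?_ ?_ <;> simp
    rw [h0] at h1
    have h2 := h1 t.2.2.2
    rw [norm_mul, Complex.norm_real, norm_inv, norm_norm, inv_mul_le_iff₀ t.2.2.1]
    refine h2.trans ?_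
    rw [mul_comm _ ‖t.1 - p‖]
    refine mul_le_mul_of_nonneg_left ?_ (norm_nonneg _)
    rw [mul_assoc]
    exact mul_le_mul_of_nonneg_left (weight_slice_le hσ _ _ y M) hC0

lemma tempFam_slice_deriv (hσ : Function.Injective σ) (hp : 0 ≤ p.2) (ha : Temp M a) :
    TempFam M (fun (t : Near p) y => ((‖t.1 - p‖⁻¹ : ℝ) : ℂ) *
      ∑ o, (hcoord o (t.1 - p) : ℂ) * slice σ (hderiv o a) p y) := by
  have hs : ∀ a, Temp M a → ∀ o, ContDiff ℝ ∞ (slice σ (hderiv o a) p) := fun a ha o =>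
    (ha.hderiv o).smooth.contDiff_slice σ hp
  refine tempFam_of_commute (σ := σ) (fun a (t : Near p) y => ((‖t.1 - p‖⁻¹ : ℝ) : ℂ) *
      ∑ o, (hcoord o (t.1 - p) : ℂ) * slice σ (hderiv o a) p y)
    (fun a ha t => contDiff_const.mul (ContDiff.sum fun o _ => contDiff_const.mul (hs a ha o)))
    (fun a ha t i => ?_) (fun a ha => ?_) ha
  · rw [cderiv_const_mul (ContDiff.sum fun o _ => contDiff_const.mul (hs a ha o)),
      cderiv_sum _ (fun o => contDiff_const.mul (hs a ha o))]
    funext y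
    congr 1
    refine Finset.sum_congr rfl fun o _ => ?_
    rw [cderiv_const_mul (hs a ha o), cderiv_slice (ha.hderiv o).smooth σ hp]
    exact congrArg _ (hderiv_comm ha.smooth _ _ _ _ hp)
  · choose C hC0 hC using fun o => (ha.hderiv o).bound []
    refine ⟨∑ o, C o * (2 * (bracket p.1 * bracket p.2)) ^ M, fun t y => ?_⟩
    rw [norm_mul, Complex.norm_real, norm_inv, norm_norm, inv_mul_le_iff₀ t.2.2.1, Finset.sum_mul,
      Finset.mul_sum]
    refine (norm_sum_le _ _).trans (Finset.sum_le_sum fun o _ => ?_)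
    rw [norm_mul, Complex.norm_real]
    refine mul_le_mul (abs_hcoord_le o _) ((hC o _ _ hp).trans ?_) (norm_nonneg _) (norm_nonneg _)
    rw [mul_assoc]
    exact mul_le_mul_of_nonneg_left (weight_slice_le hσ _ _ y M) (hC0 o)

/-- Uniformity over all nearby points is the purpose: the oscillatory form of a second-order
difference quotient stays bounded as the point approaches `p`, so no limit has to be taken under the
oscillatory integral. -/
lemma tempFam_slice_sub_sub (hσ : Function.Injective σ) (hp : 0 ≤ p.2) (ha : Temp M a) :
    TempFam M (fun (t : Near p) y => (((‖t.1 - p‖ ^ 2)⁻¹ : ℝ) : ℂ) *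
      (slice σ a t y - slice σ a p y -
        ∑ o, (hcoord o (t.1 - p) : ℂ) * slice σ (hderiv o a) p y)) := by
  have hs : ∀ a, Temp M a → ∀ o, ContDiff ℝ ∞ (slice σ (hderiv o a) p) := fun a ha o =>
    (ha.hderiv o).smooth.contDiff_slice σ hp
  have hs1 : ∀ a, Temp M a → ∀ t : Near p, ContDiff ℝ ∞ (fun y => slice σ a t y - slice σ a p y) :=
    fun a ha t => (ha.smooth.contDiff_slice σ t.2.1).sub (ha.smooth.contDiff_slice σ hp)
  have hs2 : ∀ a, Temp M a → ∀ t : Near p, ContDiff ℝ ∞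
      (fun y => ∑ o, (hcoord o (t.1 - p) : ℂ) * slice σ (hderiv o a) p y) :=
    fun a ha t => ContDiff.sum fun o _ => contDiff_const.mul (hs a ha o)
  refine tempFam_of_commute (σ := σ) (fun a (t : Near p) y => (((‖t.1 - p‖ ^ 2)⁻¹ : ℝ) : ℂ) *
      (slice σ a t y - slice σ a p y -
        ∑ o, (hcoord o (t.1 - p) : ℂ) * slice σ (hderiv o a) p y))
    (fun a ha t => contDiff_const.mul ((hs1 a ha t).sub (hs2 a ha t)))
    (fun a ha t i => ?_) (fun a ha => ?_) ha
  · rw [cderiv_const_mul ((hs1 a ha t).sub (hs2 a ha t)), cderiv_sub (hs1 a ha t) (hs2 a ha t),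
      cderiv_sub (ha.smooth.contDiff_slice σ t.2.1) (ha.smooth.contDiff_slice σ hp),
      cderiv_slice ha.smooth σ t.2.1, cderiv_slice ha.smooth σ hp,
      cderiv_sum _ (fun o => contDiff_const.mul (hs a ha o))]
    funext y
    beta_reduce
    refine congrArg (fun x : ℂ => _ * ((_ : ℂ) - x)) (Finset.sum_congr rfl fun o _ => ?_)
    rw [cderiv_const_mul (hs a ha o), cderiv_slice (ha.hderiv o).smooth σ hp]
    exact congrArg _ (hderiv_comm ha.smooth _ _ _ _ hp)
  · obtain ⟨C, hC0, hC⟩ := ha.exists_norm_sub_sub_le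
    refine ⟨C * (2 * (bracket p.1 * bracket p.2)) ^ M, fun t y => ?_⟩
    have h1 := hC (p.1 + emb σ y, p.2) (t.1.1 + emb σ y, t.1.2) hp t.2.1
    have h0 : (t.1.1 + emb σ y, t.1.2) - (p.1 + emb σ y, p.2) = t.1 - p := by
      refine Prod.ext ?_ ?_ <;> simp
    rw [h0] at h1
    have h2 := h1 t.2.2.2
    have h3 := t.2.2.1
    rw [norm_mul, Complex.norm_real, norm_inv, norm_pow, norm_norm, inv_mul_le_iff₀ (by positivity)]
    refine h2.trans ?_
    rw [mul_comm _ (‖t.1 - p‖ ^ 2)]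
    refine mul_le_mul_of_nonneg_left ?_ (by positivity)
    rw [mul_assoc]
    exact mul_le_mul_of_nonneg_left (weight_slice_le hσ _ _ y M) hC0

lemma Temp.tempered_slice (hσ : Function.Injective σ) (hp : 0 ≤ p.2) (ha : Temp M a) :
    Tempered (slice σ a p) := by
  refine ⟨M, tempFam_of_commute (σ := σ) (fun a (_ : Unit) => slice σ a p)
    (fun a ha t => ha.smooth.contDiff_slice σ hp)
    (fun a ha t i => cderiv_slice ha.smooth σ hp i) (fun a ha => ?_) ha⟩
  obtain ⟨C, hC0, hC⟩ := ha.bound []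
  refine ⟨C * (2 * (bracket p.1 * bracket p.2)) ^ M, fun t y => (hC _ _ hp).trans ?_⟩
  rw [mul_assoc]
  exact mul_le_mul_of_nonneg_left (weight_slice_le hσ _ _ y M) hC0

end Slices

/-! ### Smoothness of the Leibniz product. -/

section Leibniz

variable {n : ℕ} {a₁ a₀ : Phase n → ℝ → ℂ} {M M' : ℕ}

lemma phase_add_xi (z : Phase n) (η : Config n) :
    phase (xPart z) (xiPart z + η) = z + emb Sum.inr η := by
  ext i
  rcases i with i | i <;> simp [phase, xPart, xiPart, emb_apply, Pi.single_apply]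

lemma phase_add_x (z : Phase n) (y : Config n) :
    phase (xPart z + y) (xiPart z) = z + emb Sum.inl y := by
  ext i
  rcases i with i | i <;> simp [phase, xPart, xiPart, emb_apply, Pi.single_apply]

lemma leibnizAmplitude_eq (a₁ a₀ : Phase n → ℝ → ℂ) (z : Phase n) (μ : ℝ) :
    leibnizAmplitude (fun z' => a₁ z' μ) (fun z' => a₀ z' μ) z =
      fun y η => slice Sum.inr a₁ (z, μ) η * slice Sum.inl a₀ (z, μ) y := by
  funext y η
  simp only [leibnizAmplitude, slice, phase_add_x, phase_add_xi]

lemma leibnizParam_eq (a₁ a₀ : Phase n → ℝ → ℂ) (z : Phase n) (μ : ℝ) :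
    leibnizParam a₁ a₀ z μ = oscForm (slice Sum.inr a₁ (z, μ)) (slice Sum.inl a₀ (z, μ)) := by
  unfold leibnizParam leibniz oscForm
  rw [leibnizAmplitude_eq]

lemma oscForm_sum_right {κ : Type*} (s : Finset κ) {g : κ → Config n → ℂ} {f : Config n → ℂ}
    (hf : Tempered f) (hg : ∀ i, Tempered (g i)) :
    oscForm f (fun y => ∑ i ∈ s, g i y) = ∑ i ∈ s, oscForm f (g i) := by
  classical
  induction s using Finset.induction_on with
  | empty => simpa using oscForm_const_mul_right hf (tempered_const (n := n) 0) 0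
  | insert a s ha ih =>
    simp only [Finset.sum_insert ha]
    rw [oscForm_add_right hf (hg a) (tempered_sum s hg), ih]

/-- The first derivatives of the product. -/
def leibnizDeriv (o : Option (Fin n ⊕ Fin n)) (a₁ a₀ : Phase n → ℝ → ℂ) (z : Phase n) (μ : ℝ) : ℂ :=
  leibnizParam (hderiv o a₁) a₀ z μ + leibnizParam a₁ (hderiv o a₀) z μ

/-- Let D = |q - p|. Decompose f' = f + D·S + D²·Q and g' = g + D·U = g + (linear part) + D²·V,
where S, Q, U, V are tempered uniformly in q. By bilinearity everything beyond the linear part is D²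
times the sum of the forms of (S, U), (Q, g') and (f, V), and these are bounded. -/
lemma leibnizParam_increment (h₁ : Temp M a₁) (h₀ : Temp M' a₀) (p : Phase n × ℝ) (hp : 0 ≤ p.2) :
    ∃ C : ℝ, ∀ q : Phase n × ℝ, 0 ≤ q.2 → ‖q - p‖ ≤ 1 →
      ‖leibnizParam a₁ a₀ q.1 q.2 - leibnizParam a₁ a₀ p.1 p.2 -
        hform (fun o => leibnizDeriv o a₁ a₀ p.1 p.2) (q - p)‖ ≤ C * ‖q - p‖ ^ 2 := by
  have hr : Function.Injective (Sum.inr : Fin n → Fin n ⊕ Fin n) := Sum.inr_injective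
  have hl : Function.Injective (Sum.inl : Fin n → Fin n ⊕ Fin n) := Sum.inl_injective
  have hf := h₁.tempered_slice p hr hp
  have hg := h₀.tempered_slice p hl hp
  have hfo := fun o => (h₁.hderiv o).tempered_slice p hr hp
  have hgo := fun o => (h₀.hderiv o).tempered_slice p hl hp
  have hg' := tempFam_slice p hl h₀
  have hQ := tempFam_slice_sub_sub p hr hp h₁
  have hS := tempFam_slice_deriv p hr hp h₁
  have hU := tempFam_slice_sub p hl hp h₀
  have hV := tempFam_slice_sub_sub p hl hp h₀
  have hF : TempFam hf.choose (fun (_ : Near p) => slice Sum.inr a₁ p) :=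
    ⟨fun _ => hf.contDiff, fun l => (hf.choose_spec.bound l).imp fun C hC _ y => hC () y⟩
  obtain ⟨C1, hC1⟩ := exists_norm_oscForm_le hS hU
  obtain ⟨C2, hC2⟩ := exists_norm_oscForm_le hQ hg'
  obtain ⟨C3, hC3⟩ := exists_norm_oscForm_le hF hV
  refine ⟨C1 + C2 + C3, fun q hq hqp => ?_⟩
  rcases eq_or_ne q p with rfl | hne
  · simp
  have hD : 0 < ‖q - p‖ := norm_pos_iff.2 (sub_ne_zero.2 hne)
  set t : Near p := ⟨q, hq, hD, hqp⟩
  have hQt := hQ.tempered t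
  have hSt := hS.tempered t
  have hUt := hU.tempered t
  have hVt := hV.tempered t
  have hg't := hg'.tempered t
  have e1 := hC1 t
  have e2 := hC2 t
  have e3 := hC3 t
  simp only [show (t : Phase n × ℝ) = q from rfl] at hQt hSt hUt hVt hg't e1 e2 e3
  simp only [leibnizParam_eq, leibnizDeriv, hform_apply]
  set D : ℂ := ((‖q - p‖ : ℝ) : ℂ) with hDdef
  have hD0 : D ≠ 0 := Complex.ofReal_ne_zero.2 hD.ne'
  set f := slice Sum.inr a₁ p
  set g := slice Sum.inl a₀ p
  set f' := slice Sum.inr a₁ q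
  set g' := slice Sum.inl a₀ q
  set Q := fun y => (((‖q - p‖ ^ 2)⁻¹ : ℝ) : ℂ) *
      (f' y - f y - ∑ o, (hcoord o (q - p) : ℂ) * slice Sum.inr (hderiv o a₁) p y)
  set S := fun y => ((‖q - p‖⁻¹ : ℝ) : ℂ) *
      ∑ o, (hcoord o (q - p) : ℂ) * slice Sum.inr (hderiv o a₁) p y
  set U := fun y => ((‖q - p‖⁻¹ : ℝ) : ℂ) * (g' y - g y)
  set V := fun y => (((‖q - p‖ ^ 2)⁻¹ : ℝ) : ℂ) *
      (g' y - g y - ∑ o, (hcoord o (q - p) : ℂ) * slice Sum.inl (hderiv o a₀) p y)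
  have k1 : f' = fun y => (f y + D * S y) + D ^ 2 * Q y := by
    funext y
    simp only [Q, S, Complex.ofReal_inv, Complex.ofReal_pow, ← hDdef]
    field_simp; ring
  have k2 : g' = fun y => g y + D * U y := by
    funext y
    simp only [U, Complex.ofReal_inv, ← hDdef]
    field_simp; ring
  have k3 : g' = fun y => (g y + ∑ o, (hcoord o (q - p) : ℂ) * slice Sum.inl (hderiv o a₀) p y) +
      D ^ 2 * V y := by
    funext y
    simp only [V, Complex.ofReal_inv, Complex.ofReal_pow, ← hDdef]
    field_simp; ring
  have k4 : (fun y => D * S y) =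
      fun y => ∑ o, (hcoord o (q - p) : ℂ) * slice Sum.inr (hderiv o a₁) p y := by
    funext y
    simp only [S, Complex.ofReal_inv, ← hDdef]
    field_simp
  have b1 : oscForm f' g' = oscForm f g' + D * oscForm S g' + D ^ 2 * oscForm Q g' := by
    rw [k1, oscForm_add_left (hf.add (hSt.const_mul D)) (hQt.const_mul _) hg't,
      oscForm_add_left hf (hSt.const_mul D) hg't, oscForm_const_mul_left hSt hg't,
      oscForm_const_mul_left hQt hg't]
  have b2 : oscForm S g' = oscForm S g + D * oscForm S U := by
    rw [k2, oscForm_add_right hSt hg (hUt.const_mul D), oscForm_const_mul_right hSt hUt]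
  have b3 : oscForm f g' = oscForm f g +
      ∑ o, (hcoord o (q - p) : ℂ) * oscForm f (slice Sum.inl (hderiv o a₀) p) +
      D ^ 2 * oscForm f V := by
    rw [k3, oscForm_add_right hf (hg.add (tempered_sum _ fun o => (hgo o).const_mul _))
      (hVt.const_mul _), oscForm_add_right hf hg (tempered_sum _ fun o => (hgo o).const_mul _),
      oscForm_sum_right _ hf (fun o => (hgo o).const_mul _), oscForm_const_mul_right hf hVt]
    congr 2
    exact Finset.sum_congr rfl fun o _ => oscForm_const_mul_right hf (hgo o) _
  have b4 : D * oscForm S g =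
      ∑ o, (hcoord o (q - p) : ℂ) * oscForm (slice Sum.inr (hderiv o a₁) p) g := by
    rw [← oscForm_const_mul_left hSt hg, k4, oscForm_sum_left _ (fun o => (hfo o).const_mul _) hg]
    exact Finset.sum_congr rfl fun o _ => oscForm_const_mul_left (hfo o) hg _
  have b5 : oscForm f' g' - oscForm f g - ∑ o, (hcoord o (q - p) : ℂ) *
      (oscForm (slice Sum.inr (hderiv o a₁) p) g + oscForm f (slice Sum.inl (hderiv o a₀) p)) =
      D ^ 2 * (oscForm S U + oscForm Q g' + oscForm f V) := by
    simp only [mul_add, Finset.sum_add_distrib, b1, b2, b3, ← b4]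
    ring
  refine (congrArg norm b5).trans_le ?_
  rw [norm_mul, norm_pow, hDdef, Complex.norm_real, norm_norm, mul_comm]
  refine mul_le_mul_of_nonneg_right ?_ (by positivity)
  exact (norm_add₃_le).trans (by linarith)

lemma hasFDerivWithinAt_leibnizParam (h₁ : Temp M a₁) (h₀ : Temp M' a₀) (p : Phase n × ℝ)
    (hp : 0 ≤ p.2) : HasFDerivWithinAt (fun p : Phase n × ℝ => leibnizParam a₁ a₀ p.1 p.2)
      (hform fun o => leibnizDeriv o a₁ a₀ p.1 p.2) (halfSpace (Fin n ⊕ Fin n)) p := by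
  obtain ⟨C, hC⟩ := leibnizParam_increment h₁ h₀ p hp
  rw [hasFDerivWithinAt_iff_isLittleO]
  have h1 : (fun q : Phase n × ℝ => leibnizParam a₁ a₀ q.1 q.2 - leibnizParam a₁ a₀ p.1 p.2 -
        hform (fun o => leibnizDeriv o a₁ a₀ p.1 p.2) (q - p)) =O[𝓝[halfSpace (Fin n ⊕ Fin n)] p]
      fun q => ‖q - p‖ ^ 2 := by
    refine Asymptotics.IsBigO.of_bound C ?_
    have h2 : ∀ᶠ q in 𝓝[halfSpace (Fin n ⊕ Fin n)] p, q ∈ Metric.closedBall p 1 :=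
      nhdsWithin_le_nhds (Metric.closedBall_mem_nhds p one_pos)
    filter_upwards [h2, self_mem_nhdsWithin] with q hq hq'
    rw [norm_pow, norm_norm]
    exact hC q hq'.2 (by simpa [dist_eq_norm] using hq)
  refine h1.trans_isLittleO ?_
  have h3 : Tendsto (fun q : Phase n × ℝ => q - p) (𝓝[halfSpace (Fin n ⊕ Fin n)] p) (𝓝 0) := by
    refine Tendsto.mono_left ?_ nhdsWithin_le_nhds
    have : Tendsto (fun q : Phase n × ℝ => q - p) (𝓝 p) (𝓝 (p - p)) :=
      (continuous_id.sub continuous_const).tendsto p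
    rwa [sub_self] at this
  exact (Asymptotics.isLittleO_norm_pow_id (one_lt_two)).comp_tendsto h3

lemma hderiv_leibnizParam (h₁ : Temp M a₁) (h₀ : Temp M' a₀) (o : Option (Fin n ⊕ Fin n)) :
    EqHalf (hderiv o (leibnizParam a₁ a₀)) (leibnizDeriv o a₁ a₀) := by
  intro z μ hμ
  rw [hderiv_eq_of_hasFDerivWithinAt hμ (hasFDerivWithinAt_leibnizParam h₁ h₀ (z, μ) hμ),
    hform_apply, Finset.sum_eq_single o]
  · cases o <;> simp [hcoord, hdir]
  · intro o' _ ho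
    rcases o with _ | i <;> rcases o' with _ | i'
    · exact absurd rfl ho
    · simp [hcoord, hdir]
    · simp [hcoord, hdir]
    · have : i' ≠ i := fun h => ho (by rw [h])
      simp [hcoord, hdir, this]
  · simp

/-- The derivative of a product is built from products in which one factor is replaced by a
derivative. These are again products of temperate functions of the same orders, so each derivative
is as regular as the product and induction applies. -/
lemma smooth_leibnizParam (h₁ : Temp M a₁) (h₀ : Temp M' a₀) : Smooth (leibnizParam a₁ a₀) := by
  suffices h : ∀ k : ℕ, ∀ a₁ a₀ : Phase n → ℝ → ℂ, Temp M a₁ → Temp M' a₀ →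
      ContDiffOn ℝ k (fun p : Phase n × ℝ => leibnizParam a₁ a₀ p.1 p.2)
        (halfSpace (Fin n ⊕ Fin n)) from
    contDiffOn_infty.2 fun k => h k a₁ a₀ h₁ h₀
  intro k
  induction k with
  | zero =>
    intro a₁ a₀ h₁ h₀
    exact contDiffOn_zero.2 fun p hp =>
      (hasFDerivWithinAt_leibnizParam h₁ h₀ p hp.2).continuousWithinAt
  | succ k ih =>
    intro a₁ a₀ h₁ h₀
    rw [show ((k + 1 : ℕ) : WithTop ℕ∞) = (k : WithTop ℕ∞) + 1 by norm_cast,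
      contDiffOn_succ_iff_fderivWithin uniqueDiffOn_halfSpace]
    refine ⟨fun p hp => (hasFDerivWithinAt_leibnizParam h₁ h₀ p hp.2).differentiableWithinAt,
      by simp, ?_⟩
    have : ContDiffOn ℝ k (fun p : Phase n × ℝ => hform fun o => leibnizDeriv o a₁ a₀ p.1 p.2)
        (halfSpace (Fin n ⊕ Fin n)) := by
      unfold hform
      refine ContDiffOn.sum fun o _ => ?_
      refine contDiffOn_const.smulRight ?_
      exact (ih _ _ (h₁.hderiv o) h₀).add (ih _ _ h₁ (h₀.hderiv o))
    exact this.congr fun p hp =>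
      (hasFDerivWithinAt_leibnizParam h₁ h₀ p hp.2).fderivWithin (uniqueDiffOn_halfSpace p hp)

end Leibniz

/-! ### Temperate weights. -/

section Temperate

variable {ι : Type*} [Fintype ι] [DecidableEq ι] {ρ σ σ' : EuclideanSpace ℝ ι → ℝ → ℝ}
  {a : EuclideanSpace ℝ ι → ℝ → ℂ}

/-- Positive weights of moderate variation in `z` and polynomial growth in `μ`. -/
structure Temperate (σ : EuclideanSpace ℝ ι → ℝ → ℝ) : Prop where
  pos : ∀ z μ, 0 < σ z μ
  peetre : ∃ (C : ℝ) (M : ℕ), 0 ≤ C ∧ ∀ z h μ, σ (z + h) μ ≤ C * (σ z μ * bracket h ^ M)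
  growth : ∃ (C : ℝ) (M : ℕ), 0 ≤ C ∧ ∀ μ, σ 0 μ ≤ C * bracket μ ^ M

lemma Temperate.mul (h : Temperate σ) (h' : Temperate σ') :
    Temperate (fun z μ => σ z μ * σ' z μ) := by
  refine ⟨fun z μ => mul_pos (h.pos z μ) (h'.pos z μ), ?_, ?_⟩
  · obtain ⟨C, M, hC0, hC⟩ := h.peetre
    obtain ⟨C', M', hC0', hC'⟩ := h'.peetre
    refine ⟨C * C', M + M', by positivity, fun z k μ => ?_⟩
    refine (mul_le_mul (hC z k μ) (hC' z k μ) (h'.pos _ _).le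
      ((h.pos _ _).le.trans (hC z k μ))).trans_eq ?_
    ring
  · obtain ⟨C, M, hC0, hC⟩ := h.growth
    obtain ⟨C', M', hC0', hC'⟩ := h'.growth
    refine ⟨C * C', M + M', by positivity, fun μ => ?_⟩
    refine (mul_le_mul (hC μ) (hC' μ) (h'.pos _ _).le ((h.pos _ _).le.trans (hC μ))).trans_eq ?_
    ring

/-- Comparability is assumed in both directions because `s` may have either sign. -/
lemma rpow_le_of_ratio {x y K : ℝ} (hx : 0 < x) (hy : 0 < y) (hK : 1 ≤ K) (h : x ≤ K * y)
    (h' : y ≤ K * x) (s : ℝ) : x ^ s ≤ K ^ |s| * y ^ s := by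
  have hK0 : 0 < K := one_pos.trans_le hK
  rcases le_or_gt 0 s with hs | hs
  · rw [abs_of_nonneg hs, ← Real.mul_rpow hK0.le hy.le]
    exact Real.rpow_le_rpow hx.le h hs
  · have h1 : (K * x) ^ s ≤ y ^ s := Real.rpow_le_rpow_of_nonpos hy h' hs.le
    rw [Real.mul_rpow hK0.le hx.le] at h1
    rw [abs_of_neg hs, Real.rpow_neg hK0.le]
    rwa [inv_mul_eq_div, le_div_iff₀ (Real.rpow_pos_of_pos hK0 s), mul_comm]

lemma Temperate.rpow (h : Temperate σ) (h1 : ∀ z μ, 1 ≤ σ z μ) (s : ℝ) :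
    Temperate (fun z μ => σ z μ ^ s) := by
  refine ⟨fun z μ => Real.rpow_pos_of_pos (h.pos z μ) s, ?_, ?_⟩
  · obtain ⟨C, M, hC0, hC⟩ := h.peetre
    refine ⟨(C + 1) ^ |s|, M * ⌈|s|⌉₊, by positivity, fun z k μ => ?_⟩
    have hb := one_le_bracket k
    have hb' := one_le_pow₀ hb (n := M)
    have hK : 1 ≤ (C + 1) * bracket k ^ M := one_le_mul_of_one_le_of_one_le (by linarith) hb'
    have hσ := h.pos z μ
    have hσ' := h.pos (z + k) μ
    have e1 : σ (z + k) μ ≤ ((C + 1) * bracket k ^ M) * σ z μ := by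
      refine (hC z k μ).trans ?_
      nlinarith [mul_pos hσ (one_pos.trans_le hb')]
    have e2 : σ z μ ≤ ((C + 1) * bracket k ^ M) * σ (z + k) μ := by
      have := hC (z + k) (-k) μ
      rw [add_neg_cancel_right, show bracket (-k) = bracket k by simp [bracket]] at this
      nlinarith [mul_pos hσ' (one_pos.trans_le hb')]
    refine (rpow_le_of_ratio hσ' hσ hK e1 e2 s).trans ?_
    have : (bracket k ^ M) ^ |s| ≤ bracket k ^ (M * ⌈|s|⌉₊) := by
      rw [pow_mul, ← Real.rpow_natCast _ ⌈|s|⌉₊]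
      exact Real.rpow_le_rpow_of_exponent_le hb' (Nat.le_ceil _)
    rw [Real.mul_rpow (by positivity) (by positivity), mul_assoc, mul_comm (σ z μ ^ s)]
    have := Real.rpow_pos_of_pos hσ s
    gcongr
  · obtain ⟨C, M, hC0, hC⟩ := h.growth
    refine ⟨(C + 1) ^ |s|, M * ⌈|s|⌉₊, by positivity, fun μ => ?_⟩
    have hb' := one_le_pow₀ (one_le_bracket μ) (n := M)
    have h2 : σ 0 μ ^ s ≤ σ 0 μ ^ |s| := Real.rpow_le_rpow_of_exponent_le (h1 0 μ) (le_abs_self s)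
    have h3 : σ 0 μ ≤ (C + 1) * bracket μ ^ M := (hC μ).trans (by nlinarith)
    refine h2.trans ((Real.rpow_le_rpow (h.pos 0 μ).le h3 (abs_nonneg s)).trans ?_)
    rw [Real.mul_rpow (by positivity) (by positivity), pow_mul, ← Real.rpow_natCast _ ⌈|s|⌉₊]
    gcongr
    exact Nat.le_ceil _

lemma temperate_bracket : Temperate (fun (z : EuclideanSpace ℝ ι) (_ : ℝ) => bracket z) := by
  refine ⟨fun z _ => bracket_pos z, ⟨2, 1, by norm_num, fun z h _ => ?_⟩,
    ⟨1, 0, by norm_num, fun μ => ?_⟩⟩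
  · rw [pow_one]; exact bracket_add_le z h
  · simp [bracket_zero]

lemma one_le_jp (z : EuclideanSpace ℝ ι) (μ : ℝ) : 1 ≤ jp z μ :=
  Real.one_le_sqrt.2 (by nlinarith [sq_nonneg ‖z‖, sq_nonneg μ])

lemma one_le_jm (z : EuclideanSpace ℝ ι) (μ : ℝ) : 1 ≤ jm z μ := one_le_bracket μ

lemma jp_sq (z : EuclideanSpace ℝ ι) (μ : ℝ) : jp z μ ^ 2 = 1 + ‖z‖ ^ 2 + μ ^ 2 :=
  Real.sq_sqrt (by positivity)

lemma temperate_jp : Temperate (jp : EuclideanSpace ℝ ι → ℝ → ℝ) := by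
  refine ⟨jp_pos, ⟨2, 1, by norm_num, fun z h μ => ?_⟩, ⟨1, 1, by norm_num, fun μ => ?_⟩⟩
  · have h1 := norm_add_le z h
    have h2 := jp_sq (z + h) μ
    have h3 := jp_sq z μ
    have h4 := bracket_sq h
    have h5 := jp_pos z μ
    have h6 := bracket_pos h
    rw [pow_one]
    refine abs_le_of_sq_le_sq' ?_ (by positivity) |>.2
    rw [mul_pow, mul_pow, h2, h3, h4]
    have h7 : ‖z + h‖ ^ 2 ≤ (‖z‖ + ‖h‖) ^ 2 := pow_le_pow_left₀ (norm_nonneg _) h1 2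
    nlinarith [sq_nonneg (‖z‖ - ‖h‖), sq_nonneg ‖z‖, sq_nonneg ‖h‖, sq_nonneg μ,
      mul_nonneg (sq_nonneg ‖z‖) (sq_nonneg ‖h‖), mul_nonneg (sq_nonneg μ) (sq_nonneg ‖h‖)]
  · simp [bracketParam, bracket]

lemma temperate_jm : Temperate (jm : EuclideanSpace ℝ ι → ℝ → ℝ) := by
  refine ⟨jm_pos, ⟨1, 0, by norm_num, fun z h μ => ?_⟩, ⟨1, 1, by norm_num, fun μ => ?_⟩⟩
  · simp [jm]
  · simp [jm]

lemma temperate_wReg (d ν : ℝ) : Temperate (wReg (ι := ι) d ν) :=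
  (temperate_bracket.rpow (fun z _ => one_le_bracket z) ν).mul (temperate_jp.rpow one_le_jp (d - ν))

lemma temperate_wTen (m s : ℝ) : Temperate (wTen (ι := ι) m s) :=
  (temperate_bracket.rpow (fun z _ => one_le_bracket z) m).mul (temperate_jm.rpow one_le_jm s)

lemma temperate_wfac (hρ : Temperate ρ) (h1 : ∀ z μ, 1 ≤ ρ z μ) (o : Option ι) :
    Temperate (wfac ρ o) := by
  cases o with
  | none => simpa only [wfac, Real.rpow_neg_one] using hρ.rpow h1 (-1)
  | some i =>
    simpa only [wfac, Real.rpow_neg_one] using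
      temperate_bracket.rpow (fun z _ => one_le_bracket z) (-1)

lemma wfacs_le_one (h1 : ∀ z μ, 1 ≤ ρ z μ) (l : List (Option ι)) (z : EuclideanSpace ℝ ι) (μ : ℝ) :
    wfacs ρ l z μ ≤ 1 := by
  induction l with
  | nil => simp
  | cons o l ih =>
    have hρ : ∀ z μ, 0 < ρ z μ := fun z μ => one_pos.trans_le (h1 z μ)
    rw [wfacs_cons]
    refine mul_le_one₀ ?_ (wfacs_pos hρ l z μ).le ih
    cases o with
    | none => exact inv_le_one_of_one_le₀ (h1 z μ)
    | some i => exact inv_le_one_of_one_le₀ (one_le_bracket z)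

lemma Sym.temp (ha : Sym ρ σ Set.univ a) (h1 : ∀ z μ, 1 ≤ ρ z μ) (hσ : Temperate σ) :
    ∃ M, Temp M a := by
  obtain ⟨C, M, hC0, hC⟩ := hσ.peetre
  obtain ⟨C', M', hC0', hC'⟩ := hσ.growth
  refine ⟨M' + M, ha.smooth, fun l => ?_⟩
  obtain ⟨K, hK⟩ := ha.bound l
  refine ⟨|K| * (C * C'), by positivity, fun z μ hμ => (hK z μ hμ trivial).trans ?_⟩
  have hρ : ∀ z μ, 0 < ρ z μ := fun z μ => one_pos.trans_le (h1 z μ)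
  have e1 := wfacs_pos hρ l z μ
  have e2 := wfacs_le_one h1 l z μ
  have e3 := hσ.pos z μ
  have e4 := one_le_bracket z
  have e5 := one_le_bracket μ
  have e6 : σ z μ ≤ C * C' * (bracket z * bracket μ) ^ (M' + M) := by
    have h := hC 0 z μ
    rw [zero_add] at h
    calc σ z μ ≤ C * (σ 0 μ * bracket z ^ M) := h
      _ ≤ C * ((C' * bracket μ ^ M') * bracket z ^ M) := by gcongr; exact hC' μ
      _ = C * C' * (1 * bracket z ^ M * (bracket μ ^ M' * 1)) := by ring
      _ ≤ C * C' * (bracket z ^ M' * bracket z ^ M * (bracket μ ^ M' * bracket μ ^ M)) := by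
          gcongr
          · exact one_le_pow₀ e4
          · exact one_le_pow₀ e5
      _ = _ := by ring
  calc K * (σ z μ * wfacs ρ l z μ) ≤ |K| * (σ z μ * 1) := by
        refine mul_le_mul (le_abs_self K) ?_ (by positivity) (abs_nonneg K)
        gcongr
    _ ≤ |K| * (C * C' * (bracket z * bracket μ) ^ (M' + M)) := by rw [mul_one]; gcongr
    _ = _ := by ring

lemma wfacs_map_some (l : List ι) (z : EuclideanSpace ℝ ι) (μ : ℝ) :
    wfacs ρ (l.map some) z μ = (bracket z)⁻¹ ^ l.length := by
  simpa using wfacs_replicate_append (ρ := ρ) 0 l z μ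

/-- Peetre's inequality is used twice: for the weight `σ`, and as ⟨z + y⟩⁻¹ ≤ 2⟨z⟩⁻¹⟨y⟩ for the gain
of a derivative. Only j of the gained factors are moved to z; the others are estimated by 1. The
constants do not depend on the base point (z, μ). -/
lemma Sym.scaleFam {n : ℕ} {s : Fin n → ι} (hs : Function.Injective s)
    (ha : Sym ρ σ Set.univ a) (hσ : Temperate σ) : ∃ M : ℝ, 0 ≤ M ∧
    ScaleFam (fun p : {p : EuclideanSpace ℝ ι × ℝ // 0 ≤ p.2} => σ p.1.1 p.1.2)
      (fun p => (bracket p.1.1)⁻¹) M (fun p => Shubin.slice s a p.1) := by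
  obtain ⟨C, M, hC0, hC⟩ := hσ.peetre
  refine ⟨M, by positivity, fun p => ha.smooth.contDiff_slice s p.2, fun l j hj => ?_⟩
  obtain ⟨K, hK⟩ := ha.bound ((l.map s).map some)
  refine ⟨|K| * (C * 2 ^ j), by positivity, fun p y => ?_⟩
  rw [pd_slice ha.smooth s p.2]
  refine (hK (p.1.1 + emb s y) p.1.2 p.2 trivial).trans ?_
  rw [wfacs_map_some, List.length_map]
  set z := p.1.1
  have hz := bracket_pos z
  have hy := bracket_pos y
  have hzy := one_le_bracket (z + emb s y)
  have hzy0 := bracket_pos (z + emb s y)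
  have hσ0 := hσ.pos z p.1.2
  have hσ1 := hσ.pos (z + emb s y) p.1.2
  have e1 : (bracket (z + emb s y))⁻¹ ^ l.length ≤ (bracket (z + emb s y))⁻¹ ^ j :=
    pow_le_pow_of_le_one (by positivity) (inv_le_one_of_one_le₀ hzy) hj
  have e2 : (bracket (z + emb s y))⁻¹ ≤ 2 * ((bracket z)⁻¹ * bracket y) := by
    have := bracket_le_add z (emb s y)
    rw [bracket_emb hs] at this
    rw [inv_le_iff_one_le_mul₀ hzy0]
    have h3 : bracket (z + emb s y) * (2 * ((bracket z)⁻¹ * bracket y)) =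
      (2 * (bracket (z + emb s y) * bracket y)) / bracket z := by field_simp
    rw [mul_comm, h3, le_div_iff₀ hz]
    linarith
  have e3 := hC z (emb s y) p.1.2
  rw [bracket_emb hs] at e3
  calc K * (σ (z + emb s y) p.1.2 * (bracket (z + emb s y))⁻¹ ^ l.length)
      ≤ |K| * ((C * (σ z p.1.2 * bracket y ^ M)) * (2 * ((bracket z)⁻¹ * bracket y)) ^ j) := by
        refine mul_le_mul (le_abs_self K) ?_ (by positivity) (abs_nonneg K)
        refine mul_le_mul e3 (e1.trans ?_) (by positivity) (by positivity)
        exact pow_le_pow_left₀ (by positivity) e2 j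
    _ = _ := by
        rw [Real.rpow_add hy, Real.rpow_natCast, Real.rpow_natCast]
        ring

end Temperate

/-! ### Symbol estimates for the remainder of the product. -/

section Remainder

variable {n : ℕ} {a₁ a₀ : Phase n → ℝ → ℂ} {M M' : ℕ}
  {ρ σ₁ σ₀ : Phase n → ℝ → ℝ}

lemma hderiv_sum {ι : Type*} [Fintype ι] [DecidableEq ι] {κ : Type*} (s : Finset κ)
    {f : κ → EuclideanSpace ℝ ι → ℝ → ℂ} (hf : ∀ k, Smooth (f k)) (o : Option ι) :
    Smooth (fun z μ => ∑ k ∈ s, f k z μ) ∧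
    EqHalf (hderiv o fun z μ => ∑ k ∈ s, f k z μ) (fun z μ => ∑ k ∈ s, hderiv o (f k) z μ) := by
  classical
  induction s using Finset.induction_on with
  | empty =>
    simp only [Finset.sum_empty]
    exact ⟨smooth_const 0, hd_zero [o]⟩
  | insert k s hk ih =>
    simp only [Finset.sum_insert hk]
    refine ⟨(hf k).add ih.1, (hderiv_add (hf k) ih.1 o).trans fun z μ hμ => ?_⟩
    beta_reduce
    rw [ih.2 z μ hμ]

/-- The remainder of the asymptotic expansion of the product. -/
def leibnizRem (N : ℕ) (a₁ a₀ : Phase n → ℝ → ℂ) (z : Phase n) (μ : ℝ) : ℂ :=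
  leibnizParam a₁ a₀ z μ - leibnizSum N a₁ a₀ z μ

lemma leibnizSum_eq (N : ℕ) (a₁ a₀ : Phase n → ℝ → ℂ) :
    leibnizSum N a₁ a₀ = fun z μ => ∑ k ∈ Finset.range N,
      ∑ α ∈ Finset.piAntidiag (Finset.univ : Finset (Fin n)) k,
        ((∏ i, (α i).factorial : ℕ) : ℂ)⁻¹ * (hd ((dirList Sum.inr α).map some) a₁ z μ *
          ((-Complex.I) ^ (∑ i, α i) * hd ((dirList Sum.inl α).map some) a₀ z μ)) := by
  funext z μ
  simp only [leibnizSum, partialXi, dX, multiDeriv_eq_pd, hd_map_some]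

lemma map_dirList {ι : Type*} (s : Fin n → ι) (α : Fin n → ℕ) :
    (dirList id α).map s = dirList s α := by
  simp [dirList, List.map_flatMap]

lemma pd_dirList_slice {ι : Type*} [Fintype ι] [DecidableEq ι] {a : EuclideanSpace ℝ ι → ℝ → ℂ}
    (ha : Smooth a) (s : Fin n → ι) {z : EuclideanSpace ℝ ι}
    {μ : ℝ} (hμ : 0 ≤ μ) (α : Fin n → ℕ) :
    pd (dirList id α) (slice s a (z, μ)) 0 = hd ((dirList s α).map some) a z μ := by
  rw [pd_slice ha s hμ, map_dirList]
  simp [slice]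

lemma leibnizRem_eq (h₁ : Smooth a₁) (h₀ : Smooth a₀) (N : ℕ) {z : Phase n} {μ : ℝ} (hμ : 0 ≤ μ) :
    leibnizRem N a₁ a₀ z μ =
      oscRem N (slice Sum.inr a₁ (z, μ)) (slice Sum.inl a₀ (z, μ)) := by
  simp only [leibnizRem, oscRem, leibnizParam_eq, leibnizSum_eq, taylorTerm,
    pd_dirList_slice h₁ Sum.inr hμ, pd_dirList_slice h₀ Sum.inl hμ]

lemma hd_hderiv {ι : Type*} [Fintype ι] [DecidableEq ι] {a : EuclideanSpace ℝ ι → ℝ → ℂ}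
    (ha : Smooth a) (l : List (Option ι)) (o : Option ι) :
    EqHalf (hderiv o (hd l a)) (hd l (hderiv o a)) := by
  have h1 : hderiv o (hd l a) = hd (l ++ [o]) a := by rw [hd_append]; rfl
  rw [h1, ← hd_cons]
  exact hd_perm ha (List.perm_append_singleton o l)

lemma hderiv_leibnizSum (h₁ : Smooth a₁) (h₀ : Smooth a₀) (N : ℕ) (o : Option (Fin n ⊕ Fin n)) :
    Smooth (leibnizSum N a₁ a₀) ∧ EqHalf (hderiv o (leibnizSum N a₁ a₀)) (fun z μ =>
      leibnizSum N (hderiv o a₁) a₀ z μ + leibnizSum N a₁ (hderiv o a₀) z μ) := by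
  simp only [leibnizSum_eq]
  have hs : ∀ α : Fin n → ℕ, Smooth (fun z μ => hd ((dirList Sum.inr α).map some) a₁ z μ *
          ((-Complex.I) ^ (∑ i, α i) * hd ((dirList Sum.inl α).map some) a₀ z μ)) := fun α =>
    (h₁.hd _).mul ((h₀.hd _).const_mul _)
  have h1 : ∀ k, _ := fun k => hderiv_sum (Finset.piAntidiag (Finset.univ : Finset (Fin n)) k)
    (fun α => (hs α).const_mul (((∏ i, (α i).factorial : ℕ) : ℂ)⁻¹)) o
  have h2 := hderiv_sum (Finset.range N) (fun k => (h1 k).1) o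
  refine ⟨h2.1, h2.2.trans fun z μ hμ => ?_⟩
  beta_reduce
  rw [← Finset.sum_add_distrib]
  refine Finset.sum_congr rfl fun k _ => ((h1 k).2 z μ hμ).trans ?_
  rw [← Finset.sum_add_distrib]
  refine Finset.sum_congr rfl fun α _ => ?_
  rw [hderiv_const_mul (hs α) _ o z μ hμ]
  beta_reduce
  rw [hderiv_mul (h₁.hd _) ((h₀.hd _).const_mul _) o z μ hμ]
  beta_reduce
  rw [hderiv_const_mul (h₀.hd _) _ o z μ hμ, hd_hderiv h₁ _ o z μ hμ]
  beta_reduce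
  rw [hd_hderiv h₀ _ o z μ hμ]
  ring

lemma hderiv_leibnizRem (h₁ : Temp M a₁) (h₀ : Temp M' a₀) (N : ℕ) (o : Option (Fin n ⊕ Fin n)) :
    Smooth (leibnizRem N a₁ a₀) ∧ EqHalf (hderiv o (leibnizRem N a₁ a₀)) (fun z μ =>
      leibnizRem N (hderiv o a₁) a₀ z μ + leibnizRem N a₁ (hderiv o a₀) z μ) := by
  have hs := hderiv_leibnizSum h₁.smooth h₀.smooth N o
  have hp := smooth_leibnizParam h₁ h₀
  have e : leibnizRem N a₁ a₀ = fun z μ => leibnizParam a₁ a₀ z μ + (-1) * leibnizSum N a₁ a₀ z μ := by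
    funext z μ; simp [leibnizRem, sub_eq_add_neg]
  rw [e]
  refine ⟨hp.add (hs.1.const_mul _), fun z μ hμ => ?_⟩
  rw [hderiv_add hp (hs.1.const_mul _) o z μ hμ]
  beta_reduce
  rw [hderiv_const_mul hs.1 _ o z μ hμ]
  beta_reduce
  rw [hs.2 z μ hμ, hderiv_leibnizParam h₁ h₀ o z μ hμ]
  simp only [leibnizDeriv, leibnizRem]
  ring

/-- The pointwise bound is `exists_norm_oscRem_le` with r = ⟨z⟩⁻¹. For derivatives,
`hderiv_leibnizRem` distributes them over the factors; this multiplies the weights by `wfac`, and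
they remain temperate. The induction is therefore run for all temperate weights and not for a fixed
symbol class. -/
theorem sym_leibnizRem (hρ : Temperate ρ) (hρ1 : ∀ z μ, 1 ≤ ρ z μ) (hσ₁ : Temperate σ₁)
    (hσ₀ : Temperate σ₀) (h₁ : Sym ρ σ₁ Set.univ a₁) (h₀ : Sym ρ σ₀ Set.univ a₀) (N : ℕ) :
    Sym ρ (fun z μ => σ₁ z μ * σ₀ z μ * (bracket z)⁻¹ ^ (2 * N)) Set.univ (leibnizRem N a₁ a₀) := by
  obtain ⟨M, hM⟩ := h₁.temp hρ1 hσ₁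
  obtain ⟨M', hM'⟩ := h₀.temp hρ1 hσ₀
  refine ⟨(hderiv_leibnizRem hM hM' N none).1, fun l => ?_⟩
  induction l generalizing a₁ a₀ σ₁ σ₀ M M' with
  | nil =>
    obtain ⟨K, hK0, hK⟩ := h₁.scaleFam Sum.inr_injective hσ₁
    obtain ⟨K', hK0', hK'⟩ := h₀.scaleFam Sum.inl_injective hσ₀
    obtain ⟨C, hC⟩ := exists_norm_oscRem_le N (fun p => hσ₁.pos _ _) (fun p => hσ₀.pos _ _)
      (fun p => inv_pos.2 (bracket_pos _)) hK0 hK0' hK hK'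
    refine ⟨C, fun z μ hμ _ => ?_⟩
    have := hC ⟨(z, μ), hμ⟩
    rw [hd_nil, leibnizRem_eq h₁.smooth h₀.smooth N hμ]
    simpa using this
  | cons o l ih =>
    obtain ⟨C, hC⟩ := ih (hσ₁.mul (temperate_wfac hρ hρ1 o)) hσ₀ (h₁.hderiv o) h₀ _
      (hM.hderiv o) _ hM'
    obtain ⟨C', hC'⟩ := ih hσ₁ (hσ₀.mul (temperate_wfac hρ hρ1 o)) h₁ (h₀.hderiv o) _ hM _
      (hM'.hderiv o)
    refine ⟨C + C', fun z μ hμ hz => ?_⟩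
    rw [hd_cons, (hderiv_leibnizRem hM hM' N o).2.hd l z μ hμ,
      hd_add (hderiv_leibnizRem (hM.hderiv o) hM' N none).1
        (hderiv_leibnizRem hM (hM'.hderiv o) N none).1 l z μ hμ]
    refine (norm_add_le _ _).trans ((add_le_add (hC z μ hμ hz) (hC' z μ hμ hz)).trans_eq ?_)
    rw [wfacs_cons]; ring

end Remainder

/-! ### Localization of symbol estimates. -/

section Local

variable {ι : Type*} [Fintype ι] [DecidableEq ι] {ρ σ σ' : EuclideanSpace ℝ ι → ℝ → ℝ}
  {a b : EuclideanSpace ℝ ι → ℝ → ℂ} {Ω : Set (EuclideanSpace ℝ ι × ℝ)}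

lemma hderiv_congr_on (hΩ : IsOpen Ω) (h : ∀ z μ, 0 ≤ μ → (z, μ) ∈ Ω → a z μ = b z μ)
    (o : Option ι) : ∀ z μ, 0 ≤ μ → (z, μ) ∈ Ω → hderiv o a z μ = hderiv o b z μ := by
  intro z μ hμ hz
  cases o with
  | none =>
    have h1 : ∀ᶠ μ' in 𝓝[Set.Ici 0] μ, (z, μ') ∈ Ω :=
      nhdsWithin_le_nhds ((hΩ.preimage (by fun_prop : Continuous fun μ' : ℝ => (z, μ'))).mem_nhds hz)
    refine Filter.EventuallyEq.derivWithin_eq ?_ (h z μ hμ hz)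
    filter_upwards [h1, self_mem_nhdsWithin] with μ' h1 h2 using h z μ' h2 h1
  | some i =>
    have h1 : ∀ᶠ z' in 𝓝 z, (z', μ) ∈ Ω :=
      (hΩ.preimage (by fun_prop : Continuous fun z' : EuclideanSpace ℝ ι => (z', μ))).mem_nhds hz
    have h2 : (fun z' => a z' μ) =ᶠ[𝓝 z] fun z' => b z' μ := by
      filter_upwards [h1] with z' h1 using h z' μ hμ h1
    simp only [hderiv, cderiv, h2.fderiv_eq]

lemma hd_congr_on (hΩ : IsOpen Ω) (h : ∀ z μ, 0 ≤ μ → (z, μ) ∈ Ω → a z μ = b z μ)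
    (l : List (Option ι)) : ∀ z μ, 0 ≤ μ → (z, μ) ∈ Ω → hd l a z μ = hd l b z μ := by
  induction l generalizing a b with
  | nil => exact h
  | cons o l ih => exact ih (hderiv_congr_on hΩ h o)

lemma Sym.congr_on (hb : Sym ρ σ Ω b) (ha : Smooth a) (hΩ : IsOpen Ω)
    (h : ∀ z μ, 0 ≤ μ → (z, μ) ∈ Ω → a z μ = b z μ) : Sym ρ σ Ω a := by
  refine ⟨ha, fun l => ?_⟩
  obtain ⟨C, hC⟩ := hb.bound l
  exact ⟨C, fun z μ hμ hz => by rw [hd_congr_on hΩ h l z μ hμ hz]; exact hC z μ hμ hz⟩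

/-- Symbol estimates for derivatives of order at most `k`. -/
def BoundUpTo (k : ℕ) (ρ σ : EuclideanSpace ℝ ι → ℝ → ℝ) (Ω : Set (EuclideanSpace ℝ ι × ℝ))
    (a : EuclideanSpace ℝ ι → ℝ → ℂ) : Prop :=
  ∀ l : List (Option ι), l.length ≤ k → ∃ C : ℝ, ∀ z μ, 0 ≤ μ → (z, μ) ∈ Ω →
    ‖hd l a z μ‖ ≤ C * (σ z μ * wfacs ρ l z μ)

lemma BoundUpTo.hderiv {k : ℕ} (ha : BoundUpTo (k + 1) ρ σ Ω a) (o : Option ι) :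
    BoundUpTo k ρ (fun z μ => σ z μ * wfac ρ o z μ) Ω (hderiv o a) := fun l hl => by
  obtain ⟨C, hC⟩ := ha (o :: l) (by simpa using hl)
  refine ⟨C, fun z μ hμ hz => (hC z μ hμ hz).trans_eq ?_⟩
  rw [wfacs_cons]; ring

lemma BoundUpTo.mul {k : ℕ} (hsa : Smooth a) (hsb : Smooth b) (ha : BoundUpTo k ρ σ Ω a)
    (hb : BoundUpTo k ρ σ' Ω b) :
    BoundUpTo k ρ (fun z μ => σ z μ * σ' z μ) Ω (fun z μ => a z μ * b z μ) := by
  induction k generalizing a b σ σ' with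
  | zero =>
    intro l hl
    obtain rfl : l = [] := List.length_eq_zero_iff.1 (Nat.le_zero.1 hl)
    obtain ⟨C, hC⟩ := ha [] le_rfl
    obtain ⟨C', hC'⟩ := hb [] le_rfl
    refine ⟨C * C', fun z μ hμ hz => ?_⟩
    have h1 := hC z μ hμ hz
    have h2 := hC' z μ hμ hz
    simp only [hd_nil, wfacs_nil, mul_one] at *
    rw [norm_mul]
    calc ‖a z μ‖ * ‖b z μ‖ ≤ (C * σ z μ) * (C' * σ' z μ) :=
          mul_le_mul h1 h2 (norm_nonneg _) ((norm_nonneg _).trans h1)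
      _ = _ := by ring
  | succ k ih =>
    have hle : ∀ {τ : EuclideanSpace ℝ ι → ℝ → ℝ} {c : EuclideanSpace ℝ ι → ℝ → ℂ},
        BoundUpTo (k + 1) ρ τ Ω c → BoundUpTo k ρ τ Ω c := fun h l hl => h l (by omega)
    intro l hl
    rcases l with _ | ⟨o, l⟩
    · exact ih hsa hsb (hle ha) (hle hb) [] (by simp)
    · have hl' : l.length ≤ k := by simpa using hl
      obtain ⟨C, hC⟩ := ih (hsa.hderiv o) hsb (ha.hderiv o) (hle hb) l hl'
      obtain ⟨C', hC'⟩ := ih hsa (hsb.hderiv o) (hle ha) (hb.hderiv o) l hl'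
      refine ⟨C + C', fun z μ hμ hz => ?_⟩
      rw [hd_cons, (hderiv_mul hsa hsb o).hd l z μ hμ,
        hd_add ((hsa.hderiv o).mul hsb) (hsa.mul (hsb.hderiv o)) l z μ hμ]
      refine (norm_add_le _ _).trans ((add_le_add (hC z μ hμ hz) (hC' z μ hμ hz)).trans_eq ?_)
      rw [wfacs_cons]; ring

/-- A family of functions whose derivatives are multiples of members of the family satisfies symbol
estimates as soon as its members satisfy the corresponding bounds. -/
lemma sym_of_family {κ : Type*} (f : κ → EuclideanSpace ℝ ι → ℝ → ℂ)
    (τ : κ → EuclideanSpace ℝ ι → ℝ → ℝ) (hΩ : IsOpen Ω) (hρ : ∀ z μ, 0 < ρ z μ)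
    (hs : ∀ k, Smooth (f k)) (hτ : ∀ k z μ, 0 < τ k z μ)
    (base : ∀ k, ∃ C : ℝ, ∀ z μ, 0 ≤ μ → (z, μ) ∈ Ω → ‖f k z μ‖ ≤ C * τ k z μ)
    (step : ∀ k o, ∃ (k' : κ) (c : EuclideanSpace ℝ ι → ℝ → ℂ) (θ : EuclideanSpace ℝ ι → ℝ → ℝ)
      (K : ℝ), Sym ρ θ Ω c ∧ (∀ z μ, 0 ≤ μ → (z, μ) ∈ Ω →
        hderiv o (f k) z μ = c z μ * f k' z μ ∧ 0 ≤ θ z μ ∧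
        θ z μ * τ k' z μ ≤ K * (τ k z μ * wfac ρ o z μ))) (k : κ) : Sym ρ (τ k) Ω (f k) := by
  -- The induction is on the order of differentiation, simultaneously for all members, since a
  -- derivative of one member refers to another one.
  suffices h : ∀ m k, BoundUpTo m ρ (τ k) Ω (f k) from ⟨hs k, fun l => h l.length k l le_rfl⟩
  intro m
  induction m with
  | zero =>
    intro k l hl
    obtain rfl : l = [] := List.length_eq_zero_iff.1 (Nat.le_zero.1 hl)
    simpa using base k
  | succ m ih =>
    intro k l hl
    rcases l with _ | ⟨o, l⟩
    · exact ih k [] (by simp)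
    · obtain ⟨k', c, θ, K, hc, h⟩ := step k o
      have h1 : BoundUpTo m ρ (fun z μ => θ z μ * τ k' z μ) Ω (fun z μ => c z μ * f k' z μ) :=
        BoundUpTo.mul hc.smooth (hs k') (fun l _ => hc.bound l) (ih k')
      obtain ⟨C, hC⟩ := h1 l (by simpa using hl)
      refine ⟨|C| * K, fun z μ hμ hz => ?_⟩
      rw [hd_cons, hd_congr_on hΩ (fun z μ hμ hz => (h z μ hμ hz).1) l z μ hμ hz]
      refine (hC z μ hμ hz).trans ?_
      have e1 := (wfacs_pos hρ l z μ).le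
      have e2 := (h z μ hμ hz).2.1
      have e3 := (hτ k' z μ).le
      calc C * (θ z μ * τ k' z μ * wfacs ρ l z μ) ≤ |C| * (θ z μ * τ k' z μ * wfacs ρ l z μ) :=
            mul_le_mul_of_nonneg_right (le_abs_self C) (by positivity)
        _ ≤ |C| * ((K * (τ k z μ * wfac ρ o z μ)) * wfacs ρ l z μ) := by
            exact mul_le_mul_of_nonneg_left
              (mul_le_mul_of_nonneg_right (h z μ hμ hz).2.2 e1) (abs_nonneg C)
        _ = _ := by rw [wfacs_cons]; ring

lemma continuous_wfacs (hρ : Continuous fun p : EuclideanSpace ℝ ι × ℝ => ρ p.1 p.2)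
    (hρ0 : ∀ z μ, 0 < ρ z μ) (l : List (Option ι)) :
    Continuous fun p : EuclideanSpace ℝ ι × ℝ => wfacs ρ l p.1 p.2 := by
  induction l with
  | nil => simpa using continuous_const
  | cons o l ih =>
    simp only [wfacs_cons]
    refine Continuous.mul ?_ ih
    cases o with
    | none => exact hρ.inv₀ fun p => (hρ0 _ _).ne'
    | some i => exact (continuous_bracket.comp continuous_fst).inv₀ fun p => (bracket_pos _).ne'

/-- On compact sets, smooth functions satisfy symbol estimates of any kind. -/
lemma Smooth.sym_of_isCompact (ha : Smooth a) {S : Set (EuclideanSpace ℝ ι × ℝ)} (hS : IsCompact S)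
    (hρ : Continuous fun p : EuclideanSpace ℝ ι × ℝ => ρ p.1 p.2) (hρ0 : ∀ z μ, 0 < ρ z μ)
    (hσ : Continuous fun p : EuclideanSpace ℝ ι × ℝ => σ p.1 p.2) (hσ0 : ∀ z μ, 0 < σ z μ) :
    Sym ρ σ S a := by
  refine ⟨ha, fun l => ?_⟩
  have h1 : ContinuousOn (fun p : EuclideanSpace ℝ ι × ℝ => Shubin.hd l a p.1 p.2) (halfSpace ι) :=
    ContDiffOn.continuousOn (ha.hd l)
  have h2 := hσ.mul (continuous_wfacs hρ hρ0 l)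
  have h3 : ∀ p : EuclideanSpace ℝ ι × ℝ, 0 < σ p.1 p.2 * wfacs ρ l p.1 p.2 := fun p =>
    mul_pos (hσ0 _ _) (wfacs_pos hρ0 l _ _)
  have h4 : ContinuousOn (fun p : EuclideanSpace ℝ ι × ℝ => ‖Shubin.hd l a p.1 p.2‖ /
      (σ p.1 p.2 * wfacs ρ l p.1 p.2)) (S ∩ halfSpace ι) :=
    (h1.norm.mono Set.inter_subset_right).div h2.continuousOn fun p _ => (h3 p).ne'
  have h5 : IsCompact (S ∩ halfSpace ι) := hS.inter_right (isClosed_univ.prod isClosed_Ici)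
  obtain ⟨C, hC⟩ := (h5.image_of_continuousOn h4).bddAbove
  refine ⟨C, fun z μ hμ hz => ?_⟩
  rw [← div_le_iff₀ (h3 (z, μ))]
  exact hC ⟨(z, μ), ⟨hz, mem_halfSpace hμ⟩, rfl⟩

end Local

/-! ### Coordinates, the parameter and |z|² - 1. -/

section Basic

variable {ι : Type*} [Fintype ι] [DecidableEq ι] {ρ σ σ' : EuclideanSpace ℝ ι → ℝ → ℝ}
  {a b : EuclideanSpace ℝ ι → ℝ → ℂ} {Ω : Set (EuclideanSpace ℝ ι × ℝ)}

lemma continuous_jp : Continuous fun p : EuclideanSpace ℝ ι × ℝ => jp p.1 p.2 := by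
  unfold jp bracketParam; fun_prop

lemma continuous_jm : Continuous fun p : EuclideanSpace ℝ ι × ℝ => jm p.1 p.2 :=
  continuous_bracket.comp continuous_snd

lemma continuous_wReg (d ν : ℝ) :
    Continuous fun p : EuclideanSpace ℝ ι × ℝ => wReg d ν p.1 p.2 :=
  ((continuous_bracket.comp continuous_fst).rpow_const fun p => .inl (bracket_pos _).ne').mul
    (continuous_jp.rpow_const fun p => .inl (jp_pos _ _).ne')

lemma continuous_wTen (m s : ℝ) :
    Continuous fun p : EuclideanSpace ℝ ι × ℝ => wTen m s p.1 p.2 :=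
  ((continuous_bracket.comp continuous_fst).rpow_const fun p => .inl (bracket_pos _).ne').mul
    (continuous_jm.rpow_const fun p => .inl (jm_pos _ _).ne')

lemma hderiv_coord (i : ι) (o : Option ι) :
    hderiv o (fun (z : EuclideanSpace ℝ ι) (_ : ℝ) => ((z i : ℝ) : ℂ)) =
      fun _ _ => if o = some i then 1 else 0 := by
  funext z μ
  cases o with
  | none => simp [hderiv]
  | some j =>
    have := (Complex.ofRealCLM.comp
      (EuclideanSpace.proj i : EuclideanSpace ℝ ι →L[ℝ] ℝ)).hasFDerivAt (x := z)
    have h : HasFDerivAt (fun y : EuclideanSpace ℝ ι => ((y i : ℝ) : ℂ)) _ z := this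
    simp only [hderiv, cderiv]
    rw [h.fderiv]
    by_cases hij : i = j
    · subst hij; simp
    · simp [hij, Ne.symm hij]

lemma hderiv_param (o : Option ι) :
    EqHalf (hderiv o (fun (_ : EuclideanSpace ℝ ι) (μ : ℝ) => (μ : ℂ)))
      (fun _ _ => if o = none then 1 else 0) := by
  intro z μ hμ
  cases o with
  | none =>
    simp only [hderiv, if_true]
    exact (Complex.ofRealCLM.hasDerivWithinAt (x := μ)).derivWithin (uniqueDiffOn_Ici 0 μ hμ)
  | some j => simp [hderiv, cderiv]

lemma hd_cons_const (o : Option ι) (l : List (Option ι)) (c : ℂ) :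
    EqHalf (hd (o :: l) (fun (_ : EuclideanSpace ℝ ι) (_ : ℝ) => c)) (fun _ _ => 0) := by
  have : hderiv o (fun (_ : EuclideanSpace ℝ ι) (_ : ℝ) => c) = fun _ _ => 0 := by
    funext z μ
    cases o <;> simp [hderiv, cderiv]
  rw [hd_cons, this]
  exact hd_zero l

lemma sym_const (c : ℂ) : Sym ρ (fun _ _ => 1) Ω (fun _ _ => c) := by
  refine ⟨smooth_const c, fun l => ?_⟩
  rcases l with _ | ⟨o, l⟩
  · exact ⟨‖c‖, fun z μ _ _ => by simp⟩
  · exact ⟨0, fun z μ hμ _ => by rw [hd_cons_const o l c z μ hμ]; simp⟩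

lemma sym_coord (hρ : ∀ z μ, 0 < ρ z μ) (i : ι) :
    Sym ρ (fun z _ => bracket z) Ω (fun z _ => ((z i : ℝ) : ℂ)) := by
  refine ⟨smooth_of_contDiff (contDiff_coord i), fun l => ?_⟩
  rcases l with _ | ⟨o, l⟩
  · refine ⟨1, fun z μ _ _ => ?_⟩
    simpa using (PiLp.norm_apply_le z i).trans (norm_le_bracket z)
  · by_cases ho : o = some i
    · rcases l with _ | ⟨o', l⟩
      · refine ⟨1, fun z μ _ _ => ?_⟩
        rw [hd_cons, hd_nil, hderiv_coord, ho]
        simp [wfac, (bracket_pos z).ne']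
      · refine ⟨0, fun z μ hμ _ => ?_⟩
        rw [hd_cons, hderiv_coord, hd_cons_const o' l _ z μ hμ]
        simp
    · refine ⟨0, fun z μ hμ _ => ?_⟩
      rw [hd_cons, hderiv_coord, if_neg ho, hd_zero l z μ hμ]
      simp

lemma smooth_param : Smooth (fun (_ : EuclideanSpace ℝ ι) (μ : ℝ) => (μ : ℂ)) :=
  (Complex.ofRealCLM.contDiff.comp contDiff_snd).contDiffOn

lemma sym_param (hρ : ∀ z μ, 0 < ρ z μ) (h : ∀ z μ, |μ| ≤ ρ z μ) :
    Sym ρ ρ Ω (fun (_ : EuclideanSpace ℝ ι) (μ : ℝ) => (μ : ℂ)) := by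
  refine ⟨smooth_param, fun l => ?_⟩
  rcases l with _ | ⟨o, l⟩
  · refine ⟨1, fun z μ _ _ => ?_⟩
    simpa using h z μ
  · by_cases ho : o = none
    · rcases l with _ | ⟨o', l⟩
      · refine ⟨1, fun z μ hμ _ => ?_⟩
        rw [hd_cons, hd_nil, hderiv_param o z μ hμ, ho]
        simp [wfac, (hρ z μ).ne']
      · refine ⟨0, fun z μ hμ _ => ?_⟩
        rw [hd_cons, (hderiv_param o).hd (o' :: l) z μ hμ, hd_cons_const o' l _ z μ hμ]
        simp
    · refine ⟨0, fun z μ hμ _ => ?_⟩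
      rw [hd_cons, (hderiv_param o).hd l z μ hμ]
      simp only [if_neg ho]
      rw [hd_zero l z μ hμ]
      simp

lemma abs_le_jm (z : EuclideanSpace ℝ ι) (μ : ℝ) : |μ| ≤ jm z μ := norm_le_bracket μ

lemma jm_sq (z : EuclideanSpace ℝ ι) (μ : ℝ) : jm z μ ^ 2 = 1 + μ ^ 2 := by
  simp [jm, bracket_sq]

lemma jm_le_jp (z : EuclideanSpace ℝ ι) (μ : ℝ) : jm z μ ≤ jp z μ := by
  refine abs_le_of_sq_le_sq' ?_ (jp_pos z μ).le |>.2
  rw [jm_sq, jp_sq]; nlinarith [sq_nonneg ‖z‖]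

lemma bracket_le_jp (z : EuclideanSpace ℝ ι) (μ : ℝ) : bracket z ≤ jp z μ := by
  refine abs_le_of_sq_le_sq' ?_ (jp_pos z μ).le |>.2
  rw [bracket_sq, jp_sq]; nlinarith [sq_nonneg μ]

lemma abs_le_jp (z : EuclideanSpace ℝ ι) (μ : ℝ) : |μ| ≤ jp z μ :=
  (abs_le_jm z μ).trans (jm_le_jp z μ)

/-- The function `|z|² - 1`. -/
def quad (z : EuclideanSpace ℝ ι) : ℂ := ((‖z‖ ^ 2 - 1 : ℝ) : ℂ)

lemma quad_eq (z : EuclideanSpace ℝ ι) : quad z = ∑ i, ((z i : ℝ) : ℂ) * ((z i : ℝ) : ℂ) + -1 := by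
  rw [quad, EuclideanSpace.norm_sq_eq]
  push_cast
  rw [sub_eq_add_neg]
  congr 1
  refine Finset.sum_congr rfl fun i _ => ?_
  rw [← sq, ← Complex.ofReal_pow, ← Complex.ofReal_pow, Real.norm_eq_abs, sq_abs]

lemma sym_quad (hρ : ∀ z μ, 0 < ρ z μ) : Sym ρ (fun z _ => bracket z ^ (2 : ℝ)) Ω
    (fun z _ => quad z) := by
  simp only [quad_eq]
  refine Sym.add (Sym.sum _ fun i _ => ?_) ?_
  · refine ((sym_coord hρ i).mul (sym_coord hρ i)).mono hρ 1
      (fun z _ _ _ => by have := bracket_pos z; positivity) fun z _ _ _ => ?_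
    rw [Real.rpow_two]; simp [sq]
  · refine (sym_const (-1)).mono hρ 1 (fun _ _ _ _ => zero_le_one) fun z _ _ _ => ?_
    rw [one_mul]
    exact Real.one_le_rpow (one_le_bracket z) (by norm_num)

lemma smooth_quad : Smooth (fun (z : EuclideanSpace ℝ ι) (_ : ℝ) => quad z) :=
  (sym_quad (ρ := jp) (Ω := Set.univ) jp_pos).smooth

lemma Smooth.pow (ha : Smooth a) (k : ℕ) : Smooth (fun z μ => a z μ ^ k) := ContDiffOn.pow ha k

lemma hderiv_pow_succ (ha : Smooth a) (k : ℕ) (o : Option ι) :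
    EqHalf (hderiv o fun z μ => a z μ ^ (k + 1))
      (fun z μ => (k + 1) * a z μ ^ k * hderiv o a z μ) := by
  intro z μ hμ
  beta_reduce
  induction k with
  | zero => simp
  | succ k ih =>
    have h1 : (fun z μ => a z μ ^ (k + 1 + 1)) = fun z μ => a z μ ^ (k + 1) * a z μ := by
      funext z μ; ring
    rw [h1, hderiv_mul (ha.pow (k + 1)) ha o z μ hμ]
    beta_reduce
    rw [ih]
    push_cast; ring

lemma hderiv_quad (o : Option ι) : EqHalf (hderiv o (fun (z : EuclideanSpace ℝ ι) _ => quad z))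
    (fun z _ => match o with
      | none => 0
      | some i => 2 * ((z i : ℝ) : ℂ)) := by
  intro z μ hμ
  have hc : ∀ i, Smooth (fun (z : EuclideanSpace ℝ ι) (_ : ℝ) => ((z i : ℝ) : ℂ)) := fun i =>
    smooth_of_contDiff (contDiff_coord i)
  have h1 := hderiv_sum (Finset.univ : Finset ι) (fun i => (hc i).mul (hc i)) o
  simp only [quad_eq]
  rw [hderiv_add h1.1 (smooth_const (-1)) o z μ hμ]
  beta_reduce
  rw [h1.2 z μ hμ, show hderiv o (fun (_ : EuclideanSpace ℝ ι) (_ : ℝ) => (-1 : ℂ)) z μ = 0 from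
    hd_cons_const o [] (-1) z μ hμ]
  have h2 : ∀ i, hderiv o (fun (z : EuclideanSpace ℝ ι) (_ : ℝ) =>
      ((z i : ℝ) : ℂ) * ((z i : ℝ) : ℂ)) z μ = if o = some i then 2 * ((z i : ℝ) : ℂ) else 0 := by
    intro i
    rw [hderiv_mul (hc i) (hc i) o z μ hμ]
    simp only [hderiv_coord]
    split_ifs
    · ring
    · simp
  simp only [h2]
  cases o with
  | none => simp
  | some j => simp

end Basic

/-! ### The binomial series with remainder. -/

section Binomial

/-- Generalized binomial coefficients. -/
def bc (α : ℝ) (k : ℕ) : ℝ := ∏ i ∈ Finset.range k, (α - i) / (i + 1)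

@[simp] lemma bc_zero (α : ℝ) : bc α 0 = 1 := by simp [bc]

lemma bc_succ_mul (α : ℝ) (k : ℕ) : bc α (k + 1) * (k + 1) = bc α k * (α - k) := by
  rw [bc, Finset.prod_range_succ, ← bc]
  field_simp

lemma bc_mul_sub (α : ℝ) (k : ℕ) : bc α k * (α - k) = α * bc (α - 1) k := by
  induction k with
  | zero => simp
  | succ k ih =>
    have h1 := bc_succ_mul α k
    have h2 := bc_succ_mul (α - 1) k
    have hk : (k : ℝ) + 1 ≠ 0 := by positivity
    refine mul_right_cancel₀ hk ?_
    push_cast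
    linear_combination (α - k - 1) * h1 + (α - k - 1) * ih - α * h2

lemma bc_succ_mul' (α : ℝ) (k : ℕ) : bc α (k + 1) * (k + 1) = α * bc (α - 1) k := by
  rw [bc_succ_mul, bc_mul_sub]

/-- Remainder of the binomial series. -/
def binomRem (K : ℕ) (α x : ℝ) : ℝ := (1 + x) ^ α - ∑ k ∈ Finset.range K, bc α k * x ^ k

lemma hasDerivAt_binomRem (K : ℕ) (α : ℝ) {x : ℝ} (hx : 0 < 1 + x) :
    HasDerivAt (binomRem (K + 1) α) (α * binomRem K (α - 1) x) x := by
  have h1 : HasDerivAt (fun x : ℝ => (1 + x) ^ α) (α * (1 + x) ^ (α - 1)) x := by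
    have := ((hasDerivAt_id x).const_add 1).rpow_const (p := α) (.inl hx.ne')
    simpa using this
  have h2 : HasDerivAt (fun x : ℝ => ∑ k ∈ Finset.range (K + 1), bc α k * x ^ k)
      (∑ k ∈ Finset.range (K + 1), bc α k * (k * x ^ (k - 1))) x :=
    HasDerivAt.fun_sum fun k _ => (hasDerivAt_pow k x).const_mul _
  have h3 : HasDerivAt (binomRem (K + 1) α) _ x := h1.sub h2
  convert h3 using 1
  rw [Finset.sum_range_succ', binomRem, mul_sub, Finset.mul_sum]
  simp only [Nat.cast_zero, zero_mul, mul_zero, add_zero, Nat.add_sub_cancel]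
  congr 1
  refine Finset.sum_congr rfl fun k _ => ?_
  have := bc_succ_mul' α k
  push_cast
  linear_combination -x ^ k * this

/-- The remainder of order K + 1 vanishes at 0 and its derivative is α times the remainder of order
K for α - 1, so the mean value inequality gives induction on K. Convergence of the series plays no
role: x may exceed 1, and only 1 + x has to stay away from 0. -/
lemma exists_abs_binomRem_le (K : ℕ) (α : ℝ) : ∃ C : ℝ, 0 ≤ C ∧
    ∀ x ∈ Set.Icc (-5 / 6 : ℝ) 4, |binomRem K α x| ≤ C * |x| ^ K := by
  induction K generalizing α with
  | zero =>
    refine ⟨6 ^ |α|, by positivity, fun x hx => ?_⟩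
    have h0 : 0 < 1 + x := by linarith [hx.1]
    have := rpow_le_of_ratio (K := 6) h0 one_pos (by norm_num) (by linarith [hx.2])
      (by linarith [hx.1]) α
    simp only [binomRem, Finset.range_zero, Finset.sum_empty, sub_zero, pow_zero, mul_one]
    rw [abs_of_pos (Real.rpow_pos_of_pos h0 α)]
    simpa using this
  | succ K ih =>
    obtain ⟨C, hC0, hC⟩ := ih (α - 1)
    refine ⟨|α| * C, by positivity, fun x hx => ?_⟩
    have hsub : ∀ y ∈ Set.uIcc 0 x, y ∈ Set.Icc (-5 / 6 : ℝ) 4 ∧ |y| ≤ |x| := by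
      intro y hy
      rcases le_total 0 x with h | h
      · rw [Set.uIcc_of_le h] at hy
        exact ⟨⟨by linarith [hy.1], hy.2.trans hx.2⟩, by
          rw [abs_of_nonneg hy.1, abs_of_nonneg h]; exact hy.2⟩
      · rw [Set.uIcc_of_ge h] at hy
        exact ⟨⟨hx.1.trans hy.1, by linarith [hy.2]⟩, by
          rw [abs_of_nonpos hy.2, abs_of_nonpos h]; linarith [hy.1]⟩
    have key := (convex_uIcc 0 x).norm_image_sub_le_of_norm_hasDerivWithin_le
      (f := binomRem (K + 1) α) (f' := fun y => α * binomRem K (α - 1) y)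
      (C := |α| * (C * |x| ^ K))
      (fun y hy => (hasDerivAt_binomRem K α (by linarith [(hsub y hy).1.1])).hasDerivWithinAt)
      (fun y hy => ?_) (Set.left_mem_uIcc) (Set.right_mem_uIcc)
    · have h0 : binomRem (K + 1) α 0 = 0 := by
        rw [binomRem, Finset.sum_range_succ']; simp
      rw [h0, sub_zero, sub_zero, Real.norm_eq_abs, Real.norm_eq_abs] at key
      refine key.trans_eq ?_
      ring
    · rw [norm_mul, Real.norm_eq_abs, Real.norm_eq_abs]
      refine mul_le_mul_of_nonneg_left ((hC y (hsub y hy).1).trans ?_) (abs_nonneg α)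
      exact mul_le_mul_of_nonneg_left (pow_le_pow_left₀ (abs_nonneg y) (hsub y hy).2 K) hC0

end Binomial

/-! ### Powers of [z, μ] and of ⟨μ⟩. -/

section Powers

variable {ι : Type*} [Fintype ι] [DecidableEq ι] {Ω : Set (EuclideanSpace ℝ ι × ℝ)}
  {u : EuclideanSpace ℝ ι → ℝ → ℝ}

/-- Real powers of a positive function. -/
def rp (u : EuclideanSpace ℝ ι → ℝ → ℝ) (t : ℝ) (z : EuclideanSpace ℝ ι) (μ : ℝ) : ℂ :=
  ((u z μ ^ t : ℝ) : ℂ)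

/-- Smooth positive functions on `E × [0,∞)`. -/
structure SmoothPos (u : EuclideanSpace ℝ ι → ℝ → ℝ) : Prop where
  smooth : ContDiffOn ℝ ∞ (fun p : EuclideanSpace ℝ ι × ℝ => u p.1 p.2) (halfSpace ι)
  pos : ∀ z μ, 0 ≤ μ → 0 < u z μ

lemma SmoothPos.smooth_rp (hu : SmoothPos u) (t : ℝ) : Smooth (rp u t) :=
  Complex.ofRealCLM.contDiff.comp_contDiffOn
    (hu.smooth.rpow_const_of_ne fun p hp => (hu.pos p.1 p.2 hp.2).ne')

lemma SmoothPos.hderiv_rp (hu : SmoothPos u) (t : ℝ) (o : Option ι) :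
    EqHalf (hderiv o (rp u t)) (fun z μ => t * rp u (t - 1) z μ * hderiv o (rp u 1) z μ) := by
  intro z μ hμ
  have h0 := (hu.smooth.differentiableOn (by simp) _ (mem_halfSpace (z := z) hμ)).hasFDerivWithinAt
  have key : ∀ t : ℝ, hderiv o (rp u t) z μ = ((t * u z μ ^ (t - 1) *
      fderivWithin ℝ (fun p : EuclideanSpace ℝ ι × ℝ => u p.1 p.2) (halfSpace ι) (z, μ) (hdir o) :
        ℝ) : ℂ) := by
    intro t
    have h1 := h0.rpow_const (p := t) (.inl (hu.pos z μ hμ).ne')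
    have h2 := (Complex.ofRealCLM.hasFDerivAt).comp_hasFDerivWithinAt (z, μ) h1
    rw [hderiv_eq_of_hasFDerivWithinAt (a := rp u t) hμ h2]
    simp
  beta_reduce
  rw [key t, key 1]
  simp [rp]

lemma rp_add (hu : SmoothPos u) (s t : ℝ) : EqHalf (rp u (s + t)) (fun z μ => rp u s z μ * rp u t z μ) :=
  fun z μ hμ => by simp [rp, Real.rpow_add (hu.pos z μ hμ)]

/-- Only the square of the function is given by a simple formula. Written as (t/2) ∂(u²) u^{t-2},
the derivative stays within the family of powers, which is the form required by `sym_of_family`. -/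
lemma SmoothPos.hderiv_rp_of_sq (hu : SmoothPos u) (hΩ : IsOpen Ω)
    {F : EuclideanSpace ℝ ι → ℝ → ℂ}
    (h : ∀ z μ, 0 ≤ μ → (z, μ) ∈ Ω → ((u z μ ^ 2 : ℝ) : ℂ) = F z μ) (t : ℝ) (o : Option ι) :
    ∀ z μ, 0 ≤ μ → (z, μ) ∈ Ω → hderiv o (rp u t) z μ = (t / 2) * hderiv o F z μ *
      rp u (t - 2) z μ := by
  intro z μ hμ hz
  have h1 : ∀ z μ, 0 ≤ μ → (z, μ) ∈ Ω → rp u 2 z μ = F z μ := fun z μ hμ hz => by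
    rw [← h z μ hμ hz, rp, Real.rpow_two]
  rw [← hderiv_congr_on hΩ h1 o z μ hμ hz, hu.hderiv_rp t o z μ hμ, hu.hderiv_rp 2 o z μ hμ]
  have h2 := rp_add hu (t - 2) 1 z μ hμ
  rw [show t - 2 + 1 = t - 1 by ring] at h2
  simp only [h2, show (2 : ℝ) - 1 = 1 by norm_num]
  push_cast
  ring

/-- Derivatives of `|z|² + μ²`. -/
def sqDeriv (o : Option ι) (z : EuclideanSpace ℝ ι) (μ : ℝ) : ℂ :=
  match o with
  | none => 2 * (μ : ℂ)
  | some i => 2 * ((z i : ℝ) : ℂ)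

lemma hderiv_sq_param (c : ℂ) (o : Option ι) :
    EqHalf (hderiv o fun (_ : EuclideanSpace ℝ ι) (μ : ℝ) => (μ : ℂ) * μ + c)
      (fun z μ => if o = none then 2 * (μ : ℂ) else 0) := by
  intro z μ hμ
  rw [hderiv_add (smooth_param.mul smooth_param) (smooth_const c) o z μ hμ]
  beta_reduce
  rw [hderiv_mul smooth_param smooth_param o z μ hμ,
    show hderiv o (fun (_ : EuclideanSpace ℝ ι) (_ : ℝ) => c) z μ = 0 from
      hd_cons_const o [] c z μ hμ]
  beta_reduce
  rw [hderiv_param o z μ hμ]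
  split_ifs
  · ring
  · simp

lemma hderiv_normSq (o : Option ι) :
    EqHalf (hderiv o fun (z : EuclideanSpace ℝ ι) (μ : ℝ) => quad z + ((μ : ℂ) * μ + 1))
      (sqDeriv o) := by
  intro z μ hμ
  rw [hderiv_add smooth_quad ((smooth_param.mul smooth_param).add (smooth_const 1)) o z μ hμ]
  beta_reduce
  rw [hderiv_sq_param 1 o z μ hμ, hderiv_quad o z μ hμ]
  cases o <;> simp [sqDeriv]

lemma smoothPos_jm : SmoothPos (jm : EuclideanSpace ℝ ι → ℝ → ℝ) := by
  refine ⟨?_, fun z μ _ => jm_pos z μ⟩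
  have : ContDiff ℝ ∞ fun p : EuclideanSpace ℝ ι × ℝ => √(1 + ‖p.2‖ ^ 2) :=
    ContDiff.sqrt (contDiff_const.add (contDiff_snd.norm_sq ℝ)) fun p => by positivity
  exact this.contDiffOn

lemma hderiv_rp_jm (t : ℝ) (o : Option ι) :
    EqHalf (hderiv o (rp jm t)) (fun (z : EuclideanSpace ℝ ι) μ => if o = none then t * (μ : ℂ) * rp jm (t - 2) z μ else 0) := by
  intro z μ hμ
  rw [smoothPos_jm.hderiv_rp_of_sq isOpen_univ (F := fun _ μ => (μ : ℂ) * μ + 1)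
    (fun z μ _ _ => by rw [jm_sq]; push_cast; ring) t o z μ hμ trivial, hderiv_sq_param 1 o z μ hμ]
  split_ifs
  · ring
  · simp

lemma norm_rp (hu : ∀ z μ, 0 < u z μ) (t : ℝ) (z : EuclideanSpace ℝ ι) (μ : ℝ) :
    ‖rp u t z μ‖ = u z μ ^ t := by
  rw [rp, Complex.norm_real, Real.norm_of_nonneg (Real.rpow_nonneg (hu z μ).le t)]

lemma sym_rp_jm (t : ℝ) :
    Sym jm (fun z μ => jm z μ ^ t) Ω (rp (jm : EuclideanSpace ℝ ι → ℝ → ℝ) t) := by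
  refine Sym.subset (Ω := Set.univ) ?_ (Set.subset_univ _)
  refine sym_of_family (fun t : ℝ => rp (jm : EuclideanSpace ℝ ι → ℝ → ℝ) t)
    (fun t z μ => jm z μ ^ t) isOpen_univ jm_pos (fun t => smoothPos_jm.smooth_rp t)
    (fun t z μ => Real.rpow_pos_of_pos (jm_pos z μ) t)
    (fun t => ⟨1, fun z μ _ _ => by rw [norm_rp jm_pos, one_mul]⟩) (fun t o => ?_) t
  cases o with
  | none =>
    refine ⟨t - 2, fun z μ => (t : ℂ) * μ, jm, 1, (sym_param jm_pos abs_le_jm).const_mul t,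
      fun z μ hμ _ => ⟨by rw [hderiv_rp_jm t none z μ hμ]; simp, (jm_pos z μ).le, ?_⟩⟩
    have h := jm_pos z μ
    change _ ≤ 1 * (_ * (jm z μ)⁻¹)
    rw [← Real.rpow_neg_one, ← Real.rpow_add h, one_mul]
    nth_rw 1 [← Real.rpow_one (jm z μ)]
    rw [← Real.rpow_add h]
    exact le_of_eq (by ring_nf)
  | some i =>
    refine ⟨t, fun z μ => 0, fun _ _ => 0, 1, sym_zero, fun z μ hμ _ =>
      ⟨by rw [hderiv_rp_jm t (some i) z μ hμ]; simp, le_rfl, ?_⟩⟩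
    have h := jm_pos z μ
    have := wfac_pos (ρ := jm) jm_pos (some i) z μ
    rw [zero_mul]; positivity

lemma normParam_sq (z : EuclideanSpace ℝ ι) (μ : ℝ) : normParam z μ ^ 2 = ‖z‖ ^ 2 + μ ^ 2 :=
  Real.sq_sqrt (by positivity)

lemma continuous_normParam : Continuous fun p : EuclideanSpace ℝ ι × ℝ => normParam p.1 p.2 := by
  unfold normParam; fun_prop

/-- The complement of a ball. -/
def far (ι : Type*) [Fintype ι] (R : ℝ) : Set (EuclideanSpace ℝ ι × ℝ) := {p | R < normParam p.1 p.2}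

lemma isOpen_far (R : ℝ) : IsOpen (far ι R) := isOpen_lt continuous_const continuous_normParam

lemma isCompact_compl_far (R : ℝ) : IsCompact (far ι R)ᶜ := by
  refine Metric.isCompact_of_isClosed_isBounded (isOpen_far R).isClosed_compl ?_
  refine (Metric.isBounded_closedBall (x := (0 : EuclideanSpace ℝ ι × ℝ)) (r := |R|)).subset ?_
  intro p hp
  have h1 : normParam p.1 p.2 ≤ R := not_lt.1 hp
  have h2 : normParam p.1 p.2 ≤ |R| := h1.trans (le_abs_self R)
  rw [mem_closedBall_zero_iff, Prod.norm_def, max_le_iff]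
  exact ⟨(Real.le_sqrt_of_sq_le (by nlinarith [sq_nonneg p.2])).trans h2,
    (Real.le_sqrt_of_sq_le (by rw [Real.norm_eq_abs, sq_abs]; nlinarith [sq_nonneg ‖p.1‖])).trans h2⟩

variable {w : EuclideanSpace ℝ ι → ℝ → ℝ}

lemma IsSmoothedNorm.smoothPos (hw : IsSmoothedNorm w) : SmoothPos w := ⟨hw.smooth, hw.pos⟩

lemma IsSmoothedNorm.sq (hw : IsSmoothedNorm w) {z : EuclideanSpace ℝ ι} {μ : ℝ} (hμ : 0 ≤ μ)
    (h : 1 ≤ normParam z μ) : w z μ ^ 2 = ‖z‖ ^ 2 + μ ^ 2 := by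
  rw [hw.eq_norm z μ hμ h, normParam_sq]

lemma IsSmoothedNorm.hderiv_rp (hw : IsSmoothedNorm w) (t : ℝ) (o : Option ι) :
    ∀ z μ, 0 ≤ μ → (z, μ) ∈ far ι 1 →
      hderiv o (rp w t) z μ = (t / 2) * sqDeriv o z μ * rp w (t - 2) z μ := by
  intro z μ hμ hz
  rw [hw.smoothPos.hderiv_rp_of_sq (isOpen_far 1) (F := fun z μ => quad z + ((μ : ℂ) * μ + 1))
    (fun z μ hμ hz => ?_) t o z μ hμ hz, hderiv_normSq o z μ hμ]
  rw [hw.sq hμ (le_of_lt hz), quad]; push_cast; ring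

lemma sym_sqDeriv_jp (o : Option ι) : Sym jp (fun z μ => (wfac jp o z μ)⁻¹) Ω (sqDeriv o) := by
  cases o with
  | none =>
    simp only [wfac, inv_inv]
    exact (sym_param jp_pos abs_le_jp).const_mul 2
  | some i =>
    simp only [wfac, inv_inv]
    exact (sym_coord jp_pos i).const_mul 2

lemma IsSmoothedNorm.le_jp (hw : IsSmoothedNorm w) {z : EuclideanSpace ℝ ι} {μ : ℝ} (hμ : 0 ≤ μ)
    (h : 1 ≤ normParam z μ) : w z μ ≤ jp z μ ∧ jp z μ ≤ 2 * w z μ := by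
  have h1 := hw.pos z μ hμ
  have h2 := jp_pos z μ
  have h3 := hw.sq hμ h
  have h4 := jp_sq z μ
  have h5 : 1 ≤ w z μ := by rw [hw.eq_norm z μ hμ h]; exact h
  exact ⟨by nlinarith, by nlinarith⟩

/-- Outside the unit ball the powers form a family closed under differentiation up to factors z_i
and μ; on the remaining compact set smoothness is enough. -/
theorem IsSmoothedNorm.sym_rp (hw : IsSmoothedNorm w) (t : ℝ) :
    Sym jp (fun z μ => jp z μ ^ t) Set.univ (rp w t) := by
  have hpos : ∀ (t : ℝ) (z : EuclideanSpace ℝ ι) (μ : ℝ), 0 < jp z μ ^ t := fun t z μ =>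
    Real.rpow_pos_of_pos (jp_pos z μ) t
  have h1 : Sym jp (fun z μ => jp z μ ^ t) (far ι 1) (rp w t) := by
    refine sym_of_family (fun t : ℝ => rp w t) (fun t z μ => jp z μ ^ t) (isOpen_far 1) jp_pos
      (fun t => hw.smoothPos.smooth_rp t) hpos (fun t => ⟨2 ^ |t|, fun z μ hμ hz => ?_⟩)
      (fun t o => ?_) t
    · have h := hw.le_jp hμ (le_of_lt hz)
      have h0 := hw.pos z μ hμ
      rw [rp, Complex.norm_real, Real.norm_of_nonneg (Real.rpow_nonneg h0.le t)]
      exact rpow_le_of_ratio h0 (jp_pos z μ) one_le_two (by linarith [jp_pos z μ]) h.2 t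
    · refine ⟨t - 2, fun z μ => (t / 2 : ℂ) * sqDeriv o z μ, fun z μ => (wfac jp o z μ)⁻¹, 1,
        (sym_sqDeriv_jp o).const_mul _, fun z μ hμ hz => ⟨hw.hderiv_rp t o z μ hμ hz,
          (inv_pos.2 (wfac_pos jp_pos o z μ)).le, ?_⟩⟩
      have h2 := wfac_pos (ρ := jp) jp_pos o z μ
      have h3 := jp_pos z μ
      have h4 : (jp z μ)⁻¹ ≤ wfac jp o z μ := by
        cases o with
        | none => exact le_rfl
        | some i => exact inv_anti₀ (bracket_pos z) (bracket_le_jp z μ)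
      rw [one_mul, inv_mul_le_iff₀ h2, Real.rpow_sub h3, Real.rpow_two, div_eq_mul_inv]
      have h5 : (jp z μ ^ 2)⁻¹ ≤ wfac jp o z μ * wfac jp o z μ := by
        rw [← inv_pow, pow_two]; gcongr
      nlinarith [hpos t z μ]
  have h2 : Sym jp (fun z μ => jp z μ ^ t) (far ι 1)ᶜ (rp w t) :=
    (hw.smoothPos.smooth_rp t).sym_of_isCompact (isCompact_compl_far 1) continuous_jp jp_pos
      (continuous_jp.rpow_const fun p => .inl (jp_pos _ _).ne') (hpos t)
  have h3 := h1.union h2 jp_pos fun z μ _ _ => (hpos t z μ).le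
  rwa [Set.union_compl_self] at h3

/-- The region where `⟨z⟩` is controlled by `⟨μ⟩`. -/
def inner (ι : Type*) [Fintype ι] : Set (EuclideanSpace ℝ ι × ℝ) := {p | bracket p.1 < 2 * bracket p.2}

lemma isOpen_inner : IsOpen (inner ι) :=
  isOpen_lt (continuous_bracket.comp continuous_fst)
    (continuous_const.mul (continuous_bracket.comp continuous_snd))

/-- Remainder of the expansion of `w^t` in powers of `⟨μ⟩`. -/
def powRem (w : EuclideanSpace ℝ ι → ℝ → ℝ) (K : ℕ) (t : ℝ) (z : EuclideanSpace ℝ ι) (μ : ℝ) : ℂ :=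
  rp w t z μ - ∑ k ∈ Finset.range K, (bc (t / 2) k : ℂ) * (quad z ^ k * rp jm (t - 2 * k) z μ)

lemma powRem_zero (t : ℝ) : powRem w 0 t = rp w t := by
  funext z μ; simp [powRem]

lemma powRem_succ (K : ℕ) (t : ℝ) : powRem w (K + 1) t = fun z μ => powRem w K t z μ +
    (-(bc (t / 2) K : ℂ)) * (quad z ^ K * rp jm (t - 2 * K) z μ) := by
  funext z μ
  rw [powRem, Finset.sum_range_succ, powRem]; ring

lemma smooth_quad_rp (K : ℕ) (s : ℝ) :
    Smooth (fun (z : EuclideanSpace ℝ ι) μ => quad z ^ K * rp jm s z μ) :=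
  (smooth_quad.pow K).mul (smoothPos_jm.smooth_rp s)

lemma smooth_powRem (hw : IsSmoothedNorm w) (K : ℕ) (t : ℝ) : Smooth (powRem w K t) := by
  induction K with
  | zero => rw [powRem_zero]; exact hw.smoothPos.smooth_rp t
  | succ K ih => rw [powRem_succ]; exact ih.add ((smooth_quad_rp K _).const_mul _)

/-- The expansion may be differentiated term by term: `bc_mul_sub` turns the coefficients for t/2
into those for t/2 - 1. The number of terms is unchanged because ∂_μ does not act on `quad`. -/
lemma hderiv_none_powRem (hw : IsSmoothedNorm w) (K : ℕ) (t : ℝ) : ∀ z μ, 0 ≤ μ →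
    (z, μ) ∈ far ι 1 → hderiv none (powRem w K t) z μ = (t * (μ : ℂ)) * powRem w K (t - 2) z μ := by
  intro z μ hμ hz
  induction K with
  | zero =>
    rw [powRem_zero, powRem_zero, hw.hderiv_rp t none z μ hμ hz, sqDeriv]; ring
  | succ K ih =>
    rw [powRem_succ, powRem_succ, hderiv_add (smooth_powRem hw K t)
      ((smooth_quad_rp K _).const_mul _) none z μ hμ]
    beta_reduce
    rw [ih, hderiv_const_mul (smooth_quad_rp K _) _ none z μ hμ]
    beta_reduce
    rw [hderiv_mul (smooth_quad.pow K) (smoothPos_jm.smooth_rp _) none z μ hμ]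
    beta_reduce
    rw [hderiv_rp_jm _ none z μ hμ, show hderiv none
      (fun (z : EuclideanSpace ℝ ι) (_ : ℝ) => quad z ^ K) z μ = 0 by simp [hderiv]]
    have h1 := bc_mul_sub (t / 2) K
    have h2 : ((bc (t / 2) K : ℝ) : ℂ) * (t - 2 * K) = t * ((bc (t / 2 - 1) K : ℝ) : ℂ) := by
      have : bc (t / 2) K * (t - 2 * K) = t * bc (t / 2 - 1) K := by linarith
      exact_mod_cast this
    rw [show (t - 2) / 2 = t / 2 - 1 by ring, show t - 2 * (K : ℝ) - 2 = t - 2 - 2 * K by ring]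
    simp only [if_true, zero_mul, zero_add]
    push_cast
    linear_combination (-(quad z ^ K * μ * rp jm (t - 2 - 2 * K) z μ)) * h2

/-- Here the derivative acts on `quad z ^ k` and lowers the degree, so one term is lost. For K = 0
the truncated subtraction gives the correct formula for w^t itself. -/
lemma hderiv_some_powRem (hw : IsSmoothedNorm w) (K : ℕ) (t : ℝ) (i : ι) : ∀ z μ, 0 ≤ μ →
    (z, μ) ∈ far ι 1 → hderiv (some i) (powRem w K t) z μ =
      (t * ((z i : ℝ) : ℂ)) * powRem w (K - 1) (t - 2) z μ := by
  intro z μ hμ hz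
  induction K with
  | zero =>
    rw [powRem_zero, Nat.zero_sub, powRem_zero, hw.hderiv_rp t (some i) z μ hμ hz, sqDeriv]; ring
  | succ K ih =>
    rw [powRem_succ, hderiv_add (smooth_powRem hw K t)
      ((smooth_quad_rp K _).const_mul _) (some i) z μ hμ]
    beta_reduce
    rw [ih, hderiv_const_mul (smooth_quad_rp K _) _ (some i) z μ hμ]
    beta_reduce
    rw [hderiv_mul (smooth_quad.pow K) (smoothPos_jm.smooth_rp _) (some i) z μ hμ]
    beta_reduce
    rw [hderiv_rp_jm _ (some i) z μ hμ]
    rcases K with _ | K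
    · simp [hderiv, cderiv]
    · rw [hderiv_pow_succ smooth_quad K (some i) z μ hμ]
      beta_reduce
      rw [hderiv_quad (some i) z μ hμ]
      simp only [Nat.add_sub_cancel]
      rw [powRem_succ]
      beta_reduce
      have h1 := bc_succ_mul' (t / 2) K
      have h2 : ((bc (t / 2) (K + 1) : ℝ) : ℂ) * (2 * (K + 1)) =
          t * ((bc (t / 2 - 1) K : ℝ) : ℂ) := by
        have : bc (t / 2) (K + 1) * (2 * (K + 1)) = t * bc (t / 2 - 1) K := by linarith
        exact_mod_cast this
      rw [show (t - 2) / 2 = t / 2 - 1 by ring,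
        show t - 2 * ((K + 1 : ℕ) : ℝ) = t - 2 - 2 * K by push_cast; ring]
      simp only [reduceCtorEq, if_false]
      linear_combination (-(quad z ^ K * ((z i : ℝ) : ℂ) * rp jm (t - 2 - 2 * K) z μ)) * h2

/-- For |(z, μ)| ≥ 1 one has w² = |z|² + μ² = ⟨μ⟩²(1 + (|z|² - 1)/⟨μ⟩²), so the statement reduces to
the one-variable binomial expansion with exponent t/2. -/
lemma powRem_eq_binomRem (hw : IsSmoothedNorm w) (K : ℕ) (t : ℝ) {z : EuclideanSpace ℝ ι} {μ : ℝ}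
    (hμ : 0 ≤ μ) (hz : 1 ≤ normParam z μ) : powRem w K t z μ =
      ((jm z μ ^ t * binomRem K (t / 2) ((‖z‖ ^ 2 - 1) / jm z μ ^ 2) : ℝ) : ℂ) := by
  have h1 := jm_pos z μ
  have h2 := hw.pos z μ hμ
  have h3 : w z μ ^ t = jm z μ ^ t * (1 + (‖z‖ ^ 2 - 1) / jm z μ ^ 2) ^ (t / 2) := by
    have h4 : ∀ x : ℝ, 0 ≤ x → x ^ t = (x ^ 2) ^ (t / 2) := fun x hx => by
      rw [← Real.rpow_natCast x 2, ← Real.rpow_mul hx]; congr 1; push_cast; ring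
    have h5 : w z μ ^ 2 = jm z μ ^ 2 * (1 + (‖z‖ ^ 2 - 1) / jm z μ ^ 2) := by
      rw [mul_add, mul_div_cancel₀ _ (by positivity), hw.sq hμ hz, jm_sq]; ring
    have h6 : 0 ≤ 1 + (‖z‖ ^ 2 - 1) / jm z μ ^ 2 := by
      by_contra h
      have := mul_neg_of_pos_of_neg (pow_pos h1 2) (not_le.1 h)
      rw [← h5] at this
      nlinarith
    rw [h4 _ h2.le, h4 _ h1.le, h5, Real.mul_rpow (by positivity) h6]
  rw [powRem, rp, h3, binomRem, mul_sub, Finset.mul_sum]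
  push_cast
  congr 1
  refine Finset.sum_congr rfl fun k _ => ?_
  rw [rp, quad, Real.rpow_sub h1, Real.rpow_mul h1.le, Real.rpow_two, Real.rpow_natCast]
  push_cast
  have h7 : ((jm z μ : ℝ) : ℂ) ≠ 0 := Complex.ofReal_ne_zero.2 h1.ne'
  rw [div_pow]
  field_simp

/-- The functions `powRem w K t`, for all K and t together, are closed under differentiation up to
factors z_i and μ. Their size is given by the binomial remainder at x = (|z|² - 1)/⟨μ⟩², and the
compact set omitted from `far` is treated by continuity. -/
theorem sym_powRem (hw : IsSmoothedNorm w) (K : ℕ) (t : ℝ) :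
    Sym jm (wTen (2 * K) (t - 2 * K)) (inner ι) (powRem w K t) := by
  have h1 : Sym jm (wTen (2 * K) (t - 2 * K)) (far ι 2 ∩ inner ι) (powRem w K t) := by
    refine sym_of_family (κ := ℕ × ℝ) (fun k => powRem w k.1 k.2)
      (fun k => wTen (2 * k.1) (k.2 - 2 * k.1)) ((isOpen_far 2).inter isOpen_inner) jm_pos
      (fun k => smooth_powRem hw k.1 k.2) (fun k => wTen_pos _ _) ?_ ?_ (K, t)
    · rintro ⟨K, t⟩
      obtain ⟨C, hC0, hC⟩ := exists_abs_binomRem_le K (t / 2)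
      refine ⟨C, fun z μ hμ hz => ?_⟩
      have hfar : 2 < normParam z μ := hz.1
      have hin : bracket z < 2 * jm z μ := hz.2
      have hn := normParam_sq z μ
      have hj := jm_pos z μ
      have hj2 := jm_sq z μ
      have hb := bracket_pos z
      have hb2 := bracket_sq z
      -- The upper bound comes from ⟨z⟩ < 2⟨μ⟩. The lower bound comes from |(z, μ)| > 2, which keeps
      -- 1 + x away from 0.
      have hx : (‖z‖ ^ 2 - 1) / jm z μ ^ 2 ∈ Set.Icc (-5 / 6 : ℝ) 4 := by
        constructor
        · rw [le_div_iff₀ (by positivity)]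
          nlinarith
        · rw [div_le_iff₀ (by positivity)]
          nlinarith
      have hxb : |(‖z‖ ^ 2 - 1) / jm z μ ^ 2| ≤ bracket z ^ 2 / jm z μ ^ 2 := by
        rw [abs_div, abs_of_pos (pow_pos hj 2)]
        gcongr
        rw [abs_le]
        constructor <;> nlinarith [sq_nonneg ‖z‖]
      rw [powRem_eq_binomRem hw K t hμ (by linarith), Complex.norm_real, norm_mul,
        Real.norm_of_nonneg (Real.rpow_nonneg hj.le t), Real.norm_eq_abs]
      calc jm z μ ^ t * |binomRem K (t / 2) ((‖z‖ ^ 2 - 1) / jm z μ ^ 2)|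
          ≤ jm z μ ^ t * (C * (bracket z ^ 2 / jm z μ ^ 2) ^ K) := by
            refine mul_le_mul_of_nonneg_left ((hC _ hx).trans ?_) (Real.rpow_nonneg hj.le t)
            exact mul_le_mul_of_nonneg_left (pow_le_pow_left₀ (abs_nonneg _) hxb K) hC0
        _ = C * wTen (2 * K) (t - 2 * K) z μ := by
            rw [wTen, Real.rpow_sub hj, Real.rpow_mul hb.le, Real.rpow_mul hj.le, Real.rpow_two,
              Real.rpow_two, Real.rpow_natCast, Real.rpow_natCast, div_pow]
            field_simp
    · rintro ⟨K, t⟩ o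
      have hfar : ∀ {z : EuclideanSpace ℝ ι} {μ : ℝ}, (z, μ) ∈ far ι 2 ∩ inner ι →
          (z, μ) ∈ far ι 1 := fun {z μ} h => lt_trans one_lt_two (show 2 < normParam z μ from h.1)
      cases o with
      | none =>
        refine ⟨(K, t - 2), fun z μ => (t : ℂ) * μ, jm, 1, (sym_param jm_pos abs_le_jm).const_mul t,
          fun z μ hμ hz => ⟨hderiv_none_powRem hw K t z μ hμ (hfar hz), (jm_pos z μ).le, ?_⟩⟩
        have hj := jm_pos z μ
        change _ ≤ 1 * (_ * (jm z μ)⁻¹)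
        simp only [wTen]
        rw [one_mul, show t - 2 - 2 * (K : ℝ) = t - 2 * K - 2 by ring, Real.rpow_sub hj _ 2,
          Real.rpow_two]
        exact le_of_eq (by field_simp)
      | some i =>
        refine ⟨(K - 1, t - 2), fun z μ => (t : ℂ) * ((z i : ℝ) : ℂ), fun z _ => bracket z, 4,
          (sym_coord jm_pos i).const_mul t,
          fun z μ hμ hz => ⟨hderiv_some_powRem hw K t i z μ hμ (hfar hz), (bracket_pos z).le, ?_⟩⟩
        have hj := jm_pos z μ
        have hb := bracket_pos z
        have hin : bracket z < 2 * jm z μ := hz.2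
        change _ ≤ 4 * (_ * (bracket z)⁻¹)
        simp only [wTen]
        -- For K = 0 the derivative provides only ⟨μ⟩⁻² together with a factor z_i. As ⟨z⟩ < 2⟨μ⟩,
        -- this is at most 4⟨z⟩⁻¹, as required.
        rcases K with _ | K
        · have : bracket z * (jm z μ ^ t / jm z μ ^ 2) ≤ 4 * (jm z μ ^ t * (bracket z)⁻¹) := by
            have hjt := Real.rpow_pos_of_pos hj t
            rw [← sub_nonneg]
            have e : 4 * (jm z μ ^ t * (bracket z)⁻¹) - bracket z * (jm z μ ^ t / jm z μ ^ 2) =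
                jm z μ ^ t * ((4 * jm z μ ^ 2 - bracket z ^ 2) / (bracket z * jm z μ ^ 2)) := by
              field_simp
            rw [e]
            have : 0 ≤ 4 * jm z μ ^ 2 - bracket z ^ 2 := by nlinarith
            positivity
          simpa [Real.rpow_sub hj _ 2, Real.rpow_two] using this
        · have e1 : t - 2 - 2 * ((K : ℕ) : ℝ) = t - 2 * ((K + 1 : ℕ) : ℝ) := by push_cast; ring
          have e2 : 2 * ((K + 1 : ℕ) : ℝ) = 2 * K + 2 := by push_cast; ring
          simp only [Nat.add_sub_cancel]
          rw [e1, e2, Real.rpow_add hb _ 2, Real.rpow_two]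
          have h0 := Real.rpow_pos_of_pos hj (t - (2 * K + 2))
          have h0' := Real.rpow_pos_of_pos hb (2 * K)
          have e3 : bracket z ^ (2 * K : ℝ) * bracket z ^ 2 * jm z μ ^ (t - (2 * K + 2)) *
            (bracket z)⁻¹ = bracket z * (bracket z ^ (2 * K : ℝ) * jm z μ ^ (t - (2 * K + 2))) := by
            field_simp
          rw [e3]
          linarith [mul_pos hb (mul_pos h0' h0)]
  have h2 : Sym jm (wTen (2 * K) (t - 2 * K)) (far ι 2)ᶜ (powRem w K t) :=
    (smooth_powRem hw K t).sym_of_isCompact (isCompact_compl_far 2) continuous_jm jm_pos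
      (continuous_wTen _ _) (wTen_pos _ _)
  refine (h1.union h2 jm_pos fun z μ _ _ => (wTen_pos _ _ z μ).le).subset fun p hp => ?_
  by_cases h : p ∈ far ι 2
  · exact .inl ⟨h, hp⟩
  · exact .inr h

end Powers

/-! ### Symbols independent of the parameter. -/

section Symbols

variable {ι : Type*} [Fintype ι] [DecidableEq ι] {m m' : ℝ} {f g : EuclideanSpace ℝ ι → ℂ}

lemma IsSymbol.sym (hf : IsSymbol m f) (Ω : Set (EuclideanSpace ℝ ι × ℝ))
    {ρ : EuclideanSpace ℝ ι → ℝ → ℝ} (hρ : ∀ z μ, 0 < ρ z μ) :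
    Sym ρ (fun z _ => bracket z ^ m) Ω (fun z _ => f z) :=
  ((isSymbol_iff ρ hρ).1 hf).subset (Set.subset_univ _)

lemma isSymbol_of_sym (h : Sym jm (fun z _ => bracket z ^ m) Set.univ (fun z _ => f z)) :
    IsSymbol m f := (isSymbol_iff jm jm_pos).2 h

lemma IsSymbol.mono (hf : IsSymbol m f) (h : m ≤ m') : IsSymbol m' f :=
  isSymbol_of_sym ((hf.sym Set.univ jm_pos).mono jm_pos 1
    (fun z _ _ _ => Real.rpow_nonneg (bracket_pos z).le _)
    fun z _ _ _ => by rw [one_mul]; exact Real.rpow_le_rpow_of_exponent_le (one_le_bracket z) h)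

lemma IsSymbol.mul (hf : IsSymbol m f) (hg : IsSymbol m' g) :
    IsSymbol (m + m') (fun z => f z * g z) :=
  isSymbol_of_sym (((hf.sym Set.univ jm_pos).mul (hg.sym Set.univ jm_pos)).mono jm_pos 1
    (fun z _ _ _ => by have := bracket_pos z; positivity)
    fun z _ _ _ => by rw [one_mul, Real.rpow_add (bracket_pos z)])

lemma IsSymbol.add (hf : IsSymbol m f) (hg : IsSymbol m g) : IsSymbol m (fun z => f z + g z) :=
  isSymbol_of_sym ((hf.sym Set.univ jm_pos).add (hg.sym Set.univ jm_pos))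

lemma IsSymbol.sub (hf : IsSymbol m f) (hg : IsSymbol m g) : IsSymbol m (fun z => f z - g z) :=
  isSymbol_of_sym ((hf.sym Set.univ jm_pos).sub (hg.sym Set.univ jm_pos))

lemma IsSymbol.const_mul (hf : IsSymbol m f) (c : ℂ) : IsSymbol m (fun z => c * f z) :=
  isSymbol_of_sym ((hf.sym Set.univ jm_pos).const_mul c)

lemma isSymbol_sum {κ : Type*} (s : Finset κ) {f : κ → EuclideanSpace ℝ ι → ℂ}
    (hf : ∀ i ∈ s, IsSymbol m (f i)) : IsSymbol m (fun z => ∑ i ∈ s, f i z) :=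
  isSymbol_of_sym (Sym.sum s fun i hi => (hf i hi).sym Set.univ jm_pos)

lemma isSymbol_const (c : ℂ) : IsSymbol 0 (fun _ : EuclideanSpace ℝ ι => c) :=
  isSymbol_of_sym (by simpa using sym_const c)

lemma isSymbol_quad_pow (k : ℕ) : IsSymbol (2 * k) (fun z : EuclideanSpace ℝ ι => quad z ^ k) := by
  induction k with
  | zero => simpa using isSymbol_const (ι := ι) 1
  | succ k ih =>
    have h2 : IsSymbol 2 (quad : EuclideanSpace ℝ ι → ℂ) := isSymbol_of_sym (sym_quad jm_pos)
    have := ih.mul h2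
    simp only [← pow_succ] at this
    convert this using 1
    push_cast; ring

lemma IsSymbol.cderiv (hf : IsSymbol m f) (i : ι) : IsSymbol (m - 1) (cderiv i f) := by
  refine isSymbol_of_sym (((hf.sym Set.univ jm_pos).hderiv (some i)).mono jm_pos 1
    (fun z μ _ _ => ?_) fun z μ _ _ => ?_)
  · have := bracket_pos z
    have := wfac_pos (ρ := jm) jm_pos (some i) z μ
    positivity
  · rw [one_mul, Real.rpow_sub (bracket_pos z), Real.rpow_one, div_eq_mul_inv]; rfl

end Symbols

/-! ### Comparison of weights inside and outside ⟨z⟩ < 2⟨μ⟩. -/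

section Weights

variable {ι : Type*} [Fintype ι] [DecidableEq ι] {z : EuclideanSpace ℝ ι} {μ : ℝ}

lemma wTen_shift (m s x : ℝ) (z : EuclideanSpace ℝ ι) (μ : ℝ) :
    wTen (m + x) (s - x) z μ = (bracket z / jm z μ) ^ x * wTen m s z μ := by
  have h1 := bracket_pos z
  have h2 := jm_pos z μ
  rw [wTen, wTen, Real.rpow_add h1, Real.rpow_sub h2, Real.div_rpow h1.le h2.le]
  ring

lemma wTen_le_inner (m s : ℝ) {x : ℝ} (hx : 0 ≤ x) (h : (z, μ) ∈ inner ι) :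
    wTen (m + x) (s - x) z μ ≤ 2 ^ x * wTen m s z μ := by
  have h1 := bracket_pos z
  have h2 := jm_pos z μ
  rw [wTen_shift]
  refine mul_le_mul_of_nonneg_right (Real.rpow_le_rpow (by positivity) ?_ hx) (wTen_pos _ _ _ _).le
  rw [div_le_iff₀ h2]
  exact le_of_lt h

lemma wTen_le_outer (m s : ℝ) {x : ℝ} (hx : 0 ≤ x) (h : (z, μ) ∉ inner ι) :
    wTen m s z μ ≤ wTen (m + x) (s - x) z μ := by
  have h1 := bracket_pos z
  have h2 := jm_pos z μ
  rw [wTen_shift]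
  refine le_mul_of_one_le_left (wTen_pos _ _ _ _).le (Real.one_le_rpow ?_ hx)
  rw [le_div_iff₀ h2]
  have : 2 * jm z μ ≤ bracket z := not_lt.1 h
  linarith

lemma jp_le_inner (h : (z, μ) ∈ inner ι) : jp z μ ≤ 3 * jm z μ := by
  have h1 := bracket_pos z
  have h2 := jm_pos z μ
  have h3 : bracket z < 2 * jm z μ := h
  refine abs_le_of_sq_le_sq' ?_ (by positivity) |>.2
  rw [jp_sq]
  nlinarith [jm_sq z μ, bracket_sq z]

lemma jp_le_outer (h : (z, μ) ∉ inner ι) : jp z μ ≤ 2 * bracket z := by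
  have h1 := bracket_pos z
  have h2 := jm_pos z μ
  have h3 : 2 * jm z μ ≤ bracket z := not_lt.1 h
  refine abs_le_of_sq_le_sq' ?_ (by positivity) |>.2
  rw [jp_sq]
  nlinarith [jm_sq z μ, bracket_sq z]

lemma wReg_le_wTen_inner (d ν : ℝ) (h : (z, μ) ∈ inner ι) :
    wReg d ν z μ ≤ 3 ^ |d - ν| * wTen ν (d - ν) z μ := by
  have h1 := Real.rpow_pos_of_pos (bracket_pos z) ν
  have h2 := rpow_le_of_ratio (jp_pos z μ) (jm_pos z μ) (by norm_num) (jp_le_inner h)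
    (by linarith [jm_le_jp z μ, jp_pos z μ]) (d - ν)
  rw [wReg, wTen]
  nlinarith

lemma wTen_le_wReg_inner (d ν : ℝ) (h : (z, μ) ∈ inner ι) :
    wTen ν (d - ν) z μ ≤ 3 ^ |d - ν| * wReg d ν z μ := by
  have h1 := Real.rpow_pos_of_pos (bracket_pos z) ν
  have h2 := rpow_le_of_ratio (jm_pos z μ) (jp_pos z μ) (by norm_num)
    (by linarith [jm_le_jp z μ, jp_pos z μ]) (jp_le_inner h) (d - ν)
  rw [wReg, wTen]
  nlinarith

lemma wReg_shift (d ν ν' : ℝ) (z : EuclideanSpace ℝ ι) (μ : ℝ) :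
    wReg d ν z μ = (bracket z / jp z μ) ^ (ν - ν') * wReg d ν' z μ := by
  have h1 := bracket_pos z
  have h2 := jp_pos z μ
  rw [wReg, wReg, Real.div_rpow h1.le h2.le, Real.rpow_sub h1, Real.rpow_sub h2, Real.rpow_sub h2,
    Real.rpow_sub h2]
  field_simp

/-- In the outer region ⟨z⟩ and ⟨z, μ⟩ are comparable, so the regularity number is irrelevant there.
Remainder estimates of every order then hold for each term separately. -/
lemma wReg_le_outer (d ν ν' : ℝ) (h : (z, μ) ∉ inner ι) :
    wReg d ν z μ ≤ 2 ^ |ν - ν'| * wReg d ν' z μ := by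
  have h1 := bracket_pos z
  have h2 := jp_pos z μ
  rw [wReg_shift d ν ν']
  refine mul_le_mul_of_nonneg_right ?_ (wReg_pos _ _ _ _).le
  have := rpow_le_of_ratio (x := bracket z / jp z μ) (y := 1) (K := 2) (by positivity) one_pos
    one_le_two ?_ ?_ (ν - ν')
  · simpa using this
  · rw [div_le_iff₀ h2]; linarith [bracket_le_jp z μ]
  · rw [← mul_div_assoc, le_div_iff₀ h2]; linarith [jp_le_outer h]

lemma wReg_le_wTen (d : ℝ) {ν : ℝ} (h : d ≤ ν) (z : EuclideanSpace ℝ ι) (μ : ℝ) :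
    wReg d ν z μ ≤ wTen ν (d - ν) z μ := by
  rw [wReg, wTen]
  exact mul_le_mul_of_nonneg_left (Real.rpow_le_rpow_of_nonpos (jm_pos z μ) (jm_le_jp z μ)
    (by linarith)) (Real.rpow_nonneg (bracket_pos z).le _)

end Weights

/-! ### Expansions in powers of ⟨μ⟩ instead of [z, μ]. -/

section Limit

variable {ι : Type*} [Fintype ι] [DecidableEq ι] {w : EuclideanSpace ℝ ι → ℝ → ℝ} {d ν : ℝ}
  {a b : EuclideanSpace ℝ ι → ℝ → ℂ} {L c : ℕ → EuclideanSpace ℝ ι → ℂ}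
  {Ω : Set (EuclideanSpace ℝ ι × ℝ)}

/-- Expansion of a symbol in powers of `⟨μ⟩`. -/
structure MuExp (d ν : ℝ) (a : EuclideanSpace ℝ ι → ℝ → ℂ) (c : ℕ → EuclideanSpace ℝ ι → ℂ) :
    Prop where
  coeff : ∀ j : ℕ, IsSymbol (ν + j) (c j)
  -- The estimate is confined to the inner region; a global one is obtained for N ≥ d - ν, see
  -- `MuExp.sym_univ`.
  remainder : ∀ N : ℕ, Sym jm (wTen (ν + N) (d - ν - N)) (inner ι)
    (fun z μ => a z μ - ∑ j ∈ Finset.range N, c j z * rp jm (d - ν - j) z μ)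

lemma sym_mul_rp_jm {m : ℝ} {f : EuclideanSpace ℝ ι → ℂ} (hf : IsSymbol m f) (s : ℝ) :
    Sym jm (wTen m s) Ω (fun z μ => f z * rp jm s z μ) :=
  (hf.sym Ω jm_pos).mul (sym_rp_jm s)

lemma sym_mul_rp (hw : IsSmoothedNorm w) {ν' : ℝ} {f : EuclideanSpace ℝ ι → ℂ}
    (hf : IsSymbol ν' f) {s : ℝ} (hs : s = d - ν') :
    Sym jp (wReg d ν') Set.univ (fun z μ => f z * rp w s z μ) := by
  subst hs
  exact (hf.sym Set.univ jp_pos).mul (hw.sym_rp _)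

/-- Coefficients of the expansion in powers of `⟨μ⟩` from those of the expansion in powers of
`w`. -/
def tilde (s : ℝ) (L : ℕ → EuclideanSpace ℝ ι → ℂ) (i : ℕ) (z : EuclideanSpace ℝ ι) : ℂ :=
  ∑ k ∈ Finset.range (i / 2 + 1),
    (bc ((s - (i - 2 * k : ℕ)) / 2) k : ℂ) * (L (i - 2 * k) z * quad z ^ k)

lemma tilde_zero (s : ℝ) (L : ℕ → EuclideanSpace ℝ ι → ℂ) : tilde s L 0 = L 0 := by
  funext z; simp [tilde]

lemma isSymbol_tilde (s : ℝ) (hL : ∀ j : ℕ, IsSymbol (ν + j) (L j)) (i : ℕ) :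
    IsSymbol (ν + i) (tilde s L i) := by
  refine isSymbol_sum _ fun k hk => IsSymbol.const_mul ?_ _
  have h := (hL (i - 2 * k)).mul (isSymbol_quad_pow (ι := ι) k)
  have hk' : 2 * k ≤ i := by have := Finset.mem_range.1 hk; omega
  convert h using 1
  rw [Nat.cast_sub hk']; push_cast; ring

/-- Expand w^{s-j} by (N - j + 1)/2 terms, that is, by all k with j + 2k < N, and collect terms
according to i = j + 2k. The exponent of ⟨μ⟩ is then s - i. -/
lemma sum_tilde (s : ℝ) (L : ℕ → EuclideanSpace ℝ ι → ℂ) (N : ℕ) (z : EuclideanSpace ℝ ι) (μ : ℝ) :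
    ∑ i ∈ Finset.range N, tilde s L i z * rp jm (s - i) z μ =
      ∑ j ∈ Finset.range N, L j z * rp w (s - j) z μ -
        ∑ j ∈ Finset.range N, L j z * powRem w ((N - j + 1) / 2) (s - j) z μ := by
  rw [← Finset.sum_sub_distrib]
  simp only [powRem, tilde, Finset.sum_mul, mul_sub, sub_sub_cancel, Finset.mul_sum]
  rw [Finset.sum_sigma', Finset.sum_sigma']
  refine Finset.sum_nbij' (fun p => ⟨p.1 - 2 * p.2, p.2⟩) (fun p => ⟨p.1 + 2 * p.2, p.2⟩) ?_ ?_ ?_ ?_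
    ?_
  · rintro ⟨i, k⟩ h
    simp only [Finset.mem_sigma, Finset.mem_range] at h ⊢
    omega
  · rintro ⟨i, k⟩ h
    simp only [Finset.mem_sigma, Finset.mem_range] at h ⊢
    omega
  · rintro ⟨i, k⟩ h
    simp only [Finset.mem_sigma, Finset.mem_range] at h ⊢
    congr 1; omega
  · rintro ⟨i, k⟩ h
    simp
  · rintro ⟨i, k⟩ h
    simp only [Finset.mem_sigma, Finset.mem_range] at h ⊢
    have hk' : 2 * k ≤ i := by omega
    have e : s - ((i - 2 * k : ℕ) : ℝ) - 2 * k = s - i := by rw [Nat.cast_sub hk']; push_cast; ring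
    rw [e]; ring

/-- With K = (N - j + 1)/2 one has j + 2K ≥ N, so each binomial remainder is of order at least N;
any excess is bounded because ⟨z⟩/⟨μ⟩ < 2 in the inner region. -/
lemma sym_sum_powRem (hw : IsSmoothedNorm w) (s : ℝ) (hL : ∀ j : ℕ, IsSymbol (ν + j) (L j))
    (N : ℕ) : Sym jm (wTen (ν + N) (s - N)) (inner ι)
      (fun z μ => ∑ j ∈ Finset.range N, L j z * powRem w ((N - j + 1) / 2) (s - j) z μ) := by
  refine Sym.sum _ fun j hj => ?_
  have hj' := Finset.mem_range.1 hj
  set K := (N - j + 1) / 2 with hK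
  have h := ((hL j).sym (inner ι) jm_pos).mul (sym_powRem hw K (s - j))
  have hx : (0 : ℝ) ≤ (j : ℝ) + 2 * K - N := by
    have : N ≤ j + 2 * K := by omega
    have : (N : ℝ) ≤ j + 2 * K := by exact_mod_cast this
    linarith
  refine h.mono jm_pos (2 ^ ((j : ℝ) + 2 * K - N)) (fun z μ _ _ => ?_) fun z μ _ hz => ?_
  · exact mul_nonneg (Real.rpow_nonneg (bracket_pos z).le _) (wTen_pos _ _ _ _).le
  · have := wTen_le_inner (ν + N) (s - N) hx hz
    refine le_trans (le_of_eq ?_) this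
    rw [wTen, wTen, ← mul_assoc, ← Real.rpow_add (bracket_pos z)]
    congr 2 <;> ring

theorem HasLimitExpansion.muExp (hw : IsSmoothedNorm w) (h : HasLimitExpansion w d ν a L) :
    MuExp d ν a (tilde (d - ν) L) := by
  refine ⟨isSymbol_tilde _ h.coeff, fun N => ?_⟩
  have h1 := (isRegSymbol_iff.1 (h.remainder N)).subset (Set.subset_univ (inner ι))
  have h2 := h1.change jp_pos jm_pos 1 (fun z μ _ _ => (wReg_pos _ _ z μ).le)
    (fun z μ _ _ => by rw [one_mul]; exact jm_le_jp z μ)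
  have h3 : Sym jm (wTen (ν + N) (d - ν - N)) (inner ι) _ := h2.mono jm_pos _
    (fun z μ _ _ => (wReg_pos _ _ z μ).le)
    (fun z μ _ hz => by
      have := wReg_le_wTen_inner d (ν + N) hz
      rwa [show d - (ν + N) = d - ν - N by ring] at this)
  refine (h3.add (sym_sum_powRem hw (d - ν) h.coeff N)).congr fun z μ _ => ?_
  rw [sum_tilde (w := w)]
  simp only [rp]
  ring

/-- Inverse of `tilde`. -/
def untilde (s : ℝ) (c : ℕ → EuclideanSpace ℝ ι → ℂ) (i : ℕ) (z : EuclideanSpace ℝ ι) : ℂ :=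
  c i z - ∑ k : Fin (i / 2), (bc ((s - (i - 2 * (k.1 + 1) : ℕ)) / 2) (k.1 + 1) : ℂ) *
    (untilde s c (i - 2 * (k.1 + 1)) z * quad z ^ (k.1 + 1))
termination_by i
decreasing_by have := k.2; omega

/-- The system is triangular with unit diagonal: the summand k = 0 of `tilde` is the coefficient
itself, and the others involve lower indices. -/
lemma tilde_untilde (s : ℝ) (c : ℕ → EuclideanSpace ℝ ι → ℂ) : tilde s (untilde s c) = c := by
  funext i z
  rw [tilde, Finset.sum_range_succ']
  conv_lhs => rw [untilde]
  rw [Finset.sum_range]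
  simp

lemma untilde_zero (s : ℝ) (c : ℕ → EuclideanSpace ℝ ι → ℂ) : untilde s c 0 = c 0 := by
  rw [← tilde_zero s (untilde s c), tilde_untilde]

lemma isSymbol_untilde (s : ℝ) (hc : ∀ j : ℕ, IsSymbol (ν + j) (c j)) (i : ℕ) :
    IsSymbol (ν + i) (untilde s c i) := by
  induction i using Nat.strong_induction_on with
  | _ i ih =>
    have : untilde s c i = fun z => c i z - ∑ k : Fin (i / 2),
        (bc ((s - (i - 2 * (k.1 + 1) : ℕ)) / 2) (k.1 + 1) : ℂ) *
        (untilde s c (i - 2 * (k.1 + 1)) z * quad z ^ (k.1 + 1)) := by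
      funext z; rw [untilde]
    rw [this]
    refine (hc i).sub (isSymbol_sum _ fun k _ => IsSymbol.const_mul ?_ _)
    have hk := k.2
    have hk' : 2 * (k.1 + 1) ≤ i := by omega
    have h := (ih (i - 2 * (k.1 + 1)) (by omega)).mul (isSymbol_quad_pow (ι := ι) (k.1 + 1))
    convert h using 1
    rw [Nat.cast_sub hk']; push_cast; ring

/-- In the inner region ⟨z, μ⟩ and ⟨μ⟩ are comparable, so the two kinds of remainder estimates
agree. In the outer region cancellation is not needed: by `wReg_le_outer` the symbol and every term
satisfy the estimate separately. -/
theorem MuExp.hasLimitExpansion (hw : IsSmoothedNorm w) (ha : IsRegSymbol d ν a)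
    (h : MuExp d ν a c) : HasLimitExpansion w d ν a (untilde (d - ν) c) := by
  have hL := isSymbol_untilde (d - ν) h.coeff
  refine ⟨hL, fun N => isRegSymbol_iff.2 ?_⟩
  have hin : Sym jp (wReg d (ν + N)) (inner ι) (fun z μ => a z μ -
      ∑ j ∈ Finset.range N, untilde (d - ν) c j z * rp w (d - ν - j) z μ) := by
    have h1 := (h.remainder N).sub (sym_sum_powRem hw (d - ν) hL N)
    have h2 := h1.change jm_pos jp_pos 3 (fun z μ _ _ => (wTen_pos _ _ z μ).le)
      (fun z μ _ hz => jp_le_inner hz)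
    have h3 : Sym jp (wReg d (ν + N)) (inner ι) _ := h2.mono jp_pos _
      (fun z μ _ _ => (wTen_pos _ _ z μ).le)
      (fun z μ _ hz => by
        have := wTen_le_wReg_inner d (ν + N) hz
        rwa [show d - (ν + N) = d - ν - N by ring] at this)
    refine h3.congr fun z μ _ => ?_
    have := sum_tilde (w := w) (d - ν) (untilde (d - ν) c) N z μ
    rw [tilde_untilde] at this
    beta_reduce
    rw [this]; ring
  have hout : Sym jp (wReg d (ν + N)) (inner ι)ᶜ (fun z μ => a z μ -
      ∑ j ∈ Finset.range N, untilde (d - ν) c j z * rp w (d - ν - j) z μ) := by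
    refine Sym.sub ?_ (Sym.sum _ fun j _ => ?_)
    · exact ((isRegSymbol_iff.1 ha).subset (Set.subset_univ _)).mono jp_pos _
        (fun z μ _ _ => (wReg_pos _ _ z μ).le) fun z μ _ hz => wReg_le_outer d ν (ν + N) hz
    · exact ((sym_mul_rp (d := d) hw (hL j) (by ring)).subset (Set.subset_univ _)).mono jp_pos _
        (fun z μ _ _ => (wReg_pos _ _ z μ).le) fun z μ _ hz => wReg_le_outer d (ν + j) (ν + N) hz
  have := hin.union hout jp_pos fun z μ _ _ => (wReg_pos _ _ z μ).le
  rwa [Set.union_compl_self] at this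

theorem isLimitSymbol_iff (hw : IsSmoothedNorm w) :
    IsLimitSymbol w d ν a ↔ IsRegSymbol d ν a ∧ ∃ c, MuExp d ν a c :=
  ⟨fun h => ⟨h.1, h.2.elim fun L hL => ⟨_, hL.muExp hw⟩⟩,
    fun h => ⟨h.1, h.2.elim fun c hc => ⟨_, hc.hasLimitExpansion hw h.1⟩⟩⟩

/-- Large remainders satisfy global estimates. -/
lemma MuExp.sym_univ (ha : IsRegSymbol d ν a) (h : MuExp d ν a c) {N : ℕ} (hN : d - ν ≤ N) :
    Sym jm (wTen (ν + N) (d - ν - N)) Set.univ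
      (fun z μ => a z μ - ∑ j ∈ Finset.range N, c j z * rp jm (d - ν - j) z μ) := by
  have hout : Sym jm (wTen (ν + N) (d - ν - N)) (inner ι)ᶜ
      (fun z μ => a z μ - ∑ j ∈ Finset.range N, c j z * rp jm (d - ν - j) z μ) := by
    refine Sym.sub ?_ (Sym.sum _ fun j hj => ?_)
    · have h1 := ((isRegSymbol_iff.1 ha).subset (Set.subset_univ (inner ι)ᶜ)).change jp_pos jm_pos 1
        (fun z μ _ _ => (wReg_pos _ _ z μ).le) (fun z μ _ _ => by rw [one_mul]; exact jm_le_jp z μ)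
      refine h1.mono jm_pos (2 ^ |ν - (ν + N)|) (fun z μ _ _ => (wReg_pos _ _ z μ).le)
        fun z μ _ hz => (wReg_le_outer d ν (ν + N) hz).trans ?_
      refine mul_le_mul_of_nonneg_left ?_ (by positivity)
      -- For N ≥ d - ν the exponent of ⟨z, μ⟩ is nonpositive, so ⟨z, μ⟩ may be replaced by the
      -- smaller ⟨μ⟩.
      have := wReg_le_wTen d (show d ≤ ν + N by linarith) z μ
      rwa [show d - (ν + N) = d - ν - N by ring] at this
    · have hj' : (j : ℝ) ≤ N := by exact_mod_cast (Finset.mem_range.1 hj).le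
      refine (sym_mul_rp_jm (h.coeff j) _).mono jm_pos 1 (fun z μ _ _ => (wTen_pos _ _ z μ).le)
        fun z μ _ hz => ?_
      have := wTen_le_outer (ν + j) (d - ν - j) (x := N - j) (by linarith) hz
      rwa [show ν + j + ((N : ℝ) - j) = ν + N by ring,
        show d - ν - j - ((N : ℝ) - j) = d - ν - N by ring, ← one_mul (wTen (ν + N) _ _ _)] at this
  have := (h.remainder N).union hout jm_pos fun z μ _ _ => (wTen_pos _ _ z μ).le
  rwa [Set.union_compl_self] at this

end Limit

/-! ### Bilinear operators acting fiberwise in μ. -/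

section Bilinear

variable {ι : Type*} [Fintype ι] [DecidableEq ι]

/-- Smooth functions of temperate growth. -/
def IsTemp (a : EuclideanSpace ℝ ι → ℝ → ℂ) : Prop := ∃ M, Temp M a

lemma IsTemp.smooth {a : EuclideanSpace ℝ ι → ℝ → ℂ} (ha : IsTemp a) : Smooth a :=
  ha.elim fun _ h => h.smooth

lemma IsTemp.add {a b : EuclideanSpace ℝ ι → ℝ → ℂ} (ha : IsTemp a) (hb : IsTemp b) :
    IsTemp (fun z μ => a z μ + b z μ) := by
  obtain ⟨M, ha⟩ := ha
  obtain ⟨M', hb⟩ := hb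
  have ha := ha.mono (le_max_left M M')
  have hb := hb.mono (le_max_right M M')
  refine ⟨max M M', ha.smooth.add hb.smooth, fun l => ?_⟩
  obtain ⟨C, hC0, hC⟩ := ha.bound l
  obtain ⟨C', hC0', hC'⟩ := hb.bound l
  refine ⟨C + C', by positivity, fun z μ hμ => ?_⟩
  rw [hd_add ha.smooth hb.smooth l z μ hμ, add_mul]
  exact (norm_add_le _ _).trans (add_le_add (hC z μ hμ) (hC' z μ hμ))

lemma isTemp_zero : IsTemp (fun (_ : EuclideanSpace ℝ ι) (_ : ℝ) => (0 : ℂ)) :=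
  ⟨0, smooth_const 0, fun l => ⟨0, le_rfl, fun z μ hμ => by rw [hd_zero l z μ hμ]; simp⟩⟩

lemma isTemp_sum {κ : Type*} (s : Finset κ) {f : κ → EuclideanSpace ℝ ι → ℝ → ℂ}
    (hf : ∀ k, IsTemp (f k)) : IsTemp (fun z μ => ∑ k ∈ s, f k z μ) := by
  classical
  induction s using Finset.induction_on with
  | empty => simpa using isTemp_zero
  | insert k s hk ih => simpa only [Finset.sum_insert hk] using (hf k).add ih

lemma IsTemp.congr {a b : EuclideanSpace ℝ ι → ℝ → ℂ} (ha : IsTemp a) (h : EqHalf b a) :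
    IsTemp b := by
  obtain ⟨M, ha⟩ := ha
  refine ⟨M, ha.smooth.congr h, fun l => ?_⟩
  obtain ⟨C, hC0, hC⟩ := ha.bound l
  exact ⟨C, hC0, fun z μ hμ => by rw [h.hd l z μ hμ]; exact hC z μ hμ⟩

/-- Bilinear operators that act on functions of `z`, for each `μ` separately, and map symbols to
symbols with a gain of `⟨z⟩^{-m}`. -/
structure FiberBilin (m : ℕ) (B : (EuclideanSpace ℝ ι → ℝ → ℂ) → (EuclideanSpace ℝ ι → ℝ → ℂ) →
    EuclideanSpace ℝ ι → ℝ → ℂ) : Prop where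
  sym : ∀ {ρ σ₁ σ₀ : EuclideanSpace ℝ ι → ℝ → ℝ} {a₁ a₀ : EuclideanSpace ℝ ι → ℝ → ℂ},
    Temperate ρ → (∀ z μ, 1 ≤ ρ z μ) → Temperate σ₁ → Temperate σ₀ → Sym ρ σ₁ Set.univ a₁ →
    Sym ρ σ₀ Set.univ a₀ →
    Sym ρ (fun z μ => σ₁ z μ * σ₀ z μ * (bracket z)⁻¹ ^ m) Set.univ (B a₁ a₀)
  add_left : ∀ {a a' b : EuclideanSpace ℝ ι → ℝ → ℂ}, IsTemp a → IsTemp a' → IsTemp b →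
    EqHalf (B (fun z μ => a z μ + a' z μ) b) (fun z μ => B a b z μ + B a' b z μ)
  add_right : ∀ {a b b' : EuclideanSpace ℝ ι → ℝ → ℂ}, IsTemp a → IsTemp b → IsTemp b' →
    EqHalf (B a (fun z μ => b z μ + b' z μ)) (fun z μ => B a b z μ + B a b' z μ)
  -- The value at μ depends only on the restrictions to this μ, and scalars may be taken out. The
  -- scalars will be powers of ⟨μ⟩, or 0 to treat empty sums.
  fiber : ∀ {a b a' b' : EuclideanSpace ℝ ι → ℝ → ℂ} {c c' : ℂ} {μ μ' : ℝ}, IsTemp a → IsTemp b →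
    IsTemp a' → IsTemp b' → 0 ≤ μ → 0 ≤ μ' → (∀ z, a z μ = c * a' z μ') →
    (∀ z, b z μ = c' * b' z μ') → ∀ z, B a b z μ = c * c' * B a' b' z μ'

variable {m : ℕ} {B : (EuclideanSpace ℝ ι → ℝ → ℂ) → (EuclideanSpace ℝ ι → ℝ → ℂ) →
    EuclideanSpace ℝ ι → ℝ → ℂ}

lemma FiberBilin.congr (hB : FiberBilin m B) {a b a' b' : EuclideanSpace ℝ ι → ℝ → ℂ}
    (ha : IsTemp a) (hb : IsTemp b) (h : EqHalf a' a) (h' : EqHalf b' b) :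
    EqHalf (B a' b') (B a b) := by
  intro z μ hμ
  simpa using hB.fiber (c := 1) (c' := 1) (ha.congr h) (hb.congr h') ha hb hμ hμ
    (fun z => by simpa using h z μ hμ) (fun z => by simpa using h' z μ hμ) z

lemma FiberBilin.sum_left (hB : FiberBilin m B) {κ : Type*} (s : Finset κ)
    {f : κ → EuclideanSpace ℝ ι → ℝ → ℂ} {b : EuclideanSpace ℝ ι → ℝ → ℂ}
    (hf : ∀ k, IsTemp (f k)) (hb : IsTemp b) :
    EqHalf (B (fun z μ => ∑ k ∈ s, f k z μ) b) (fun z μ => ∑ k ∈ s, B (f k) b z μ) := by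
  classical
  induction s using Finset.induction_on with
  | empty =>
    intro z μ hμ
    have := hB.fiber (c := 0) (c' := 1) isTemp_zero hb isTemp_zero hb hμ hμ (fun z => by simp)
      (fun z => by simp) z
    simpa using this
  | insert k s hk ih =>
    simp only [Finset.sum_insert hk]
    refine (hB.add_left (hf k) (isTemp_sum s hf) hb).trans fun z μ hμ => ?_
    beta_reduce
    rw [ih z μ hμ]

lemma FiberBilin.sum_right (hB : FiberBilin m B) {κ : Type*} (s : Finset κ)
    {f : κ → EuclideanSpace ℝ ι → ℝ → ℂ} {a : EuclideanSpace ℝ ι → ℝ → ℂ}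
    (ha : IsTemp a) (hf : ∀ k, IsTemp (f k)) :
    EqHalf (B a (fun z μ => ∑ k ∈ s, f k z μ)) (fun z μ => ∑ k ∈ s, B a (f k) z μ) := by
  classical
  induction s using Finset.induction_on with
  | empty =>
    intro z μ hμ
    have := hB.fiber (c := 1) (c' := 0) ha isTemp_zero ha isTemp_zero hμ hμ (fun z => by simp)
      (fun z => by simp) z
    simpa using this
  | insert k s hk ih =>
    simp only [Finset.sum_insert hk]
    refine (hB.add_right ha (hf k) (isTemp_sum s hf)).trans fun z μ hμ => ?_
    beta_reduce
    rw [ih z μ hμ]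

/-- The action of a fiberwise operator on functions of `z`. -/
def onFiber (B : (EuclideanSpace ℝ ι → ℝ → ℂ) → (EuclideanSpace ℝ ι → ℝ → ℂ) →
    EuclideanSpace ℝ ι → ℝ → ℂ) (f g : EuclideanSpace ℝ ι → ℂ) (z : EuclideanSpace ℝ ι) : ℂ :=
  B (fun z _ => f z) (fun z _ => g z) z 0

lemma temperate_rpow_bracket (s : ℝ) :
    Temperate (fun (z : EuclideanSpace ℝ ι) (_ : ℝ) => bracket z ^ s) :=
  temperate_bracket.rpow (fun z _ => one_le_bracket z) s

lemma IsSymbol.isTemp {s : ℝ} {f : EuclideanSpace ℝ ι → ℂ} (hf : IsSymbol s f) :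
    IsTemp (fun z (_ : ℝ) => f z) :=
  (hf.sym Set.univ jm_pos).temp one_le_jm (temperate_rpow_bracket s)

lemma IsRegSymbol.isTemp {d ν : ℝ} {a : EuclideanSpace ℝ ι → ℝ → ℂ} (ha : IsRegSymbol d ν a) :
    IsTemp a :=
  (isRegSymbol_iff.1 ha).temp one_le_jp (temperate_wReg d ν)

lemma FiberBilin.isSymbol_onFiber (hB : FiberBilin m B) {s t : ℝ} {f g : EuclideanSpace ℝ ι → ℂ}
    (hf : IsSymbol s f) (hg : IsSymbol t g) : IsSymbol (s + t - m) (onFiber B f g) := by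
  have h := hB.sym temperate_jm one_le_jm (temperate_rpow_bracket s) (temperate_rpow_bracket t)
    (hf.sym Set.univ jm_pos) (hg.sym Set.univ jm_pos)
  refine isSymbol_of_sym ((h.mono (σ' := fun z _ => bracket z ^ (s + t - m)) jm_pos 1
    (fun z _ _ _ => by have := bracket_pos z; positivity) fun z _ _ _ => ?_).congr
      fun z μ hμ => ?_)
  · rw [one_mul, ← rpow_mul_inv_pow (bracket_pos z), Real.rpow_add (bracket_pos z)]
  · simpa [onFiber] using hB.fiber (c := 1) (c' := 1) hf.isTemp hg.isTemp hf.isTemp hg.isTemp le_rfl hμ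
      (fun z => by simp) (fun z => by simp) z

theorem FiberBilin.isRegSymbol (hB : FiberBilin m B) {d₁ ν₁ d₀ ν₀ : ℝ}
    {a₁ a₀ : EuclideanSpace ℝ ι → ℝ → ℂ} (h₁ : IsRegSymbol d₁ ν₁ a₁) (h₀ : IsRegSymbol d₀ ν₀ a₀) :
    IsRegSymbol (d₀ + d₁ - m) (ν₀ + ν₁ - m) (B a₁ a₀) := by
  refine isRegSymbol_iff.2 ((hB.sym temperate_jp one_le_jp (temperate_wReg d₁ ν₁)
    (temperate_wReg d₀ ν₀) (isRegSymbol_iff.1 h₁) (isRegSymbol_iff.1 h₀)).mono jp_pos 1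
    (fun z μ _ _ => ?_) fun z μ _ _ => ?_)
  · have := wReg_pos d₁ ν₁ z μ
    have := wReg_pos d₀ ν₀ z μ
    have := bracket_pos z
    positivity
  · rw [one_mul]
    refine le_of_eq ?_
    have h1 := bracket_pos z
    have h2 := jp_pos z μ
    simp only [wReg]
    rw [show d₀ + d₁ - (m : ℝ) - (ν₀ + ν₁ - m) = (d₁ - ν₁) + (d₀ - ν₀) by ring,
      show ν₀ + ν₁ - (m : ℝ) = ν₁ + ν₀ - m by ring, ← rpow_mul_inv_pow h1, Real.rpow_add h1,
      Real.rpow_add h2]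
    ring

/-- Each symbol is a sum of J terms c_i ⟨μ⟩^{s-i} and a remainder, all with global estimates in
separated weights. The operator applied to the i-th and k-th pieces is of order i + k. If i + k < N,
neither piece is a remainder, the powers of ⟨μ⟩ factor out and the result is a genuine term of the
expansion. If i + k ≥ N, it belongs to the remainder in the inner region. -/
theorem FiberBilin.muExp (hB : FiberBilin m B) {d₁ ν₁ d₀ ν₀ : ℝ}
    {a₁ a₀ : EuclideanSpace ℝ ι → ℝ → ℂ} {c₁ c₀ : ℕ → EuclideanSpace ℝ ι → ℂ}
    (h₁ : IsRegSymbol d₁ ν₁ a₁) (h₀ : IsRegSymbol d₀ ν₀ a₀) (e₁ : MuExp d₁ ν₁ a₁ c₁)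
    (e₀ : MuExp d₀ ν₀ a₀ c₀) :
    MuExp (d₀ + d₁ - m) (ν₀ + ν₁ - m) (B a₁ a₀)
      (fun j z => ∑ p ∈ Finset.HasAntidiagonal.antidiagonal j, onFiber B (c₁ p.1) (c₀ p.2) z) := by
  refine ⟨fun j => isSymbol_sum _ fun p hp => ?_, fun N => ?_⟩
  · have := hB.isSymbol_onFiber (e₁.coeff p.1) (e₀.coeff p.2)
    convert this using 1
    have h : (j : ℝ) = p.1 + p.2 := by rw [← Finset.HasAntidiagonal.mem_antidiagonal.1 hp]; push_cast; ring
    rw [h]; ring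
  set s₁ := d₁ - ν₁ with hs₁
  set s₀ := d₀ - ν₀ with hs₀
  have hs : d₀ + d₁ - (m : ℝ) - (ν₀ + ν₁ - m) = s₁ + s₀ := by rw [hs₁, hs₀]; ring
  rw [hs]
  -- The operator is not assumed local in z, so remainder estimates in the inner region alone would
  -- be useless. This choice makes both remainders satisfy the global estimates of `MuExp.sym_univ`,
  -- and J ≥ N keeps them out of the terms with i + k < N.
  set J : ℕ := max N (max ⌈s₁⌉₊ ⌈s₀⌉₊) with hJ
  have hJN : N ≤ J := le_max_left _ _
  have hJ1 : s₁ ≤ J := (Nat.le_ceil _).trans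
    (by exact_mod_cast (le_max_left _ _).trans (le_max_right N (max ⌈s₁⌉₊ ⌈s₀⌉₊)))
  have hJ0 : s₀ ≤ J := (Nat.le_ceil _).trans
    (by exact_mod_cast (le_max_right _ _).trans (le_max_right N (max ⌈s₁⌉₊ ⌈s₀⌉₊)))
  have pieces : ∀ {d ν : ℝ} {a : EuclideanSpace ℝ ι → ℝ → ℂ} {c : ℕ → EuclideanSpace ℝ ι → ℂ},
      IsRegSymbol d ν a → MuExp d ν a c → d - ν ≤ J → ∃ x : ℕ → EuclideanSpace ℝ ι → ℝ → ℂ,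
        (∀ i : ℕ, Sym jm (wTen (ν + i) (d - ν - i)) Set.univ (x i)) ∧
        (∀ i < J, x i = fun z μ => c i z * rp jm (d - ν - i) z μ) ∧
        ∀ z μ, a z μ = ∑ i ∈ Finset.range (J + 1), x i z μ := by
    intro d ν a c h e hJ
    refine ⟨fun i => if i = J then
      (fun z μ => a z μ - ∑ j ∈ Finset.range J, c j z * rp jm (d - ν - j) z μ) else
      fun z μ => c i z * rp jm (d - ν - i) z μ, fun i => ?_, fun i hi => if_neg hi.ne, fun z μ => ?_⟩
    · by_cases hi : i = J
      · subst hi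
        simpa using e.sym_univ h hJ
      · simpa [hi] using sym_mul_rp_jm (Ω := Set.univ) (e.coeff i) (d - ν - i)
    · beta_reduce
      rw [Finset.sum_range_succ, if_pos rfl, Finset.sum_congr rfl fun i hi => by
        rw [if_neg (Finset.mem_range.1 hi).ne]]
      ring
  obtain ⟨x, hx, hxe, hxs⟩ := pieces h₁ e₁ hJ1
  obtain ⟨y, hy, hye, hys⟩ := pieces h₀ e₀ hJ0
  have hxt : ∀ i, IsTemp (x i) := fun i => (hx i).temp one_le_jm (temperate_wTen _ _)
  have hyt : ∀ i, IsTemp (y i) := fun i => (hy i).temp one_le_jm (temperate_wTen _ _)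
  have hxy : ∀ i k, Sym jm (wTen (ν₀ + ν₁ - m + (i + k : ℕ)) (s₁ + s₀ - (i + k : ℕ))) Set.univ
      (B (x i) (y k)) := by
    intro i k
    refine (hB.sym temperate_jm one_le_jm (temperate_wTen _ _) (temperate_wTen _ _) (hx i)
      (hy k)).mono jm_pos 1 (fun z μ _ _ => ?_) fun z μ _ _ => ?_
    · have := wTen_pos (ν₁ + i) (d₁ - ν₁ - i) z μ
      have := wTen_pos (ν₀ + k) (d₀ - ν₀ - k) z μ
      have := bracket_pos z
      positivity
    · rw [one_mul]
      refine le_of_eq ?_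
      have h1 := bracket_pos z
      have h2 := jm_pos z μ
      simp only [wTen]
      rw [show s₁ + s₀ - ((i + k : ℕ) : ℝ) = (d₁ - ν₁ - i) + (d₀ - ν₀ - k) by push_cast; ring,
        show ν₀ + ν₁ - (m : ℝ) + (i + k : ℕ) = (ν₁ + i) + (ν₀ + k) - m by push_cast; ring,
        ← rpow_mul_inv_pow h1, Real.rpow_add h1 (ν₁ + i) (ν₀ + k),
        Real.rpow_add h2 (d₁ - ν₁ - i) (d₀ - ν₀ - k)]
      ring
  have hsplit : EqHalf (B a₁ a₀) (fun z μ => ∑ i ∈ Finset.range (J + 1),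
      ∑ k ∈ Finset.range (J + 1), B (x i) (y k) z μ) := by
    refine (hB.congr (isTemp_sum (Finset.range (J + 1)) hxt) (isTemp_sum (Finset.range (J + 1)) hyt)
      (fun z μ _ => hxs z μ) (fun z μ _ => hys z μ)).trans ?_
    refine (hB.sum_left _ hxt (isTemp_sum _ hyt)).trans fun z μ hμ => ?_
    exact Finset.sum_congr rfl fun i _ => hB.sum_right _ (hxt i) hyt z μ hμ
  have hmain : ∀ i k, i < J → k < J → EqHalf (B (x i) (y k))
      (fun z μ => onFiber B (c₁ i) (c₀ k) z * rp jm (s₁ + s₀ - (i + k : ℕ)) z μ) := by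
    intro i k hi hk z μ hμ
    have := hB.fiber (c := rp jm (s₁ - i) (0 : EuclideanSpace ℝ ι) μ)
      (c' := rp jm (s₀ - k) (0 : EuclideanSpace ℝ ι) μ) (hxt i) (hyt k)
      (e₁.coeff i).isTemp (e₀.coeff k).isTemp hμ le_rfl
      (fun z => by rw [hxe i hi, mul_comm]; rfl) (fun z => by rw [hye k hk, mul_comm]; rfl) z
    beta_reduce
    rw [this, show s₁ + s₀ - ((i + k : ℕ) : ℝ) = (s₁ - i) + (s₀ - k) by push_cast; ring,
      rp_add smoothPos_jm _ _ z μ hμ, mul_comm]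
    rfl
  have hsum : EqHalf (fun z μ => ∑ j ∈ Finset.range N,
      (∑ p ∈ Finset.HasAntidiagonal.antidiagonal j, onFiber B (c₁ p.1) (c₀ p.2) z) * rp jm (s₁ + s₀ - j) z μ)
      (fun z μ => ∑ p ∈ (Finset.range (J + 1) ×ˢ Finset.range (J + 1)).filter
        (fun p => p.1 + p.2 < N), B (x p.1) (y p.2) z μ) := by
    intro z μ hμ
    simp only [Finset.sum_mul]
    rw [Finset.sum_sigma']
    refine Finset.sum_nbij' (fun p => p.2) (fun p => ⟨p.1 + p.2, p⟩) ?_ ?_ ?_ ?_ ?_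
    · rintro ⟨i, p⟩ h
      simp only [Finset.mem_sigma, Finset.mem_range, Finset.HasAntidiagonal.mem_antidiagonal, Finset.mem_filter,
        Finset.mem_product] at h ⊢
      omega
    · rintro p h
      simp only [Finset.mem_sigma, Finset.mem_range, Finset.HasAntidiagonal.mem_antidiagonal]
      exact ⟨(Finset.mem_filter.1 h).2, trivial⟩
    · rintro ⟨i, p⟩ h
      simp only [Finset.mem_sigma, Finset.HasAntidiagonal.mem_antidiagonal] at h
      rw [h.2]
    · rintro p h
      rfl
    · rintro ⟨i, p⟩ h
      simp only [Finset.mem_sigma, Finset.mem_range, Finset.HasAntidiagonal.mem_antidiagonal] at h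
      rw [hmain p.1 p.2 (by omega) (by omega) z μ hμ, h.2]
  have hfin : Sym jm (wTen (ν₀ + ν₁ - m + N) (s₁ + s₀ - N)) (inner ι) (fun z μ =>
      ∑ p ∈ (Finset.range (J + 1) ×ˢ Finset.range (J + 1)).filter
        (fun p => ¬ p.1 + p.2 < N), B (x p.1) (y p.2) z μ) := by
    refine Sym.sum _ fun p hp => ?_
    have hp' : (N : ℝ) ≤ ((p.1 + p.2 : ℕ) : ℝ) := by
      exact_mod_cast not_lt.1 (Finset.mem_filter.1 hp).2
    refine ((hxy p.1 p.2).subset (Set.subset_univ _)).mono jm_pos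
      (2 ^ (((p.1 + p.2 : ℕ) : ℝ) - N)) (fun z μ _ _ => (wTen_pos _ _ z μ).le) fun z μ _ hz => ?_
    have := wTen_le_inner (ν₀ + ν₁ - m + N) (s₁ + s₀ - N) (sub_nonneg.2 hp') hz
    rwa [show ν₀ + ν₁ - (m : ℝ) + N + (((p.1 + p.2 : ℕ) : ℝ) - N) =
        ν₀ + ν₁ - m + ((p.1 + p.2 : ℕ) : ℝ) by ring,
      show s₁ + s₀ - (N : ℝ) - (((p.1 + p.2 : ℕ) : ℝ) - N) = s₁ + s₀ - ((p.1 + p.2 : ℕ) : ℝ) by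
        ring] at this
  refine hfin.congr fun z μ hμ => ?_
  beta_reduce
  rw [hsplit z μ hμ]
  have := hsum z μ hμ
  beta_reduce at this
  rw [this, sub_eq_iff_eq_add']
  beta_reduce
  rw [← Finset.sum_product']
  exact (Finset.sum_filter_add_sum_filter_not (Finset.range (J + 1) ×ˢ Finset.range (J + 1))
    (fun p : ℕ × ℕ => p.1 + p.2 < N) (fun p => B (x p.1) (y p.2) z μ)).symm

theorem FiberBilin.isLimitSymbol (hB : FiberBilin m B) {w : EuclideanSpace ℝ ι → ℝ → ℝ}
    (hw : IsSmoothedNorm w) {d₁ ν₁ d₀ ν₀ : ℝ} {a₁ a₀ : EuclideanSpace ℝ ι → ℝ → ℂ}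
    (h₁ : IsLimitSymbol w d₁ ν₁ a₁) (h₀ : IsLimitSymbol w d₀ ν₀ a₀) :
    IsLimitSymbol w (d₀ + d₁ - m) (ν₀ + ν₁ - m) (B a₁ a₀) := by
  obtain ⟨r₁, c₁, e₁⟩ := (isLimitSymbol_iff hw).1 h₁
  obtain ⟨r₀, c₀, e₀⟩ := (isLimitSymbol_iff hw).1 h₀
  exact (isLimitSymbol_iff hw).2 ⟨hB.isRegSymbol r₁ r₀, _, hB.muExp r₁ r₀ e₁ e₀⟩

/-- Thus pointwise products of limit symbols are covered by the same theorem as Leibniz products. -/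
lemma fiberBilin_mul : FiberBilin (ι := ι) 0 (fun a b z μ => a z μ * b z μ) where
  sym _ _ _ _ h₁ h₀ := by simpa using h₁.mul h₀
  add_left _ _ _ := fun z μ _ => by ring
  add_right _ _ _ := fun z μ _ => by ring
  fiber _ _ _ _ _ _ h h' z := by rw [h, h']; ring

end Bilinear

/-! ### The Leibniz remainders as fiberwise operators. -/

section Leibniz

variable {n : ℕ}

lemma taylorTerm_add_left (k : ℕ) {f f' g : Config n → ℂ} (hf : ContDiff ℝ ∞ f)
    (hf' : ContDiff ℝ ∞ f') :
    taylorTerm k (fun y => f y + f' y) g = taylorTerm k f g + taylorTerm k f' g := by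
  simp only [taylorTerm, pd_add hf hf', ← Finset.sum_add_distrib]
  exact Finset.sum_congr rfl fun α _ => by ring

lemma taylorTerm_add_right (k : ℕ) {f g g' : Config n → ℂ} (hg : ContDiff ℝ ∞ g)
    (hg' : ContDiff ℝ ∞ g') :
    taylorTerm k f (fun y => g y + g' y) = taylorTerm k f g + taylorTerm k f g' := by
  simp only [taylorTerm, pd_add hg hg', ← Finset.sum_add_distrib]
  exact Finset.sum_congr rfl fun α _ => by ring

lemma taylorTerm_const_mul (k : ℕ) {f g : Config n → ℂ} (hf : ContDiff ℝ ∞ f)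
    (hg : ContDiff ℝ ∞ g) (c c' : ℂ) :
    taylorTerm k (fun y => c * f y) (fun y => c' * g y) = c * c' * taylorTerm k f g := by
  simp only [taylorTerm, pd_const_mul hf, pd_const_mul hg, Finset.mul_sum]
  exact Finset.sum_congr rfl fun α _ => by ring

lemma IsTemp.tempered_slice {a : Phase n → ℝ → ℂ} (ha : IsTemp a) {s : Fin n → Fin n ⊕ Fin n}
    (hs : Function.Injective s) (z : Phase n) {μ : ℝ} (hμ : 0 ≤ μ) :
    Tempered (slice s a (z, μ)) :=
  ha.elim fun _ h => h.tempered_slice (z, μ) hs hμ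

/-- Taking N = 0 gives the product itself, so the mapping property and the asymptotic expansion are
instances of one result. -/
theorem fiberBilin_leibnizRem (N : ℕ) : FiberBilin (2 * N) (leibnizRem (n := n) N) where
  sym hρ hρ1 hσ₁ hσ₀ h₁ h₀ := sym_leibnizRem hρ hρ1 hσ₁ hσ₀ h₁ h₀ N
  add_left {a a' b} ha ha' hb := fun z μ hμ => by
    have h1 := ha.tempered_slice Sum.inr_injective z hμ
    have h2 := ha'.tempered_slice Sum.inr_injective z hμ
    have h3 := hb.tempered_slice Sum.inl_injective z hμ
    beta_reduce
    rw [leibnizRem_eq (ha.smooth.add ha'.smooth) hb.smooth N hμ, leibnizRem_eq ha.smooth hb.smooth N hμ,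
      leibnizRem_eq ha'.smooth hb.smooth N hμ]
    change oscRem N (fun y => slice Sum.inr a (z, μ) y + slice Sum.inr a' (z, μ) y) _ = _
    simp only [oscRem, oscForm_add_left h1 h2 h3, taylorTerm_add_left _ h1.contDiff h2.contDiff,
      Finset.sum_add_distrib]
    ring
  add_right {a b b'} ha hb hb' := fun z μ hμ => by
    have h1 := ha.tempered_slice Sum.inr_injective z hμ
    have h2 := hb.tempered_slice Sum.inl_injective z hμ
    have h3 := hb'.tempered_slice Sum.inl_injective z hμ
    beta_reduce
    rw [leibnizRem_eq ha.smooth (hb.smooth.add hb'.smooth) N hμ, leibnizRem_eq ha.smooth hb.smooth N hμ,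
      leibnizRem_eq ha.smooth hb'.smooth N hμ]
    change oscRem N _ (fun y => slice Sum.inl b (z, μ) y + slice Sum.inl b' (z, μ) y) = _
    simp only [oscRem, oscForm_add_right h1 h2 h3, taylorTerm_add_right _ h2.contDiff h3.contDiff,
      Finset.sum_add_distrib]
    ring
  fiber {a b a' b' c c' μ μ'} ha hb ha' hb' hμ hμ' h h' z := by
    have h1 := ha'.tempered_slice Sum.inr_injective z hμ'
    have h2 := hb'.tempered_slice Sum.inl_injective z hμ'
    rw [leibnizRem_eq ha.smooth hb.smooth N hμ, leibnizRem_eq ha'.smooth hb'.smooth N hμ']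
    have e1 : slice Sum.inr a (z, μ) = fun y => c * slice Sum.inr a' (z, μ') y :=
      funext fun y => h _
    have e2 : slice Sum.inl b (z, μ) = fun y => c' * slice Sum.inl b' (z, μ') y :=
      funext fun y => h' _
    rw [e1, e2]
    simp only [oscRem, oscForm_const_mul_left h1 (h2.const_mul c'), oscForm_const_mul_right h1 h2,
      taylorTerm_const_mul _ h1.contDiff h2.contDiff, ← Finset.mul_sum]
    ring

end Leibniz

/-! ### Closure properties of limit symbols. -/

section Closure

variable {ι : Type*} [Fintype ι] [DecidableEq ι] {w : EuclideanSpace ℝ ι → ℝ → ℝ} {d ν : ℝ}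
  {a b : EuclideanSpace ℝ ι → ℝ → ℂ} {L c c' : ℕ → EuclideanSpace ℝ ι → ℂ}

lemma IsRegSymbol.congr (ha : IsRegSymbol d ν a) (h : EqHalf b a) : IsRegSymbol d ν b :=
  isRegSymbol_iff.2 ((isRegSymbol_iff.1 ha).congr h)

lemma MuExp.congr (ha : MuExp d ν a c) (h : EqHalf b a) : MuExp d ν b c :=
  ⟨ha.coeff, fun N => (ha.remainder N).congr fun z μ hμ => by simp only [h z μ hμ]⟩

lemma MuExp.add (ha : MuExp d ν a c) (hb : MuExp d ν b c') :
    MuExp d ν (fun z μ => a z μ + b z μ) (fun j z => c j z + c' j z) :=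
  ⟨fun j => (ha.coeff j).add (hb.coeff j), fun N =>
    ((ha.remainder N).add (hb.remainder N)).congr fun z μ _ => by
      simp only [add_mul, Finset.sum_add_distrib]; ring⟩

lemma MuExp.const_mul (ha : MuExp d ν a c) (k : ℂ) :
    MuExp d ν (fun z μ => k * a z μ) (fun j z => k * c j z) :=
  ⟨fun j => (ha.coeff j).const_mul k, fun N =>
    ((ha.remainder N).const_mul k).congr fun z μ _ => by
      simp only [mul_assoc, ← Finset.mul_sum, mul_sub]⟩

lemma IsLimitSymbol.congr (hw : IsSmoothedNorm w) (ha : IsLimitSymbol w d ν a) (h : EqHalf b a) :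
    IsLimitSymbol w d ν b := by
  obtain ⟨h1, c, h2⟩ := (isLimitSymbol_iff hw).1 ha
  exact (isLimitSymbol_iff hw).2 ⟨h1.congr h, c, h2.congr h⟩

lemma IsLimitSymbol.add (hw : IsSmoothedNorm w) (ha : IsLimitSymbol w d ν a)
    (hb : IsLimitSymbol w d ν b) : IsLimitSymbol w d ν (fun z μ => a z μ + b z μ) := by
  obtain ⟨h1, c, h2⟩ := (isLimitSymbol_iff hw).1 ha
  obtain ⟨h1', c', h2'⟩ := (isLimitSymbol_iff hw).1 hb
  exact (isLimitSymbol_iff hw).2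
    ⟨isRegSymbol_iff.2 ((isRegSymbol_iff.1 h1).add (isRegSymbol_iff.1 h1')), _, h2.add h2'⟩

lemma IsLimitSymbol.const_mul (hw : IsSmoothedNorm w) (ha : IsLimitSymbol w d ν a) (k : ℂ) :
    IsLimitSymbol w d ν (fun z μ => k * a z μ) := by
  obtain ⟨h1, c, h2⟩ := (isLimitSymbol_iff hw).1 ha
  exact (isLimitSymbol_iff hw).2
    ⟨isRegSymbol_iff.2 ((isRegSymbol_iff.1 h1).const_mul k), _, h2.const_mul k⟩

lemma IsLimitSymbol.sub (hw : IsSmoothedNorm w) (ha : IsLimitSymbol w d ν a)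
    (hb : IsLimitSymbol w d ν b) : IsLimitSymbol w d ν (fun z μ => a z μ - b z μ) := by
  simpa [sub_eq_add_neg] using ha.add hw (hb.const_mul hw (-1))

lemma isLimitSymbol_zero (hw : IsSmoothedNorm w) : IsLimitSymbol w d ν (fun _ _ => 0) := by
  refine (isLimitSymbol_iff hw).2 ⟨isRegSymbol_iff.2 sym_zero, fun _ _ => 0, fun j => ?_, fun N => ?_⟩
  · exact isSymbol_of_sym sym_zero
  · simpa using sym_zero

lemma isLimitSymbol_sum (hw : IsSmoothedNorm w) {κ : Type*} (s : Finset κ)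
    {f : κ → EuclideanSpace ℝ ι → ℝ → ℂ} (hf : ∀ k ∈ s, IsLimitSymbol w d ν (f k)) :
    IsLimitSymbol w d ν (fun z μ => ∑ k ∈ s, f k z μ) := by
  classical
  induction s using Finset.induction_on with
  | empty => simpa using isLimitSymbol_zero hw
  | insert k s hk ih =>
    simp only [Finset.sum_insert hk]
    exact (hf k (Finset.mem_insert_self k s)).add hw
      (ih fun j hj => hf j (Finset.mem_insert_of_mem hj))

/-- Raising both orders by the same amount leaves the exponents d - ν - j unchanged, so the same
coefficients serve. -/
lemma IsLimitSymbol.mono (hw : IsSmoothedNorm w) {d' ν' : ℝ} (ha : IsLimitSymbol w d ν a)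
    (hs : d' - ν' = d - ν) (h : ν ≤ ν') : IsLimitSymbol w d' ν' a := by
  obtain ⟨h1, c, h2⟩ := (isLimitSymbol_iff hw).1 ha
  have hb : ∀ (z : EuclideanSpace ℝ ι) (x : ℝ), bracket z ^ (ν + x) ≤ bracket z ^ (ν' + x) :=
    fun z x => Real.rpow_le_rpow_of_exponent_le (one_le_bracket z) (by linarith)
  refine (isLimitSymbol_iff hw).2 ⟨isRegSymbol_iff.2 ((isRegSymbol_iff.1 h1).mono jp_pos 1
    (fun z μ _ _ => (wReg_pos _ _ z μ).le) fun z μ _ _ => ?_), c,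
    fun j => (h2.coeff j).mono (by linarith), fun N => ?_⟩
  · have := hb z 0
    rw [add_zero, add_zero] at this
    rw [one_mul, wReg, wReg, hs]
    exact mul_le_mul_of_nonneg_right this (Real.rpow_nonneg (jp_pos z μ).le _)
  · rw [hs]
    refine (h2.remainder N).mono jm_pos 1 (fun z μ _ _ => (wTen_pos _ _ z μ).le) fun z μ _ _ => ?_
    rw [one_mul, wTen, wTen]
    exact mul_le_mul_of_nonneg_right (hb z N) (Real.rpow_nonneg (jm_pos z μ).le _)

lemma IsLimitSymbol.hderiv (hw : IsSmoothedNorm w) (ha : IsLimitSymbol w d ν a) (i : ι) :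
    IsLimitSymbol w (d - 1) (ν - 1) (hderiv (some i) a) := by
  obtain ⟨h1, c, h2⟩ := (isLimitSymbol_iff hw).1 ha
  have hb : ∀ (z : EuclideanSpace ℝ ι) (x : ℝ), bracket z ^ x * (bracket z)⁻¹ = bracket z ^ (x - 1) :=
    fun z x => by rw [Real.rpow_sub (bracket_pos z), Real.rpow_one, div_eq_mul_inv]
  have hs : d - 1 - (ν - 1) = d - ν := by ring
  refine (isLimitSymbol_iff hw).2 ⟨isRegSymbol_iff.2
    (((isRegSymbol_iff.1 h1).hderiv (some i)).mono jp_pos 1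
    (fun z μ _ _ => (mul_pos (wReg_pos _ _ z μ) (wfac_pos jp_pos (some i) z μ)).le)
    fun z μ _ _ => ?_), fun j => cderiv i (c j), fun j => ?_, fun N => ?_⟩
  · rw [one_mul, wReg, wReg, hs, ← hb]
    exact le_of_eq (by simp only [wfac]; ring)
  · have := (h2.coeff j).cderiv i
    rwa [show ν + (j : ℝ) - 1 = ν - 1 + j by ring] at this
  · rw [hs]
    refine Sym.congr (((h2.remainder N).hderiv (some i)).mono jm_pos 1
      (fun z μ _ _ => (mul_pos (wTen_pos _ _ z μ) (wfac_pos jm_pos (some i) z μ)).le)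
      fun z μ _ _ => ?_) fun z μ hμ => ?_
    · rw [one_mul, wTen, wTen, show ν - 1 + (N : ℝ) = ν + N - 1 by ring, ← hb]
      exact le_of_eq (by simp only [wfac]; ring)
    · have hsm : ∀ j, Smooth (fun z μ => c j z * rp jm (d - ν - j) z μ) := fun j =>
        (smooth_of_contDiff (h2.coeff j).smooth).mul (smoothPos_jm.smooth_rp _)
      have hsum := hderiv_sum (Finset.range N) hsm (some i)
      have e : (fun z μ => a z μ - ∑ j ∈ Finset.range N, c j z * rp jm (d - ν - j) z μ) =
        fun z μ => a z μ + (-1) * ∑ j ∈ Finset.range N, c j z * rp jm (d - ν - j) z μ := by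
        funext z μ; ring
      rw [e, hderiv_add (isRegSymbol_iff.1 h1).smooth (hsum.1.const_mul _) (some i) z μ hμ]
      beta_reduce
      rw [hderiv_const_mul hsum.1 _ (some i) z μ hμ]
      beta_reduce
      rw [hsum.2 z μ hμ, neg_one_mul, sub_eq_add_neg]
      congr 2
      refine Finset.sum_congr rfl fun j _ => ?_
      rw [hderiv_mul (smooth_of_contDiff (h2.coeff j).smooth) (smoothPos_jm.smooth_rp _) (some i) z
        μ hμ]
      beta_reduce
      rw [hderiv_rp_jm _ (some i) z μ hμ]
      simp [Shubin.hderiv]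

lemma IsLimitSymbol.hd_some (hw : IsSmoothedNorm w) (ha : IsLimitSymbol w d ν a) (l : List ι) :
    IsLimitSymbol w (d - l.length) (ν - l.length) (hd (l.map some) a) := by
  induction l generalizing a d ν with
  | nil => simpa using ha
  | cons i l ih =>
    have := ih (ha.hderiv hw i)
    rw [List.map_cons, hd_cons]
    convert this using 1
    · simp; ring
    · simp; ring

lemma IsSymbol.isLimitSymbol (hw : IsSmoothedNorm w) {m : ℝ} {f : EuclideanSpace ℝ ι → ℂ}
    (hf : IsSymbol m f) : IsLimitSymbol w m m (fun z _ => f z) := by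
  refine (isLimitSymbol_iff hw).2 ⟨isRegSymbol_iff.2 ((hf.sym Set.univ jp_pos).mono jp_pos 1
    (fun z μ _ _ => Real.rpow_nonneg (bracket_pos z).le _) fun z μ _ _ => ?_),
    fun j => if j = 0 then f else fun _ => 0, fun j => ?_, fun N => ?_⟩
  · simp [wReg]
  · by_cases hj : j = 0
    · subst hj; simpa using hf
    · simpa [hj] using isSymbol_of_sym sym_zero
  · rcases N with _ | N
    · have := sym_mul_rp_jm (Ω := inner ι) hf 0
      simpa [rp] using this
    · refine sym_zero.congr fun z μ hμ => ?_
      rw [Finset.sum_range_succ']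
      simp [rp]

/-- Products of symbols. -/
lemma IsLimitSymbol.mul (hw : IsSmoothedNorm w) {d₁ ν₁ d₀ ν₀ : ℝ}
    {a₁ a₀ : EuclideanSpace ℝ ι → ℝ → ℂ} (h₁ : IsLimitSymbol w d₁ ν₁ a₁)
    (h₀ : IsLimitSymbol w d₀ ν₀ a₀) :
    IsLimitSymbol w (d₀ + d₁) (ν₀ + ν₁) (fun z μ => a₁ z μ * a₀ z μ) := by
  simpa using fiberBilin_mul.isLimitSymbol hw h₁ h₀

/-- Uniqueness of the principal limit symbol. -/
lemma HasLimitExpansion.unique (hw : IsSmoothedNorm w) {L L' : ℕ → EuclideanSpace ℝ ι → ℂ}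
    (h : HasLimitExpansion w d ν a L) (h' : HasLimitExpansion w d ν a L') : L 0 = L' 0 := by
  funext z
  have h1 := (isRegSymbol_iff.1 (h.remainder 1)).sub (isRegSymbol_iff.1 (h'.remainder 1))
  obtain ⟨C, hC⟩ := h1.bound []
  -- Subtracting the two remainders of order 1 shows that (L 0 - L' 0) w^{d-ν} is O(⟨z, μ⟩^{d-ν-1})
  -- for fixed z. As w and ⟨z, μ⟩ are comparable, μ → ∞ forces equality.
  have hev : ∀ᶠ μ : ℝ in atTop, ‖L 0 z - L' 0 z‖ ≤
      |C| * bracket z ^ (ν + 1) * 2 ^ |d - ν| * (jp z μ)⁻¹ := by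
    filter_upwards [eventually_ge_atTop 1] with μ hμ1
    have hμ : (0 : ℝ) ≤ μ := zero_le_one.trans hμ1
    have hn : 1 ≤ normParam z μ := Real.one_le_sqrt.2 (by nlinarith [sq_nonneg ‖z‖])
    have h2 := hC z μ hμ trivial
    have hj := jp_pos z μ
    have hwp := hw.pos z μ hμ
    have h3 := hw.le_jp hμ hn
    have h4 := rpow_le_of_ratio hj hwp one_le_two h3.2 (by linarith) (d - ν)
    have h5 := Real.rpow_pos_of_pos hwp (d - ν)
    have h6 := Real.rpow_pos_of_pos (bracket_pos z) (ν + 1)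
    simp only [hd_nil, wfacs_nil, mul_one, Finset.sum_range_one, Nat.cast_zero, sub_zero,
      Nat.cast_one] at h2
    rw [show a z μ - L 0 z * ((w z μ ^ (d - ν) : ℝ) : ℂ) - (a z μ - L' 0 z *
      ((w z μ ^ (d - ν) : ℝ) : ℂ)) = -((L 0 z - L' 0 z) * ((w z μ ^ (d - ν) : ℝ) : ℂ)) by ring,
      norm_neg, norm_mul, Complex.norm_real, Real.norm_of_nonneg h5.le, wReg,
      show d - (ν + 1) = d - ν - 1 by ring, Real.rpow_sub hj, Real.rpow_one] at h2
    refine le_of_mul_le_mul_right (h2.trans ?_) h5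
    calc C * (bracket z ^ (ν + 1) * (jp z μ ^ (d - ν) / jp z μ))
        ≤ |C| * (bracket z ^ (ν + 1) * (jp z μ ^ (d - ν) / jp z μ)) :=
          mul_le_mul_of_nonneg_right (le_abs_self C) (by positivity)
      _ ≤ |C| * (bracket z ^ (ν + 1) * ((2 ^ |d - ν| * w z μ ^ (d - ν)) / jp z μ)) := by gcongr
      _ = _ := by field_simp
  have hlim : Tendsto (fun μ : ℝ => |C| * bracket z ^ (ν + 1) * 2 ^ |d - ν| * (jp z μ)⁻¹) atTop
      (𝓝 0) := by
    have h7 : Tendsto (fun μ : ℝ => jp z μ) atTop atTop :=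
      tendsto_atTop_mono (fun μ => (le_abs_self μ).trans (abs_le_jp z μ)) tendsto_id
    simpa using h7.inv_tendsto_atTop.const_mul (|C| * bracket z ^ (ν + 1) * 2 ^ |d - ν|)
  have h8 := ge_of_tendsto hlim hev
  exact sub_eq_zero.1 (norm_le_zero_iff.1 h8)

end Closure

/-! ### Dilations. -/

section Dilation

variable {ι : Type*} [Fintype ι] [DecidableEq ι] {w : EuclideanSpace ℝ ι → ℝ → ℝ} {d ν : ℝ}
  {a b : EuclideanSpace ℝ ι → ℝ → ℂ} {t : ℝ}

/-- Dilations. -/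
def dil (t : ℝ) (a : EuclideanSpace ℝ ι → ℝ → ℂ) (z : EuclideanSpace ℝ ι) (μ : ℝ) : ℂ :=
  a (t • z) (t * μ)

lemma hasFDerivWithinAt_dil (ht : 0 < t) (ha : Smooth a) {z : EuclideanSpace ℝ ι} {μ : ℝ}
    (hμ : 0 ≤ μ) : HasFDerivWithinAt (fun p : EuclideanSpace ℝ ι × ℝ => dil t a p.1 p.2)
      ((fderivWithin ℝ (fun p : EuclideanSpace ℝ ι × ℝ => a p.1 p.2) (halfSpace ι)
        (t • z, t * μ)).comp (t • ContinuousLinearMap.id ℝ _)) (halfSpace ι) (z, μ) := by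
  have h1 := ha.hasFDerivWithinAt (z := t • z) (mul_nonneg ht.le hμ)
  have h2 : HasFDerivWithinAt (fun p : EuclideanSpace ℝ ι × ℝ => t • p)
      (t • ContinuousLinearMap.id ℝ _) (halfSpace ι) (z, μ) :=
    (t • ContinuousLinearMap.id ℝ (EuclideanSpace ℝ ι × ℝ)).hasFDerivWithinAt
  exact HasFDerivWithinAt.comp (g := fun p : EuclideanSpace ℝ ι × ℝ => a p.1 p.2)
    (f := fun p : EuclideanSpace ℝ ι × ℝ => t • p) (z, μ) h1 h2
    fun p hp => ⟨trivial, mul_nonneg ht.le hp.2⟩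

lemma Smooth.dil (ht : 0 < t) (ha : Smooth a) : Smooth (Shubin.dil t a) :=
  ContDiffOn.comp (g := fun p : EuclideanSpace ℝ ι × ℝ => a p.1 p.2) ha
    (contDiff_const_smul t).contDiffOn fun p hp => ⟨trivial, mul_nonneg ht.le hp.2⟩

lemma hderiv_dil (ht : 0 < t) (ha : Smooth a) (o : Option ι) :
    EqHalf (hderiv o (dil t a)) (fun z μ => (t : ℂ) * dil t (hderiv o a) z μ) := by
  intro z μ hμ
  rw [hderiv_eq_of_hasFDerivWithinAt hμ (hasFDerivWithinAt_dil ht ha hμ)]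
  beta_reduce
  rw [dil, ha.hderiv_eq (mul_nonneg ht.le hμ)]
  simp

lemma exists_hd_dil_le {ρ σ : EuclideanSpace ℝ ι → ℝ → ℝ} (ht : 0 < t)
    (ha : Sym ρ σ Set.univ a) (l : List (Option ι)) : ∃ C : ℝ, ∀ z μ, 0 ≤ μ →
      ‖hd l (dil t a) z μ‖ ≤ C * (σ (t • z) (t * μ) * wfacs ρ l (t • z) (t * μ)) := by
  induction l generalizing a σ with
  | nil =>
    obtain ⟨C, hC⟩ := ha.bound []
    exact ⟨C, fun z μ hμ => hC (t • z) (t * μ) (mul_nonneg ht.le hμ) trivial⟩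
  | cons o l ih =>
    obtain ⟨C, hC⟩ := ih (ha.hderiv o)
    refine ⟨t * C, fun z μ hμ => ?_⟩
    rw [hd_cons, (hderiv_dil ht ha.smooth o).hd l z μ hμ,
      hd_const_mul ((ha.smooth.hderiv o).dil ht) _ l z μ hμ, norm_mul, Complex.norm_real,
      Real.norm_of_nonneg ht.le, mul_assoc]
    refine mul_le_mul_of_nonneg_left ((hC z μ hμ).trans_eq ?_) ht.le
    rw [wfacs_cons]; ring

lemma jp_dil_le {K : ℝ} (hK : 1 ≤ K) (hK' : |t| ≤ K) (z : EuclideanSpace ℝ ι) (μ : ℝ) :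
    jp (t • z) (t * μ) ≤ K * jp z μ := by
  have h1 := jp_pos z μ
  refine abs_le_of_sq_le_sq' ?_ (by positivity) |>.2
  rw [mul_pow, jp_sq, jp_sq, norm_smul, mul_pow, mul_pow, Real.norm_eq_abs, ← sq_abs t]
  have h2 : |t| ^ 2 ≤ K ^ 2 := pow_le_pow_left₀ (abs_nonneg t) hK' 2
  nlinarith [sq_nonneg ‖z‖, sq_nonneg μ, mul_nonneg (sub_nonneg.2 h2) (sq_nonneg ‖z‖),
    mul_nonneg (sub_nonneg.2 h2) (sq_nonneg μ)]

lemma bracket_eq_jp (z : EuclideanSpace ℝ ι) : bracket z = jp z 0 := by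
  simp [bracket, bracketParam]

lemma wfacs_jp_dil_le {K : ℝ} (hK : 1 ≤ K) (hK' : ∀ (z : EuclideanSpace ℝ ι) (μ : ℝ),
    jp z μ ≤ K * jp (t • z) (t * μ)) (l : List (Option ι)) (z : EuclideanSpace ℝ ι) (μ : ℝ) :
    wfacs jp l (t • z) (t * μ) ≤ K ^ l.length * wfacs jp l z μ := by
  induction l with
  | nil => simp
  | cons o l ih =>
    rw [wfacs_cons, wfacs_cons, List.length_cons, pow_succ]
    have h1 : wfac jp o (t • z) (t * μ) ≤ K * wfac jp o z μ := by
      have key : ∀ x y : ℝ, 0 < x → 0 < y → x ≤ K * y → y⁻¹ ≤ K * x⁻¹ := fun x y hx hy h => by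
        rw [← div_eq_mul_inv, le_div_iff₀ hx, inv_mul_le_iff₀ hy]; linarith
      cases o with
      | none => exact key _ _ (jp_pos _ _) (jp_pos _ _) (hK' z μ)
      | some i =>
        refine key _ _ (bracket_pos _) (bracket_pos _) ?_
        have := hK' z 0
        rwa [mul_zero, ← bracket_eq_jp, ← bracket_eq_jp] at this
    calc _ ≤ (K * wfac jp o z μ) * (K ^ l.length * wfacs jp l z μ) :=
          mul_le_mul h1 ih (wfacs_pos jp_pos _ _ _).le
            (mul_nonneg (by linarith) (wfac_pos jp_pos _ _ _).le)
      _ = _ := by ring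

lemma Sym.dil_wReg (ht : 0 < t) (ha : Sym jp (wReg d ν) Set.univ a) :
    Sym jp (wReg d ν) Set.univ (Shubin.dil t a) := by
  refine ⟨ha.smooth.dil ht, fun l => ?_⟩
  obtain ⟨C, hC⟩ := exists_hd_dil_le ht ha l
  set K := max 1 (max t t⁻¹) with hKdef
  have hK : 1 ≤ K := le_max_left _ _
  have hKt : |t| ≤ K := by
    rw [abs_of_pos ht]; exact (le_max_left _ _).trans (le_max_right _ _)
  have hKt' : |t⁻¹| ≤ K := by
    rw [abs_of_pos (inv_pos.2 ht)]; exact (le_max_right _ _).trans (le_max_right _ _)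
  have e1 : ∀ (z : EuclideanSpace ℝ ι) (μ : ℝ), jp (t • z) (t * μ) ≤ K * jp z μ := jp_dil_le hK hKt
  have e2 : ∀ (z : EuclideanSpace ℝ ι) (μ : ℝ), jp z μ ≤ K * jp (t • z) (t * μ) := fun z μ => by
    have := jp_dil_le hK hKt' (t • z) (t * μ)
    rwa [inv_smul_smul₀ ht.ne', inv_mul_cancel_left₀ ht.ne'] at this
  refine ⟨|C| * (K ^ |ν| * K ^ |d - ν| * K ^ l.length), fun z μ hμ _ => (hC z μ hμ).trans ?_⟩
  have hw1 : wReg d ν (t • z) (t * μ) ≤ K ^ |ν| * K ^ |d - ν| * wReg d ν z μ := by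
    have h1 := rpow_le_of_ratio (bracket_pos (t • z)) (bracket_pos z) hK
      (by have := e1 z 0; rwa [mul_zero, ← bracket_eq_jp, ← bracket_eq_jp] at this)
      (by have := e2 z 0; rwa [mul_zero, ← bracket_eq_jp, ← bracket_eq_jp] at this) ν
    have h2 := rpow_le_of_ratio (jp_pos (t • z) (t * μ)) (jp_pos z μ) hK (e1 z μ) (e2 z μ) (d - ν)
    rw [wReg, wReg]
    refine (mul_le_mul h1 h2 (Real.rpow_nonneg (jp_pos _ _).le _) ?_).trans_eq (by ring)
    exact mul_nonneg (by positivity) (Real.rpow_nonneg (bracket_pos _).le _)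
  have hw2 := wfacs_jp_dil_le hK e2 l z μ
  have p1 := wReg_pos d ν (t • z) (t * μ)
  have p2 := wfacs_pos (ρ := jp) jp_pos l (t • z) (t * μ)
  have p3 := wReg_pos d ν z μ
  calc C * (wReg d ν (t • z) (t * μ) * wfacs jp l (t • z) (t * μ))
      ≤ |C| * ((K ^ |ν| * K ^ |d - ν| * wReg d ν z μ) * (K ^ l.length * wfacs jp l z μ)) := by
        refine mul_le_mul (le_abs_self C) ?_ (mul_pos p1 p2).le (abs_nonneg C)
        exact mul_le_mul hw1 hw2 p2.le (by positivity)
    _ = _ := by ring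

lemma IsSymbol.dil {m : ℝ} {f : EuclideanSpace ℝ ι → ℂ} (hf : IsSymbol m f) (ht : 0 < t) :
    IsSymbol m (fun z => f (t • z)) := by
  have h1 : Sym jp (wReg m m) Set.univ (fun z (_ : ℝ) => f z) := by
    simpa [wReg] using (hf.sym Set.univ jp_pos).mono (σ' := wReg m m) jp_pos 1
      (fun z μ _ _ => Real.rpow_nonneg (bracket_pos z).le _) fun z μ _ _ => by simp [wReg]
  have h2 := h1.dil_wReg ht
  refine (isSymbol_iff jp jp_pos).2 (h2.mono jp_pos 1 (fun z μ _ _ => (wReg_pos _ _ z μ).le)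
    fun z μ _ _ => by simp [wReg])

lemma normParam_dil (ht : 0 < t) (z : EuclideanSpace ℝ ι) (μ : ℝ) :
    normParam (t • z) (t * μ) = t * normParam z μ := by
  rw [normParam, normParam, norm_smul, Real.norm_of_nonneg ht.le, mul_pow, mul_pow, ← mul_add,
    Real.sqrt_mul (sq_nonneg t), Real.sqrt_sq ht.le]

/-- For large (z, μ) the function w is the norm, hence homogeneous, and the difference vanishes. On
the remaining compact set any estimate holds, so `d'` and `ν'` are arbitrary. -/
lemma sym_dil_rp_sub (hw : IsSmoothedNorm w) (ht : 0 < t) (s d' ν' : ℝ) :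
    Sym jp (wReg d' ν') Set.univ
      (fun z μ => dil t (rp w s) z μ - ((t ^ s : ℝ) : ℂ) * rp w s z μ) := by
  set R := max 1 t⁻¹
  have hsm : Smooth (fun z μ => dil t (rp w s) z μ - ((t ^ s : ℝ) : ℂ) * rp w s z μ) := by
    have := ((hw.smoothPos.smooth_rp s).dil ht).add
      ((hw.smoothPos.smooth_rp s).const_mul (-((t ^ s : ℝ) : ℂ)))
    simpa [sub_eq_add_neg] using this
  have h1 : Sym jp (wReg d' ν') (far ι R)
      (fun z μ => dil t (rp w s) z μ - ((t ^ s : ℝ) : ℂ) * rp w s z μ) := by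
    refine Sym.congr_on sym_zero hsm (isOpen_far R) fun z μ hμ hz => ?_
    have hz' : R < normParam z μ := hz
    have hn : 1 ≤ normParam z μ := (le_max_left _ _).trans hz'.le
    have hn' : 1 ≤ normParam (t • z) (t * μ) := by
      rw [normParam_dil ht]
      have : t⁻¹ ≤ normParam z μ := (le_max_right _ _).trans hz'.le
      have := mul_le_mul_of_nonneg_left this ht.le
      rwa [mul_inv_cancel₀ ht.ne'] at this
    rw [dil, rp, rp, hw.eq_norm _ _ (mul_nonneg ht.le hμ) hn', hw.eq_norm z μ hμ hn,
      normParam_dil ht, Real.mul_rpow ht.le (by linarith)]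
    push_cast; ring
  have h2 := h1.union (hsm.sym_of_isCompact (isCompact_compl_far R) continuous_jp jp_pos
    (continuous_wReg d' ν') (wReg_pos _ _)) jp_pos fun z μ _ _ => (wReg_pos _ _ z μ).le
  rwa [Set.union_compl_self] at h2

/-- Dilations will be used to change the radius at which a homogeneous symbol is cut off near z = 0.
-/
theorem IsLimitSymbol.dil (hw : IsSmoothedNorm w) (ha : IsLimitSymbol w d ν a) (ht : 0 < t) :
    IsLimitSymbol w d ν (Shubin.dil t a) := by
  obtain ⟨h1, L, hL⟩ := ha
  refine ⟨isRegSymbol_iff.2 ((isRegSymbol_iff.1 h1).dil_wReg ht),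
    fun j z => ((t ^ (d - ν - j) : ℝ) : ℂ) * L j (t • z), fun j => ((hL.coeff j).dil ht).const_mul _,
    fun N => isRegSymbol_iff.2 ?_⟩
  have h2 := (isRegSymbol_iff.1 (hL.remainder N)).dil_wReg ht
  have h3 : Sym jp (wReg d (ν + N)) Set.univ (fun z μ => ∑ j ∈ Finset.range N, L j (t • z) *
      (Shubin.dil t (rp w (d - ν - j)) z μ - ((t ^ (d - ν - j) : ℝ) : ℂ) *
        rp w (d - ν - j) z μ)) := by
    refine Sym.sum _ fun j _ => ?_
    refine ((((hL.coeff j).dil ht).sym Set.univ jp_pos).mul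
      (sym_dil_rp_sub hw ht (d - ν - j) (d - ν - j) (N - j))).mono jp_pos 1 (fun z μ _ _ => ?_)
      fun z μ _ _ => ?_
    · exact mul_nonneg (Real.rpow_nonneg (bracket_pos z).le _) (wReg_pos _ _ z μ).le
    · rw [one_mul, wReg, wReg, ← mul_assoc, ← Real.rpow_add (bracket_pos z)]
      refine le_of_eq ?_
      congr 2 <;> ring
  refine (h2.add h3).congr fun z μ hμ => ?_
  simp only [Shubin.dil, mul_sub, Finset.sum_sub_distrib, rp]
  rw [add_sub, sub_add_cancel]
  congr 1
  exact Finset.sum_congr rfl fun j _ => by ring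

end Dilation

/-! ### Homogeneous symbols in the coordinate t = 1/μ. -/

section Homogeneous

variable {ι : Type*} [Fintype ι] [DecidableEq ι] {d ν d₀ d₁ ν₀ ν₁ : ℝ}
  {A A₁ A₀ : EuclideanSpace ℝ ι → ℝ → ℂ}

/-- `{z ≠ 0, μ ≥ 0}`. -/
abbrev punctured (ι : Type*) [Fintype ι] : Set (EuclideanSpace ℝ ι × ℝ) := {0}ᶜ ×ˢ Set.Ici 0

/-- `{t ≥ 0, z ≠ 0}`, where `t = 1 / μ`. -/
abbrev puncturedInv (ι : Type*) [Fintype ι] : Set (ℝ × EuclideanSpace ℝ ι) := Set.Ici 0 ×ˢ {0}ᶜ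

/-- Homogeneous symbols described by their behaviour as `μ = 1 / t → ∞`. -/
structure HomSym (d ν : ℝ) (A : EuclideanSpace ℝ ι → ℝ → ℂ) : Prop where
  smooth : ContDiffOn ℝ ∞ (fun p : EuclideanSpace ℝ ι × ℝ => A p.1 p.2) (punctured ι)
  hom : ∀ t : ℝ, 0 < t → ∀ z, z ≠ 0 → ∀ μ, 0 ≤ μ → A (t • z) (t * μ) = ((t ^ d : ℝ) : ℂ) * A z μ
  -- In this chart a derivative in z of the symbol is a derivative in z of `K`, with the same
  -- exponent d - ν. Closure under differentiation is less visible in the polar coordinates of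
  -- `IsTaylorSphere`.
  ext : ∃ K : ℝ × EuclideanSpace ℝ ι → ℂ, ContDiffOn ℝ ∞ K (puncturedInv ι) ∧
    ∀ t : ℝ, 0 < t → ∀ z, z ≠ 0 → K (t, z) = ((t ^ (d - ν) : ℝ) : ℂ) * A z t⁻¹

lemma uniqueDiffOn_punctured : UniqueDiffOn ℝ (punctured ι) :=
  isOpen_compl_singleton.uniqueDiffOn.prod (uniqueDiffOn_Ici 0)

lemma uniqueDiffOn_puncturedInv : UniqueDiffOn ℝ (puncturedInv ι) :=
  (uniqueDiffOn_Ici 0).prod isOpen_compl_singleton.uniqueDiffOn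

lemma normParam_pos {z : EuclideanSpace ℝ ι} (hz : z ≠ 0) (μ : ℝ) : 0 < normParam z μ := by
  have := norm_pos_iff.2 hz
  exact Real.sqrt_pos.2 (by positivity)

lemma contDiffOn_normParam :
    ContDiffOn ℝ ∞ (fun p : EuclideanSpace ℝ ι × ℝ => normParam p.1 p.2) (punctured ι) := by
  refine ContDiffOn.sqrt ?_ fun p hp => ?_
  · exact ((contDiff_fst.norm_sq ℝ).add (contDiff_snd.pow 2)).contDiffOn
  · exact (Real.sqrt_pos.1 (normParam_pos hp.1 p.2)).ne'

lemma contDiffOn_ofReal {F : Type*} [NormedAddCommGroup F] [NormedSpace ℝ F] {f : F → ℝ} {s : Set F}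
    (hf : ContDiffOn ℝ ∞ f s) : ContDiffOn ℝ ∞ (fun x => (f x : ℂ)) s :=
  Complex.ofRealCLM.contDiff.comp_contDiffOn hf

lemma contDiffOn_normalize : ContDiffOn ℝ ∞ (fun p : EuclideanSpace ℝ ι × ℝ =>
    ((normParam p.1 p.2)⁻¹ • p.1, (normParam p.1 p.2)⁻¹ * p.2)) (punctured ι) := by
  have h : ContDiffOn ℝ ∞ (fun p : EuclideanSpace ℝ ι × ℝ => (normParam p.1 p.2)⁻¹) (punctured ι) :=
    contDiffOn_normParam.inv fun p hp => (normParam_pos hp.1 p.2).ne'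
  exact (h.smul contDiffOn_fst).prodMk (h.mul contDiffOn_snd)

/-- Let S = √(1 + t²|z|²). The point (z, 1/t) has norm S/t and projects to the half-sphere at radius
r = t|z|/S, which is smooth up to t = 0 and stays below 1. Collecting powers, K = S^{d-ν} |z|^ν G(r,
z/|z|). -/
lemma IsHomSymbol.homSym (hA : IsHomSymbol d ν A) : HomSym d ν A := by
  obtain ⟨b, ⟨hb, G, hG, hGb⟩, hAb⟩ := hA
  refine ⟨?_, fun t ht z hz μ hμ => ?_, ?_⟩
  · refine ((contDiffOn_ofReal (contDiffOn_normParam.rpow_const_of_ne fun p hp =>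
      (normParam_pos hp.1 p.2).ne')).mul hb).congr fun p hp => hAb p.1 hp.1 p.2 hp.2
  · rw [hAb z hz μ hμ, hAb _ (smul_ne_zero ht.ne' hz) _ (mul_nonneg ht.le hμ), normParam_dil ht,
      Real.mul_rpow ht.le (normParam_pos hz μ).le, mul_inv, smul_smul]
    have e1 : t⁻¹ * (normParam z μ)⁻¹ * t = (normParam z μ)⁻¹ := by field_simp
    have e2 : t⁻¹ * (normParam z μ)⁻¹ * (t * μ) = (normParam z μ)⁻¹ * μ := by field_simp
    rw [e1, e2]
    push_cast; ring
  · have hn : ContDiffOn ℝ ∞ (fun p : ℝ × EuclideanSpace ℝ ι => ‖p.2‖) (puncturedInv ι) :=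
      contDiffOn_snd.norm ℝ fun p hp => hp.2
    have hS : ContDiffOn ℝ ∞ (fun p : ℝ × EuclideanSpace ℝ ι => √(1 + (p.1 * ‖p.2‖) ^ 2))
        (puncturedInv ι) :=
      (contDiffOn_const.add ((contDiffOn_fst.mul hn).pow 2)).sqrt fun p hp => by positivity
    have hSpos : ∀ x : ℝ, 0 < √(1 + x ^ 2) := fun x => Real.sqrt_pos.2 (by positivity)
    refine ⟨fun p => ((√(1 + (p.1 * ‖p.2‖) ^ 2) ^ (d - ν) * ‖p.2‖ ^ ν : ℝ) : ℂ) *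
      G (p.1 * ‖p.2‖ / √(1 + (p.1 * ‖p.2‖) ^ 2)) (‖p.2‖⁻¹ • p.2), ?_, fun t ht z hz => ?_⟩
    · refine (contDiffOn_ofReal ((hS.rpow_const_of_ne fun p hp => (hSpos _).ne').mul
        (hn.rpow_const_of_ne fun p hp => (norm_pos_iff.2 hp.2).ne'))).mul ?_
      refine hG.comp (f := fun p : ℝ × EuclideanSpace ℝ ι =>
        (p.1 * ‖p.2‖ / √(1 + (p.1 * ‖p.2‖) ^ 2), p.2))
        (((contDiffOn_fst.mul hn).div hS fun p hp => (hSpos _).ne').prodMk contDiffOn_snd) ?_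
      rintro ⟨t, z⟩ ⟨ht, hz⟩
      have ht' : (0 : ℝ) ≤ t := ht
      refine ⟨⟨by positivity, ?_⟩, hz⟩
      rw [div_lt_one (hSpos _)]
      exact Real.lt_sqrt_of_sq_lt (by linarith)
    · have hz' := norm_pos_iff.2 hz
      set S := √(1 + (t * ‖z‖) ^ 2) with hSdef
      have hS0 : 0 < S := hSpos _
      have hS2 : S ^ 2 = 1 + (t * ‖z‖) ^ 2 := Real.sq_sqrt (by positivity)
      have hN : normParam z t⁻¹ = t⁻¹ * S := by
        rw [normParam, Real.sqrt_eq_iff_mul_self_eq (by positivity) (by positivity), ← pow_two, mul_pow,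
          hS2]
        field_simp; ring
      have hr : t * ‖z‖ / S ∈ Set.Ioo (0 : ℝ) 1 := by
        refine ⟨by positivity, ?_⟩
        rw [div_lt_one hS0]
        exact Real.lt_sqrt_of_sq_lt (by linarith)
      beta_reduce
      rw [hGb _ hr _ (by rw [norm_smul, norm_inv, norm_norm, inv_mul_cancel₀ hz'.ne']),
        hAb z hz _ (inv_nonneg.2 ht.le), hN, smul_smul]
      have e1 : t * ‖z‖ / S * ‖z‖⁻¹ = (t⁻¹ * S)⁻¹ := by field_simp
      have e2 : √(1 - (t * ‖z‖ / S) ^ 2) = (t⁻¹ * S)⁻¹ * t⁻¹ := by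
        rw [show (t⁻¹ * S)⁻¹ * t⁻¹ = S⁻¹ by field_simp]
        rw [Real.sqrt_eq_iff_mul_self_eq (by rw [div_pow, hS2, sub_nonneg, div_le_one (by positivity)]; linarith)
          (by positivity), ← pow_two, div_pow, inv_pow, hS2]
        field_simp; ring
      rw [e1, e2, ← mul_assoc, ← mul_assoc, ← Complex.ofReal_mul, ← Complex.ofReal_mul]
      congr 2
      rw [Real.div_rpow (by positivity) hS0.le, Real.mul_rpow ht.le hz'.le,
        Real.mul_rpow (by positivity) hS0.le, Real.inv_rpow ht.le, Real.rpow_sub hS0,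
        Real.rpow_sub ht, Real.rpow_neg ht.le, Real.rpow_neg hz'.le, Real.rpow_neg hS0.le]
      have p1 := Real.rpow_pos_of_pos ht d
      have p2 := Real.rpow_pos_of_pos ht ν
      have p3 := Real.rpow_pos_of_pos hS0 d
      have p4 := Real.rpow_pos_of_pos hS0 ν
      have p5 := Real.rpow_pos_of_pos hz' ν
      field_simp

/-- By homogeneity the symbol itself serves as the function on the half-sphere. The point (rφ, √(1 -
r²)) is a dilate of (φ, 1/t) with t = r/√(1 - r²), and t is smooth on 0 ≤ r < 1. -/
lemma HomSym.isHomSymbol (hA : HomSym d ν A) : IsHomSymbol d ν A := by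
  obtain ⟨hs, hh, K, hK, hKA⟩ := hA
  refine ⟨A, ⟨?_, fun r φ => (((1 - r ^ 2) ^ ((d - ν) / 2) : ℝ) : ℂ) * K (r / √(1 - r ^ 2), φ), ?_,
    fun r hr φ hφ => ?_⟩, fun z hz μ hμ => ?_⟩
  · refine hs.comp contDiffOn_normalize fun p hp => ?_
    have := inv_pos.2 (normParam_pos hp.1 p.2)
    exact ⟨smul_ne_zero this.ne' hp.1, mul_nonneg this.le hp.2⟩
  · have hq : ∀ p ∈ (Set.Ico (0 : ℝ) 1 ×ˢ {0}ᶜ : Set (ℝ × EuclideanSpace ℝ ι)), 0 < 1 - p.1 ^ 2 := by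
      rintro ⟨r, z⟩ ⟨hr, -⟩
      have h1 : 0 ≤ r := hr.1
      have h2 : r < 1 := hr.2
      show 0 < 1 - r ^ 2
      nlinarith
    have h1 : ContDiffOn ℝ ∞ (fun p : ℝ × EuclideanSpace ℝ ι => 1 - p.1 ^ 2)
        (Set.Ico (0 : ℝ) 1 ×ˢ {0}ᶜ) := contDiffOn_const.sub (contDiffOn_fst.pow 2)
    refine (contDiffOn_ofReal (h1.rpow_const_of_ne fun p hp => (hq p hp).ne')).mul ?_
    refine hK.comp (f := fun p : ℝ × EuclideanSpace ℝ ι => (p.1 / √(1 - p.1 ^ 2), ‖p.2‖⁻¹ • p.2))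
      ((contDiffOn_fst.div (h1.sqrt fun p hp => (hq p hp).ne') fun p hp =>
        (Real.sqrt_pos.2 (hq p hp)).ne').prodMk
        (((contDiffOn_snd.norm ℝ fun p hp => hp.2).inv fun p hp =>
          (norm_pos_iff.2 hp.2).ne').smul contDiffOn_snd)) fun p hp => ?_
    have h0 : (0 : ℝ) ≤ p.1 := hp.1.1
    exact ⟨show (0 : ℝ) ≤ p.1 / √(1 - p.1 ^ 2) by positivity,
      smul_ne_zero (inv_ne_zero (norm_pos_iff.2 hp.2).ne') hp.2⟩
  · have hr0 := hr.1
    have hq : 0 < 1 - r ^ 2 := by nlinarith [hr.1, hr.2]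
    have hq' := Real.sqrt_pos.2 hq
    have hφ0 : φ ≠ 0 := norm_pos_iff.1 (by rw [hφ]; exact one_pos)
    have e := hh r hr0 φ hφ0 (r / √(1 - r ^ 2))⁻¹ (by positivity)
    rw [show r * (r / √(1 - r ^ 2))⁻¹ = √(1 - r ^ 2) by field_simp] at e
    beta_reduce
    rw [hKA _ (by positivity) φ hφ0, e, ← mul_assoc, ← mul_assoc, ← Complex.ofReal_mul,
      ← Complex.ofReal_mul]
    congr 2
    rw [Real.div_rpow hr0.le hq'.le, ← Real.rpow_add hr0, Real.sqrt_eq_rpow, ← Real.rpow_mul hq.le,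
      show 1 / 2 * (d - ν) = (d - ν) / 2 by ring, mul_div_cancel₀ _ (Real.rpow_pos_of_pos hq _).ne']
    congr 1; ring
  · have h0 := normParam_pos hz μ
    have := hh _ (inv_pos.2 h0) z hz μ hμ
    rw [this, ← mul_assoc, ← Complex.ofReal_mul, Real.inv_rpow h0.le,
      mul_inv_cancel₀ (Real.rpow_pos_of_pos h0 d).ne', Complex.ofReal_one, one_mul]

lemma HomSym.mul (h₁ : HomSym d₁ ν₁ A₁) (h₀ : HomSym d₀ ν₀ A₀) :
    HomSym (d₀ + d₁) (ν₀ + ν₁) (fun z μ => A₁ z μ * A₀ z μ) := by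
  obtain ⟨K₁, hK₁, e₁⟩ := h₁.ext
  obtain ⟨K₀, hK₀, e₀⟩ := h₀.ext
  refine ⟨h₁.smooth.mul h₀.smooth, fun t ht z hz μ hμ => ?_, fun p => K₁ p * K₀ p, hK₁.mul hK₀,
    fun t ht z hz => ?_⟩
  · rw [h₁.hom t ht z hz μ hμ, h₀.hom t ht z hz μ hμ, Real.rpow_add ht]
    push_cast; ring
  · beta_reduce
    rw [e₁ t ht z hz, e₀ t ht z hz, show d₀ + d₁ - (ν₀ + ν₁) = (d₀ - ν₀) + (d₁ - ν₁) by ring,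
      Real.rpow_add ht]
    push_cast; ring

lemma HomSym.const_mul (h : HomSym d ν A) (c : ℂ) : HomSym d ν (fun z μ => c * A z μ) := by
  obtain ⟨K, hK, e⟩ := h.ext
  refine ⟨contDiffOn_const.mul h.smooth, fun t ht z hz μ hμ => ?_, fun p => c * K p,
    contDiffOn_const.mul hK, fun t ht z hz => ?_⟩
  · rw [h.hom t ht z hz μ hμ]; ring
  · beta_reduce
    rw [e t ht z hz]; ring

lemma homSym_sum {κ : Type*} (s : Finset κ) {F : κ → EuclideanSpace ℝ ι → ℝ → ℂ}
    (h : ∀ k ∈ s, HomSym d ν (F k)) : HomSym d ν (fun z μ => ∑ k ∈ s, F k z μ) := by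
  choose! K hK e using fun k hk => (h k hk).ext
  refine ⟨ContDiffOn.sum fun k hk => (h k hk).smooth, fun t ht z hz μ hμ => ?_,
    fun p => ∑ k ∈ s, K k p, ContDiffOn.sum hK, fun t ht z hz => ?_⟩
  · rw [Finset.mul_sum]
    exact Finset.sum_congr rfl fun k hk => (h k hk).hom t ht z hz μ hμ
  · rw [Finset.mul_sum]
    exact Finset.sum_congr rfl fun k hk => e k hk t ht z hz

lemma HomSym.hasFDerivAt (h : HomSym d ν A) {z : EuclideanSpace ℝ ι} (hz : z ≠ 0) {μ : ℝ}
    (hμ : 0 ≤ μ) : HasFDerivAt (fun z' => A z' μ)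
      ((fderivWithin ℝ (fun p : EuclideanSpace ℝ ι × ℝ => A p.1 p.2) (punctured ι) (z, μ)).comp
        (.inl ℝ _ _)) z := by
  have h1 : HasFDerivWithinAt (fun z' : EuclideanSpace ℝ ι => (z', μ)) (.inl ℝ _ _) {0}ᶜ z :=
    (hasFDerivAt_prodMk_left z μ).hasFDerivWithinAt
  have := ((h.smooth.differentiableOn (by simp) (z, μ) ⟨hz, hμ⟩).hasFDerivWithinAt).comp z h1
    (fun z' hz' => (⟨hz', hμ⟩ : (z', μ) ∈ punctured ι))
  exact this.hasFDerivAt (isOpen_compl_singleton.mem_nhds hz)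

/-- Differentiate the homogeneity relation and the formula for `K` in z. Both orders drop by 1, so
the exponent d - ν in the latter is preserved. -/
lemma HomSym.hderiv (h : HomSym d ν A) (i : ι) : HomSym (d - 1) (ν - 1) (hderiv (some i) A) := by
  obtain ⟨K, hK, e⟩ := h.ext
  have hnhds : ∀ z : EuclideanSpace ℝ ι, z ≠ 0 → {(0 : EuclideanSpace ℝ ι)}ᶜ ∈ 𝓝 z :=
    fun z hz => isOpen_compl_singleton.mem_nhds hz
  refine ⟨?_, fun t ht z hz μ hμ => ?_, fun p => fderivWithin ℝ K (puncturedInv ι) p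
    (0, EuclideanSpace.single i 1), ?_, fun t ht z hz => ?_⟩
  · have h1 := h.smooth.fderivWithin (m := ∞) uniqueDiffOn_punctured (by simp)
    refine (h1.clm_apply (g := fun _ => (EuclideanSpace.single i 1, 0)) contDiffOn_const).congr
      fun p hp => ?_
    simp only [Shubin.hderiv, cderiv, (h.hasFDerivAt hp.1 hp.2).fderiv]
    simp
  · have h1 := h.hasFDerivAt (smul_ne_zero ht.ne' hz) (mul_nonneg ht.le hμ)
    have h2 : HasFDerivAt (fun z' : EuclideanSpace ℝ ι => t • z') (t • ContinuousLinearMap.id ℝ _) z :=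
      (t • ContinuousLinearMap.id ℝ (EuclideanSpace ℝ ι)).hasFDerivAt
    have h3 := HasFDerivAt.comp (g := fun z' => A z' (t * μ)) z h1 h2
    have h4 : (fun z' => ((t ^ d : ℝ) : ℂ) * A z' μ) =ᶠ[𝓝 z] (fun z' => A z' (t * μ)) ∘ (t • ·) := by
      filter_upwards [hnhds z hz] with z' hz' using (h.hom t ht z' hz' μ hμ).symm
    have h5 := (h3.congr_of_eventuallyEq h4).unique ((h.hasFDerivAt hz hμ).const_mul _)
    have h6 := congrArg (fun L : EuclideanSpace ℝ ι →L[ℝ] ℂ => L (EuclideanSpace.single i 1)) h5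
    simp only [Shubin.hderiv, cderiv, h1.fderiv, (h.hasFDerivAt hz hμ).fderiv]
    simp only [ContinuousLinearMap.comp_apply, _root_.smul_apply,
      ContinuousLinearMap.id_apply, map_smul, ContinuousLinearMap.inl_apply, smul_eq_mul,
      Complex.real_smul] at h6 ⊢
    rw [Real.rpow_sub ht, Real.rpow_one]
    have ht' : (t : ℂ) ≠ 0 := Complex.ofReal_ne_zero.2 ht.ne'
    push_cast
    rw [div_mul_eq_mul_div, eq_div_iff ht', ← h6]
    ring
  · have h1 := hK.fderivWithin (m := ∞) uniqueDiffOn_puncturedInv (by simp)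
    exact h1.clm_apply contDiffOn_const
  · have h1 : HasFDerivWithinAt (fun z' : EuclideanSpace ℝ ι => (t, z')) (.inr ℝ ℝ _) {0}ᶜ z :=
      (hasFDerivAt_prodMk_right t z).hasFDerivWithinAt
    have h2 := (((hK.differentiableOn (by simp) (t, z) ⟨ht.le, hz⟩).hasFDerivWithinAt).comp z h1
      (fun z' hz' => ⟨ht.le, hz'⟩)).hasFDerivAt (hnhds z hz)
    have h3 : (fun z' => ((t ^ (d - ν) : ℝ) : ℂ) * A z' t⁻¹) =ᶠ[𝓝 z] K ∘ fun z' => (t, z') := by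
      filter_upwards [hnhds z hz] with z' hz' using (e t ht z' hz').symm
    have h4 := (h2.congr_of_eventuallyEq h3).unique
      ((h.hasFDerivAt hz (inv_nonneg.2 ht.le)).const_mul _)
    have h5 := congrArg (fun L : EuclideanSpace ℝ ι →L[ℝ] ℂ => L (EuclideanSpace.single i 1)) h4
    simp only [Shubin.hderiv, cderiv, (h.hasFDerivAt hz (inv_nonneg.2 ht.le)).fderiv]
    rw [sub_sub_sub_cancel_right]
    simpa using h5

lemma HomSym.hd_some (h : HomSym d ν A) (l : List ι) :
    HomSym (d - l.length) (ν - l.length) (hd (l.map some) A) := by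
  induction l generalizing A d ν with
  | nil => simpa using h
  | cons i l ih =>
    have := ih (h.hderiv i)
    rw [List.map_cons, hd_cons]
    convert this using 1
    · simp; ring
    · simp; ring

/-- The limit defining the angular symbol exists. -/
lemma IsHomSymbol.exists_tendsto (hA : IsHomSymbol d ν A) {φ : EuclideanSpace ℝ ι} (hφ : ‖φ‖ = 1) :
    ∃ l, Tendsto (fun r : ℝ => ((r ^ (-ν) : ℝ) : ℂ) * A (r • φ) √(1 - r ^ 2)) (𝓝[>] 0) (𝓝 l) := by
  obtain ⟨b, ⟨hb, G, hG, hGb⟩, hAb⟩ := hA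
  have hφ0 : φ ≠ 0 := norm_pos_iff.1 (by rw [hφ]; exact one_pos)
  have h1 : ContinuousOn (fun r : ℝ => G r φ) (Set.Ico 0 1) := by
    have := hG.continuousOn.comp (f := fun r : ℝ => (r, φ)) (s := Set.Ico 0 1)
      (by fun_prop) (fun r hr => ⟨hr, hφ0⟩)
    simpa [Function.comp_def, hφ] using this
  have h2 := (h1 0 ⟨le_rfl, one_pos⟩).mono_left
    (nhdsWithin_mono 0 (Set.Ioo_subset_Ico_self (a := (0 : ℝ)) (b := 1)))
  rw [nhdsWithin_Ioo_eq_nhdsGT one_pos] at h2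
  refine ⟨G 0 φ, h2.congr' ?_⟩
  filter_upwards [Ioo_mem_nhdsGT (zero_lt_one' ℝ)] with r hr
  have hN : normParam (r • φ) √(1 - r ^ 2) = 1 := by
    rw [normParam, norm_smul, hφ, Real.sq_sqrt (by nlinarith [hr.1, hr.2]), Real.norm_eq_abs, mul_one,
      sq_abs]
    simp
  rw [hGb r hr φ hφ, hAb _ (smul_ne_zero hr.1.ne' hφ0) _ (Real.sqrt_nonneg _), hN]
  simp

lemma angularSymbol_mul (h₁ : IsHomSymbol d₁ ν₁ A₁) (h₀ : IsHomSymbol d₀ ν₀ A₀)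
    (hA : ∀ z, z ≠ 0 → ∀ μ, 0 ≤ μ → A z μ = A₁ z μ * A₀ z μ) {z : EuclideanSpace ℝ ι} (hz : z ≠ 0) :
    angularSymbol (ν₀ + ν₁) A z = angularSymbol ν₁ A₁ z * angularSymbol ν₀ A₀ z := by
  have hz' := norm_pos_iff.2 hz
  have hφ : ‖‖z‖⁻¹ • z‖ = 1 := by rw [norm_smul, norm_inv, norm_norm, inv_mul_cancel₀ hz'.ne']
  have hφ0 : ‖z‖⁻¹ • z ≠ 0 := norm_pos_iff.1 (by rw [hφ]; exact one_pos)
  obtain ⟨l₁, hl₁⟩ := h₁.exists_tendsto hφ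
  obtain ⟨l₀, hl₀⟩ := h₀.exists_tendsto hφ
  have hl : Tendsto (fun r : ℝ => ((r ^ (-(ν₀ + ν₁)) : ℝ) : ℂ) * A (r • (‖z‖⁻¹ • z)) √(1 - r ^ 2))
      (𝓝[>] 0) (𝓝 (l₁ * l₀)) := by
    refine (hl₁.mul hl₀).congr' ?_
    filter_upwards [self_mem_nhdsWithin] with r hr
    have hr' : (0 : ℝ) < r := hr
    rw [hA _ (smul_ne_zero hr'.ne' hφ0) _ (Real.sqrt_nonneg _), neg_add, Real.rpow_add hr']
    push_cast; ring
  rw [angularSymbol, angularSymbol, angularSymbol, hl.limUnder_eq, hl₁.limUnder_eq, hl₀.limUnder_eq,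
    Real.rpow_add hz']
  push_cast; ring

end Homogeneous

/-! ### Excision functions and homogeneous components. -/

section Excision

variable {ι : Type*} [Fintype ι] [DecidableEq ι] {w : EuclideanSpace ℝ ι → ℝ → ℝ}
  {χ : EuclideanSpace ℝ ι → ℝ} {d ν d₀ d₁ ν₀ ν₁ : ℝ} {a A A₁ A₀ : EuclideanSpace ℝ ι → ℝ → ℂ}

lemma isSymbol_of_eq_zero {f : EuclideanSpace ℝ ι → ℂ} (hf : ContDiff ℝ ∞ f) {R : ℝ}
    (h : ∀ z, R < ‖z‖ → f z = 0) (m : ℝ) : IsSymbol m f := by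
  refine ⟨hf, fun k => ?_⟩
  have hc : HasCompactSupport f := HasCompactSupport.intro (isCompact_closedBall 0 R) fun z hz =>
    h z (by simpa using hz)
  have h0 : Continuous fun z => ‖iteratedFDeriv ℝ k f z‖ :=
    (hf.continuous_iteratedFDeriv (m := k) (by exact_mod_cast le_top)).norm
  have h1 : Continuous fun z => bracket z ^ (-(m - k)) * ‖iteratedFDeriv ℝ k f z‖ := by
    have h2 : Continuous fun z : EuclideanSpace ℝ ι => bracket z := by unfold bracket; fun_prop
    exact (h2.rpow_const fun z => Or.inl (bracket_pos z).ne').mul h0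
  have h2 : HasCompactSupport fun z => bracket z ^ (-(m - k)) * ‖iteratedFDeriv ℝ k f z‖ :=
    (hc.iteratedFDeriv k).norm.mul_left
  obtain ⟨C, hC⟩ := h1.bounded_above_of_compact_support h2
  refine ⟨C, fun z => ?_⟩
  have h3 := (le_abs_self _).trans (hC z)
  have h4 := Real.rpow_pos_of_pos (bracket_pos z) (m - k)
  rw [Real.rpow_neg (bracket_pos z).le, inv_mul_le_iff₀ h4] at h3
  linarith

lemma IsZeroExcision.isSymbol_one_sub (hχ : IsZeroExcision χ) (m : ℝ) :
    IsSymbol m (fun z => 1 - (χ z : ℂ)) := by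
  obtain ⟨R, hR⟩ := hχ.one_far
  refine isSymbol_of_eq_zero (contDiff_const.sub (Complex.ofRealCLM.contDiff.comp hχ.smooth))
    (R := R) (fun z hz => ?_) m
  simp [hR z hz.le]

lemma IsZeroExcision.isSymbol (hχ : IsZeroExcision χ) : IsSymbol 0 (fun z => (χ z : ℂ)) := by
  have := (isSymbol_const (ι := ι) 1).sub (hχ.isSymbol_one_sub 0)
  simpa using this

/-- Symbols that vanish for large `z` are of order `-∞` in `z`. -/
lemma IsLimitSymbol.of_eq_zero (hw : IsSmoothedNorm w) (hχ : IsZeroExcision χ)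
    (ha : IsLimitSymbol w d ν a) {R : ℝ} (h : ∀ z μ, 0 ≤ μ → R < ‖z‖ → a z μ = 0) (M : ℝ) :
    IsLimitSymbol w (d - M) (ν - M) a := by
  obtain ⟨r, hr, hr0⟩ := hχ.zero_near
  -- With this ε, |z| ≤ R implies |εz| ≤ r. Hence 1 - χ(εz) equals 1 wherever the symbol may be
  -- nonzero; it has every order -M, and multiplying by it does not change the symbol.
  have hε : 0 < r / (|R| + 1) := by positivity
  have h1 := ((hχ.isSymbol_one_sub (-M)).dil hε).isLimitSymbol hw
  have h2 := h1.mul hw ha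
  refine (h2.congr hw (b := a) fun z μ hμ => ?_)
  by_cases hz : R < ‖z‖
  · rw [h z μ hμ hz, mul_zero]
  · rw [hr0, Complex.ofReal_zero, sub_zero, one_mul]
    rw [norm_smul, Real.norm_of_nonneg hε.le, div_mul_eq_mul_div, div_le_iff₀ (by positivity)]
    refine mul_le_mul_of_nonneg_left ?_ hr.le
    linarith [le_abs_self R]

/-- An excised component is the difference of two consecutive remainders. -/
lemma HasHomExpansion.isLimitSymbol_component (hw : IsSmoothedNorm w)
    {B : ℕ → EuclideanSpace ℝ ι → ℝ → ℂ} (h : HasHomExpansion w χ d ν a B) (j : ℕ) :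
    IsLimitSymbol w (d - j) (ν - j) (fun z μ => (χ z : ℂ) * B j z μ) := by
  have h1 := (h.remainder (j + 1)).mono hw (d' := d - j) (ν' := ν - j) (by push_cast; ring)
    (by push_cast; linarith)
  refine ((h.remainder j).sub hw h1).congr hw fun z μ hμ => ?_
  rw [Finset.sum_range_succ]; ring

/-- A homogeneous symbol coincides with a symbol away from any neighbourhood of `z = 0`. -/
lemma HomSym.exists_isLimitSymbol (hw : IsSmoothedNorm w) (hχ : IsZeroExcision χ)
    (hA : HomSym d ν A) (hu : IsLimitSymbol w d ν (fun z μ => (χ z : ℂ) * A z μ)) {r : ℝ}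
    (hr : 0 < r) : ∃ U, IsLimitSymbol w d ν U ∧ ∀ z μ, 0 ≤ μ → r < ‖z‖ → U z μ = A z μ := by
  obtain ⟨R, hR⟩ := hχ.one_far
  -- This factor sends |z| > r into the region where χ = 1. There the dilated excised symbol is t^d
  -- times the homogeneous one, and the constant is divided out.
  have ht : 0 < (|R| + 1) / r := by positivity
  set t := (|R| + 1) / r
  refine ⟨_, (hu.dil hw ht).const_mul hw (((t ^ d : ℝ) : ℂ)⁻¹), fun z μ hμ hz => ?_⟩
  have hz0 : z ≠ 0 := norm_pos_iff.1 (hr.trans hz)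
  have h1 : R ≤ ‖t • z‖ := by
    have h2 : t * r ≤ t * ‖z‖ := mul_le_mul_of_nonneg_left hz.le ht.le
    rw [div_mul_cancel₀ _ hr.ne'] at h2
    rw [norm_smul, Real.norm_of_nonneg ht.le]
    linarith [le_abs_self R]
  rw [dil, hR _ h1, hA.hom t ht z hz0 μ hμ, Complex.ofReal_one, one_mul, inv_mul_cancel_left₀]
  exact Complex.ofReal_ne_zero.2 (Real.rpow_pos_of_pos ht d).ne'

lemma isOpen_norm_gt (R : ℝ) : IsOpen {p : EuclideanSpace ℝ ι × ℝ | R < ‖p.1‖} :=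
  isOpen_lt continuous_const continuous_fst.norm

/-- Up to residual terms, excision commutes with derivatives and products of homogeneous symbols. -/
lemma isLimitSymbol_hd_excision (hw : IsSmoothedNorm w) (hχ : IsZeroExcision χ)
    (h₁ : HomSym d₁ ν₁ A₁) (h₀ : HomSym d₀ ν₀ A₀)
    (hu : IsLimitSymbol w d₁ ν₁ (fun z μ => (χ z : ℂ) * A₁ z μ))
    (hv : IsLimitSymbol w d₀ ν₀ (fun z μ => (χ z : ℂ) * A₀ z μ)) (l₁ l₀ : List ι) (M : ℝ) :
    IsLimitSymbol w (d₀ - l₀.length + (d₁ - l₁.length) - M) (ν₀ - l₀.length + (ν₁ - l₁.length) - M)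
      (fun z μ => hd (l₁.map some) (fun z μ => (χ z : ℂ) * A₁ z μ) z μ *
        hd (l₀.map some) (fun z μ => (χ z : ℂ) * A₀ z μ) z μ -
        (χ z : ℂ) * (hd (l₁.map some) A₁ z μ * hd (l₀.map some) A₀ z μ)) := by
  obtain ⟨r, hr, hr0⟩ := hχ.zero_near
  obtain ⟨R, hR⟩ := hχ.one_far
  obtain ⟨U, hU, eU⟩ := h₁.exists_isLimitSymbol hw hχ hu hr
  obtain ⟨V, hV, eV⟩ := h₀.exists_isLimitSymbol hw hχ hv hr
  have hUV := (hU.hd_some hw l₁).mul hw (hV.hd_some hw l₀)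
  have hχUV := (hχ.isSymbol.isLimitSymbol hw).mul hw hUV
  rw [add_zero, add_zero] at hχUV
  -- The difference vanishes for |z| > R, where χ = 1, so it only needs to be a limit symbol of the
  -- leading order. Smoothness at z = 0 is secured by replacing the homogeneous factors by `U` and
  -- `V`: where χ may be nonzero these agree with them, together with all derivatives.
  refine IsLimitSymbol.of_eq_zero hw hχ (R := R) ?_ ?_ M
  · refine (((hu.hd_some hw l₁).mul hw (hv.hd_some hw l₀)).sub hw hχUV).congr hw fun z μ hμ => ?_
    rcases le_or_gt ‖z‖ r with hz | hz
    · rw [hr0 z hz]; simp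
    · rw [hd_congr_on (isOpen_norm_gt r) eU _ z μ hμ hz, hd_congr_on (isOpen_norm_gt r) eV _ z μ hμ hz]
  · intro z μ hμ hz
    have e : ∀ (F : EuclideanSpace ℝ ι → ℝ → ℂ) (z : EuclideanSpace ℝ ι) (μ : ℝ), 0 ≤ μ →
        (z, μ) ∈ {p : EuclideanSpace ℝ ι × ℝ | R < ‖p.1‖} → (χ z : ℂ) * F z μ = F z μ :=
      fun F z μ _ hz => by rw [hR z (le_of_lt hz), Complex.ofReal_one, one_mul]
    rw [hd_congr_on (isOpen_norm_gt R) (e A₁) _ z μ hμ hz,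
      hd_congr_on (isOpen_norm_gt R) (e A₀) _ z μ hμ hz, hR z (le_of_lt hz)]
    simp

lemma hd_sum {κ : Type*} (s : Finset κ) {f : κ → EuclideanSpace ℝ ι → ℝ → ℂ}
    (hf : ∀ k, Smooth (f k)) (l : List (Option ι)) :
    EqHalf (hd l (fun z μ => ∑ k ∈ s, f k z μ)) (fun z μ => ∑ k ∈ s, hd l (f k) z μ) := by
  induction l generalizing f with
  | nil => exact EqHalf.refl _
  | cons o l ih =>
    exact ((hderiv_sum s hf o).2.hd l).trans (ih fun k => (hf k).hderiv o)

/-- The homogeneous principal symbol is the leading coefficient along rays. -/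
lemma HasHomExpansion.tendsto (hχ : IsZeroExcision χ) {B : ℕ → EuclideanSpace ℝ ι → ℝ → ℂ}
    (h : HasHomExpansion w χ d ν a B) {z : EuclideanSpace ℝ ι} (hz : z ≠ 0) {μ : ℝ} (hμ : 0 ≤ μ) :
    Tendsto (fun t : ℝ => ((t ^ (-d) : ℝ) : ℂ) * a (t • z) (t * μ)) atTop (𝓝 (B 0 z μ)) := by
  obtain ⟨R, hR⟩ := hχ.one_far
  obtain ⟨C, hC⟩ := (isRegSymbol_iff.1 (h.remainder 1).1).bound []
  have hz' := norm_pos_iff.2 hz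
  have hB : HomSym d ν (B 0) := by simpa using (h.component 0).homSym
  -- The remainder of order (d - 1, ν - 1) is O(t^{d-1}) along the ray, because ⟨tz⟩ and ⟨tz, tμ⟩
  -- are comparable to t|z| and t|(z, μ)| as soon as t|z| ≥ 1. After multiplication by t^{-d} the
  -- error is at most K/t.
  set K := |C| * (2 ^ |ν - 1| * ‖z‖ ^ (ν - 1) * (2 ^ |d - ν| * normParam z μ ^ (d - ν)))
  have hn := normParam_pos hz μ
  have hnz : ‖z‖ ≤ normParam z μ := Real.le_sqrt_of_sq_le (by nlinarith [sq_nonneg μ])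
  rw [tendsto_iff_norm_sub_tendsto_zero]
  refine squeeze_zero' (Eventually.of_forall fun t => norm_nonneg _) (g := fun t : ℝ => K * t⁻¹) ?_
    (by simpa using tendsto_inv_atTop_zero.const_mul K)
  filter_upwards [eventually_ge_atTop (‖z‖⁻¹), eventually_ge_atTop (R / ‖z‖)] with t ht htR
  have ht0 : 0 < t := (inv_pos.2 hz').trans_le ht
  have h1 : 1 ≤ t * ‖z‖ := by
    have := mul_le_mul_of_nonneg_right ht hz'.le
    rwa [inv_mul_cancel₀ hz'.ne'] at this
  have hR1 : R ≤ ‖t • z‖ := by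
    rw [norm_smul, Real.norm_of_nonneg ht0.le]; exact (div_le_iff₀ hz').1 htR
  have h2 := hC (t • z) (t * μ) (mul_nonneg ht0.le hμ) trivial
  simp only [hd_nil, wfacs_nil, mul_one, Finset.sum_range_one, Nat.cast_one] at h2
  rw [hR _ hR1, hB.hom t ht0 z hz μ hμ, Complex.ofReal_one, one_mul, wReg,
    show d - 1 - (ν - 1) = d - ν by ring] at h2
  have hb2 : bracket (t • z) ^ 2 = 1 + (t * ‖z‖) ^ 2 := by
    rw [bracket_sq, norm_smul, Real.norm_of_nonneg ht0.le]
  have hj2 : jp (t • z) (t * μ) ^ 2 = 1 + (t * normParam z μ) ^ 2 := by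
    rw [jp_sq, mul_pow t (normParam z μ), normParam_sq, norm_smul, Real.norm_of_nonneg ht0.le]; ring
  have h1' : 1 ≤ t * normParam z μ := h1.trans (mul_le_mul_of_nonneg_left hnz ht0.le)
  have key : ∀ {x y : ℝ} (s : ℝ), 0 < x → 1 ≤ y → x ^ 2 = 1 + y ^ 2 → x ^ s ≤ 2 ^ |s| * y ^ s :=
    fun {x y} s hx hy e => rpow_le_of_ratio hx (by linarith) one_le_two (by nlinarith) (by nlinarith) s
  have h3 := key (ν - 1) (bracket_pos (t • z)) h1 hb2
  have h4 := key (d - ν) (jp_pos (t • z) (t * μ)) h1' hj2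
  have h5 : C * (bracket (t • z) ^ (ν - 1) * jp (t • z) (t * μ) ^ (d - ν)) ≤ K * t ^ (d - 1) := by
    calc C * (bracket (t • z) ^ (ν - 1) * jp (t • z) (t * μ) ^ (d - ν))
        ≤ |C| * ((2 ^ |ν - 1| * (t * ‖z‖) ^ (ν - 1)) *
            (2 ^ |d - ν| * (t * normParam z μ) ^ (d - ν))) := by
          have p1 := Real.rpow_pos_of_pos (bracket_pos (t • z)) (ν - 1)
          have p2 := Real.rpow_pos_of_pos (jp_pos (t • z) (t * μ)) (d - ν)
          refine mul_le_mul (le_abs_self C) ?_ (mul_pos p1 p2).le (abs_nonneg C)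
          exact mul_le_mul h3 h4 p2.le (p1.le.trans h3)
      _ = _ := by
          rw [Real.mul_rpow ht0.le hz'.le, Real.mul_rpow ht0.le hn.le,
            show d - 1 = (ν - 1) + (d - ν) by ring, Real.rpow_add ht0]
          simp only [K]; ring
  have p3 := Real.rpow_pos_of_pos ht0 d
  have h6 : ((t ^ (-d) : ℝ) : ℂ) * a (t • z) (t * μ) - B 0 z μ =
      ((t ^ (-d) : ℝ) : ℂ) * (a (t • z) (t * μ) - ((t ^ d : ℝ) : ℂ) * B 0 z μ) := by
    rw [mul_sub, ← mul_assoc, ← Complex.ofReal_mul, Real.rpow_neg ht0.le, inv_mul_cancel₀ p3.ne']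
    simp
  rw [h6, norm_mul, Complex.norm_real, Real.norm_of_nonneg (Real.rpow_nonneg ht0.le _)]
  refine (mul_le_mul_of_nonneg_left (h2.trans h5) (Real.rpow_nonneg ht0.le _)).trans_eq ?_
  rw [Real.rpow_neg ht0.le, Real.rpow_sub ht0, Real.rpow_one]
  field_simp

end Excision

/-! ### Leibniz products of poly-homogeneous symbols. -/

section Polyhomogeneous

variable {n : ℕ} {w : Phase n → ℝ → ℝ} {χ : Phase n → ℝ} {d ν d₀ d₁ ν₀ ν₁ : ℝ}
  {a₁ a₀ : Phase n → ℝ → ℂ} {A₁ A₀ : ℕ → Phase n → ℝ → ℂ}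

/-- The term `(1/α!) (∂_ξ^α a₁) (D_x^α a₀)`. -/
def leibnizTerm (α : Fin n → ℕ) (a₁ a₀ : Phase n → ℝ → ℂ) (z : Phase n) (μ : ℝ) : ℂ :=
  ((∏ i, (α i).factorial : ℕ) : ℂ)⁻¹ * (hd ((dirList Sum.inr α).map some) a₁ z μ *
    ((-Complex.I) ^ (∑ i, α i) * hd ((dirList Sum.inl α).map some) a₀ z μ))

/-- The order by which the term with index `(α, k, l)` is lower than the leading one. -/
def grade (p : (Fin n → ℕ) × ℕ × ℕ) : ℕ := 2 * ∑ i, p.1 i + p.2.1 + p.2.2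

/-- The indices `(α, k, l)` with `|α| < N` and `k, l ≤ N`. -/
def indexBox (n N : ℕ) : Finset ((Fin n → ℕ) × ℕ × ℕ) :=
  (Finset.range N).biUnion (Finset.piAntidiag (Finset.univ : Finset (Fin n))) ×ˢ
    (Finset.range (N + 1) ×ˢ Finset.range (N + 1))

/-- The homogeneous components of a Leibniz product. -/
def leibnizComponent (A₁ A₀ : ℕ → Phase n → ℝ → ℂ) (j : ℕ) (z : Phase n) (μ : ℝ) : ℂ :=
  ∑ p ∈ indexBox n (j + 1) with grade p = j, leibnizTerm p.1 (A₁ p.2.1) (A₀ p.2.2) z μ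

lemma mem_indexBox {N : ℕ} {p : (Fin n → ℕ) × ℕ × ℕ} :
    p ∈ indexBox n N ↔ ∑ i, p.1 i < N ∧ p.2.1 ≤ N ∧ p.2.2 ≤ N := by
  simp [indexBox, Finset.mem_biUnion]

/-- The box is merely a finite container: it holds all indices of grade j as soon as j < N. -/
lemma filter_indexBox {N j : ℕ} (h : j < N) :
    (indexBox n N).filter (fun p => grade p = j) = (indexBox n (j + 1)).filter (fun p => grade p = j) := by
  ext p
  rw [Finset.mem_filter, Finset.mem_filter, mem_indexBox, mem_indexBox, grade]
  omega

lemma sum_leibnizComponent (N : ℕ) (z : Phase n) (μ : ℝ) :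
    ∑ j ∈ Finset.range N, leibnizComponent A₁ A₀ j z μ =
      ∑ p ∈ indexBox n N with grade p < N, leibnizTerm p.1 (A₁ p.2.1) (A₀ p.2.2) z μ := by
  rw [← Finset.sum_fiberwise_of_maps_to (s := (indexBox n N).filter (fun p => grade p < N))
    (t := Finset.range N) (g := grade) (fun p hp => Finset.mem_range.2 (Finset.mem_filter.1 hp).2)]
  refine Finset.sum_congr rfl fun j hj => ?_
  have hj' := Finset.mem_range.1 hj
  rw [leibnizComponent, ← filter_indexBox hj', Finset.filter_filter]
  refine Finset.sum_congr (Finset.filter_congr fun p _ => ?_) fun _ _ => rfl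
  constructor
  · intro h; exact ⟨h ▸ hj', h⟩
  · exact fun h => h.2

lemma leibnizSum_eq_sum_leibnizTerm (N : ℕ) (z : Phase n) (μ : ℝ) :
    leibnizSum N a₁ a₀ z μ = ∑ α ∈ (Finset.range N).biUnion
      (Finset.piAntidiag (Finset.univ : Finset (Fin n))), leibnizTerm α a₁ a₀ z μ := by
  rw [leibnizSum_eq, Finset.sum_biUnion]
  · rfl
  · refine fun i _ j _ hij => Finset.disjoint_left.2 fun α hi hj => hij ?_
    rw [← (Finset.mem_piAntidiag.1 hi).1, ← (Finset.mem_piAntidiag.1 hj).1]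

lemma leibnizSum_sum (N : ℕ) {p q : ℕ → Phase n → ℝ → ℂ} (hp : ∀ k, Smooth (p k))
    (hq : ∀ k, Smooth (q k)) :
    EqHalf (leibnizSum N (fun z μ => ∑ k ∈ Finset.range (N + 1), p k z μ)
        (fun z μ => ∑ k ∈ Finset.range (N + 1), q k z μ))
      (fun z μ => ∑ i ∈ indexBox n N, leibnizTerm i.1 (p i.2.1) (q i.2.2) z μ) := by
  intro z μ hμ
  beta_reduce
  rw [leibnizSum_eq_sum_leibnizTerm, indexBox, Finset.sum_product]
  refine Finset.sum_congr rfl fun α _ => ?_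
  rw [Finset.sum_product, leibnizTerm, hd_sum _ hp _ z μ hμ, hd_sum _ hq _ z μ hμ]
  beta_reduce
  simp only [leibnizTerm, Finset.sum_mul, Finset.mul_sum]
  exact Finset.sum_comm

lemma IsLimitSymbol.leibnizTerm (hw : IsSmoothedNorm w) (h₁ : IsLimitSymbol w d₁ ν₁ a₁)
    (h₀ : IsLimitSymbol w d₀ ν₀ a₀) (α : Fin n → ℕ) :
    IsLimitSymbol w (d₀ + d₁ - 2 * ((∑ i, α i : ℕ) : ℝ)) (ν₀ + ν₁ - 2 * ((∑ i, α i : ℕ) : ℝ))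
      (leibnizTerm α a₁ a₀) := by
  have := (((h₁.hd_some hw (dirList Sum.inr α)).mul hw ((h₀.hd_some hw
    (dirList Sum.inl α)).const_mul hw ((-Complex.I) ^ (∑ i, α i)))).const_mul hw
      (((∏ i, (α i).factorial : ℕ) : ℂ)⁻¹))
  rw [length_dirList, length_dirList] at this
  convert this using 1
  · ring
  · ring
  · rfl

lemma HomSym.leibnizTerm {A₁ A₀ : Phase n → ℝ → ℂ} (h₁ : HomSym d₁ ν₁ A₁) (h₀ : HomSym d₀ ν₀ A₀)
    (α : Fin n → ℕ) :
    HomSym (d₀ + d₁ - 2 * ((∑ i, α i : ℕ) : ℝ)) (ν₀ + ν₁ - 2 * ((∑ i, α i : ℕ) : ℝ))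
      (leibnizTerm α A₁ A₀) := by
  have := (((h₁.hd_some (dirList Sum.inr α)).mul ((h₀.hd_some
    (dirList Sum.inl α)).const_mul ((-Complex.I) ^ (∑ i, α i)))).const_mul
      (((∏ i, (α i).factorial : ℕ) : ℂ)⁻¹))
  rw [length_dirList, length_dirList] at this
  convert this using 1
  · ring
  · ring
  · rfl

lemma isHomSymbol_leibnizComponent (h₁ : ∀ j : ℕ, IsHomSymbol (d₁ - j) (ν₁ - j) (A₁ j))
    (h₀ : ∀ j : ℕ, IsHomSymbol (d₀ - j) (ν₀ - j) (A₀ j)) (j : ℕ) :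
    IsHomSymbol (d₀ + d₁ - j) (ν₀ + ν₁ - j) (leibnizComponent A₁ A₀ j) := by
  refine (homSym_sum _ fun p hp => ?_).isHomSymbol
  have hg := (Finset.mem_filter.1 hp).2
  have := (h₁ p.2.1).homSym.leibnizTerm (h₀ p.2.2).homSym p.1
  have e : (j : ℝ) = 2 * ((∑ i, p.1 i : ℕ) : ℝ) + p.2.1 + p.2.2 := by
    rw [← hg, grade]; push_cast; ring
  convert this using 1 <;> rw [e] <;> ring

lemma isLimitSymbol_leibnizTerm_excision (hw : IsSmoothedNorm w) (hχ : IsZeroExcision χ)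
    {A₁ A₀ : Phase n → ℝ → ℂ} (h₁ : HomSym d₁ ν₁ A₁) (h₀ : HomSym d₀ ν₀ A₀)
    (hu : IsLimitSymbol w d₁ ν₁ (fun z μ => (χ z : ℂ) * A₁ z μ))
    (hv : IsLimitSymbol w d₀ ν₀ (fun z μ => (χ z : ℂ) * A₀ z μ)) (α : Fin n → ℕ) (M : ℝ) :
    IsLimitSymbol w (d₀ + d₁ - M) (ν₀ + ν₁ - M)
      (fun z μ => leibnizTerm α (fun z μ => (χ z : ℂ) * A₁ z μ) (fun z μ => (χ z : ℂ) * A₀ z μ) z μ -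
        (χ z : ℂ) * leibnizTerm α A₁ A₀ z μ) := by
  have := (isLimitSymbol_hd_excision hw hχ h₁ h₀ hu hv (dirList Sum.inr α) (dirList Sum.inl α)
    (M - 2 * ((∑ i, α i : ℕ) : ℝ))).const_mul hw
    (((∏ i, (α i).factorial : ℕ) : ℂ)⁻¹ * (-Complex.I) ^ (∑ i, α i))
  rw [length_dirList, length_dirList] at this
  convert this using 1
  · ring
  · ring
  · funext z μ; simp only [leibnizTerm]; ring

/-- The pieces of a poly-homogeneous symbol: excised components of index `k < N` and the remainder. -/
def homPiece (χ : Phase n → ℝ) (a : Phase n → ℝ → ℂ) (A : ℕ → Phase n → ℝ → ℂ) (N k : ℕ)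
    (z : Phase n) (μ : ℝ) : ℂ :=
  if k < N then (χ z : ℂ) * A k z μ else a z μ - (χ z : ℂ) * ∑ j ∈ Finset.range N, A j z μ

lemma homPiece_of_lt {a : Phase n → ℝ → ℂ} {A : ℕ → Phase n → ℝ → ℂ} {N k : ℕ} (h : k < N) :
    homPiece χ a A N k = fun z μ => (χ z : ℂ) * A k z μ := by
  funext z μ; rw [homPiece, if_pos h]

lemma homPiece_of_not_lt {a : Phase n → ℝ → ℂ} {A : ℕ → Phase n → ℝ → ℂ} {N k : ℕ} (h : ¬ k < N) :
    homPiece χ a A N k = fun z μ => a z μ - (χ z : ℂ) * ∑ j ∈ Finset.range N, A j z μ := by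
  funext z μ; rw [homPiece, if_neg h]

lemma sum_homPiece (a : Phase n → ℝ → ℂ) (A : ℕ → Phase n → ℝ → ℂ) (N : ℕ) :
    (fun z μ => ∑ k ∈ Finset.range (N + 1), homPiece χ a A N k z μ) = a := by
  funext z μ
  rw [Finset.sum_range_succ, homPiece_of_not_lt (lt_irrefl N)]
  beta_reduce
  rw [Finset.mul_sum, Finset.sum_congr rfl fun k hk => by rw [homPiece_of_lt (Finset.mem_range.1 hk)]]
  ring

lemma HasHomExpansion.isLimitSymbol_homPiece (hw : IsSmoothedNorm w) {a : Phase n → ℝ → ℂ}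
    {A : ℕ → Phase n → ℝ → ℂ} (h : HasHomExpansion w χ d ν a A) {N k : ℕ} (hk : k ≤ N) :
    IsLimitSymbol w (d - k) (ν - k) (homPiece χ a A N k) := by
  by_cases hkN : k < N
  · rw [homPiece_of_lt hkN]; exact h.isLimitSymbol_component hw k
  · obtain rfl : k = N := by omega
    rw [homPiece_of_not_lt hkN]; exact h.remainder k

lemma HasHomExpansion.smooth_homPiece (hw : IsSmoothedNorm w) {a : Phase n → ℝ → ℂ}
    {A : ℕ → Phase n → ℝ → ℂ} (h : HasHomExpansion w χ d ν a A) (N k : ℕ) :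
    Smooth (homPiece χ a A N k) := by
  by_cases hkN : k < N
  · exact (h.isLimitSymbol_homPiece hw hkN.le).1.smooth
  · rw [homPiece_of_not_lt hkN]; exact (h.remainder N).1.smooth

/-- Three contributions have to be of order N lower than the product. The Leibniz remainder even
gains 2N. In the Leibniz sum of the decomposed symbols, terms of grade below N contain excised
components only, and moving the excision function to the front costs a residual symbol. Terms of
grade at least N, among them all those containing a remainder, are of sufficiently low order. -/
theorem HasHomExpansion.leibnizParam (hw : IsSmoothedNorm w) (hχ : IsZeroExcision χ)
    (h₁ : IsLimitSymbol w d₁ ν₁ a₁) (h₀ : IsLimitSymbol w d₀ ν₀ a₀)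
    (e₁ : HasHomExpansion w χ d₁ ν₁ a₁ A₁) (e₀ : HasHomExpansion w χ d₀ ν₀ a₀ A₀) :
    HasHomExpansion w χ (d₀ + d₁) (ν₀ + ν₁) (leibnizParam a₁ a₀) (leibnizComponent A₁ A₀) := by
  refine ⟨isHomSymbol_leibnizComponent e₁.component e₀.component, fun N => ?_⟩
  have r1 := ((fiberBilin_leibnizRem N).isLimitSymbol hw h₁ h₀).mono hw (d' := d₀ + d₁ - N)
    (ν' := ν₀ + ν₁ - N) (by ring) (by push_cast; linarith [Nat.cast_nonneg (α := ℝ) N])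
  have r2 : IsLimitSymbol w (d₀ + d₁ - N) (ν₀ + ν₁ - N) (fun z μ =>
      ∑ p ∈ indexBox n N with grade p < N, (leibnizTerm p.1 (homPiece χ a₁ A₁ N p.2.1)
        (homPiece χ a₀ A₀ N p.2.2) z μ - (χ z : ℂ) * leibnizTerm p.1 (A₁ p.2.1) (A₀ p.2.2) z μ)) := by
    refine isLimitSymbol_sum hw _ fun p hp => ?_
    have hg := (Finset.mem_filter.1 hp).2
    rw [homPiece_of_lt (by rw [grade] at hg; omega), homPiece_of_lt (by rw [grade] at hg; omega)]
    have := isLimitSymbol_leibnizTerm_excision hw hχ (e₁.component p.2.1).homSym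
      (e₀.component p.2.2).homSym (e₁.isLimitSymbol_component hw _) (e₀.isLimitSymbol_component hw _)
      p.1 (N - p.2.1 - p.2.2)
    convert this using 1 <;> ring
  have r3 : IsLimitSymbol w (d₀ + d₁ - N) (ν₀ + ν₁ - N) (fun z μ =>
      ∑ p ∈ indexBox n N with ¬ grade p < N, leibnizTerm p.1 (homPiece χ a₁ A₁ N p.2.1)
        (homPiece χ a₀ A₀ N p.2.2) z μ) := by
    refine isLimitSymbol_sum hw _ fun p hp => ?_
    have hp' := Finset.mem_filter.1 hp
    have hb := mem_indexBox.1 hp'.1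
    refine ((e₁.isLimitSymbol_homPiece hw hb.2.1).leibnizTerm hw
      (e₀.isLimitSymbol_homPiece hw hb.2.2) p.1).mono hw (by ring) ?_
    have hg : (N : ℝ) ≤ 2 * ((∑ i, p.1 i : ℕ) : ℝ) + p.2.1 + p.2.2 := by
      exact_mod_cast not_lt.1 hp'.2
    linarith
  refine ((r1.add hw r2).add hw r3).congr hw fun z μ hμ => ?_
  have e := leibnizSum_sum N (e₁.smooth_homPiece hw N) (e₀.smooth_homPiece hw N) z μ hμ
  rw [sum_homPiece, sum_homPiece] at e
  rw [sum_leibnizComponent, leibnizRem, e]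
  beta_reduce
  rw [← Finset.sum_filter_add_sum_filter_not (indexBox n N)
    (fun p => grade p < N), Finset.sum_sub_distrib, Finset.mul_sum]
  ring

lemma leibnizComponent_zero (z : Phase n) (μ : ℝ) :
    leibnizComponent A₁ A₀ 0 z μ = A₁ 0 z μ * A₀ 0 z μ := by
  have h : (indexBox n (0 + 1)).filter (fun p => grade p = 0) = {(0, 0, 0)} := by
    ext ⟨α, k, l⟩
    rw [Finset.mem_filter, mem_indexBox, grade, Finset.mem_singleton, Prod.mk.injEq, Prod.mk.injEq]
    constructor
    · rintro ⟨-, h⟩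
      dsimp only at h
      refine ⟨funext fun i => ?_, by omega, by omega⟩
      have : ∑ i, α i = 0 := by omega
      exact Finset.sum_eq_zero_iff.1 this i (Finset.mem_univ i)
    · rintro ⟨rfl, rfl, rfl⟩; simp
  have h0 : ∀ σ : Fin n → Fin n ⊕ Fin n, dirList σ 0 = [] := fun σ =>
    List.eq_nil_of_length_eq_zero (by rw [length_dirList]; simp)
  rw [leibnizComponent, h, Finset.sum_singleton, leibnizTerm, h0, h0]
  simp

end Polyhomogeneous

/-! ### The Leibniz product of limit symbols. -/

section Product

variable {n : ℕ} {w : Phase n → ℝ → ℝ} {d₀ d₁ ν₀ ν₁ : ℝ} {a₁ a₀ : Phase n → ℝ → ℂ}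

lemma leibnizRem_zero (a₁ a₀ : Phase n → ℝ → ℂ) : leibnizRem 0 a₁ a₀ = leibnizParam a₁ a₀ := by
  funext z μ; simp [leibnizRem, leibnizSum]

lemma hasOscIntegral_leibnizParam (h₁ : IsTemp a₁) (h₀ : IsTemp a₀) (z : Phase n) {μ : ℝ}
    (hμ : 0 ≤ μ) : HasOscIntegral (leibnizAmplitude (fun z' => a₁ z' μ) (fun z' => a₀ z' μ) z)
      (leibnizParam a₁ a₀ z μ) := by
  rw [leibnizAmplitude_eq, leibnizParam_eq]
  exact hasOscIntegral_oscForm (h₁.tempered_slice Sum.inr_injective z hμ)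
    (h₀.tempered_slice Sum.inl_injective z hμ)

lemma isLimitSymbol_leibnizParam (hw : IsSmoothedNorm w) (h₁ : IsLimitSymbol w d₁ ν₁ a₁)
    (h₀ : IsLimitSymbol w d₀ ν₀ a₀) :
    IsLimitSymbol w (d₀ + d₁) (ν₀ + ν₁) (leibnizParam a₁ a₀) := by
  have := (fiberBilin_leibnizRem 0).isLimitSymbol hw h₁ h₀
  rw [leibnizRem_zero] at this
  simpa using this

/-- The conversions `tilde` and `untilde` fix the zeroth coefficient, and the antidiagonal of 0 has
a single element. Uniqueness of the principal limit symbol allows an arbitrary expansion of the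
product in the statement. -/
lemma limitSymbol_leibnizParam (hw : IsSmoothedNorm w) (h₁ : IsRegSymbol d₁ ν₁ a₁)
    (h₀ : IsRegSymbol d₀ ν₀ a₀) {L₁ L₀ L : ℕ → Phase n → ℂ}
    (e₁ : HasLimitExpansion w d₁ ν₁ a₁ L₁) (e₀ : HasLimitExpansion w d₀ ν₀ a₀ L₀)
    (e : HasLimitExpansion w (d₀ + d₁) (ν₀ + ν₁) (leibnizParam a₁ a₀) L) (z : Phase n) :
    L 0 z = leibniz (L₁ 0) (L₀ 0) z := by
  have hB := fiberBilin_leibnizRem (n := n) 0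
  have h2 := (hB.muExp h₁ h₀ (e₁.muExp hw) (e₀.muExp hw)).hasLimitExpansion hw
    (hB.isRegSymbol h₁ h₀)
  rw [leibnizRem_zero] at h2
  simp only [Nat.cast_zero, mul_zero, sub_zero] at h2
  rw [e.unique hw h2, untilde_zero, Finset.HasAntidiagonal.antidiagonal_zero, Finset.sum_singleton,
    onFiber, leibnizRem_zero, tilde_zero, tilde_zero]
  rfl

end Product

end Shubin

end

theorem mainTheorem6 (n : ℕ)
    (w : Shubin.Phase n → ℝ → ℝ) (hw : Shubin.IsSmoothedNorm w)
    (χ : Shubin.Phase n → ℝ) (hχ : Shubin.IsZeroExcision χ)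
    (d₀ d₁ ν₀ ν₁ : ℝ) (a₁ a₀ : Shubin.Phase n → ℝ → ℂ)
    (h₁ : Shubin.IsLimitSymbol w d₁ ν₁ a₁) (h₀ : Shubin.IsLimitSymbol w d₀ ν₀ a₀) :
    -- the oscillatory integral defining the product converges
    (∀ z : Shubin.Phase n, ∀ μ : ℝ, 0 ≤ μ →
      Shubin.HasOscIntegral
        (Shubin.leibnizAmplitude (fun z' => a₁ z' μ) (fun z' => a₀ z' μ) z)
        (Shubin.leibnizParam a₁ a₀ z μ)) ∧
    -- mapping property
    Shubin.IsLimitSymbol w (d₀ + d₁) (ν₀ + ν₁) (Shubin.leibnizParam a₁ a₀) ∧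
    -- asymptotic expansion
    (∀ N : ℕ, Shubin.IsLimitSymbol w (d₀ + d₁ - 2 * N) (ν₀ + ν₁ - 2 * N)
      (fun z μ => Shubin.leibnizParam a₁ a₀ z μ - Shubin.leibnizSum N a₁ a₀ z μ)) ∧
    -- principal limit symbol
    (∀ L₁ L₀ L : ℕ → Shubin.Phase n → ℂ,
      Shubin.HasLimitExpansion w d₁ ν₁ a₁ L₁ →
      Shubin.HasLimitExpansion w d₀ ν₀ a₀ L₀ →
      Shubin.HasLimitExpansion w (d₀ + d₁) (ν₀ + ν₁) (Shubin.leibnizParam a₁ a₀) L →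
      ∀ z : Shubin.Phase n,
        Shubin.HasOscIntegral (Shubin.leibnizAmplitude (L₁ 0) (L₀ 0) z)
          (Shubin.leibniz (L₁ 0) (L₀ 0) z) ∧
        L 0 z = Shubin.leibniz (L₁ 0) (L₀ 0) z) ∧
    -- poly-homogeneous symbols
    (Shubin.IsPolyhomogeneous w χ d₁ ν₁ a₁ → Shubin.IsPolyhomogeneous w χ d₀ ν₀ a₀ →
      Shubin.IsPolyhomogeneous w χ (d₀ + d₁) (ν₀ + ν₁) (Shubin.leibnizParam a₁ a₀) ∧
      ∀ A₁ A₀ A : ℕ → Shubin.Phase n → ℝ → ℂ,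
        Shubin.HasHomExpansion w χ d₁ ν₁ a₁ A₁ →
        Shubin.HasHomExpansion w χ d₀ ν₀ a₀ A₀ →
        Shubin.HasHomExpansion w χ (d₀ + d₁) (ν₀ + ν₁) (Shubin.leibnizParam a₁ a₀) A →
        (∀ z : Shubin.Phase n, z ≠ 0 → ∀ μ : ℝ, 0 ≤ μ → A 0 z μ = A₁ 0 z μ * A₀ 0 z μ) ∧
        (∀ z : Shubin.Phase n, z ≠ 0 →
          Shubin.angularSymbol (ν₀ + ν₁) (A 0) z =
            Shubin.angularSymbol ν₁ (A₁ 0) z * Shubin.angularSymbol ν₀ (A₀ 0) z)) := by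
  have hprod : Shubin.IsLimitSymbol w (d₀ + d₁) (ν₀ + ν₁) (Shubin.leibnizParam a₁ a₀) :=
    Shubin.isLimitSymbol_leibnizParam hw h₁ h₀
  refine ⟨fun z μ hμ => Shubin.hasOscIntegral_leibnizParam h₁.1.isTemp h₀.1.isTemp z hμ, hprod,
    fun N => by
      have := (Shubin.fiberBilin_leibnizRem N).isLimitSymbol hw h₁ h₀
      push_cast at this
      exact this, fun L₁ L₀ L e₁ e₀ e z => ?_,
    fun p₁ p₀ => ⟨?_, fun A₁ A₀ A e₁ e₀ e => ?_⟩⟩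
  · exact ⟨Shubin.hasOscIntegral_leibnizParam (e₁.coeff 0).isTemp (e₀.coeff 0).isTemp z le_rfl,
      Shubin.limitSymbol_leibnizParam hw h₁.1 h₀.1 e₁ e₀ e z⟩
  · obtain ⟨-, A₁, e₁⟩ := p₁
    obtain ⟨-, A₀, e₀⟩ := p₀
    exact ⟨hprod, _, e₁.leibnizParam hw hχ h₁ h₀ e₀⟩
  · have hA : ∀ z : Shubin.Phase n, z ≠ 0 → ∀ μ : ℝ, 0 ≤ μ → A 0 z μ = A₁ 0 z μ * A₀ 0 z μ :=
      fun z hz μ hμ => by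
        rw [← Shubin.leibnizComponent_zero]
        -- Both the given principal component and the constructed one are limits of t^{-d} a(tz, tμ)
        -- for the same symbol, so they coincide.
        exact tendsto_nhds_unique (e.tendsto hχ hz hμ)
          ((e₁.leibnizParam hw hχ h₁ h₀ e₀).tendsto hχ hz hμ)
    exact ⟨hA, fun z hz => by
      simpa using Shubin.angularSymbol_mul (e₁.component 0) (e₀.component 0) hA hz⟩
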